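/- Let $n,k\ge 1$, let $A_1,\dots,A_k\in\mathbb R^{n\times n}$, $x_0\in\mathbb R^n$, and consider the switched linear system $$x_{t+1}=A_{s_t}x_t+w_t,\qquad t\ge 0,$$ where the switching $(s_t)_{t\ge0}$ is i.i.d. with $\mathbb P(s_t=i)=p_i>0$, $\sum_{i=1}^k p_i=1$, each $s_t$ being independent of the preceding states $(x_0,\dots,x_t,s_0,\dots,s_{t-1})$. Put $\mathcal F_{t-1}=\sigma(x_0,\dots,x_t,s_0,\dots,s_t)$ and assume: 1. $\mathbb E\|w_t\|<\infty$ and $\mathbb E[w_t\mid\mathcal F_{t-1}]=0$ for all $t$; for some $\alpha>2$, $M:=\sup_{t\ge0}\mathbb E[\|w_t\|^\alpha\mid\mathcal F_{t-1}]<\infty$ almost surely; and, for some symmetric positive definite matrix $C$, almost surely $\liminf_{T\to\infty}\frac1T\sum_{t=0}^{T-1}w_tw_t^{\top}=C$, in the sense that $\liminf_{T\to\infty} \frac1T\sum_{t=0}^{T-1}(v^\top w_t)^2=v^\top C v$ for every $v\in\mathbb R^n$. 2. $\prod_{i=1}^k\sigma_i^{p_i}<1$, where $\sigma_i$ is the largest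 singular value of $A_i$. Let $\hat A_{i,T}$ be any minimizer over $B\in\mathbb R^{n\times n}$ of $\sum_{t<T,\ s_t=i}\|x_{t+1}-Bx_t\|^2$, let $\theta^\top=[A_1,\dots,A_k]$ and $\hat\theta_T^\top=[\hat A_{1,T},\dots,\hat A_{k,T}]$, and let $\|\cdot\|_\infty$ denote the largest absolute value of an entry. Then almost surely, for every $i$, $$\|\hat A_{i,T}-A_i\|_\infty= O\Big(\sqrt{\tfrac{\log T}{p_i\,T}}\Big)\qquad(T\to\infty),$$ where the constant in $O(\cdot)$ does not depend on $p$ and $T$: there is a function $K$, depending only on $n,k,(A_i)_{i},x_0,C,\alpha$, such that almost surely, for all $i$ and all sufficiently large $T$, $\|\hat A_{i,T}-A_i\|_\infty\le K(M)\sqrt{\log T/(p_iT)}$. Consequently the estimate is strongly consistent, $\lim_{T\to\infty}\|\hat\theta_T-\theta\|_\infty=0$ almost surely, and, with the same $K$ and $p^*=\min_jp_j$, almost surely for all sufficiently large $T$, $$\|\hat\theta_T-\theta\|_\infty\le K(M)\sqrt{\tfrac{\log T}{p^*T}} .$$ -/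

import Mathlib

open MeasureTheory ProbabilityTheory Filter Topology
open scoped NNReal ENNReal

namespace SwitchedLS

noncomputable section

/-- The continuous state of the switched linear system: `x 0 = x₀` and
`x (t + 1) = A_{s t} x t + w t`. -/
def state {Ω : Type*} {n k : ℕ} (A : Fin k → Matrix (Fin n) (Fin n) ℝ)
    (x₀ : EuclideanSpace ℝ (Fin n)) (s : ℕ → Ω → Fin k)
    (w : ℕ → Ω → EuclideanSpace ℝ (Fin n)) : ℕ → Ω → EuclideanSpace ℝ (Fin n)
  | 0, _ => x₀
  | t + 1, ω => Matrix.toEuclideanLin (A (s t ω)) (state A x₀ s w t ω) + w t ω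

/-- The sigma-algebra `σ(x 0, …, x t, s 0, …, s t)` of the complete state up to time `t`. -/
@[reducible] def history {Ω : Type*} {n k : ℕ} (x : ℕ → Ω → EuclideanSpace ℝ (Fin n))
    (s : ℕ → Ω → Fin k) (t : ℕ) : MeasurableSpace Ω :=
  (⨆ r ≤ t, MeasurableSpace.comap (x r) inferInstance) ⊔
    (⨆ r ≤ t, MeasurableSpace.comap (s r) inferInstance)

/-- The sigma-algebra `σ(x 0, …, x t, s 0, …, s (t - 1))` of everything that precedes the
draw of `s t`. -/
@[reducible] def past {Ω : Type*} {n k : ℕ} (x : ℕ → Ω → EuclideanSpace ℝ (Fin n))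
    (s : ℕ → Ω → Fin k) (t : ℕ) : MeasurableSpace Ω :=
  (⨆ r ≤ t, MeasurableSpace.comap (x r) inferInstance) ⊔
    (⨆ r < t, MeasurableSpace.comap (s r) inferInstance)

/-- I.i.d. switching with probability mass function `p`: each `s t` has law `p` and is drawn
independently of the states `x 0, …, x t` and `s 0, …, s (t - 1)` that precede it. In particular
`s 0, s 1, …` are independent and identically distributed. -/
structure IsIIDSwitching {Ω : Type*} [MeasurableSpace Ω] (μ : Measure Ω) {n k : ℕ}
    (x : ℕ → Ω → EuclideanSpace ℝ (Fin n)) (s : ℕ → Ω → Fin k) (p : Fin k → ℝ) : Prop where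
  measurable : ∀ t, Measurable (s t)
  law : ∀ t i, μ {ω | s t ω = i} = ENNReal.ofReal (p i)
  indep : ∀ t, Indep (MeasurableSpace.comap (s t) inferInstance) (past x s t) μ

/-- The conditional moment `E[‖w t‖ ^ α | x 0, …, x t, s 0, …, s t]`, as a conditional
expectation of a `[0, ∞]`-valued function (no integrability is presupposed). -/
def condMoment {Ω : Type*} [MeasurableSpace Ω] (μ : Measure Ω) {n k : ℕ}
    (x : ℕ → Ω → EuclideanSpace ℝ (Fin n)) (s : ℕ → Ω → Fin k)
    (w : ℕ → Ω → EuclideanSpace ℝ (Fin n)) (α : ℝ) (t : ℕ) : Ω → ℝ≥0∞ :=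
  condLExp (history x s t) μ (fun ω => ‖w t ω‖ₑ ^ α)

/-- The assumption on the noise: a martingale difference sequence with respect to the history of
the complete state, with almost surely bounded conditional moments of order `α`, and with
`liminf (1 / T) ∑_{t < T} w t (w t)ᵀ = C`. The inferior limit of these symmetric matrices is that
of their quadratic forms: `liminf vᵀ M_T v = vᵀ C v` for every vector `v`. -/
structure NoiseAssumption {Ω : Type*} [MeasurableSpace Ω] (μ : Measure Ω) {n k : ℕ}
    (x : ℕ → Ω → EuclideanSpace ℝ (Fin n)) (s : ℕ → Ω → Fin k)
    (w : ℕ → Ω → EuclideanSpace ℝ (Fin n)) (α : ℝ) (C : Matrix (Fin n) (Fin n) ℝ) : Prop where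
  measurable : ∀ t, Measurable (w t)
  integrable : ∀ t, Integrable (w t) μ
  condExp_eq_zero : ∀ t, condExp (history x s t) μ (w t) =ᵐ[μ] 0
  condMoment_bounded : ∀ᵐ ω ∂μ, (⨆ t, condMoment μ x s w α t ω) < ∞
  liminf_eq : ∀ᵐ ω ∂μ, ∀ v : Fin n → ℝ,
    liminf (fun T : ℕ =>
      (((1 / (T : ℝ)) * (v ⬝ᵥ Matrix.mulVec
        (∑ t ∈ Finset.range T, Matrix.vecMulVec (w t ω).ofLp (w t ω).ofLp) v) : ℝ) : EReal)) atTop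
      = ((v ⬝ᵥ Matrix.mulVec C v : ℝ) : EReal)

/-- The spectral norm (largest singular value) of a square matrix. -/
def spectralNorm {n : ℕ} (M : Matrix (Fin n) (Fin n) ℝ) : ℝ :=
  ‖Matrix.toEuclideanCLM (n := Fin n) (𝕜 := ℝ) M‖

/-- The times `t < T` at which the discrete state equals `i`. -/
def modeTimes {Ω : Type*} {k : ℕ} (s : ℕ → Ω → Fin k) (i : Fin k) (T : ℕ) (ω : Ω) : Finset ℕ :=
  (Finset.range T).filter (fun t => s t ω = i)

/-- The squared error `∑ ‖x (t + 1) - B x t‖ ^ 2` over the times `t < T` with `s t = i`. -/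
def lsCost {Ω : Type*} {n k : ℕ} (x : ℕ → Ω → EuclideanSpace ℝ (Fin n))
    (s : ℕ → Ω → Fin k) (i : Fin k) (T : ℕ) (ω : Ω) (B : Matrix (Fin n) (Fin n) ℝ) : ℝ :=
  ∑ t ∈ modeTimes s i T ω, ‖x (t + 1) ω - Matrix.toEuclideanLin B (x t ω)‖ ^ 2

/-- Along the sample path `ω`, the matrices `Ahat T i` are switched least squares estimates: each
is a minimizer of the corresponding squared error (it is unique once the empirical covariance of
mode `i` is invertible). -/
def IsSwitchedLeastSquares {Ω : Type*} {n k : ℕ} (x : ℕ → Ω → EuclideanSpace ℝ (Fin n))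
    (s : ℕ → Ω → Fin k) (ω : Ω) (Ahat : ℕ → Fin k → Matrix (Fin n) (Fin n) ℝ) : Prop :=
  ∀ T i, ∀ B : Matrix (Fin n) (Fin n) ℝ, lsCost x s i T ω (Ahat T i) ≤ lsCost x s i T ω B

/-- The largest absolute value of an entry of a matrix. -/
def maxNorm {a b : Type*} [Fintype a] [Fintype b] (M : Matrix a b ℝ) : ℝ :=
  ⨆ q : a × b, |M q.1 q.2|

/-- The stacked parameter `θ`, with `θᵀ = [A_1, …, A_k]`. -/
def stack {n k : ℕ} (A : Fin k → Matrix (Fin n) (Fin n) ℝ) :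
    Matrix (Fin k × Fin n) (Fin n) ℝ :=
  Matrix.of fun q r => A q.1 r q.2

end

end SwitchedLS

/-! For mode `i` let `V` be the regularized Gram matrix of the regressors up to time `T`, and `S`
their correlation with one coordinate of the noise. The basic inequality of least squares and
Cauchy–Schwarz bound the squared error of a row by a multiple of `quad V⁻¹ S`, divided by the least
eigenvalue of the unregularized Gram matrix (`dotProduct_self_le_of_leastSquares`). The noise
excites every direction, so that eigenvalue is at least a `p`-free multiple of `p i * T`
(`ae_eventually_sum_regressor_ge`). What remains is to bound `quad V⁻¹ S` by `log T` times a
constant free of `p`.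

The usual bound of `quad V⁻¹ S` is a multiple of `log det V`. Contraction on average gives the state
bounded moments only of some order `θ` that depends on `p` (`exists_rpow_sum_lt_one`), so `log det
V` is at most `log T` times a constant of order `1 / θ` (`exists_ae_log_det_le`), which is not
uniform in `p`. Two devices remove this dependence.

The noise is split at a high level (`exists_noise_split`). The conditional variance of the large
part is so small that its product with the bad constant is below one. For the bounded part, Ville's
inequality for an exponential supermartingale (`measure_selfNormalized_le`) allows the identity in
the Gram matrix to be replaced, on each dyadic epoch `2 ^ m ≤ T < 2 ^ (m + 1)`, by a deterministic
positive definite form `U`. The bound is then `m` plus a multiple of the sum of the leverages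
relative to `U`, and that sum is at most `n * log` of `n` plus the sum of `quad U⁻¹` over the
regressors. So it suffices that `U` lies below the random Gram matrix at time `2 ^ m`, and that the
sum of `quad U⁻¹` is polynomial in `2 ^ m` with an exponent free of `p`.

Such a form comes from `exists_reference_form`. A form below the identity is tame if random words of
switches, of length of order `m ^ 2`, amplify it above level two with probability at most `(a / 2) ^
m`, for a fixed `a > 1`. Raising the level by a factor `2 ^ m` makes amplification rarer by an
exponentially small factor (`wordPr_amplifies_le`). Hence tame forms are stable under sums up to a
scalar polynomial in `2 ^ m`, and a tame form of nearly maximal determinant dominates all others up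
to a polynomial factor. By the same gain and Borel–Cantelli, almost surely no window of switches in
a late epoch amplifies this form beyond `2 * 2 ^ m` (`exists_epoch_forms`).

Finally, the inverse Gram matrix at time `2 ^ m` is itself tame for large `m`
(`ae_eventually_inv_gram_mem_tameForms`). Otherwise, by duality, too many words would transport the
noise into directions not yet excited. Each such excitation multiplies the Gram determinant by a
fixed factor, so their number would have to be exponential in `m`, while the expectation of `log det
V` is only linear in `m`. -/

namespace SwitchedLS

/-! ### Quadratic forms: Cauchy–Schwarz, determinants and rank-one updates. -/

section LinearAlgebra

open Matrix

variable {n : ℕ}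

/-- The quadratic form of a square matrix. -/
def quad (M : Matrix (Fin n) (Fin n) ℝ) (z : Fin n → ℝ) : ℝ := z ⬝ᵥ (M *ᵥ z)

lemma quad_add (M N : Matrix (Fin n) (Fin n) ℝ) (z : Fin n → ℝ) :
    quad (M + N) z = quad M z + quad N z := by
  simp [quad, Matrix.add_mulVec, dotProduct_add]

lemma quad_smul (c : ℝ) (M : Matrix (Fin n) (Fin n) ℝ) (z : Fin n → ℝ) :
    quad (c • M) z = c * quad M z := by
  simp [quad, Matrix.smul_mulVec]

lemma quad_smul_right (c : ℝ) (M : Matrix (Fin n) (Fin n) ℝ) (z : Fin n → ℝ) :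
    quad M (c • z) = c ^ 2 * quad M z := by
  simp [quad, Matrix.mulVec_smul]; ring

lemma quad_vecMulVec (y z : Fin n → ℝ) : quad (vecMulVec y y) z = (y ⬝ᵥ z) ^ 2 := by
  simp [quad, Matrix.vecMulVec_mulVec, dotProduct_comm z y]; ring

lemma quad_one (z : Fin n → ℝ) : quad (1 : Matrix (Fin n) (Fin n) ℝ) z = z ⬝ᵥ z := by
  simp [quad]

lemma quad_sum {ι : Type*} (s : Finset ι) (M : ι → Matrix (Fin n) (Fin n) ℝ) (z : Fin n → ℝ) :
    quad (∑ j ∈ s, M j) z = ∑ j ∈ s, quad (M j) z := by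
  classical
  induction s using Finset.induction_on with
  | empty => simp [quad]
  | insert a s ha ih => rw [Finset.sum_insert ha, Finset.sum_insert ha, quad_add, ih]

lemma quad_nonneg {M : Matrix (Fin n) (Fin n) ℝ} (hM : M.PosSemidef) (z : Fin n → ℝ) :
    0 ≤ quad M z := by
  simpa [quad] using hM.dotProduct_mulVec_nonneg z

lemma quad_pos {M : Matrix (Fin n) (Fin n) ℝ} (hM : M.PosDef) {z : Fin n → ℝ} (hz : z ≠ 0) :
    0 < quad M z := by
  simpa [quad] using hM.dotProduct_mulVec_pos hz

lemma dotProduct_mulVec_symm {M : Matrix (Fin n) (Fin n) ℝ} (hM : Mᵀ = M) (u v : Fin n → ℝ) :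
    u ⬝ᵥ (M *ᵥ v) = v ⬝ᵥ (M *ᵥ u) := by
  rw [dotProduct_mulVec, ← mulVec_transpose, hM, dotProduct_comm]

lemma transpose_of_posSemidef {M : Matrix (Fin n) (Fin n) ℝ} (hM : M.PosSemidef) : Mᵀ = M := by
  simpa [IsHermitian, conjTranspose_eq_transpose_of_trivial] using hM.1

lemma posSemidef_of_quad {M : Matrix (Fin n) (Fin n) ℝ} (hs : Mᵀ = M)
    (h : ∀ z, 0 ≤ quad M z) : M.PosSemidef := by
  refine PosSemidef.of_dotProduct_mulVec_nonneg ?_ (fun z => by simpa [quad] using h z)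
  simpa [IsHermitian, conjTranspose_eq_transpose_of_trivial] using hs

/-- The Cauchy–Schwarz inequality for a positive semidefinite form. -/
lemma sq_dotProduct_mulVec_le {M : Matrix (Fin n) (Fin n) ℝ} (hM : M.PosSemidef)
    (u v : Fin n → ℝ) : (u ⬝ᵥ (M *ᵥ v)) ^ 2 ≤ quad M u * quad M v := by
  have hs := transpose_of_posSemidef hM
  have key : ∀ t : ℝ, 0 ≤ quad M v * (t * t) + (2 * (u ⬝ᵥ (M *ᵥ v))) * t + quad M u := by
    intro t
    have h := quad_nonneg hM (u + t • v)
    have e : quad M (u + t • v)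
        = quad M v * (t * t) + (2 * (u ⬝ᵥ (M *ᵥ v))) * t + quad M u := by
      simp only [quad, mulVec_add, mulVec_smul, dotProduct_add, add_dotProduct, dotProduct_smul,
        smul_dotProduct, smul_eq_mul]
      rw [dotProduct_mulVec_symm hs v u]; ring
    linarith
  have := discrim_le_zero key
  simp only [discrim] at this
  nlinarith

lemma quad_mulVec_inv {U : Matrix (Fin n) (Fin n) ℝ} (hU : U.PosDef) (S : Fin n → ℝ) :
    quad U (U⁻¹ *ᵥ S) = quad U⁻¹ S := by
  have hd : IsUnit U.det := hU.det_pos.ne'.isUnit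
  have : U *ᵥ (U⁻¹ *ᵥ S) = S := by
    rw [mulVec_mulVec, mul_nonsing_inv _ hd, one_mulVec]
  simp only [quad, this]
  rw [dotProduct_comm]

/-- Cauchy–Schwarz in the form `U` for the pair `v`, `U⁻¹ S`. This duality between `U` and `U⁻¹` is
what links linear responses to determinants and to self-normalized sums. -/
lemma sq_dotProduct_le {U : Matrix (Fin n) (Fin n) ℝ} (hU : U.PosDef) (v S : Fin n → ℝ) :
    (v ⬝ᵥ S) ^ 2 ≤ quad U v * quad U⁻¹ S := by
  have hd : IsUnit U.det := hU.det_pos.ne'.isUnit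
  have : U *ᵥ (U⁻¹ *ᵥ S) = S := by
    rw [mulVec_mulVec, mul_nonsing_inv _ hd, one_mulVec]
  have h := sq_dotProduct_mulVec_le hU.posSemidef v (U⁻¹ *ᵥ S)
  rwa [this, quad_mulVec_inv hU] at h

/-- Inversion reverses the order of positive definite forms. -/
lemma quad_inv_le {A B : Matrix (Fin n) (Fin n) ℝ} (hA : A.PosDef) (hB : B.PosDef) {c : ℝ}
    (h : ∀ z, quad A z ≤ c * quad B z) (S : Fin n → ℝ) :
    quad B⁻¹ S ≤ c * quad A⁻¹ S := by
  by_cases hS : quad B⁻¹ S = 0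
  · by_cases hz : S = 0
    · simp [hz, quad]
    · exact absurd hS (quad_pos hB.inv hz).ne'
  have hpos : 0 < quad B⁻¹ S := lt_of_le_of_ne (quad_nonneg hB.inv.posSemidef S) (Ne.symm hS)
  -- Duality for `A`, tested at `B⁻¹ S`: the left side is the square of `quad B⁻¹ S`, and one factor
  -- of it cancels at the end.
  have h1 := sq_dotProduct_le hA (B⁻¹ *ᵥ S) S
  have h2 : (B⁻¹ *ᵥ S) ⬝ᵥ S = quad B⁻¹ S := by rw [dotProduct_comm]; rfl
  have h3 := h (B⁻¹ *ᵥ S)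
  rw [quad_mulVec_inv hB] at h3
  rw [h2] at h1
  have h4 : 0 ≤ quad A⁻¹ S := quad_nonneg hA.inv.posSemidef S
  have h5 : (quad B⁻¹ S) * quad B⁻¹ S ≤ (quad B⁻¹ S) * (c * quad A⁻¹ S) := by
    nlinarith
  exact le_of_mul_le_mul_left h5 hpos

lemma posSemidef_vecMulVec (y : Fin n → ℝ) : (vecMulVec y y).PosSemidef := by
  simpa using posSemidef_vecMulVec_self_star y

lemma det_add_vecMulVec {U : Matrix (Fin n) (Fin n) ℝ} (hU : U.PosDef) (y : Fin n → ℝ) :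
    (U + vecMulVec y y).det = U.det * (1 + quad U⁻¹ y) := by
  have hd : IsUnit U.det := hU.det_pos.ne'.isUnit
  have e : vecMulVec y y = replicateCol Unit y * replicateRow Unit y :=
    vecMulVec_eq Unit y y
  rw [e, det_add_replicateCol_mul_replicateRow hd]
  congr 1
  rw [det_unique]
  simp [Matrix.mul_apply, quad, dotProduct, mulVec, Finset.sum_mul, Finset.mul_sum]
  rw [Finset.sum_comm]
  refine Finset.sum_congr rfl fun i _ => Finset.sum_congr rfl fun j _ => by ring

/-- A positive semidefinite `M` is a sum of rank-one squares, and each of them multiplies the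
determinant by a factor `1 + quad _⁻¹ _ ≥ 1`. -/
lemma det_add_mono {U M : Matrix (Fin n) (Fin n) ℝ} (hU : U.PosDef) (hM : M.PosSemidef) :
    U.det ≤ (U + M).det := by
  obtain ⟨m, v, rfl⟩ := posSemidef_iff_eq_sum_vecMulVec.1 hM
  suffices H : ∀ s : Finset (Fin m), (U + ∑ i ∈ s, vecMulVec (v i) (star (v i))).PosDef ∧
      U.det ≤ (U + ∑ i ∈ s, vecMulVec (v i) (star (v i))).det from (H _).2
  intro s
  induction s using Finset.induction_on with
  | empty => simpa using hU
  | insert a s ha ih =>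
    rw [Finset.sum_insert ha, add_comm (vecMulVec _ _), ← add_assoc]
    have e : star (v a) = v a := by ext; simp
    rw [e]
    refine ⟨ih.1.add_posSemidef (posSemidef_vecMulVec _), ?_⟩
    rw [det_add_vecMulVec ih.1]
    have := quad_nonneg ih.1.inv.posSemidef (v a)
    nlinarith [ih.1.det_pos, ih.2]

/-- A determinant bound on a sum of forms turns into an order bound. -/
lemma quad_le_of_det_le {P P' : Matrix (Fin n) (Fin n) ℝ} (hP : P.PosDef) (hP' : P'.PosSemidef)
    {c : ℝ} (h : (P + P').det ≤ c * P.det) (z : Fin n → ℝ) : quad P' z ≤ c * quad P z := by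
  by_cases hz : quad P' z = 0
  · rw [hz]
    have hc : 0 ≤ c := by
      by_contra hc
      have := (hP.add_posSemidef hP').det_pos
      nlinarith [hP.det_pos]
    exact mul_nonneg hc (quad_nonneg hP.posSemidef z)
  have hq : 0 < quad P' z := lt_of_le_of_ne (quad_nonneg hP' z) (Ne.symm hz)
  have hz0 : z ≠ 0 := by rintro rfl; exact hz (by simp [quad])
  have hqP := quad_pos hP hz0
  -- The rank-one form `y yᵀ` lies below `P'` and agrees with it at `z`. For this rank-one form the
  -- determinant hypothesis reads `1 + quad P⁻¹ y ≤ c`, and duality for `P` returns the value at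
  -- `z`.
  set y : Fin n → ℝ := (Real.sqrt (quad P' z))⁻¹ • (P' *ᵥ z) with hy
  have hs : Real.sqrt (quad P' z) ^ 2 = quad P' z := Real.sq_sqrt hq.le
  have hsp : 0 < Real.sqrt (quad P' z) := Real.sqrt_pos.2 hq
  have hyv : ∀ v, (y ⬝ᵥ v) ^ 2 ≤ quad P' v := by
    intro v
    have h1 := sq_dotProduct_mulVec_le hP' v z
    have e : y ⬝ᵥ v = (Real.sqrt (quad P' z))⁻¹ * (v ⬝ᵥ (P' *ᵥ z)) := by
      rw [hy, smul_dotProduct, smul_eq_mul, dotProduct_comm]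
    rw [e, mul_pow, inv_pow, hs, inv_mul_le_iff₀ hq]
    linarith
  have hyz : (y ⬝ᵥ z) ^ 2 = quad P' z := by
    have e : y ⬝ᵥ z = (Real.sqrt (quad P' z))⁻¹ * quad P' z := by
      rw [hy, smul_dotProduct, smul_eq_mul, dotProduct_comm]; rfl
    rw [e, mul_pow, inv_pow, hs]; field_simp
  have hrem : (P' - vecMulVec y y).PosSemidef := by
    refine posSemidef_of_quad ?_ ?_
    · rw [transpose_sub, transpose_of_posSemidef hP', transpose_vecMulVec]
    · intro v
      have := hyv v
      rw [← quad_vecMulVec] at this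
      have e : quad (P' - vecMulVec y y) v = quad P' v - quad (vecMulVec y y) v := by
        simp [quad, sub_mulVec, dotProduct_sub]
      linarith
  have h1 : (P + vecMulVec y y).det ≤ (P + P').det := by
    have := det_add_mono (hP.add_posSemidef (posSemidef_vecMulVec y)) hrem
    rwa [show P + vecMulVec y y + (P' - vecMulVec y y) = P + P' by abel] at this
  rw [det_add_vecMulVec hP] at h1
  have h2 : 1 + quad P⁻¹ y ≤ c := by
    have : P.det * (1 + quad P⁻¹ y) ≤ P.det * c := by linarith
    exact le_of_mul_le_mul_left this hP.det_pos
  have h3 := sq_dotProduct_le hP z y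
  rw [dotProduct_comm, hyz] at h3
  nlinarith [quad_nonneg hP.inv.posSemidef y]

/-- A positive semidefinite matrix has determinant at most a power of its trace. -/
lemma det_le_trace_pow {M : Matrix (Fin n) (Fin n) ℝ} (hM : M.PosSemidef) :
    M.det ≤ M.trace ^ n := by
  have hd := hM.1.det_eq_prod_eigenvalues
  have ht := hM.1.trace_eq_sum_eigenvalues
  simp only [RCLike.ofReal_real_eq_id, id_eq] at hd ht
  rw [hd, ht]
  calc ∏ i, hM.1.eigenvalues i ≤ ∏ _i : Fin n, ∑ j, hM.1.eigenvalues j := by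
        refine Finset.prod_le_prod (fun i _ => hM.eigenvalues_nonneg i) fun i _ => ?_
        exact Finset.single_le_sum (fun j _ => hM.eigenvalues_nonneg j) (Finset.mem_univ i)
    _ = _ := by simp

lemma trace_mul_vecMulVec (P : Matrix (Fin n) (Fin n) ℝ) (y : Fin n → ℝ) :
    (P * vecMulVec y y).trace = quad P y := by
  simp [Matrix.trace, Matrix.mul_apply, vecMulVec_apply, quad, dotProduct, mulVec, Finset.mul_sum]
  refine Finset.sum_congr rfl fun i _ => Finset.sum_congr rfl fun j _ => by ring

open scoped MatrixOrder Matrix.Norms.L2Operator in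
lemma exists_eq_conjTranspose_mul_self {M : Matrix (Fin n) (Fin n) ℝ} (hM : M.PosSemidef) :
    ∃ B : Matrix (Fin n) (Fin n) ℝ, M = Bᴴ * B :=
  CStarAlgebra.nonneg_iff_eq_star_mul_self.mp hM.nonneg

/-- Factor `U⁻¹ = Bᵀ B`. Conjugation by `B` turns `U + V` into `1 + B V Bᵀ`, a positive semidefinite
matrix of trace `n + tr (U⁻¹ V)`, and its determinant is at most the `n`-th power of its trace. -/
lemma det_add_le {U V : Matrix (Fin n) (Fin n) ℝ} (hU : U.PosDef) (hV : V.PosSemidef) :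
    (U + V).det ≤ U.det * ((n : ℝ) + (U⁻¹ * V).trace) ^ n := by
  obtain ⟨B, hB⟩ := exists_eq_conjTranspose_mul_self hU.inv.posSemidef
  rw [conjTranspose_eq_transpose_of_trivial] at hB
  have hd : IsUnit U.det := hU.det_pos.ne'.isUnit
  have hdet : U.det * (Bᵀ.det * B.det) = 1 := by
    rw [← det_mul, ← hB, ← det_mul, mul_nonsing_inv _ hd, det_one]
  have hBunit : IsUnit B.det := by
    refine IsUnit.mk0 _ fun h => ?_
    rw [h] at hdet; simp at hdet
  have hBtunit : IsUnit Bᵀ.det := by rwa [det_transpose]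
  have hBUB : B * U * Bᵀ = 1 := by
    have h1 : U⁻¹ * U = 1 := nonsing_inv_mul _ hd
    rw [hB] at h1
    have h2 : Bᵀ * (B * U * Bᵀ) = Bᵀ * 1 := by
      rw [← mul_assoc, ← mul_assoc, h1]; simp
    calc B * U * Bᵀ = Bᵀ⁻¹ * (Bᵀ * (B * U * Bᵀ)) := by
          rw [← mul_assoc Bᵀ⁻¹, nonsing_inv_mul _ hBtunit, one_mul]
      _ = 1 := by rw [h2, ← mul_assoc, nonsing_inv_mul _ hBtunit, one_mul]
  have hBVB : (B * V * Bᵀ).PosSemidef := by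
    have := hV.mul_mul_conjTranspose_same B
    rwa [conjTranspose_eq_transpose_of_trivial] at this
  have h1 : (B * (U + V) * Bᵀ) = 1 + B * V * Bᵀ := by
    rw [mul_add, add_mul, hBUB]
  have h2 := det_le_trace_pow (PosSemidef.one.add hBVB)
  rw [← h1, det_mul, det_mul, h1, trace_add, trace_one, trace_mul_comm (B * V),
    ← mul_assoc Bᵀ, ← hB] at h2
  have h3 : (U + V).det = U.det * (B.det * (U + V).det * Bᵀ.det) := by
    calc (U + V).det = (U.det * (Bᵀ.det * B.det)) * (U + V).det := by rw [hdet, one_mul]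
      _ = _ := by ring
  rw [h3]
  refine mul_le_mul_of_nonneg_left ?_ hU.det_pos.le
  simpa using h2

/-- The Sherman–Morrison update of an inverse. -/
lemma inv_add_vecMulVec {U : Matrix (Fin n) (Fin n) ℝ} (hU : U.PosDef) (y : Fin n → ℝ) :
    (U + vecMulVec y y)⁻¹
      = U⁻¹ - (1 + quad U⁻¹ y)⁻¹ • vecMulVec (U⁻¹ *ᵥ y) (U⁻¹ *ᵥ y) := by
  have hd : IsUnit U.det := hU.det_pos.ne'.isUnit
  have hq := quad_nonneg hU.inv.posSemidef y
  have hUy : U *ᵥ (U⁻¹ *ᵥ y) = y := by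
    rw [mulVec_mulVec, mul_nonsing_inv _ hd, one_mulVec]
  have hyU : vecMulVec y y * U⁻¹ = vecMulVec y (U⁻¹ *ᵥ y) := by
    rw [vecMulVec_mul, ← mulVec_transpose, transpose_of_posSemidef hU.inv.posSemidef]
  refine inv_eq_right_inv ?_
  rw [mul_sub, add_mul, mul_nonsing_inv _ hd, hyU, Matrix.mul_smul, add_mul, mul_vecMulVec, hUy,
    vecMulVec_mul_vecMulVec]
  have e : y ⬝ᵥ (U⁻¹ *ᵥ y) = quad U⁻¹ y := rfl
  rw [e]
  ext i j
  simp only [Matrix.sub_apply, Matrix.add_apply, Matrix.smul_apply, vecMulVec_apply, smul_eq_mul, Pi.smul_apply]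
  field_simp
  ring

/-- One step of the self-normalized recursion for `S ⬝ᵥ U⁻¹ S`. -/
lemma quad_inv_update {U : Matrix (Fin n) (Fin n) ℝ} (hU : U.PosDef) (y S : Fin n → ℝ) (w : ℝ) :
    quad (U + vecMulVec y y)⁻¹ (S + w • y)
      = quad U⁻¹ S
        - (1 + quad U⁻¹ y) * ((y ⬝ᵥ (U⁻¹ *ᵥ S)) / (1 + quad U⁻¹ y)) ^ 2
        + 2 * w * ((y ⬝ᵥ (U⁻¹ *ᵥ S)) / (1 + quad U⁻¹ y))
        + quad U⁻¹ y / (1 + quad U⁻¹ y) * w ^ 2 := by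
  have hq := quad_nonneg hU.inv.posSemidef y
  have hs := transpose_of_posSemidef hU.inv.posSemidef
  rw [inv_add_vecMulVec hU]
  have e1 : ∀ z, quad (U⁻¹ - (1 + quad U⁻¹ y)⁻¹ • vecMulVec (U⁻¹ *ᵥ y) (U⁻¹ *ᵥ y)) z
      = quad U⁻¹ z - (1 + quad U⁻¹ y)⁻¹ * (y ⬝ᵥ (U⁻¹ *ᵥ z)) ^ 2 := by
    intro z
    have : (U⁻¹ *ᵥ y) ⬝ᵥ z = y ⬝ᵥ (U⁻¹ *ᵥ z) := by
      rw [dotProduct_comm, dotProduct_mulVec_symm hs]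
    rw [← this, ← quad_vecMulVec, ← quad_smul]
    simp [quad, sub_mulVec, dotProduct_sub]
  have e2 : quad U⁻¹ (S + w • y)
      = quad U⁻¹ S + 2 * w * (y ⬝ᵥ (U⁻¹ *ᵥ S)) + w ^ 2 * quad U⁻¹ y := by
    simp only [quad, mulVec_add, mulVec_smul, dotProduct_add, add_dotProduct, dotProduct_smul,
      smul_dotProduct, smul_eq_mul]
    rw [dotProduct_mulVec_symm hs S y]; ring
  have e3 : y ⬝ᵥ (U⁻¹ *ᵥ (S + w • y)) = y ⬝ᵥ (U⁻¹ *ᵥ S) + w * quad U⁻¹ y := by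
    simp only [quad, mulVec_add, mulVec_smul, dotProduct_add, dotProduct_smul, smul_eq_mul]
  rw [e1, e2, e3]
  generalize quad U⁻¹ y = h at *
  generalize y ⬝ᵥ (U⁻¹ *ᵥ S) = e at *
  have : (1 + h) ≠ 0 := by positivity
  field_simp
  ring

end LinearAlgebra

/-! ### Deterministic summation lemmas: Kronecker's lemma and self-normalized sums. -/

section Kronecker

/-- Kronecker's lemma, in a form that does not require the weights to diverge. -/
lemma exists_abs_sum_mul_le {d L : ℕ → ℝ} (hL : Monotone L) (hL0 : 0 ≤ L 0) {l : ℝ}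
    (hd : Tendsto (fun T => ∑ t ∈ Finset.range T, d t) atTop (𝓝 l)) {δ : ℝ} (hδ : 0 < δ) :
    ∃ K, ∀ T, |∑ t ∈ Finset.range T, L (t + 1) * d t| ≤ δ * L T + K := by
  set e : ℕ → ℝ := fun T => ∑ t ∈ Finset.range T, d t - l with he
  have he0 : Tendsto e atTop (𝓝 0) := by
    have := hd.sub_const l
    simpa [he] using this
  have hde : ∀ t, d t = e (t + 1) - e t := by
    intro t; simp [he, Finset.sum_range_succ]
  obtain ⟨E, hE⟩ := he0.abs.bddAbove_range
  have hE' : ∀ t, |e t| ≤ E := fun t => hE ⟨t, rfl⟩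
  have hE0 : 0 ≤ E := (abs_nonneg _).trans (hE' 0)
  have hLn : ∀ t, 0 ≤ L t := fun t => hL0.trans (hL (Nat.zero_le t))
  obtain ⟨t0, ht0⟩ : ∃ t0, ∀ t ≥ t0, |e t| ≤ δ / 2 := by
    have := he0.abs
    rw [abs_zero] at this
    exact eventually_atTop.1 (this.eventually (ge_mem_nhds (by positivity)))
  -- Summation by parts against the tails `e`. Increments of `L` before `t0` are charged at the
  -- crude rate `E`, later ones at the rate `δ / 2`.
  have hA : ∀ T, |∑ t ∈ Finset.range T, L (t + 1) * d t - L T * e T|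
      ≤ δ / 2 * L T + E * L (min T t0) := by
    intro T
    induction T with
    | zero =>
      simp only [Finset.range_zero, Finset.sum_empty, zero_sub, abs_neg, abs_mul, Nat.zero_min]
      rw [abs_of_nonneg (hLn 0)]
      nlinarith [hE' 0, hLn 0, mul_nonneg hδ.le (hLn 0)]
    | succ T ih =>
      have e1 : ∑ t ∈ Finset.range (T + 1), L (t + 1) * d t - L (T + 1) * e (T + 1)
          = (∑ t ∈ Finset.range T, L (t + 1) * d t - L T * e T) - (L (T + 1) - L T) * e T := by
        rw [Finset.sum_range_succ, hde T]; ring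
      have hinc : 0 ≤ L (T + 1) - L T := sub_nonneg.2 (hL (Nat.le_succ T))
      rw [e1]
      refine (abs_sub _ _).trans ?_
      rw [abs_mul, abs_of_nonneg hinc]
      rcases lt_or_ge T t0 with h | h
      · rw [min_eq_left (by omega : T + 1 ≤ t0)]
        rw [min_eq_left h.le] at ih
        have := mul_le_mul_of_nonneg_left (hE' T) hinc
        nlinarith
      · rw [min_eq_right (by omega : t0 ≤ T + 1)]
        rw [min_eq_right h] at ih
        have := mul_le_mul_of_nonneg_left (ht0 T h) hinc
        nlinarith
  refine ⟨2 * (E * L t0), fun T => ?_⟩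
  have h1 := hA T
  have h2 : E * L (min T t0) ≤ E * L t0 :=
    mul_le_mul_of_nonneg_left (hL (min_le_right _ _)) hE0
  have h3 : |L T * e T| ≤ δ / 2 * L T + E * L t0 := by
    rw [abs_mul, abs_of_nonneg (hLn T)]
    rcases lt_or_ge T t0 with h | h
    · have := mul_le_mul (hL h.le) (hE' T) (abs_nonneg _) (hLn t0)
      nlinarith [mul_nonneg hδ.le (hLn T)]
    · have := mul_le_mul_of_nonneg_left (ht0 T h) (hLn T)
      nlinarith [mul_nonneg hE0 (hLn t0)]
  have h4 : |∑ t ∈ Finset.range T, L (t + 1) * d t|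
      ≤ |∑ t ∈ Finset.range T, L (t + 1) * d t - L T * e T| + |L T * e T| := by
    have := abs_add_le (∑ t ∈ Finset.range T, L (t + 1) * d t - L T * e T) (L T * e T)
    simpa using this
  linarith

/-- A self-normalized sum with exponent greater than one is bounded. -/
lemma sum_mul_rpow_neg_le {a : ℕ → ℝ} (ha : ∀ t, 0 ≤ a t) {γ : ℝ} (hγ : 1 < γ) (T : ℕ) :
    ∑ t ∈ Finset.range T, a t * (1 + ∑ r ∈ Finset.range (t + 1), a r) ^ (-γ)
      ≤ (1 - (1 + ∑ r ∈ Finset.range T, a r) ^ (1 - γ)) / (γ - 1) := by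
  have hγ' : 0 < γ - 1 := by linarith
  induction T with
  | zero => simp
  | succ T ih =>
    rw [Finset.sum_range_succ]
    set x := 1 + ∑ r ∈ Finset.range T, a r with hx
    have hxy : 1 + ∑ r ∈ Finset.range (T + 1), a r = x + a T := by
      rw [Finset.sum_range_succ, hx]; ring
    rw [hxy]
    have hx1 : 1 ≤ x := by
      have := Finset.sum_nonneg fun r (_ : r ∈ Finset.range T) => ha r
      rw [hx]; linarith
    have hy : 0 < x + a T := by linarith [ha T]
    have hx0 : 0 < x := by linarith
    -- Comparison of a term with the integral of `u ^ (-γ)` over the interval from `x` to `x + a T`,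
    -- so that the bounds telescope. It follows from the tangent inequality for `u ^ (1 - γ)` at `u
    -- = 1`.
    have key : (γ - 1) * (a T * (x + a T) ^ (-γ)) ≤ x ^ (1 - γ) - (x + a T) ^ (1 - γ) := by
      have h1 : 1 + (γ - 1) * (1 - x / (x + a T)) ≤ (x / (x + a T)) ^ (1 - γ) := by
        have hu : 0 < x / (x + a T) := by positivity
        rw [Real.rpow_def_of_pos hu]
        have h2 := Real.add_one_le_exp (Real.log (x / (x + a T)) * (1 - γ))
        have h3 := Real.log_le_sub_one_of_pos hu
        nlinarith
      rw [Real.div_rpow hx0.le hy.le, le_div_iff₀ (Real.rpow_pos_of_pos hy _)] at h1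
      have h4 : (x + a T) ^ (1 - γ) = (x + a T) * (x + a T) ^ (-γ) := by
        rw [sub_eq_add_neg, Real.rpow_add hy, Real.rpow_one]
      have h5 : (γ - 1) * (1 - x / (x + a T)) * (x + a T) ^ (1 - γ)
          = (γ - 1) * (a T * (x + a T) ^ (-γ)) := by
        rw [h4]; field_simp; ring
      nlinarith
    have e1 : (1 - (x + a T) ^ (1 - γ)) / (γ - 1)
        = (1 - x ^ (1 - γ)) / (γ - 1) + (x ^ (1 - γ) - (x + a T) ^ (1 - γ)) / (γ - 1) := by
      rw [← add_div]; congr 1; ring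
    rw [e1]
    refine add_le_add ih ?_
    rw [le_div_iff₀ hγ']; linarith

lemma sum_mul_rpow_neg_le' {a : ℕ → ℝ} (ha : ∀ t, 0 ≤ a t) {γ : ℝ} (hγ : 1 < γ) (T : ℕ) :
    ∑ t ∈ Finset.range T, a t * (1 + ∑ r ∈ Finset.range (t + 1), a r) ^ (-γ) ≤ 1 / (γ - 1) := by
  refine (sum_mul_rpow_neg_le ha hγ T).trans ?_
  have hγ' : 0 < γ - 1 := by linarith
  gcongr
  have h : 0 ≤ ∑ r ∈ Finset.range T, a r := Finset.sum_nonneg fun r _ => ha r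
  have : (0 : ℝ) ≤ (1 + ∑ r ∈ Finset.range T, a r) ^ (1 - γ) := by positivity
  linarith

end Kronecker

/-! ### Conditional moment bounds, Ville's inequality and almost sure martingale limit laws. -/

section Conditional

variable {Ω : Type*} {m m0 : MeasurableSpace Ω} {μ : Measure Ω}

/-- The conditional expectation of `ξ` given `m` is at most `c`, in integrated form. -/
def CondBound (m : MeasurableSpace Ω) {m0 : MeasurableSpace Ω} (μ : Measure Ω) (ξ : Ω → ℝ≥0∞)
    (c : ℝ≥0∞) : Prop :=
  ∀ F, MeasurableSet[m] F → ∫⁻ ω in F, ξ ω ∂μ ≤ c * μ F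

lemma CondBound.mono {ξ ξ' : Ω → ℝ≥0∞} {c : ℝ≥0∞} (h : CondBound m μ ξ c)
    (hle : ∀ ω, ξ' ω ≤ ξ ω) : CondBound m μ ξ' c :=
  fun F hF => (lintegral_mono hle).trans (h F hF)

/-- On `m` the hypothesis compares two measures, the one with density `ξ` and `c • μ`; an
`m`-measurable weight has the same integral against a measure and against its restriction to `m`. -/
lemma CondBound.lintegral_mul_le (hm : m ≤ m0) {ξ : Ω → ℝ≥0∞} (hξ : Measurable ξ) {c : ℝ≥0∞}
    (h : CondBound m μ ξ c) {Y : Ω → ℝ≥0∞} (hY : Measurable[m] Y) :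
    ∫⁻ ω, Y ω * ξ ω ∂μ ≤ c * ∫⁻ ω, Y ω ∂μ := by
  have h1 : (μ.withDensity ξ).trim hm ≤ c • μ.trim hm := by
    refine Measure.le_iff.2 fun F hF => ?_
    rw [trim_measurableSet_eq hm hF, withDensity_apply _ (hm F hF), Measure.smul_apply,
      trim_measurableSet_eq hm hF, smul_eq_mul]
    exact h F hF
  calc ∫⁻ ω, Y ω * ξ ω ∂μ = ∫⁻ ω, Y ω ∂(μ.withDensity ξ) := by
        rw [lintegral_withDensity_eq_lintegral_mul _ hξ (hY.mono hm le_rfl)]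
        simp [mul_comm]
    _ = ∫⁻ ω, Y ω ∂((μ.withDensity ξ).trim hm) := (lintegral_trim hm hY).symm
    _ ≤ ∫⁻ ω, Y ω ∂(c • μ.trim hm) := lintegral_mono' h1 le_rfl
    _ = c * ∫⁻ ω, Y ω ∂μ := by rw [lintegral_smul_measure, lintegral_trim hm hY, smul_eq_mul]

lemma integral_mul_eq_zero_of_condExp [IsFiniteMeasure μ] (hm : m ≤ m0) {Y ζ : Ω → ℝ}
    (hζ : Integrable ζ μ) (hc : μ[ζ | m] =ᵐ[μ] 0) (hY : StronglyMeasurable[m] Y)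
    (hi : Integrable (fun ω => Y ω * ζ ω) μ) : ∫ ω, Y ω * ζ ω ∂μ = 0 := by
  have h1 := condExp_mul_of_stronglyMeasurable_left hY (show Integrable (Y * ζ) μ from hi) hζ
  have h2 : ∫ ω, (Y * ζ) ω ∂μ = ∫ ω, (μ[Y * ζ | m]) ω ∂μ := (integral_condExp hm).symm
  have h3 : ∫ ω, (μ[Y * ζ | m]) ω ∂μ = 0 := by
    rw [integral_congr_ae (g := fun _ => 0), integral_zero]
    filter_upwards [h1, hc] with ω h1 h2
    rw [h1]; simp [h2]
  rw [← h3, ← h2]; rfl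

/-- Ville's maximal inequality. -/
lemma ville {𝒢 : Filtration ℕ m0} {Z : ℕ → Ω → ℝ≥0∞} (hZ : ∀ t, Measurable[𝒢 t] (Z t))
    (hsup : ∀ t F, MeasurableSet[𝒢 t] F → ∫⁻ ω in F, Z (t + 1) ω ∂μ ≤ ∫⁻ ω in F, Z t ω ∂μ)
    (c : ℝ≥0∞) : c * μ {ω | ∃ t, c ≤ Z t ω} ≤ ∫⁻ ω, Z 0 ω ∂μ := by
  set A : ℕ → Set Ω := fun t => {ω | ∃ r ≤ t, c ≤ Z r ω} with hA
  have hAm : ∀ t, MeasurableSet[𝒢 t] (A t) := by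
    intro t
    have : A t = ⋃ r ∈ Set.Iic t, {ω | c ≤ Z r ω} := by ext; simp [hA]
    rw [this]
    refine MeasurableSet.biUnion (Set.to_countable _) fun r hr => ?_
    exact 𝒢.mono hr _ (measurableSet_le measurable_const (hZ r))
  have hstep : ∀ t, ∫⁻ ω in (A t)ᶜ, Z t ω ∂μ + c * μ (A t) ≤ ∫⁻ ω, Z 0 ω ∂μ := by
    intro t
    induction t with
    | zero =>
      refine le_trans ?_ (lintegral_add_compl (Z 0) (𝒢.le 0 _ (hAm 0))).le
      refine (add_comm _ _).le.trans (add_le_add ?_ le_rfl)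
      rw [← setLIntegral_const]
      refine setLIntegral_mono ((hZ 0).mono (𝒢.le 0) le_rfl) fun ω hω => ?_
      obtain ⟨r, hr, h⟩ := hω
      obtain rfl : r = 0 := by omega
      exact h
    | succ t ih =>
      refine le_trans ?_ ih
      have hsub : A t ⊆ A (t + 1) := fun ω ⟨r, hr, h⟩ => ⟨r, by omega, h⟩
      have h1 := hsup t _ (hAm t).compl
      have hmA := 𝒢.le _ _ (hAm t)
      have hmA' := 𝒢.le _ _ (hAm (t + 1))
      have h2 : ∫⁻ ω in (A (t + 1))ᶜ, Z (t + 1) ω ∂μ + c * μ (A (t + 1) \ A t)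
          ≤ ∫⁻ ω in (A t)ᶜ, Z (t + 1) ω ∂μ := by
        have e : (A t)ᶜ = (A (t + 1))ᶜ ∪ (A (t + 1) \ A t) := by
          ext ω
          simp only [Set.mem_compl_iff, Set.mem_union, Set.mem_sdiff]
          constructor
          · intro h; by_cases h' : ω ∈ A (t + 1) <;> tauto
          · rintro (h | h) hh
            · exact h (hsub hh)
            · exact h.2 hh
        rw [e, lintegral_union (hmA'.diff hmA)]
        · gcongr
          rw [← setLIntegral_const]
          refine setLIntegral_mono ((hZ _).mono (𝒢.le _) le_rfl) fun ω hω => ?_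
          obtain ⟨⟨r, hr, h⟩, hn⟩ := hω
          rcases Nat.lt_or_ge r (t + 1) with h' | h'
          · exact absurd ⟨r, by omega, h⟩ hn
          · obtain rfl : r = t + 1 := by omega
            exact h
        · rw [Set.disjoint_left]; intro ω h h'; exact h h'.1
      have h3 : μ (A (t + 1)) = μ (A (t + 1) \ A t) + μ (A t) :=
        (measure_sdiff_add_inter (A (t + 1)) hmA).symm.trans (by
          rw [Set.inter_eq_self_of_subset_right hsub])
      rw [h3, mul_add, ← add_assoc]
      gcongr
      exact h2.trans h1
  have hU : {ω | ∃ t, c ≤ Z t ω} = ⋃ t, A t := by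
    ext ω; simp only [hA, Set.mem_ofPred_eq, Set.mem_iUnion]
    exact ⟨fun ⟨t, h⟩ => ⟨t, t, le_rfl, h⟩, fun ⟨t, r, _, h⟩ => ⟨r, h⟩⟩
  have hmono : Monotone A := fun a b hab ω ⟨r, hr, h⟩ => ⟨r, hr.trans hab, h⟩
  rw [hU, hmono.measure_iUnion, ENNReal.mul_iSup]
  exact iSup_le fun t => le_trans le_add_self (hstep t)

variable [IsProbabilityMeasure μ]

/-- Martingale differences with summable variances have an almost surely convergent sum. -/
lemma ae_tendsto_sum_of_sq {𝒢 : Filtration ℕ m0} {d : ℕ → Ω → ℝ}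
    (hd : ∀ t, StronglyMeasurable[𝒢 (t + 1)] (d t)) (h2 : ∀ t, MemLp (d t) 2 μ)
    (hc : ∀ t, μ[d t | 𝒢 t] =ᵐ[μ] 0) {C : ℝ}
    (hC : ∀ T, ∑ t ∈ Finset.range T, ∫ ω, (d t ω) ^ 2 ∂μ ≤ C) :
    ∀ᵐ ω ∂μ, ∃ l, Tendsto (fun T => ∑ t ∈ Finset.range T, d t ω) atTop (𝓝 l) := by
  set M : ℕ → Ω → ℝ := fun T ω => ∑ t ∈ Finset.range T, d t ω with hM
  have hMsucc : ∀ T, M (T + 1) = fun ω => M T ω + d T ω := by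
    intro T; ext ω; simp [hM, Finset.sum_range_succ]
  have hMm : ∀ T, StronglyMeasurable[𝒢 T] (M T) := by
    intro T
    refine Finset.stronglyMeasurable_fun_sum _ fun t ht => ?_
    exact (hd t).mono (𝒢.mono (Nat.succ_le_of_lt (Finset.mem_range.1 ht)))
  have hM2 : ∀ T, MemLp (M T) 2 μ := fun T => memLp_finsetSum _ fun t _ => h2 t
  have hdi : ∀ t, Integrable (d t) μ := fun t => (h2 t).integrable (by norm_num)
  have hMi : ∀ t, Integrable (M t) μ := fun t => (hM2 t).integrable (by norm_num)
  have hmart : Martingale M 𝒢 μ := by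
    refine martingale_of_condExp_sub_eq_zero_nat hMm hMi fun t => ?_
    have : M (t + 1) - M t = d t := by ext ω; simp [hM, Finset.sum_range_succ]
    rw [this]; exact hc t
  have hsq : ∀ T, ∫ ω, (M T ω) ^ 2 ∂μ = ∑ t ∈ Finset.range T, ∫ ω, (d t ω) ^ 2 ∂μ := by
    intro T
    induction T with
    | zero => simp [hM]
    | succ T ih =>
      rw [Finset.sum_range_succ, ← ih]
      have hi : Integrable (fun ω => M T ω * d T ω) μ := (hM2 T).integrable_mul (h2 T)
      have h0 := integral_mul_eq_zero_of_condExp (𝒢.le T) (hdi T) (hc T) (hMm T) hi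
      have e : (fun ω => (M (T + 1) ω) ^ 2)
          = fun ω => ((M T ω) ^ 2 + (d T ω) ^ 2) + 2 * (M T ω * d T ω) := by
        ext ω; rw [hMsucc]; ring
      have hi2 : Integrable (fun ω => (M T ω) ^ 2 + (d T ω) ^ 2) μ :=
        (hM2 T).integrable_sq.add (h2 T).integrable_sq
      rw [e, integral_add hi2 (hi.const_mul 2), integral_add (hM2 T).integrable_sq (h2 T).integrable_sq, integral_const_mul, h0]
      ring
  have hbdd : ∀ T, eLpNorm (M T) 1 μ ≤ (Real.toNNReal (1 + C) : ℝ≥0∞) := by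
    intro T
    have h1 : eLpNorm (M T) 1 μ = ENNReal.ofReal (∫ ω, |M T ω| ∂μ) := by
      rw [eLpNorm_one_eq_lintegral_enorm, ofReal_integral_eq_lintegral_ofReal (hMi T).abs
        (ae_of_all _ fun ω => abs_nonneg _)]
      refine lintegral_congr fun ω => ?_
      rw [Real.enorm_eq_ofReal_abs]
    rw [h1]
    refine ENNReal.ofReal_le_ofReal ?_
    calc ∫ ω, |M T ω| ∂μ ≤ ∫ ω, (1 + (M T ω) ^ 2) ∂μ := by
          refine integral_mono (hMi T).abs ((integrable_const 1).add (hM2 T).integrable_sq) ?_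
          intro ω
          have : |M T ω| ≤ 1 + (M T ω) ^ 2 := by
            rw [← sq_abs (M T ω)]; nlinarith [sq_nonneg (|M T ω| - 1), abs_nonneg (M T ω)]
          exact this
      _ = 1 + ∑ t ∈ Finset.range T, ∫ ω, (d t ω) ^ 2 ∂μ := by
          rw [integral_add (integrable_const 1) (hM2 T).integrable_sq, hsq]; simp
      _ ≤ 1 + C := by linarith [hC T]
  exact hmart.submartingale.exists_ae_tendsto_of_bdd hbdd

/-- A martingale transform is negligible with respect to a predictable normalization. -/
lemma ae_abs_sum_mul_le {𝒢 : Filtration ℕ m0} {y ζ : ℕ → Ω → ℝ} {L : ℕ → Ω → ℝ}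
    (hy : ∀ t, StronglyMeasurable[𝒢 t] (y t)) (hζ : ∀ t, StronglyMeasurable[𝒢 (t + 1)] (ζ t))
    (hζi : ∀ t, Integrable (ζ t) μ) (hc : ∀ t, μ[ζ t | 𝒢 t] =ᵐ[μ] 0) {N : ℝ}
    (hN : ∀ t, CondBound (𝒢 t) μ (fun ω => ENNReal.ofReal ((ζ t ω) ^ 2)) (ENNReal.ofReal N))
    (hLm : ∀ t, StronglyMeasurable[𝒢 t] (L (t + 1))) (hL : ∀ ω, Monotone fun t => L t ω)
    (hL0 : ∀ ω, 1 ≤ L 0 ω) {C : ℝ≥0}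
    (hC : ∀ T, ∑ t ∈ Finset.range T, ∫⁻ ω, ENNReal.ofReal ((y t ω / L (t + 1) ω) ^ 2) ∂μ ≤ C) :
    ∀ᵐ ω ∂μ, ∀ δ > 0, ∃ K, ∀ T, |∑ t ∈ Finset.range T, y t ω * ζ t ω| ≤ δ * L T ω + K := by
  -- The divisor is `L (t + 1)`, which is already known at time `t`, so `d` is still a martingale
  -- difference. Its variances are summable, hence its partial sums converge and Kronecker's lemma
  -- restores the weights.
  set d : ℕ → Ω → ℝ := fun t ω => (y t ω / L (t + 1) ω) * ζ t ω with hd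
  have hq : ∀ t, StronglyMeasurable[𝒢 t] (fun ω => y t ω / L (t + 1) ω) := fun t =>
    (hy t).div (hLm t)
  have hζ2 : ∀ t, ∫⁻ ω, ENNReal.ofReal ((d t ω) ^ 2) ∂μ
      ≤ ENNReal.ofReal N * ∫⁻ ω, ENNReal.ofReal ((y t ω / L (t + 1) ω) ^ 2) ∂μ := by
    intro t
    have hm : Measurable[𝒢 t] fun ω => ENNReal.ofReal ((y t ω / L (t + 1) ω) ^ 2) :=
      ((hq t).measurable.pow_const 2).ennreal_ofReal
    have h := (hN t).lintegral_mul_le (𝒢.le t)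
      (((hζ t).measurable.mono (𝒢.le _) le_rfl).pow_const 2).ennreal_ofReal hm
    refine le_trans (le_of_eq (lintegral_congr fun ω => ?_)) h
    rw [← ENNReal.ofReal_mul (sq_nonneg _), hd]; congr 1; ring
  have hfin : ∀ t, ∫⁻ ω, ENNReal.ofReal ((y t ω / L (t + 1) ω) ^ 2) ∂μ < ∞ := by
    intro t
    refine lt_of_le_of_lt ?_ (ENNReal.coe_lt_top (r := C))
    exact (Finset.single_le_sum (f := fun t => ∫⁻ ω, ENNReal.ofReal ((y t ω / L (t + 1) ω) ^ 2) ∂μ)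
      (fun _ _ => zero_le) (Finset.mem_range.2 (Nat.lt_succ_self t))).trans (hC (t + 1))
  have hdm : ∀ t, StronglyMeasurable[𝒢 (t + 1)] (d t) := fun t =>
    ((hq t).mono (𝒢.mono (Nat.le_succ t))).mul (hζ t)
  have hd2 : ∀ t, MemLp (d t) 2 μ := by
    intro t
    rw [memLp_two_iff_integrable_sq ((hdm t).mono (𝒢.le _)).aestronglyMeasurable]
    refine ⟨(((hdm t).mono (𝒢.le _)).pow 2).aestronglyMeasurable, ?_⟩
    rw [hasFiniteIntegral_iff_ofReal (ae_of_all _ fun ω => sq_nonneg _)]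
    exact (hζ2 t).trans_lt (ENNReal.mul_lt_top ENNReal.ofReal_lt_top (hfin t))
  have hdc : ∀ t, μ[d t | 𝒢 t] =ᵐ[μ] 0 := by
    intro t
    have h1 := condExp_mul_of_stronglyMeasurable_left (hq t)
      (show Integrable ((fun ω => y t ω / L (t + 1) ω) * ζ t) μ from
        (hd2 t).integrable (by norm_num)) (hζi t)
    filter_upwards [h1, hc t] with ω h1 h2
    have h1' : (μ[d t | 𝒢 t]) ω = y t ω / L (t + 1) ω * (μ[ζ t | 𝒢 t]) ω := h1
    rw [h1', h2]; simp
  have hsum : ∀ T, ∑ t ∈ Finset.range T, ∫ ω, (d t ω) ^ 2 ∂μ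
      ≤ (ENNReal.ofReal N * C).toReal := by
    intro T
    have : ∀ t, ∫ ω, (d t ω) ^ 2 ∂μ = (∫⁻ ω, ENNReal.ofReal ((d t ω) ^ 2) ∂μ).toReal := fun t =>
      integral_eq_lintegral_of_nonneg_ae (ae_of_all _ fun ω => sq_nonneg _)
        (((hdm t).mono (𝒢.le _)).pow 2).aestronglyMeasurable
    simp_rw [this]
    rw [← ENNReal.toReal_sum fun t _ => ((hζ2 t).trans_lt
      (ENNReal.mul_lt_top ENNReal.ofReal_lt_top (hfin t))).ne]
    refine ENNReal.toReal_mono (ENNReal.mul_ne_top ENNReal.ofReal_ne_top ENNReal.coe_ne_top) ?_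
    calc _ ≤ ∑ t ∈ Finset.range T, ENNReal.ofReal N *
          ∫⁻ ω, ENNReal.ofReal ((y t ω / L (t + 1) ω) ^ 2) ∂μ := Finset.sum_le_sum fun t _ => hζ2 t
      _ ≤ _ := by rw [← Finset.mul_sum]; gcongr; exact hC T
  filter_upwards [ae_tendsto_sum_of_sq hdm hd2 hdc hsum] with ω ⟨l, hl⟩ δ hδ
  obtain ⟨K, hK⟩ := exists_abs_sum_mul_le (hL ω) (by linarith [hL0 ω]) hl hδ
  refine ⟨K, fun T => ?_⟩
  have e : ∑ t ∈ Finset.range T, y t ω * ζ t ω = ∑ t ∈ Finset.range T, L (t + 1) ω * d t ω := by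
    refine Finset.sum_congr rfl fun t _ => ?_
    have : 0 < L (t + 1) ω := by linarith [hL0 ω, hL ω (Nat.zero_le (t + 1))]
    simp only [hd]; field_simp
  rw [e]; exact hK T

/-- A martingale transform is negligible with respect to its own quadratic variation. -/
lemma ae_abs_sum_mul_le_sq {𝒢 : Filtration ℕ m0} {y ζ : ℕ → Ω → ℝ}
    (hy : ∀ t, StronglyMeasurable[𝒢 t] (y t)) (hζ : ∀ t, StronglyMeasurable[𝒢 (t + 1)] (ζ t))
    (hζi : ∀ t, Integrable (ζ t) μ) (hc : ∀ t, μ[ζ t | 𝒢 t] =ᵐ[μ] 0) {N : ℝ}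
    (hN : ∀ t, CondBound (𝒢 t) μ (fun ω => ENNReal.ofReal ((ζ t ω) ^ 2)) (ENNReal.ofReal N)) :
    ∀ᵐ ω ∂μ, ∀ δ > 0, ∃ K, ∀ T, |∑ t ∈ Finset.range T, y t ω * ζ t ω|
      ≤ δ * (1 + ∑ t ∈ Finset.range T, (y t ω) ^ 2) + K := by
  have hmono : ∀ ω, Monotone fun T => 1 + ∑ t ∈ Finset.range T, (y t ω) ^ 2 := fun ω =>
    monotone_nat_of_le_succ fun T => by
      rw [Finset.sum_range_succ]; nlinarith [sq_nonneg (y T ω)]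
  have hpos : ∀ ω T, 1 ≤ 1 + ∑ t ∈ Finset.range T, (y t ω) ^ 2 := fun ω T => by
    have := Finset.sum_nonneg fun t (_ : t ∈ Finset.range T) => sq_nonneg (y t ω)
    linarith
  have hm : ∀ t, StronglyMeasurable[𝒢 t]
      (fun ω => 1 + ∑ r ∈ Finset.range (t + 1), (y r ω) ^ 2) := fun t =>
    stronglyMeasurable_const.add (Finset.stronglyMeasurable_fun_sum _ fun r hr =>
      ((hy r).mono (𝒢.mono (Nat.lt_succ_iff.1 (Finset.mem_range.1 hr)))).pow 2)
  -- With this normalization the sum of `(y / L) ^ 2` is a self-normalized sum of exponent two, at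
  -- most `1 / (2 - 1)` on every path. This gives the constant `C := 1`.
  refine ae_abs_sum_mul_le (L := fun T ω => 1 + ∑ t ∈ Finset.range T, (y t ω) ^ 2) (C := 1)
    hy hζ hζi hc hN hm hmono (fun ω => hpos ω 0) fun T => ?_
  rw [← lintegral_finsetSum' _ fun t _ => by
    have h1 := ((hy t).measurable.mono (𝒢.le _) le_rfl)
    have h2 := ((hm t).measurable.mono (𝒢.le _) le_rfl)
    exact ((h1.div h2).pow_const 2).ennreal_ofReal.aemeasurable]
  calc _ ≤ ∫⁻ _, 1 ∂μ := by
        refine lintegral_mono fun ω => ?_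
        rw [← ENNReal.ofReal_sum_of_nonneg fun t _ => sq_nonneg _]
        have h := sum_mul_rpow_neg_le' (a := fun t => (y t ω) ^ 2) (fun t => sq_nonneg _)
          (γ := 2) (by norm_num) T
        rw [← ENNReal.ofReal_one]
        refine ENNReal.ofReal_le_ofReal ?_
        refine le_trans (Finset.sum_le_sum fun t _ => le_of_eq ?_) (h.trans (by norm_num))
        have := hpos ω (t + 1)
        rw [Real.rpow_neg (by linarith), div_pow, div_eq_mul_inv]
        norm_num
    _ = _ := by simp

/-- A weighted upper law of large numbers for nonnegative variables with bounded conditional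
moments of an order above one. -/
lemma ae_sum_mul_le {𝒢 : Filtration ℕ m0} {a ξ : ℕ → Ω → ℝ}
    (ha : ∀ t, StronglyMeasurable[𝒢 t] (a t)) (ha0 : ∀ t ω, 0 ≤ a t ω) (ha1 : ∀ t ω, a t ω ≤ 1)
    (hξ : ∀ t, StronglyMeasurable[𝒢 (t + 1)] (ξ t)) (hξ0 : ∀ t ω, 0 ≤ ξ t ω)
    {M N γ : ℝ} (hM0 : 0 ≤ M) (hγ : 1 < γ) (hγ2 : γ ≤ 2)
    (hM : ∀ t, CondBound (𝒢 t) μ (fun ω => ENNReal.ofReal (ξ t ω)) (ENNReal.ofReal M))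
    (hN : ∀ t, CondBound (𝒢 t) μ (fun ω => ENNReal.ofReal ((ξ t ω) ^ γ)) (ENNReal.ofReal N)) :
    ∀ᵐ ω ∂μ, ∀ δ > 0, ∃ K, ∀ T, ∑ t ∈ Finset.range T, a t ω * ξ t ω
      ≤ (M + δ) * (1 + ∑ t ∈ Finset.range T, a t ω) + K := by
  set L : ℕ → Ω → ℝ := fun T ω => 1 + ∑ t ∈ Finset.range T, a t ω with hL
  have hLmono : ∀ ω, Monotone fun T => L T ω := fun ω =>
    monotone_nat_of_le_succ fun T => by
      simp only [hL]; rw [Finset.sum_range_succ]; linarith [ha0 T ω]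
  have hL1 : ∀ ω T, 1 ≤ L T ω := fun ω T => by
    have := Finset.sum_nonneg fun t (_ : t ∈ Finset.range T) => ha0 t ω
    simp only [hL]; linarith
  have hLp : ∀ ω T, 0 < L T ω := fun ω T => one_pos.trans_le (hL1 ω T)
  have hLm : ∀ t, StronglyMeasurable[𝒢 t] (L (t + 1)) := fun t =>
    stronglyMeasurable_const.add (Finset.stronglyMeasurable_fun_sum _ fun r hr =>
      ((ha r).mono (𝒢.mono (Nat.lt_succ_iff.1 (Finset.mem_range.1 hr)))))
  set q : ℕ → Ω → ℝ := fun t ω => a t ω / L (t + 1) ω with hq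
  have hqm : ∀ t, StronglyMeasurable[𝒢 t] (q t) := fun t => (ha t).div (hLm t)
  have hq0 : ∀ t ω, 0 ≤ q t ω := fun t ω => div_nonneg (ha0 t ω) (hLp ω _).le
  -- moments of the normalized variables
  have hmom : ∀ T, ∑ t ∈ Finset.range T, ∫⁻ ω, ENNReal.ofReal ((q t ω * ξ t ω) ^ γ) ∂μ
      ≤ ENNReal.ofReal N * ENNReal.ofReal (1 / (γ - 1)) := by
    intro T
    have h1 : ∀ t, ∫⁻ ω, ENNReal.ofReal ((q t ω * ξ t ω) ^ γ) ∂μ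
        ≤ ENNReal.ofReal N * ∫⁻ ω, ENNReal.ofReal ((q t ω) ^ γ) ∂μ := by
      intro t
      have hm : Measurable[𝒢 t] fun ω => ENNReal.ofReal ((q t ω) ^ γ) :=
        ((hqm t).measurable.pow_const γ).ennreal_ofReal
      have h := (hN t).lintegral_mul_le (𝒢.le t)
        (((hξ t).measurable.mono (𝒢.le _) le_rfl).pow_const γ).ennreal_ofReal hm
      refine le_trans (le_of_eq (lintegral_congr fun ω => ?_)) h
      rw [← ENNReal.ofReal_mul (Real.rpow_nonneg (hq0 t ω) _), Real.mul_rpow (hq0 t ω) (hξ0 t ω)]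
    refine (Finset.sum_le_sum fun t _ => h1 t).trans ?_
    rw [← Finset.mul_sum]
    gcongr
    rw [← lintegral_finsetSum' _ fun t _ =>
      (((hqm t).measurable.mono (𝒢.le _) le_rfl).pow_const γ).ennreal_ofReal.aemeasurable]
    calc _ ≤ ∫⁻ _, ENNReal.ofReal (1 / (γ - 1)) ∂μ := by
          refine lintegral_mono fun ω => ?_
          rw [← ENNReal.ofReal_sum_of_nonneg fun t _ => Real.rpow_nonneg (hq0 t ω) _]
          refine ENNReal.ofReal_le_ofReal ?_
          refine le_trans (Finset.sum_le_sum fun t _ => ?_)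
            (sum_mul_rpow_neg_le' (a := fun t => a t ω) (fun t => ha0 t ω) hγ T)
          simp only [hq]
          rw [Real.div_rpow (ha0 t ω) (hLp ω _).le, div_eq_mul_inv, ← Real.rpow_neg (hLp ω _).le]
          refine mul_le_mul_of_nonneg_right ?_ (Real.rpow_nonneg (hLp ω _).le _)
          calc (a t ω) ^ γ ≤ (a t ω) ^ (1 : ℝ) :=
                Real.rpow_le_rpow_of_exponent_ge' (ha0 t ω) (ha1 t ω) zero_le_one hγ.le
            _ = a t ω := Real.rpow_one _
      _ = _ := by simp
  have hξm : ∀ t, Measurable (ξ t) := fun t => (hξ t).measurable.mono (𝒢.le _) le_rfl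
  have hqm0 : ∀ t, Measurable (q t) := fun t => (hqm t).measurable.mono (𝒢.le _) le_rfl
  -- only finitely many normalized variables exceed one
  have hBC : ∀ᵐ ω ∂μ, ∀ᶠ t in atTop, ω ∉ {ω | 1 ≤ q t ω * ξ t ω} := by
    refine ae_eventually_notMem (ne_top_of_le_ne_top
      (b := ENNReal.ofReal N * ENNReal.ofReal (1 / (γ - 1)))
      (ENNReal.mul_ne_top ENNReal.ofReal_ne_top ENNReal.ofReal_ne_top) ?_)
    rw [ENNReal.tsum_eq_iSup_nat]
    refine iSup_le fun T => le_trans (Finset.sum_le_sum fun t _ => ?_) (hmom T)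
    have h := mul_meas_ge_le_lintegral₀ (μ := μ) (f := fun ω => ENNReal.ofReal ((q t ω * ξ t ω) ^ γ))
      (((hqm0 t).mul (hξm t)).pow_const γ).ennreal_ofReal.aemeasurable 1
    rw [one_mul] at h
    refine le_trans (measure_mono fun ω hω => ?_) h
    have : (1 : ℝ) ≤ (q t ω * ξ t ω) ^ γ := Real.one_le_rpow hω (by linarith)
    simpa using this
  -- Truncation at one alters only finitely many terms of almost every path, and it supplies the
  -- missing second moments: `η ^ 2 ≤ η ^ γ` because `0 ≤ η ≤ 1` and `γ ≤ 2`.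
  set η : ℕ → Ω → ℝ := fun t ω => if q t ω * ξ t ω ≤ 1 then q t ω * ξ t ω else 0 with hη
  have hη0 : ∀ t ω, 0 ≤ η t ω := fun t ω => by
    simp only [hη]; split_ifs
    · exact mul_nonneg (hq0 t ω) (hξ0 t ω)
    · exact le_rfl
  have hη1 : ∀ t ω, η t ω ≤ 1 := fun t ω => by
    simp only [hη]; split_ifs with h
    · exact h
    · exact zero_le_one
  have hηle : ∀ t ω, η t ω ≤ q t ω * ξ t ω := fun t ω => by
    simp only [hη]; split_ifs with h
    · exact le_rfl
    · exact mul_nonneg (hq0 t ω) (hξ0 t ω)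
  have hηm : ∀ t, StronglyMeasurable[𝒢 (t + 1)] (η t) := by
    intro t
    have h := ((hqm t).mono (𝒢.mono (Nat.le_succ t))).mul (hξ t)
    exact StronglyMeasurable.ite (measurableSet_le h.measurable measurable_const) h
      stronglyMeasurable_const
  have hηm0 : ∀ t, StronglyMeasurable (η t) := fun t => (hηm t).mono (𝒢.le _)
  have hηL : ∀ t, MemLp (η t) 2 μ := fun t => by
    refine MemLp.of_bound (hηm0 t).aestronglyMeasurable 1 (ae_of_all _ fun ω => ?_)
    rw [Real.norm_eq_abs, abs_of_nonneg (hη0 t ω)]; exact hη1 t ω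
  have hηi : ∀ t, Integrable (η t) μ := fun t => (hηL t).integrable (by norm_num)
  set e : ℕ → Ω → ℝ := fun t => μ[η t | 𝒢 t] with he
  have heL : ∀ t, MemLp (e t) 2 μ := fun t => (hηL t).condExp (by norm_num)
  have hem : ∀ t, StronglyMeasurable[𝒢 t] (e t) := fun t => stronglyMeasurable_condExp
  -- The compensator inherits the first-moment bound `M`. The comparison is made by integrals over
  -- the sets of `𝒢 t`, which is enough because both sides are `𝒢 t`-measurable.
  have hele : ∀ t, ∀ᵐ ω ∂μ, e t ω ≤ q t ω * M := by
    intro t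
    have hqi : Integrable (fun ω => q t ω * M) μ := by
      refine Integrable.of_bound ((hqm t).mono (𝒢.le _) |>.mul_const M).aestronglyMeasurable M
        (ae_of_all _ fun ω => ?_)
      have h1 : q t ω ≤ 1 := by
        simp only [hq]; rw [div_le_one (hLp ω _)]; exact (ha1 t ω).trans (hL1 ω _)
      rw [Real.norm_eq_abs, abs_of_nonneg (mul_nonneg (hq0 t ω) hM0)]
      exact mul_le_of_le_one_left hM0 h1
    have hm := 𝒢.le t
    refine ae_le_of_ae_le_trim (hm := hm) ?_
    refine ae_le_of_forall_setIntegral_le ((integrable_condExp).trim hm (hem t))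
      (hqi.trim hm ((hqm t).mul_const M)) fun F hF _ => ?_
    rw [← setIntegral_trim hm (hem t) hF, ← setIntegral_trim hm ((hqm t).mul_const M) hF,
      setIntegral_condExp hm (hηi t) hF]
    have hF' := hm _ hF
    rw [integral_eq_lintegral_of_nonneg_ae (ae_of_all _ fun ω => hη0 t ω)
        (hηm0 t).aestronglyMeasurable.restrict,
      integral_eq_lintegral_of_nonneg_ae (ae_of_all _ fun ω => mul_nonneg (hq0 t ω) hM0)
        ((hqm t).mono hm |>.mul_const M).aestronglyMeasurable.restrict]
    refine ENNReal.toReal_mono ?_ ?_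
    · have := hqi.integrableOn (s := F)
      have := this.hasFiniteIntegral
      rw [hasFiniteIntegral_iff_ofReal (ae_of_all _ fun ω => mul_nonneg (hq0 t ω) hM0)] at this
      exact this.ne
    · have hY : Measurable[𝒢 t] (F.indicator fun ω => ENNReal.ofReal (q t ω)) :=
        ((hqm t).measurable.ennreal_ofReal).indicator hF
      have h := (hM t).lintegral_mul_le hm (hξm t).ennreal_ofReal hY
      rw [← lintegral_indicator hF', ← lintegral_indicator hF']
      calc _ ≤ ∫⁻ ω, F.indicator (fun ω => ENNReal.ofReal (q t ω)) ω
            * ENNReal.ofReal (ξ t ω) ∂μ := by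
            refine lintegral_mono fun ω => ?_
            by_cases hω : ω ∈ F
            · simp only [Set.indicator_of_mem hω]
              rw [← ENNReal.ofReal_mul (hq0 t ω)]
              exact ENNReal.ofReal_le_ofReal (hηle t ω)
            · simp [Set.indicator_of_notMem hω]
        _ ≤ _ := h
        _ = _ := by
            rw [← lintegral_const_mul _ (hY.mono hm le_rfl)]
            refine lintegral_congr fun ω => ?_
            by_cases hω : ω ∈ F
            · simp only [Set.indicator_of_mem hω]
              rw [← ENNReal.ofReal_mul hM0, mul_comm]
            · simp [Set.indicator_of_notMem hω]
  have hconv : ∀ᵐ ω ∂μ, ∃ l, Tendsto (fun T => ∑ t ∈ Finset.range T, (η t ω - e t ω))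
      atTop (𝓝 l) := by
    refine ae_tendsto_sum_of_sq (𝒢 := 𝒢) (d := fun t ω => η t ω - e t ω)
      (C := (ENNReal.ofReal N * ENNReal.ofReal (1 / (γ - 1))).toReal)
      (fun t => (hηm t).sub ((hem t).mono (𝒢.mono (Nat.le_succ t))))
      (fun t => (hηL t).sub (heL t)) (fun t => ?_) fun T => ?_
    · have h1 := condExp_sub (hηi t) (integrable_condExp (μ := μ) (m := 𝒢 t) (f := η t)) (𝒢 t)
      have h2 := condExp_of_stronglyMeasurable (𝒢.le t) (hem t) integrable_condExp
      filter_upwards [h1] with ω h1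
      have h1' : (μ[fun ω => η t ω - e t ω | 𝒢 t]) ω
        = (μ[η t | 𝒢 t]) ω - (μ[e t | 𝒢 t]) ω := h1
      rw [h1', h2]; simp [he]
    · have hvar : ∀ t, ∫ ω, (η t ω - e t ω) ^ 2 ∂μ
          ≤ (∫⁻ ω, ENNReal.ofReal ((q t ω * ξ t ω) ^ γ) ∂μ).toReal := by
        intro t
        have hee : ∫ ω, e t ω * (η t ω - e t ω) ∂μ = 0 := by
          have hc : μ[fun ω => η t ω - e t ω | 𝒢 t] =ᵐ[μ] 0 := by
            have h1 := condExp_sub (hηi t)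
              (integrable_condExp (μ := μ) (m := 𝒢 t) (f := η t)) (𝒢 t)
            have h2 := condExp_of_stronglyMeasurable (𝒢.le t) (hem t) integrable_condExp
            filter_upwards [h1] with ω h1
            have h1' : (μ[fun ω => η t ω - e t ω | 𝒢 t]) ω
              = (μ[η t | 𝒢 t]) ω - (μ[e t | 𝒢 t]) ω := h1
            rw [h1', h2]; simp [he]
          exact integral_mul_eq_zero_of_condExp (𝒢.le t)
            ((hηi t).sub integrable_condExp) hc (hem t)
            ((heL t).integrable_mul ((hηL t).sub (heL t)))
        have hle : ∫ ω, (η t ω - e t ω) ^ 2 ∂μ ≤ ∫ ω, (η t ω) ^ 2 ∂μ := by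
          have hi1 : Integrable (fun ω => (η t ω - e t ω) ^ 2) μ :=
            ((hηL t).sub (heL t)).integrable_sq
          have hi2 : Integrable (fun ω => e t ω * (η t ω - e t ω)) μ :=
            (heL t).integrable_mul ((hηL t).sub (heL t))
          have hi3 : Integrable (fun ω => 2 * (e t ω * (η t ω - e t ω)) + (e t ω) ^ 2) μ :=
            (hi2.const_mul 2).add (heL t).integrable_sq
          have e1 : ∀ ω, (η t ω) ^ 2 = (η t ω - e t ω) ^ 2 + (2 * (e t ω * (η t ω - e t ω))
              + (e t ω) ^ 2) := fun ω => by ring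
          have : ∫ ω, (η t ω) ^ 2 ∂μ = ∫ ω, (η t ω - e t ω) ^ 2 ∂μ + ∫ ω, (e t ω) ^ 2 ∂μ := by
            simp_rw [e1]
            rw [integral_add hi1 hi3,
              integral_add (hi2.const_mul 2) (heL t).integrable_sq, integral_const_mul, hee]
            ring
          rw [this]
          linarith [integral_nonneg (μ := μ) (f := fun ω => (e t ω) ^ 2) fun ω => sq_nonneg _]
        refine hle.trans ?_
        rw [integral_eq_lintegral_of_nonneg_ae (ae_of_all _ fun ω => sq_nonneg _)
          ((hηm0 t).pow 2).aestronglyMeasurable]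
        refine ENNReal.toReal_mono ?_ (lintegral_mono fun ω => ENNReal.ofReal_le_ofReal ?_)
        · refine ne_top_of_le_ne_top (ENNReal.mul_ne_top ENNReal.ofReal_ne_top
            ENNReal.ofReal_ne_top) (le_trans ?_ (hmom (t + 1)))
          exact Finset.single_le_sum
            (f := fun t => ∫⁻ ω, ENNReal.ofReal ((q t ω * ξ t ω) ^ γ) ∂μ)
            (fun _ _ => zero_le) (Finset.mem_range.2 (Nat.lt_succ_self t))
        · rw [← Real.rpow_natCast]
          calc (η t ω) ^ ((2 : ℕ) : ℝ) ≤ (η t ω) ^ γ :=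
                Real.rpow_le_rpow_of_exponent_ge' (hη0 t ω) (hη1 t ω) (by linarith)
                  (by exact_mod_cast hγ2)
            _ ≤ _ := Real.rpow_le_rpow (hη0 t ω) (hηle t ω) (by linarith)
      refine (Finset.sum_le_sum fun t _ => hvar t).trans ?_
      rw [← ENNReal.toReal_sum fun t _ => ?_]
      · exact ENNReal.toReal_mono (ENNReal.mul_ne_top ENNReal.ofReal_ne_top
          ENNReal.ofReal_ne_top) (hmom T)
      · refine ne_top_of_le_ne_top (ENNReal.mul_ne_top ENNReal.ofReal_ne_top
          ENNReal.ofReal_ne_top) (le_trans ?_ (hmom (t + 1)))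
        exact Finset.single_le_sum
          (f := fun t => ∫⁻ ω, ENNReal.ofReal ((q t ω * ξ t ω) ^ γ) ∂μ)
          (fun _ _ => zero_le) (Finset.mem_range.2 (Nat.lt_succ_self t))
  filter_upwards [hBC, hconv, ae_all_iff.2 hele] with ω hω1 ⟨l, hl⟩ hω3 δ hδ
  obtain ⟨K, hK⟩ := exists_abs_sum_mul_le (hLmono ω) (by linarith [hL1 ω 0]) hl hδ
  obtain ⟨t0, ht0⟩ := eventually_atTop.1 hω1
  refine ⟨K + ∑ t ∈ Finset.range t0, a t ω * ξ t ω, fun T => ?_⟩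
  -- After multiplication by `L (t + 1)`: a martingale part for Kronecker's lemma, a compensator of
  -- at most `M * a`, and the finitely many terms before `t0`, which go into the constant.
  have hterm : ∀ t, a t ω * ξ t ω ≤ L (t + 1) ω * (η t ω - e t ω) + M * a t ω
      + (if t < t0 then a t ω * ξ t ω else 0) := by
    intro t
    have hLt := hLp ω (t + 1)
    have h1 : L (t + 1) ω * q t ω = a t ω := by simp only [hq]; field_simp
    have h2 : L (t + 1) ω * e t ω ≤ M * a t ω := by
      calc L (t + 1) ω * e t ω ≤ L (t + 1) ω * (q t ω * M) :=
            mul_le_mul_of_nonneg_left (hω3 t) hLt.le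
        _ = M * a t ω := by rw [← mul_assoc, h1, mul_comm]
    by_cases h : t < t0
    · rw [if_pos h]
      nlinarith [mul_nonneg hLt.le (hη0 t ω)]
    · rw [if_neg h]
      have h3 : η t ω = q t ω * ξ t ω := by
        simp only [hη]; rw [if_pos]
        have := ht0 t (not_lt.1 h)
        simp only [not_le] at this
        exact this.le
      have h4 : L (t + 1) ω * η t ω = a t ω * ξ t ω := by rw [h3, ← mul_assoc, h1]
      nlinarith
  have hsum := Finset.sum_le_sum fun t (_ : t ∈ Finset.range T) => hterm t
  rw [Finset.sum_add_distrib, Finset.sum_add_distrib, ← Finset.mul_sum] at hsum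
  have h5 : ∑ t ∈ Finset.range T, (if t < t0 then a t ω * ξ t ω else 0)
      ≤ ∑ t ∈ Finset.range t0, a t ω * ξ t ω := by
    rw [← Finset.sum_filter]
    refine Finset.sum_le_sum_of_subset_of_nonneg (fun t ht => ?_) fun t _ _ =>
      mul_nonneg (ha0 t ω) (hξ0 t ω)
    exact Finset.mem_range.2 (Finset.mem_filter.1 ht).2
  have h6 := (abs_le.1 (hK T)).2
  have h7 : M * ∑ t ∈ Finset.range T, a t ω ≤ M * (1 + ∑ t ∈ Finset.range T, a t ω) := by
    nlinarith
  simp only [hL] at h6 hsum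
  nlinarith

end Conditional

/-! ### Random words of switches and the amplification of quadratic forms along them. -/

section Words

open Matrix

variable {n k : ℕ}

lemma spectralNorm_nonneg (M : Matrix (Fin n) (Fin n) ℝ) : 0 ≤ spectralNorm M := norm_nonneg _

lemma spectralNorm_one_le : spectralNorm (1 : Matrix (Fin n) (Fin n) ℝ) ≤ 1 := by
  unfold spectralNorm; rw [map_one]; exact ContinuousLinearMap.norm_id_le

lemma spectralNorm_mul_le (M N : Matrix (Fin n) (Fin n) ℝ) :
    spectralNorm (M * N) ≤ spectralNorm M * spectralNorm N := by
  unfold spectralNorm; rw [map_mul]; exact norm_mul_le _ _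

lemma dotProduct_self_eq_norm_sq (z : Fin n → ℝ) : z ⬝ᵥ z = ‖WithLp.toLp 2 z‖ ^ 2 := by
  rw [EuclideanSpace.norm_sq_eq]; simp [dotProduct, sq]

lemma dotProduct_self_nonneg' (z : Fin n → ℝ) : 0 ≤ z ⬝ᵥ z := by
  rw [dotProduct_self_eq_norm_sq]; positivity

lemma sq_dotProduct_le_mul (y z : Fin n → ℝ) : (y ⬝ᵥ z) ^ 2 ≤ (y ⬝ᵥ y) * (z ⬝ᵥ z) := by
  have := sq_dotProduct_mulVec_le (M := (1 : Matrix (Fin n) (Fin n) ℝ)) PosSemidef.one y z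
  simpa [quad] using this

lemma mulVec_self_le (M : Matrix (Fin n) (Fin n) ℝ) (z : Fin n → ℝ) :
    (M *ᵥ z) ⬝ᵥ (M *ᵥ z) ≤ spectralNorm M ^ 2 * (z ⬝ᵥ z) := by
  rw [dotProduct_self_eq_norm_sq, dotProduct_self_eq_norm_sq, ← mul_pow]
  refine pow_le_pow_left₀ (norm_nonneg _) ?_ 2
  have := (Matrix.toEuclideanCLM (n := Fin n) (𝕜 := ℝ) M).le_opNorm (WithLp.toLp 2 z)
  simpa [spectralNorm] using this

/-- The product of the system matrices along a word, the first letter acting first. -/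
def wordMat (A : Fin k → Matrix (Fin n) (Fin n) ℝ) : List (Fin k) → Matrix (Fin n) (Fin n) ℝ
  | [] => 1
  | j :: u => wordMat A u * A j

lemma wordMat_append (A : Fin k → Matrix (Fin n) (Fin n) ℝ) (u v : List (Fin k)) :
    wordMat A (u ++ v) = wordMat A v * wordMat A u := by
  induction u with
  | nil => simp [wordMat]
  | cons j u ih => simp [wordMat, ih, Matrix.mul_assoc]

lemma spectralNorm_wordMat_cons_le (A : Fin k → Matrix (Fin n) (Fin n) ℝ) (j : Fin k)
    (u : List (Fin k)) :
    spectralNorm (wordMat A (j :: u)) ≤ spectralNorm (A j) * spectralNorm (wordMat A u) := by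
  rw [mul_comm]; exact spectralNorm_mul_le _ _

lemma wordMat_mulVec_self_le {A : Fin k → Matrix (Fin n) (Fin n) ℝ} {b : ℝ}
    (hb : ∀ j, spectralNorm (A j) ^ 2 ≤ b) (u : List (Fin k)) (z : Fin n → ℝ) :
    (wordMat A u *ᵥ z) ⬝ᵥ (wordMat A u *ᵥ z) ≤ b ^ u.length * (z ⬝ᵥ z) := by
  induction u generalizing z with
  | nil => simp [wordMat]
  | cons j u ih =>
    have hb0 : 0 ≤ b := (sq_nonneg _).trans (hb j)
    have h := ih (A j *ᵥ z)
    rw [wordMat, ← Matrix.mulVec_mulVec, List.length_cons, pow_succ, mul_assoc]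
    refine h.trans (mul_le_mul_of_nonneg_left ?_ (by positivity))
    exact (mulVec_self_le _ _).trans
      (mul_le_mul_of_nonneg_right (hb j) (dotProduct_self_nonneg' z))

/-- The expectation of a function of a random word of given length with i.i.d. letters. -/
def wordE (p : Fin k → ℝ) : ℕ → (List (Fin k) → ℝ) → ℝ
  | 0, f => f []
  | l + 1, f => ∑ j, p j * wordE p l fun u => f (j :: u)

variable {p : Fin k → ℝ}

lemma wordE_mono (hp : ∀ j, 0 ≤ p j) {l : ℕ} {f g : List (Fin k) → ℝ}
    (h : ∀ u, u.length = l → f u ≤ g u) : wordE p l f ≤ wordE p l g := by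
  induction l generalizing f g with
  | zero => exact h [] rfl
  | succ l ih =>
    exact Finset.sum_le_sum fun j _ => mul_le_mul_of_nonneg_left
      (ih fun u hu => h (j :: u) (by simp [hu])) (hp j)

lemma wordE_congr {l : ℕ} {f g : List (Fin k) → ℝ}
    (h : ∀ u, u.length = l → f u = g u) : wordE p l f = wordE p l g := by
  induction l generalizing f g with
  | zero => exact h [] rfl
  | succ l ih =>
    exact Finset.sum_congr rfl fun j _ => by rw [ih fun u hu => h (j :: u) (by simp [hu])]

lemma wordE_const (h1 : ∑ j, p j = 1) (l : ℕ) (c : ℝ) : wordE p l (fun _ => c) = c := by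
  induction l with
  | zero => rfl
  | succ l ih => simp only [wordE, ih]; rw [← Finset.sum_mul, h1, one_mul]

lemma wordE_add (l : ℕ) (f g : List (Fin k) → ℝ) :
    wordE p l (fun u => f u + g u) = wordE p l f + wordE p l g := by
  induction l generalizing f g with
  | zero => rfl
  | succ l ih => simp only [wordE, ih, mul_add, Finset.sum_add_distrib]

lemma wordE_const_mul (l : ℕ) (c : ℝ) (f : List (Fin k) → ℝ) :
    wordE p l (fun u => c * f u) = c * wordE p l f := by
  induction l generalizing f with
  | zero => rfl
  | succ l ih =>
    simp only [wordE, ih, Finset.mul_sum]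
    exact Finset.sum_congr rfl fun j _ => by ring

lemma wordE_append (l m : ℕ) (f : List (Fin k) → ℝ) :
    wordE p (l + m) f = wordE p l fun u => wordE p m fun v => f (u ++ v) := by
  induction l generalizing f with
  | zero => simp [wordE]
  | succ l ih =>
    rw [Nat.succ_add]
    simp only [wordE, ih, List.cons_append]

lemma wordE_nonneg (hp : ∀ j, 0 ≤ p j) {l : ℕ} {f : List (Fin k) → ℝ}
    (h : ∀ u, u.length = l → 0 ≤ f u) : 0 ≤ wordE p l f := by
  have := wordE_mono (l := l) (f := fun _ => 0 * (0 : ℝ)) hp (by simpa using h)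
  rwa [wordE_const_mul, zero_mul] at this

open Classical in
/-- The probability that a random word of given length with i.i.d. letters lies in a set. -/
noncomputable def wordPr (p : Fin k → ℝ) (l : ℕ) (B : Set (List (Fin k))) : ℝ :=
  wordE p l fun u => if u ∈ B then 1 else 0

lemma wordPr_nonneg (hp : ∀ j, 0 ≤ p j) (l : ℕ) (B : Set (List (Fin k))) : 0 ≤ wordPr p l B :=
  wordE_nonneg hp fun u _ => by positivity

lemma wordPr_mono (hp : ∀ j, 0 ≤ p j) {l : ℕ} {B B' : Set (List (Fin k))}
    (h : ∀ u, u.length = l → u ∈ B → u ∈ B') : wordPr p l B ≤ wordPr p l B' := by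
  refine wordE_mono hp fun u hu => ?_
  have := h u hu
  split_ifs <;> first | tauto | norm_num

lemma wordPr_union_le (hp : ∀ j, 0 ≤ p j) (l : ℕ) (B B' : Set (List (Fin k))) :
    wordPr p l {u | u ∈ B ∨ u ∈ B'} ≤ wordPr p l B + wordPr p l B' := by
  unfold wordPr
  rw [← wordE_add]
  refine wordE_mono hp fun u hu => ?_
  by_cases h1 : u ∈ B <;> by_cases h2 : u ∈ B' <;> simp [h1, h2]

lemma wordPr_cons (hp : ∀ j, 0 ≤ p j) (h1 : ∑ j, p j = 1) {l : ℕ} {B B' : Set (List (Fin k))}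
    (h : ∀ j u, u.length = l → j :: u ∈ B → u ∈ B') : wordPr p (l + 1) B ≤ wordPr p l B' := by
  calc wordPr p (l + 1) B = ∑ j, p j * wordPr p l {u | j :: u ∈ B} := rfl
    _ ≤ ∑ j, p j * wordPr p l B' := Finset.sum_le_sum fun j _ =>
        mul_le_mul_of_nonneg_left (wordPr_mono hp fun u hu hB => h j u hu hB) (hp j)
    _ = _ := by rw [← Finset.sum_mul, h1, one_mul]

lemma wordPr_le_append_left (hp : ∀ j, 0 ≤ p j) (h1 : ∑ j, p j = 1) {l m : ℕ}
    {B B' : Set (List (Fin k))} (h : ∀ u v, u.length = l → v.length = m → v ∈ B → u ++ v ∈ B') :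
    wordPr p m B ≤ wordPr p (l + m) B' := by
  unfold wordPr
  rw [wordE_append, ← wordE_const h1 l (wordE p m _)]
  refine wordE_mono hp fun u hu => wordE_mono hp fun v hv => ?_
  have := h u v hu hv
  split_ifs <;> first | tauto | norm_num

open Classical in
lemma wordPr_le_append_right (hp : ∀ j, 0 ≤ p j) (h1 : ∑ j, p j = 1) {l m : ℕ}
    {B B' : Set (List (Fin k))} (h : ∀ u v, u.length = l → v.length = m → u ∈ B → u ++ v ∈ B') :
    wordPr p l B ≤ wordPr p (l + m) B' := by
  unfold wordPr
  rw [wordE_append]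
  refine wordE_mono hp fun u hu => ?_
  rw [← wordE_const h1 m (if u ∈ B then (1 : ℝ) else 0)]
  refine wordE_mono hp fun v hv => ?_
  have := h u v hu hv
  split_ifs <;> first | tauto | norm_num

/-- Submultiplicativity of the spectral norm and independence of the letters. For the `θ` of
`exists_rpow_sum_lt_one` the base on the right is below one, so expansion along long words is
exponentially rare. -/
lemma wordE_spectralNorm_rpow_le (A : Fin k → Matrix (Fin n) (Fin n) ℝ) (hp : ∀ j, 0 ≤ p j)
    {θ : ℝ} (hθ : 0 ≤ θ) (l : ℕ) :
    wordE p l (fun u => spectralNorm (wordMat A u) ^ θ)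
      ≤ (∑ j, p j * spectralNorm (A j) ^ θ) ^ l := by
  induction l with
  | zero => simpa [wordE, wordMat] using
      Real.rpow_le_one (spectralNorm_nonneg _) spectralNorm_one_le hθ
  | succ l ih =>
    calc wordE p (l + 1) (fun u => spectralNorm (wordMat A u) ^ θ)
        ≤ ∑ j, p j * wordE p l (fun u => spectralNorm (A j) ^ θ * spectralNorm (wordMat A u) ^ θ) := by
          refine Finset.sum_le_sum fun j _ => mul_le_mul_of_nonneg_left (wordE_mono hp ?_) (hp j)
          intro u _
          rw [← Real.mul_rpow (spectralNorm_nonneg _) (spectralNorm_nonneg _)]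
          exact Real.rpow_le_rpow (spectralNorm_nonneg _) (spectralNorm_wordMat_cons_le A j u) hθ
      _ = (∑ j, p j * spectralNorm (A j) ^ θ)
            * wordE p l (fun u => spectralNorm (wordMat A u) ^ θ) := by
          rw [Finset.sum_mul]
          exact Finset.sum_congr rfl fun j _ => by rw [wordE_const_mul]; ring
      _ ≤ _ := by
          rw [pow_succ, mul_comm]
          exact mul_le_mul_of_nonneg_right ih (Finset.sum_nonneg fun j _ =>
            mul_nonneg (hp j) (Real.rpow_nonneg (spectralNorm_nonneg _) _))

lemma wordPr_one_lt_spectralNorm_le (A : Fin k → Matrix (Fin n) (Fin n) ℝ) (hp : ∀ j, 0 ≤ p j)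
    {θ : ℝ} (hθ : 0 ≤ θ) (l : ℕ) :
    wordPr p l {u | 1 < spectralNorm (wordMat A u)}
      ≤ (∑ j, p j * spectralNorm (A j) ^ θ) ^ l := by
  refine le_trans (wordE_mono hp fun u _ => ?_) (wordE_spectralNorm_rpow_le A hp hθ l)
  by_cases h : 1 < spectralNorm (wordMat A u)
  · simpa [h] using Real.one_le_rpow h.le hθ
  · simpa [h] using Real.rpow_nonneg (spectralNorm_nonneg _) _

/-- The word `u` has a factor `a ++ [i]` along which some vector of the unit ball is mapped to
one where the quadratic form of `P` is at least `X`. -/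
def Amplifies (A : Fin k → Matrix (Fin n) (Fin n) ℝ) (i : Fin k) (P : Matrix (Fin n) (Fin n) ℝ)
    (X : ℝ) : Set (List (Fin k)) :=
  {u | ∃ a z, (a ++ [i]) <:+: u ∧ z ⬝ᵥ z ≤ 1 ∧ X ≤ quad P (wordMat A a *ᵥ z)}

variable {A : Fin k → Matrix (Fin n) (Fin n) ℝ} {i : Fin k} {P : Matrix (Fin n) (Fin n) ℝ}

lemma Amplifies.mono {X Y : ℝ} (h : Y ≤ X) {u : List (Fin k)} (hu : u ∈ Amplifies A i P X) :
    u ∈ Amplifies A i P Y := by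
  obtain ⟨a, z, ha, hz, hX⟩ := hu
  exact ⟨a, z, ha, hz, h.trans hX⟩

lemma Amplifies.infix {X : ℝ} {u v : List (Fin k)} (huv : u <:+: v)
    (hu : u ∈ Amplifies A i P X) : v ∈ Amplifies A i P X := by
  obtain ⟨a, z, ha, hz, hX⟩ := hu
  exact ⟨a, z, ha.trans huv, hz, hX⟩

/-- Each letter multiplies a squared norm by at most `b` and `P` is below the identity, so fewer
than `d` letters cannot exceed `b ^ d`. -/
lemma length_of_lt_quad {b : ℝ} (hb1 : 1 ≤ b) (hb : ∀ j, spectralNorm (A j) ^ 2 ≤ b)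
    (hP : ∀ z, quad P z ≤ z ⬝ᵥ z) {d : ℕ} {X : ℝ} (hX : b ^ d < X) {a : List (Fin k)}
    {z : Fin n → ℝ} (hz : z ⬝ᵥ z ≤ 1) (h : X ≤ quad P (wordMat A a *ᵥ z)) : d ≤ a.length := by
  by_contra hlt
  have h1 := (hP (wordMat A a *ᵥ z)).trans (wordMat_mulVec_self_le hb a z)
  have h2 : b ^ a.length ≤ b ^ d := pow_le_pow_right₀ hb1 (by omega)
  have h3 : b ^ a.length * (z ⬝ᵥ z) ≤ b ^ a.length := mul_le_of_le_one_right (by positivity) hz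
  linarith

/-- Consider an amplifying factor that starts at the first letter, and its first `d` letters. If
they contract, they may be dropped and `z` replaced by its image, which stays in the unit ball; the
factor then lies in `u`. If they expand, which is rare, the image rescaled by `√(b ^ d)` returns to
the unit ball, and the remaining letters still amplify at the level divided by `b ^ d`. The two
conditions of this second case concern disjoint blocks of letters, hence are independent. -/
lemma Amplifies.of_cons {b : ℝ} (hb1 : 1 ≤ b) (hb : ∀ j, spectralNorm (A j) ^ 2 ≤ b)
    (hP : ∀ z, quad P z ≤ z ⬝ᵥ z) {d : ℕ} (hd : 1 ≤ d) {X : ℝ} (hX : b ^ d < X) {j : Fin k}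
    {u : List (Fin k)} (h : j :: u ∈ Amplifies A i P X) :
    u ∈ Amplifies A i P X ∨ (d ≤ (j :: u).length ∧
      1 < spectralNorm (wordMat A ((j :: u).take d)) ∧
        (j :: u).drop d ∈ Amplifies A i P (X / b ^ d)) := by
  obtain ⟨a, z, ha, hz, hq⟩ := h
  rcases List.infix_cons_iff.1 ha with ha | ha
  swap
  · exact Or.inl ⟨a, z, ha, hz, hq⟩
  have hda := length_of_lt_quad hb1 hb hP hX hz hq
  obtain ⟨c, hc⟩ := ha
  obtain ⟨a1, a2, rfl, h1⟩ : ∃ a1 a2, a = a1 ++ a2 ∧ a1.length = d :=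
    ⟨a.take d, a.drop d, (List.take_append_drop d a).symm, by simp [hda]⟩
  have htake : (j :: u).take d = a1 := by
    rw [← hc, List.append_assoc, List.append_assoc, List.take_append_of_le_length h1.ge, ← h1,
      List.take_length]
  have hdrop : (j :: u).drop d = a2 ++ [i] ++ c := by
    rw [← hc, List.append_assoc, List.append_assoc, List.drop_append_of_le_length h1.ge, ← h1,
      List.drop_length, List.nil_append, List.append_assoc]
  rw [wordMat_append, ← Matrix.mulVec_mulVec] at hq
  have hbd : 0 < b ^ d := by positivity
  rcases le_or_gt (spectralNorm (wordMat A a1)) 1 with hs | hs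
  · left
    refine ⟨a2, wordMat A a1 *ᵥ z, ?_, ?_, hq⟩
    · have h2 : (j :: u).drop d = u.drop (d - 1) := by
        obtain ⟨e, rfl⟩ : ∃ e, d = e + 1 := ⟨d - 1, by omega⟩
        rfl
      have h3 : (a2 ++ [i]) <:+: u.drop (d - 1) := by
        rw [← h2, hdrop]; exact (List.prefix_append _ _).isInfix
      exact h3.trans (List.drop_suffix _ _).isInfix
    · refine (mulVec_self_le _ _).trans ?_
      have : spectralNorm (wordMat A a1) ^ 2 ≤ 1 := pow_le_one₀ (spectralNorm_nonneg _) hs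
      nlinarith [dotProduct_self_nonneg' z]
  · right
    refine ⟨by rw [← h1, ← hc]; simp, by rwa [htake], a2,
      (√(b ^ d))⁻¹ • (wordMat A a1 *ᵥ z), ?_, ?_, ?_⟩
    · rw [hdrop]; exact (List.prefix_append _ _).isInfix
    · have h2 := wordMat_mulVec_self_le hb a1 z
      rw [h1] at h2
      rw [smul_dotProduct, dotProduct_smul, smul_eq_mul, smul_eq_mul, ← mul_assoc, ← mul_inv,
        Real.mul_self_sqrt hbd.le, inv_mul_le_iff₀ hbd]
      nlinarith
    · rw [Matrix.mulVec_smul, quad_smul_right, inv_pow, Real.sq_sqrt hbd.le, div_eq_inv_mul]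
      exact mul_le_mul_of_nonneg_left hq (by positivity)

/-- Lowering the amplification level by a constant factor makes the probability much larger. -/
lemma wordPr_amplifies_le {b : ℝ} (hb1 : 1 ≤ b) (hb : ∀ j, spectralNorm (A j) ^ 2 ≤ b)
    (hp : ∀ j, 0 ≤ p j) (h1 : ∑ j, p j = 1)
    (hP : ∀ z, quad P z ≤ z ⬝ᵥ z) {d : ℕ} (hd : 1 ≤ d) {X : ℝ} (hX : b ^ d < X) {r : ℝ}
    (hr : wordPr p d {u | 1 < spectralNorm (wordMat A u)} ≤ r) (l : ℕ) :
    wordPr p l (Amplifies A i P X) ≤ l * r * wordPr p l (Amplifies A i P (X / b ^ d)) := by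
  have hr0 : 0 ≤ r := (wordPr_nonneg hp _ _).trans hr
  induction l with
  | zero =>
    have : wordPr p 0 (Amplifies A i P X) = 0 := by
      have : ([] : List (Fin k)) ∉ Amplifies A i P X := by
        rintro ⟨a, z, ha, -⟩
        simp at ha
      simp [wordPr, wordE, this]
    rw [this]; simp
  | succ l ih =>
    set B := Amplifies A i P X
    set B' := Amplifies A i P (X / b ^ d)
    -- By independence of the two blocks, `G` has probability at most `r` times that of the lower
    -- level. Peeling off the letters one by one meets such an event at most once per letter, whence
    -- the factor `l`.
    set G : Set (List (Fin k)) := {u | d ≤ u.length ∧ 1 < spectralNorm (wordMat A (u.take d)) ∧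
        u.drop d ∈ B'} with hG
    have e1 : wordPr p (l + 1) B ≤ wordPr p (l + 1) {u | u ∈ {u | u.tail ∈ B} ∨ u ∈ G} := by
      refine wordPr_mono hp fun u hu hB => ?_
      obtain ⟨j, u, rfl⟩ : ∃ j v, u = j :: v := by
        cases u with
        | nil => simp at hu
        | cons j v => exact ⟨j, v, rfl⟩
      exact Amplifies.of_cons hb1 hb hP hd hX hB
    have e2 : wordPr p (l + 1) {u | u.tail ∈ B} ≤ wordPr p l B :=
      wordPr_cons hp h1 fun j u _ h => h
    have e3 : wordPr p l B' ≤ wordPr p (l + 1) B' := by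
      rw [add_comm]
      exact wordPr_le_append_left hp h1 fun u v _ _ h =>
        Amplifies.infix (List.suffix_append u v).isInfix h
    have e4 : wordPr p (l + 1) G ≤ r * wordPr p (l + 1) B' := by
      rcases lt_or_ge (l + 1) d with hl | hl
      · have : wordPr p (l + 1) G ≤ wordE p (l + 1) (fun _ => 0) := by
          refine wordE_mono hp fun u hu => ?_
          rw [if_neg]; rintro ⟨h, -⟩; omega
        rw [wordE_const h1] at this
        exact this.trans (mul_nonneg hr0 (wordPr_nonneg hp _ _))
      · obtain ⟨e, he⟩ := Nat.exists_eq_add_of_le hl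
        rw [he]
        have e5 : wordPr p e B' ≤ wordPr p (d + e) B' :=
          wordPr_le_append_left hp h1 fun u v _ _ h =>
            Amplifies.infix (List.suffix_append u v).isInfix h
        refine le_trans ?_ (mul_le_mul hr e5 (wordPr_nonneg hp _ _) hr0)
        unfold wordPr
        rw [wordE_append, mul_comm, ← wordE_const_mul]
        refine wordE_mono hp fun u hu => ?_
        rw [mul_comm, ← wordE_const_mul]
        refine wordE_mono hp fun v hv => ?_
        by_cases h : u ++ v ∈ G
        · obtain ⟨-, h2, h3⟩ := h
          rw [List.take_append_of_le_length hu.ge, ← hu, List.take_length] at h2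
          rw [List.drop_append_of_le_length hu.ge, ← hu, List.drop_length, List.nil_append] at h3
          have h2' : u ∈ {u | 1 < spectralNorm (wordMat A u)} := h2
          rw [if_pos h2', if_pos h3]
          split_ifs <;> norm_num
        · rw [if_neg h]; positivity
    have e6 := wordPr_union_le hp (l + 1) {u | u.tail ∈ B} G
    have e7 : (l : ℝ) * r * wordPr p l B' ≤ l * r * wordPr p (l + 1) B' :=
      mul_le_mul_of_nonneg_left e3 (by positivity)
    push_cast
    linarith

/-- Existence of a moment that contracts on average. -/
lemma exists_rpow_sum_lt_one {σ : Fin k → ℝ} (hσ : ∀ j, 0 ≤ σ j) (hp : ∀ j, 0 < p j)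
    (h1 : ∑ j, p j = 1) (h : ∏ j, σ j ^ p j < 1) :
    ∃ θ : ℝ, 0 < θ ∧ θ ≤ 1 ∧ ∑ j, p j * σ j ^ θ < 1 := by
  -- Spectral norms may vanish. Raising them to a small `ε > 0` keeps the product below one and
  -- makes logarithms available.
  obtain ⟨ε, hε, hτ⟩ : ∃ ε > 0, ∏ j, (max (σ j) ε) ^ p j < 1 := by
    have hc : Tendsto (fun ε : ℝ => ∏ j, (max (σ j) ε) ^ p j) (𝓝[>] 0) (𝓝 (∏ j, σ j ^ p j)) := by
      have : Continuous fun ε : ℝ => ∏ j, (max (σ j) ε) ^ p j := by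
        refine continuous_finsetProd _ fun j _ => ?_
        exact (continuous_const.max continuous_id).rpow_const fun _ => Or.inr (hp j).le
      have := this.tendsto 0
      simp only [max_eq_left (hσ _)] at this
      exact this.mono_left nhdsWithin_le_nhds
    obtain ⟨ε, h, h'⟩ := ((hc.eventually (gt_mem_nhds h)).and self_mem_nhdsWithin).exists
    exact ⟨ε, h', h⟩
  set τ := fun j => max (σ j) ε with hτd
  have hτ0 : ∀ j, 0 < τ j := fun j => lt_max_of_lt_right hε
  have hlog : ∑ j, p j * Real.log (τ j) < 0 := by
    have := Real.log_neg (Finset.prod_pos fun j _ => Real.rpow_pos_of_pos (hτ0 j) (p j)) hτ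
    rw [Real.log_prod (fun j _ => (Real.rpow_pos_of_pos (hτ0 j) (p j)).ne')] at this
    simpa only [Real.log_rpow (hτ0 _)] using this
  -- At `θ = 0` the average equals one and its derivative is the mean logarithm, which is negative;
  -- so it is below one for small positive `θ`.
  have hder : HasDerivAt (fun θ : ℝ => ∑ j, p j * τ j ^ θ) (∑ j, p j * Real.log (τ j)) 0 := by
    refine HasDerivAt.fun_sum fun j _ => ?_
    have := (Real.hasStrictDerivAt_const_rpow (hτ0 j) 0).hasDerivAt.const_mul (p j)
    simpa using this
  have hs := hder.tendsto_slope_zero_right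
  obtain ⟨θ, ⟨hθ, hθ1⟩, hθ0⟩ := (((hs.eventually (gt_mem_nhds hlog)).and
    (nhdsWithin_le_nhds (ge_mem_nhds (zero_lt_one' ℝ)))).and self_mem_nhdsWithin).exists
  have hθ0 : 0 < θ := hθ0
  refine ⟨θ, hθ0, hθ1, ?_⟩
  simp only [zero_add, Real.rpow_zero, mul_one, h1, smul_eq_mul] at hθ
  have : ∑ j, p j * τ j ^ θ < 1 := by
    by_contra hcon
    have := mul_nonneg (inv_nonneg.2 hθ0.le) (sub_nonneg.2 (not_lt.1 hcon))
    linarith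
  refine lt_of_le_of_lt (Finset.sum_le_sum fun j _ => ?_) this
  exact mul_le_mul_of_nonneg_left (Real.rpow_le_rpow (hσ j) (le_max_left _ _) hθ0.le) (hp j).le

end Words

/-! ### Tame forms, and one of nearly maximal determinant. -/

section Reference

open Matrix

variable {n k : ℕ}

/-- The contractive quadratic forms that are amplified above level two by few words. -/
def tameForms (A : Fin k → Matrix (Fin n) (Fin n) ℝ) (i : Fin k) (p : Fin k → ℝ) (l : ℕ) (τ : ℝ) :
    Set (Matrix (Fin n) (Fin n) ℝ) :=
  {P | P.PosSemidef ∧ (∀ z, quad P z ≤ z ⬝ᵥ z) ∧ wordPr p l (Amplifies A i P 2) ≤ τ}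

variable {A : Fin k → Matrix (Fin n) (Fin n) ℝ} {i : Fin k} {p : Fin k → ℝ} {l : ℕ} {τ : ℝ}

lemma det_le_of_quad_le {P : Matrix (Fin n) (Fin n) ℝ} (hP : P.PosSemidef)
    (h : ∀ z, quad P z ≤ z ⬝ᵥ z) : P.det ≤ (n : ℝ) ^ n := by
  refine (det_le_trace_pow hP).trans (pow_le_pow_left₀ hP.trace_nonneg ?_ n)
  have : ∀ j, P j j ≤ 1 := fun j => by
    have := h (Pi.single j 1)
    simpa [quad] using this
  calc P.trace ≤ ∑ _j : Fin n, (1 : ℝ) := Finset.sum_le_sum fun j _ => this j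
    _ = n := by simp

/-- If the scaled sum exceeds two somewhere, then `P` or `P'` exceeds `2 * S` there. Passing from
level two to `2 * S` costs a factor `l * r ≤ 1 / 2` in probability, so the two events together have
probability at most `τ`. -/
lemma smul_add_mem_tameForms {b S : ℝ} (hb1 : 1 ≤ b) (hb : ∀ j, spectralNorm (A j) ^ 2 ≤ b)
    (hp : ∀ j, 0 ≤ p j) (h1 : ∑ j, p j = 1) {d : ℕ} (hd : 1 ≤ d) (hS : b ^ d ≤ S) {r : ℝ}
    (hr : wordPr p d {u | 1 < spectralNorm (wordMat A u)} ≤ r) (hlr : 2 * (l * r) ≤ 1)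
    {P P' : Matrix (Fin n) (Fin n) ℝ} (hP : P ∈ tameForms A i p l τ)
    (hP' : P' ∈ tameForms A i p l τ) : (2 * S)⁻¹ • (P + P') ∈ tameForms A i p l τ := by
  have hr0 : 0 ≤ r := (wordPr_nonneg hp _ _).trans hr
  have hbd : 1 ≤ b ^ d := one_le_pow₀ hb1
  have hS1 : 1 ≤ S := hbd.trans hS
  have hS0 : 0 ≤ (2 * S)⁻¹ := by positivity
  obtain ⟨hP1, hP2, hP3⟩ := hP
  obtain ⟨hP1', hP2', hP3'⟩ := hP'
  have hτ : 0 ≤ τ := (wordPr_nonneg hp _ _).trans hP3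
  refine ⟨(hP1.add hP1').smul hS0, fun z => ?_, ?_⟩
  · rw [quad_smul, quad_add, inv_mul_le_iff₀ (by positivity)]
    nlinarith [hP2 z, hP2' z, dotProduct_self_nonneg' z]
  have key : ∀ Q : Matrix (Fin n) (Fin n) ℝ, (∀ z, quad Q z ≤ z ⬝ᵥ z) →
      wordPr p l (Amplifies A i Q 2) ≤ τ → wordPr p l (Amplifies A i Q (2 * S)) ≤ τ / 2 := by
    intro Q hQ hτQ
    have h := wordPr_amplifies_le (i := i) hb1 hb hp h1 hQ hd (X := 2 * S) (by linarith) hr l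
    have h2 : wordPr p l (Amplifies A i Q (2 * S / b ^ d)) ≤ wordPr p l (Amplifies A i Q 2) := by
      refine wordPr_mono hp fun u _ hu => Amplifies.mono ?_ hu
      rw [le_div_iff₀ (by positivity)]; linarith
    have h3 : (l : ℝ) * r * wordPr p l (Amplifies A i Q (2 * S / b ^ d)) ≤ l * r * τ :=
      mul_le_mul_of_nonneg_left (h2.trans hτQ) (by positivity)
    nlinarith
  have hsub : wordPr p l (Amplifies A i ((2 * S)⁻¹ • (P + P')) 2)
      ≤ wordPr p l {u | u ∈ Amplifies A i P (2 * S) ∨ u ∈ Amplifies A i P' (2 * S)} := by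
    refine wordPr_mono hp fun u _ hu => ?_
    obtain ⟨a, z, ha, hz, hX⟩ := hu
    rw [quad_smul, quad_add, le_inv_mul_iff₀ (by positivity)] at hX
    rcases le_total (2 * S) (quad P (wordMat A a *ᵥ z)) with h | h
    · exact Or.inl ⟨a, z, ha, hz, h⟩
    · exact Or.inr ⟨a, z, ha, hz, by linarith⟩
  linarith [wordPr_union_le hp l (Amplifies A i P (2 * S)) (Amplifies A i P' (2 * S)),
    key P hP2 hP3, key P' hP2' hP3']

/-- Words of length at most `l` expand squared norms by at most `b ^ l`, so the identity divided by
`b ^ l` never reaches level two. This makes the supremum of the determinants over the class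
positive. -/
lemma exists_smul_one_mem_tameForms {b : ℝ} (hb1 : 1 ≤ b) (hb : ∀ j, spectralNorm (A j) ^ 2 ≤ b)
    (h1 : ∑ j, p j = 1) (hp : ∀ j, 0 ≤ p j) (hτ : 0 ≤ τ) :
    ∃ ε > (0 : ℝ), ε • (1 : Matrix (Fin n) (Fin n) ℝ) ∈ tameForms A i p l τ := by
  have hbl : 1 ≤ b ^ l := one_le_pow₀ hb1
  refine ⟨(b ^ l)⁻¹, by positivity, PosSemidef.one.smul (by positivity), fun z => ?_, ?_⟩
  · rw [quad_smul, quad_one]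
    exact mul_le_of_le_one_left (dotProduct_self_nonneg' z) (inv_le_one_of_one_le₀ hbl)
  · refine le_trans ?_ ((wordE_const h1 l 0).le.trans hτ)
    refine wordE_mono hp fun u hu => ?_
    rw [if_neg]
    rintro ⟨a, z, ha, hz, hX⟩
    rw [quad_smul, quad_one, le_inv_mul_iff₀ (by positivity)] at hX
    have h2 := wordMat_mulVec_self_le hb a z
    have h3 : a.length ≤ l := by
      have := ha.length_le
      simp at this; omega
    have h4 : b ^ a.length ≤ b ^ l := pow_le_pow_right₀ hb1 h3
    have h5 : b ^ a.length * (z ⬝ᵥ z) ≤ b ^ a.length := mul_le_of_le_one_right (by positivity) hz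
    linarith

/-- There is a deterministic tame form that dominates every tame form up to a polynomial factor. -/
lemma exists_reference_form {b S : ℝ} (hb1 : 1 ≤ b) (hb : ∀ j, spectralNorm (A j) ^ 2 ≤ b)
    (hp : ∀ j, 0 ≤ p j) (h1 : ∑ j, p j = 1) {d : ℕ} (hd : 1 ≤ d) (hS : b ^ d ≤ S) {r : ℝ}
    (hr : wordPr p d {u | 1 < spectralNorm (wordMat A u)} ≤ r) (hlr : 2 * (l * r) ≤ 1)
    (hτ : 0 ≤ τ) :
    ∃ P ∈ tameForms A i p l τ, P.PosDef ∧
      ∀ P' ∈ tameForms A i p l τ, ∀ z, quad P' z ≤ 2 * (2 * S) ^ n * quad P z := by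
  obtain ⟨ε, hε, hεm⟩ := exists_smul_one_mem_tameForms (A := A) (i := i) (l := l) hb1 hb h1 hp hτ
  set E := Matrix.det '' tameForms A i p l τ with hE
  have hbdd : BddAbove E := ⟨(n : ℝ) ^ n, by
    rintro _ ⟨P, hP, rfl⟩; exact det_le_of_quad_le hP.1 hP.2.1⟩
  have hpos : 0 < sSup E := by
    refine lt_of_lt_of_le ?_ (le_csSup hbdd ⟨_, hεm, rfl⟩)
    rw [det_smul, det_one]; positivity
  -- The supremum need not be attained as far as this argument knows; half of it suffices and
  -- explains the factor two in the conclusion.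
  obtain ⟨_, ⟨P, hP, rfl⟩, hlt⟩ := exists_lt_of_lt_csSup
    (show E.Nonempty from ⟨_, _, hεm, rfl⟩) (half_lt_self hpos)
  have hPd : P.PosDef := hP.1.posDef_iff_det_ne_zero.2 (by
    have := half_pos hpos
    exact (this.trans hlt).ne')
  refine ⟨P, hP, hPd, fun P' hP' => quad_le_of_det_le hPd hP'.1 ?_⟩
  have hS1 : 1 ≤ S := (one_le_pow₀ hb1).trans hS
  have h2 := le_csSup hbdd ⟨_, smul_add_mem_tameForms hb1 hb hp h1 hd hS hr hlr hP hP', rfl⟩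
  rw [det_smul, Fintype.card_fin, inv_pow, inv_mul_le_iff₀ (by positivity)] at h2
  -- The scaled sum of `P` and `P'` is again tame, so its determinant is at most the supremum, which
  -- is less than `2 * P.det`. `quad_le_of_det_le` turns this into an order bound.
  calc (P + P').det ≤ (2 * S) ^ n * sSup E := h2
    _ ≤ (2 * S) ^ n * (2 * P.det) := by gcongr; linarith
    _ = _ := by ring

end Reference

/-! ### The abstract switched model: states along a given word, and noise given a future word. -/

section Model

open Matrix

/-- The Euclidean norm of a coordinate vector. -/
noncomputable def vnorm {n : ℕ} (z : Fin n → ℝ) : ℝ := ‖WithLp.toLp 2 z‖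

lemma vnorm_nonneg {n : ℕ} (z : Fin n → ℝ) : 0 ≤ vnorm z := norm_nonneg _

lemma vnorm_sq {n : ℕ} (z : Fin n → ℝ) : vnorm z ^ 2 = z ⬝ᵥ z := (dotProduct_self_eq_norm_sq z).symm

lemma vnorm_add_le {n : ℕ} (y z : Fin n → ℝ) : vnorm (y + z) ≤ vnorm y + vnorm z :=
  norm_add_le (WithLp.toLp 2 y) (WithLp.toLp 2 z)

lemma vnorm_mulVec_le {n : ℕ} (M : Matrix (Fin n) (Fin n) ℝ) (z : Fin n → ℝ) :
    vnorm (M *ᵥ z) ≤ spectralNorm M * vnorm z := by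
  have := (Matrix.toEuclideanCLM (n := Fin n) (𝕜 := ℝ) M).le_opNorm (WithLp.toLp 2 z)
  simpa [spectralNorm, vnorm] using this

lemma continuous_vnorm {n : ℕ} : Continuous (vnorm : (Fin n → ℝ) → ℝ) :=
  (PiLp.continuous_toLp 2 _).norm

lemma measurable_vnorm {n : ℕ} : Measurable (vnorm : (Fin n → ℝ) → ℝ) :=
  continuous_vnorm.measurable

lemma measurable_dotProduct_left {n : ℕ} (y : Fin n → ℝ) : Measurable fun z : Fin n → ℝ => y ⬝ᵥ z := by
  unfold dotProduct; fun_prop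

lemma measurable_mulVec {n : ℕ} (M : Matrix (Fin n) (Fin n) ℝ) :
    Measurable fun z : Fin n → ℝ => M *ᵥ z :=
  measurable_pi_lambda _ fun _ => measurable_dotProduct_left _

/-- A switched linear system with i.i.d. switching and martingale difference noise, relative to
filtrations `𝒬 t` (everything before the draw of `s t`) and `ℋ t` (including `s t`). -/
structure SwitchedModel {Ω : Type*} {m0 : MeasurableSpace Ω} (μ : Measure Ω) {n k : ℕ}
    (A : Fin k → Matrix (Fin n) (Fin n) ℝ) (p : Fin k → ℝ) (α N : ℝ) (𝒬 ℋ : Filtration ℕ m0)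
    (x : ℕ → Ω → Fin n → ℝ) (s : ℕ → Ω → Fin k) (w : ℕ → Ω → Fin n → ℝ) : Prop where
  past_le : ∀ t, 𝒬 t ≤ ℋ t
  le_past : ∀ t, ℋ t ≤ 𝒬 (t + 1)
  state_meas : ∀ t, Measurable[𝒬 t] (x t)
  switch_meas : ∀ t, Measurable[ℋ t] (s t)
  noise_meas : ∀ t, Measurable[𝒬 (t + 1)] (w t)
  switch_law : ∀ t j F, MeasurableSet[𝒬 t] F →
    μ (F ∩ {ω | s t ω = j}) = ENNReal.ofReal (p j) * μ F
  noise_integrable : ∀ t l, Integrable (fun ω => w t ω l) μ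
  noise_condExp : ∀ t l, μ[fun ω => w t ω l | ℋ t] =ᵐ[μ] 0
  noise_moment : ∀ t, CondBound (ℋ t) μ (fun ω => ENNReal.ofReal (vnorm (w t ω) ^ α))
    (ENNReal.ofReal N)
  state_succ : ∀ t ω, x (t + 1) ω = A (s t ω) *ᵥ x t ω + w t ω
  state_zero : ∃ x₀, ∀ ω, x 0 ω = x₀
  prob_pos : ∀ j, 0 < p j
  prob_sum : ∑ j, p j = 1
  two_lt : 2 < α
  moment_nonneg : 0 ≤ N

/-- The event that the switching sequence spells the word from time `r` on. -/
def occurs {Ω : Type*} {k : ℕ} (s : ℕ → Ω → Fin k) : ℕ → List (Fin k) → Set Ω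
  | _, [] => Set.univ
  | r, j :: u => {ω | s r ω = j} ∩ occurs s (r + 1) u

/-- The accumulated noise in `v ⬝ᵥ x (r + a.length)` when the word `a` occurs at time `r`. -/
def noiseSum {Ω : Type*} {n k : ℕ} (A : Fin k → Matrix (Fin n) (Fin n) ℝ)
    (w : ℕ → Ω → Fin n → ℝ) (v : Fin n → ℝ) : ℕ → List (Fin k) → Ω → ℝ
  | _, [], _ => 0
  | r, _ :: a, ω => ((wordMat A a)ᵀ *ᵥ v) ⬝ᵥ w r ω + noiseSum A w v (r + 1) a ω

/-- The sum of `‖Φ(a')ᵀ v‖²` over the proper suffixes `a'` of a word. -/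
def suffixSq {n k : ℕ} (A : Fin k → Matrix (Fin n) (Fin n) ℝ) (v : Fin n → ℝ) :
    List (Fin k) → ℝ
  | [] => 0
  | _ :: a => ((wordMat A a)ᵀ *ᵥ v) ⬝ᵥ ((wordMat A a)ᵀ *ᵥ v) + suffixSq A v a

lemma dotProduct_mulVec_transpose {n : ℕ} (M : Matrix (Fin n) (Fin n) ℝ) (v z : Fin n → ℝ) :
    (Mᵀ *ᵥ v) ⬝ᵥ z = v ⬝ᵥ (M *ᵥ z) := by
  rw [dotProduct_mulVec, ← mulVec_transpose]

variable {Ω : Type*} {m0 : MeasurableSpace Ω} {μ : Measure Ω} {n k : ℕ}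
  {A : Fin k → Matrix (Fin n) (Fin n) ℝ} {p : Fin k → ℝ} {α N : ℝ} {𝒬 ℋ : Filtration ℕ m0}
  {x : ℕ → Ω → Fin n → ℝ} {s : ℕ → Ω → Fin k} {w : ℕ → Ω → Fin n → ℝ}

namespace SwitchedModel

lemma dotProduct_state_eq (hM : SwitchedModel μ A p α N 𝒬 ℋ x s w) (v : Fin n → ℝ) {r : ℕ}
    {a : List (Fin k)} {ω : Ω} (hω : ω ∈ occurs s r a) :
    v ⬝ᵥ x (r + a.length) ω = v ⬝ᵥ (wordMat A a *ᵥ x r ω) + noiseSum A w v r a ω := by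
  induction a generalizing r with
  | nil => simp [wordMat, noiseSum]
  | cons j a ih =>
    obtain ⟨h1, h2⟩ := hω
    have h1 : s r ω = j := h1
    have h3 := ih h2
    rw [List.length_cons, show r + (a.length + 1) = r + 1 + a.length by ring, h3, hM.state_succ,
      h1, wordMat, noiseSum, mulVec_add, dotProduct_add, mulVec_mulVec,
      dotProduct_mulVec_transpose]
    ring

lemma measurableSet_switch (hM : SwitchedModel μ A p α N 𝒬 ℋ x s w) (t : ℕ) (j : Fin k) :
    MeasurableSet[ℋ t] {ω | s t ω = j} :=
  hM.switch_meas t (measurableSet_singleton j)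

lemma measurableSet_occurs (hM : SwitchedModel μ A p α N 𝒬 ℋ x s w) (r : ℕ) (u : List (Fin k)) :
    MeasurableSet[𝒬 (r + u.length)] (occurs s r u) := by
  induction u generalizing r with
  | nil => exact MeasurableSet.univ
  | cons j u ih =>
    refine MeasurableSet.inter ?_ ?_
    · exact 𝒬.mono (by simp) _ (hM.le_past r _ (hM.measurableSet_switch r j))
    · have := ih (r + 1)
      rwa [show r + 1 + u.length = r + (j :: u).length by simp; ring] at this

lemma measure_inter_occurs (hM : SwitchedModel μ A p α N 𝒬 ℋ x s w) (u : List (Fin k)) (r : ℕ)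
    {F : Set Ω} (hF : MeasurableSet[𝒬 r] F) :
    μ (F ∩ occurs s r u) = ENNReal.ofReal ((u.map p).prod) * μ F := by
  induction u generalizing r F with
  | nil => simp [occurs]
  | cons j u ih =>
    rw [occurs, ← Set.inter_assoc, ih (r + 1) (F := F ∩ {ω | s r ω = j}), hM.switch_law r j F hF,
      ← mul_assoc, List.map_cons, List.prod_cons, ← ENNReal.ofReal_mul, mul_comm (p j)]
    · exact List.prod_nonneg (by simpa using fun a _ => (hM.prob_pos a).le)
    · exact (𝒬.mono (Nat.le_succ r) _ hF).inter (hM.le_past r _ (hM.measurableSet_switch r j))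

lemma word_prob_nonneg (hM : SwitchedModel μ A p α N 𝒬 ℋ x s w) (u : List (Fin k)) :
    0 ≤ (u.map p).prod :=
  List.prod_nonneg (by simpa using fun a _ => (hM.prob_pos a).le)

/-- Seen from the past `𝒬 r`, restricting to the event that a given word occurs from time `r` on
only multiplies the measure by the probability of that word. -/
lemma trim_restrict_occurs (hM : SwitchedModel μ A p α N 𝒬 ℋ x s w) (u : List (Fin k)) (r : ℕ) :
    (μ.restrict (occurs s r u)).trim (𝒬.le r)
      = ENNReal.ofReal ((u.map p).prod) • μ.trim (𝒬.le r) := by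
  refine @Measure.ext _ (𝒬 r) _ _ fun F hF => ?_
  rw [trim_measurableSet_eq _ hF, Measure.restrict_apply (𝒬.le r _ hF), Measure.smul_apply,
    trim_measurableSet_eq _ hF, hM.measure_inter_occurs u r hF, smul_eq_mul]

lemma setIntegral_occurs (hM : SwitchedModel μ A p α N 𝒬 ℋ x s w) (u : List (Fin k)) (r : ℕ)
    {Y : Ω → ℝ} (hY : StronglyMeasurable[𝒬 r] Y) :
    ∫ ω in occurs s r u, Y ω ∂μ = (u.map p).prod * ∫ ω, Y ω ∂μ := by
  rw [integral_trim (𝒬.le r) hY, hM.trim_restrict_occurs, integral_smul_measure,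
    ← integral_trim (𝒬.le r) hY, ENNReal.toReal_ofReal (hM.word_prob_nonneg u), smul_eq_mul]

lemma setLIntegral_switch (hM : SwitchedModel μ A p α N 𝒬 ℋ x s w) (r : ℕ) (j : Fin k)
    {Y : Ω → ℝ≥0∞} (hY : Measurable[𝒬 r] Y) :
    ∫⁻ ω in {ω | s r ω = j}, Y ω ∂μ = ENNReal.ofReal (p j) * ∫⁻ ω, Y ω ∂μ := by
  have := hM.trim_restrict_occurs [j] r
  have e : occurs s r [j] = {ω | s r ω = j} := by simp [occurs]
  rw [e] at this
  rw [← lintegral_trim (𝒬.le r) hY, this, lintegral_smul_measure, lintegral_trim (𝒬.le r) hY]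
  simp

set_option linter.unusedSectionVars false

variable [IsProbabilityMeasure μ]

lemma noise_meas' (hM : SwitchedModel μ A p α N 𝒬 ℋ x s w) (t : ℕ) : Measurable (w t) :=
  (hM.noise_meas t).mono (𝒬.le _) le_rfl

lemma dotProduct_noise_meas (hM : SwitchedModel μ A p α N 𝒬 ℋ x s w) (y : Fin n → ℝ) (t : ℕ) :
    StronglyMeasurable[𝒬 (t + 1)] fun ω => y ⬝ᵥ w t ω :=
  ((measurable_dotProduct_left y).comp (hM.noise_meas t)).stronglyMeasurable

/-- From `u ^ β ≤ 1 + u ^ α`. This is the origin of the constant `1 + N` wherever a lower moment of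
the noise is used. -/
lemma noise_moment_of_le (hM : SwitchedModel μ A p α N 𝒬 ℋ x s w) {β : ℝ} (hβ0 : 0 ≤ β)
    (hβ : β ≤ α) (t : ℕ) :
    CondBound (ℋ t) μ (fun ω => ENNReal.ofReal (vnorm (w t ω) ^ β)) (ENNReal.ofReal (1 + N)) := by
  intro F hF
  have h := hM.noise_moment t F hF
  calc ∫⁻ ω in F, ENNReal.ofReal (vnorm (w t ω) ^ β) ∂μ
      ≤ ∫⁻ ω in F, (1 + ENNReal.ofReal (vnorm (w t ω) ^ α)) ∂μ := by
        refine lintegral_mono fun ω => ?_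
        have h0 := vnorm_nonneg (w t ω)
        rw [← ENNReal.ofReal_one, ← ENNReal.ofReal_add zero_le_one (Real.rpow_nonneg h0 _)]
        refine ENNReal.ofReal_le_ofReal ?_
        rcases le_total (vnorm (w t ω)) 1 with h1 | h1
        · linarith [Real.rpow_le_one h0 h1 hβ0, Real.rpow_nonneg h0 α]
        · linarith [Real.rpow_le_rpow_of_exponent_le h1 hβ]
    _ = μ F + ∫⁻ ω in F, ENNReal.ofReal (vnorm (w t ω) ^ α) ∂μ := by
        rw [lintegral_add_left measurable_const]; simp
    _ ≤ ENNReal.ofReal (1 + N) * μ F := by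
        rw [ENNReal.ofReal_add zero_le_one hM.moment_nonneg, add_mul]
        rw [ENNReal.ofReal_one, one_mul]
        exact add_le_add le_rfl h

lemma noise_sq_condBound (hM : SwitchedModel μ A p α N 𝒬 ℋ x s w) (y : Fin n → ℝ) (t : ℕ) :
    CondBound (ℋ t) μ (fun ω => ENNReal.ofReal ((y ⬝ᵥ w t ω) ^ 2))
      (ENNReal.ofReal ((y ⬝ᵥ y) * (1 + N))) := by
  intro F hF
  have h := hM.noise_moment_of_le (β := 2) (by norm_num) hM.two_lt.le t F hF
  calc ∫⁻ ω in F, ENNReal.ofReal ((y ⬝ᵥ w t ω) ^ 2) ∂μ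
      ≤ ∫⁻ ω in F, ENNReal.ofReal (y ⬝ᵥ y) * ENNReal.ofReal (vnorm (w t ω) ^ (2 : ℝ)) ∂μ := by
        refine lintegral_mono fun ω => ?_
        rw [← ENNReal.ofReal_mul (dotProduct_self_nonneg' y)]
        refine ENNReal.ofReal_le_ofReal ?_
        rw [Real.rpow_two, vnorm_sq]
        exact sq_dotProduct_le_mul _ _
    _ = ENNReal.ofReal (y ⬝ᵥ y) * ∫⁻ ω in F, ENNReal.ofReal (vnorm (w t ω) ^ (2 : ℝ)) ∂μ := by
        rw [lintegral_const_mul]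
        exact ((measurable_vnorm.comp (hM.noise_meas' t)).pow_const _).ennreal_ofReal
    _ ≤ _ := by
        rw [ENNReal.ofReal_mul (dotProduct_self_nonneg' y), mul_assoc]; gcongr

lemma dotProduct_noise_integrable (hM : SwitchedModel μ A p α N 𝒬 ℋ x s w) (y : Fin n → ℝ)
    (t : ℕ) : Integrable (fun ω => y ⬝ᵥ w t ω) μ := by
  unfold dotProduct
  exact integrable_finsetSum _ fun l _ => (hM.noise_integrable t l).const_mul _

lemma dotProduct_noise_condExp (hM : SwitchedModel μ A p α N 𝒬 ℋ x s w) (y : Fin n → ℝ)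
    (t : ℕ) : μ[fun ω => y ⬝ᵥ w t ω | ℋ t] =ᵐ[μ] 0 := by
  have e : (fun ω => y ⬝ᵥ w t ω) = ∑ l, y l • fun ω => w t ω l := by
    ext ω; simp [dotProduct]
  rw [e]
  have h1 := condExp_finsetSum (μ := μ) (m := ℋ t) (s := Finset.univ)
    (f := fun l => y l • fun ω => w t ω l) fun l _ => (hM.noise_integrable t l).smul _
  have h2 : ∀ l, μ[y l • (fun ω => w t ω l) | ℋ t] =ᵐ[μ] 0 := fun l => by
    filter_upwards [condExp_smul (μ := μ) (m := ℋ t) (y l) (fun ω => w t ω l),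
      hM.noise_condExp t l] with ω h h'
    rw [h]; simp [h']
  filter_upwards [h1, ae_all_iff.2 h2] with ω h1 h2
  rw [h1]; simp [Finset.sum_apply, h2]

lemma dotProduct_noise_memLp (hM : SwitchedModel μ A p α N 𝒬 ℋ x s w) (y : Fin n → ℝ)
    (t : ℕ) : MemLp (fun ω => y ⬝ᵥ w t ω) 2 μ := by
  have hm := (hM.dotProduct_noise_meas y t).mono (𝒬.le _)
  rw [memLp_two_iff_integrable_sq hm.aestronglyMeasurable]
  refine ⟨(hm.pow 2).aestronglyMeasurable, ?_⟩
  rw [hasFiniteIntegral_iff_ofReal (ae_of_all _ fun ω => sq_nonneg _)]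
  have := hM.noise_sq_condBound y t Set.univ MeasurableSet.univ
  rw [Measure.restrict_univ] at this
  exact this.trans_lt (by simp)

lemma noiseSum_memLp (hM : SwitchedModel μ A p α N 𝒬 ℋ x s w) (v : Fin n → ℝ)
    (a : List (Fin k)) (r : ℕ) : MemLp (noiseSum A w v r a) 2 μ := by
  induction a generalizing r with
  | nil => exact MemLp.zero'
  | cons j a ih => exact (hM.dotProduct_noise_memLp _ r).add (ih (r + 1))

lemma setIntegral_occurs_cons (hM : SwitchedModel μ A p α N 𝒬 ℋ x s w) (j : Fin k)
    (u : List (Fin k)) (r : ℕ) (f : Ω → ℝ) :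
    ∫ ω in occurs s r (j :: u), f ω ∂μ
      = ∫ ω in occurs s (r + 1) u, {ω | s r ω = j}.indicator f ω ∂μ := by
  have hm : MeasurableSet {ω | s r ω = j} := ℋ.le _ _ (hM.measurableSet_switch r j)
  rw [setIntegral_indicator hm, occurs, Set.inter_comm]

/-- Prescribing the switches does not bias the noise: the switches after time `r` are independent of
`w r`, and the switch at time `r` is known before `w r`. In the induction the indicator of the first
letter is absorbed into `g`, which becomes `ℋ r`-measurable; the later letters factor out. -/
lemma setIntegral_mul_noiseSum (hM : SwitchedModel μ A p α N 𝒬 ℋ x s w) (v : Fin n → ℝ)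
    {a u : List (Fin k)} (hau : a <+: u) (r : ℕ) {g : Ω → ℝ} (hg : StronglyMeasurable[𝒬 r] g)
    (hg2 : MemLp g 2 μ) :
    ∫ ω in occurs s r u, g ω * noiseSum A w v r a ω ∂μ = 0 := by
  induction a generalizing r u g with
  | nil => simp [noiseSum]
  | cons j a ih =>
    obtain ⟨c, rfl⟩ := hau
    rw [List.cons_append, hM.setIntegral_occurs_cons]
    set S := {ω | s r ω = j} with hS
    have hSm := hM.measurableSet_switch r j
    set y := (wordMat A a)ᵀ *ᵥ v
    have hg' : StronglyMeasurable[ℋ r] (S.indicator g) :=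
      (hg.mono (hM.past_le r)).indicator hSm
    have hg2' : MemLp (S.indicator g) 2 μ := hg2.indicator (ℋ.le _ _ hSm)
    have e : ∀ ω, S.indicator (fun ω => g ω * noiseSum A w v r (j :: a) ω) ω
        = S.indicator g ω * (y ⬝ᵥ w r ω) + S.indicator g ω * noiseSum A w v (r + 1) a ω := by
      intro ω
      by_cases h : ω ∈ S
      · simp only [Set.indicator_of_mem h, noiseSum]; ring
      · simp [Set.indicator_of_notMem h]
    simp_rw [e]
    have hi1 : Integrable (fun ω => S.indicator g ω * (y ⬝ᵥ w r ω)) μ :=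
      hg2'.integrable_mul (hM.dotProduct_noise_memLp y r)
    have hi2 : Integrable (fun ω => S.indicator g ω * noiseSum A w v (r + 1) a ω) μ :=
      hg2'.integrable_mul (hM.noiseSum_memLp v a (r + 1))
    rw [integral_add hi1.integrableOn hi2.integrableOn,
      ih (List.prefix_append a c) (r + 1) (hg'.mono (hM.le_past r)) hg2',
      hM.setIntegral_occurs (a ++ c) (r + 1) (Y := fun ω => S.indicator g ω * (y ⬝ᵥ w r ω))
        ((hg'.mono (hM.le_past r)).mul (hM.dotProduct_noise_meas y r)),
      integral_mul_eq_zero_of_condExp (ℋ.le r) (hM.dotProduct_noise_integrable y r)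
        (hM.dotProduct_noise_condExp y r) hg' hi1]
    simp

/-- The mixed terms vanish by `setIntegral_mul_noiseSum`, and the noise entering before a suffix
`a'` contributes at most `(1 + N) * ‖Φ(a')ᵀ v‖²`; these sum to `suffixSq`. Boundedness of `g` only
secures integrability. -/
lemma setIntegral_sq_mul_noiseSum_le (hM : SwitchedModel μ A p α N 𝒬 ℋ x s w) (v : Fin n → ℝ)
    {a u : List (Fin k)} (hau : a <+: u) (r : ℕ) {g : Ω → ℝ} (hg : StronglyMeasurable[𝒬 r] g)
    {c : ℝ} (hgc : ∀ ω, |g ω| ≤ c) :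
    ∫ ω in occurs s r u, (g ω * noiseSum A w v r a ω) ^ 2 ∂μ
      ≤ (u.map p).prod * ((1 + N) * suffixSq A v a * ∫ ω, g ω ^ 2 ∂μ) := by
  induction a generalizing r u g with
  | nil => simp [noiseSum, suffixSq]
  | cons j a ih =>
    obtain ⟨b, rfl⟩ := hau
    rw [List.cons_append, hM.setIntegral_occurs_cons]
    set S := {ω | s r ω = j} with hS
    have hSm := hM.measurableSet_switch r j
    set y := (wordMat A a)ᵀ *ᵥ v with hy
    set g' := S.indicator g with hg'd
    have hg' : StronglyMeasurable[ℋ r] g' := (hg.mono (hM.past_le r)).indicator hSm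
    have hgc' : ∀ ω, |g' ω| ≤ c := fun ω => by
      by_cases h : ω ∈ S
      · rw [hg'd, Set.indicator_of_mem h]; exact hgc ω
      · rw [hg'd, Set.indicator_of_notMem h, abs_zero]; exact (abs_nonneg _).trans (hgc ω)
    have hc0 : ∀ ω, 0 ≤ c := fun ω => (abs_nonneg _).trans (hgc ω)
    set R := noiseSum A w v (r + 1) a with hR
    set ξ : Ω → ℝ := fun ω => y ⬝ᵥ w r ω with hξ
    have hξ2 : MemLp ξ 2 μ := hM.dotProduct_noise_memLp y r
    have hξm : StronglyMeasurable[𝒬 (r + 1)] ξ := hM.dotProduct_noise_meas y r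
    have hR2 : MemLp R 2 μ := hM.noiseSum_memLp v a (r + 1)
    have hgm0 : StronglyMeasurable g' := hg'.mono (ℋ.le r)
    have hb : ∀ {f : Ω → ℝ}, MemLp f 2 μ → MemLp (fun ω => g' ω * f ω) 2 μ := fun {f} hf => by
      refine MemLp.of_le_mul (c := c) hf (hgm0.aestronglyMeasurable.mul hf.1) (ae_of_all _ fun ω => ?_)
      rw [norm_mul]
      exact mul_le_mul_of_nonneg_right (hgc' ω) (norm_nonneg _)
    have hg2 : MemLp g' 2 μ := MemLp.of_bound hgm0.aestronglyMeasurable c (ae_of_all _ hgc')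
    have e : ∀ ω, S.indicator (fun ω => (g ω * noiseSum A w v r (j :: a) ω) ^ 2) ω
        = ((g' ω * ξ ω) ^ 2 + (2 * ((g' ω * (g' ω * ξ ω)) * R ω))) + (g' ω * R ω) ^ 2 := by
      intro ω
      by_cases h : ω ∈ S
      · simp only [hg'd, Set.indicator_of_mem h, noiseSum]; ring
      · simp [hg'd, Set.indicator_of_notMem h]
    simp_rw [e]
    have hi1 : Integrable (fun ω => (g' ω * ξ ω) ^ 2) μ := (hb hξ2).integrable_sq
    have hi2 : Integrable (fun ω => 2 * ((g' ω * (g' ω * ξ ω)) * R ω)) μ :=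
      ((hb (hb hξ2)).integrable_mul hR2).const_mul 2
    have hi3 : Integrable (fun ω => (g' ω * R ω) ^ 2) μ := (hb hR2).integrable_sq
    have hi12 : Integrable (fun ω => (g' ω * ξ ω) ^ 2 + 2 * ((g' ω * (g' ω * ξ ω)) * R ω)) μ :=
      hi1.add hi2
    rw [integral_add hi12.integrableOn hi3.integrableOn, integral_add hi1.integrableOn
      hi2.integrableOn, integral_const_mul]
    have hg'' := hg'.mono (hM.le_past r)
    have hpre : a <+: a ++ b := List.prefix_append a b
    have hp0 := hM.word_prob_nonneg (a ++ b)
    rw [hM.setIntegral_mul_noiseSum v hpre (r + 1) (g := fun ω => g' ω * (g' ω * ξ ω))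
      (hg''.mul (hg''.mul hξm)) (hb (hb hξ2))]
    have h3 := ih hpre (r + 1) hg'' hgc'
    rw [hM.setIntegral_occurs (a ++ b) (r + 1) (Y := fun ω => (g' ω * ξ ω) ^ 2) ((hg''.mul hξm).pow 2)]
    have h1 : ∫ ω, (g' ω * ξ ω) ^ 2 ∂μ ≤ (y ⬝ᵥ y) * (1 + N) * ∫ ω, g' ω ^ 2 ∂μ := by
      have hN : 0 ≤ (y ⬝ᵥ y) * (1 + N) :=
        mul_nonneg (dotProduct_self_nonneg' y) (by linarith [hM.moment_nonneg])
      rw [integral_eq_lintegral_of_nonneg_ae (ae_of_all _ fun ω => sq_nonneg _)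
        hi1.aestronglyMeasurable, integral_eq_lintegral_of_nonneg_ae
        (ae_of_all _ fun ω => sq_nonneg _) hg2.integrable_sq.aestronglyMeasurable,
        ← ENNReal.toReal_ofReal hN, ← ENNReal.toReal_mul]
      refine ENNReal.toReal_mono (ENNReal.mul_ne_top ENNReal.ofReal_ne_top ?_) ?_
      · have := hg2.integrable_sq.hasFiniteIntegral
        rw [hasFiniteIntegral_iff_ofReal (ae_of_all _ fun ω => sq_nonneg _)] at this
        exact this.ne
      · refine le_trans (le_of_eq (lintegral_congr fun ω => ?_))
          ((hM.noise_sq_condBound y r).lintegral_mul_le (ℋ.le r)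
            ((hξm.mono (𝒬.le _)).measurable.pow_const 2).ennreal_ofReal
            (Y := fun ω => ENNReal.ofReal (g' ω ^ 2)) (hg'.measurable.pow_const 2).ennreal_ofReal)
        rw [← ENNReal.ofReal_mul (sq_nonneg _), mul_pow]
    have h4 : ∫ ω, g' ω ^ 2 ∂μ = p j * ∫ ω, g ω ^ 2 ∂μ := by
      have h5 := hM.setIntegral_occurs [j] r (hg.pow 2)
      rw [hM.setIntegral_occurs_cons] at h5
      simp only [occurs, Measure.restrict_univ, List.map_cons, List.map_nil, List.prod_cons,
        List.prod_nil, mul_one] at h5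
      rw [show (∫ ω, g ω ^ 2 ∂μ) = ∫ ω, (g ^ 2) ω ∂μ from rfl, ← h5]
      refine integral_congr_ae (ae_of_all _ fun ω => ?_)
      by_cases h : ω ∈ S
      · simp only [hg'd, Set.indicator_of_mem h]; rw [Set.indicator_of_mem h]; rfl
      · simp only [hg'd, Set.indicator_of_notMem h]; rw [Set.indicator_of_notMem h]; norm_num
    rw [h4] at h1 h3
    have h6 := mul_le_mul_of_nonneg_left h1 hp0
    have e2 : ((((j :: (a ++ b)).map p).prod) : ℝ) = p j * ((a ++ b).map p).prod := by simp
    rw [e2, suffixSq]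
    calc _ ≤ ((a ++ b).map p).prod * ((y ⬝ᵥ y) * (1 + N) * (p j * ∫ ω, g ω ^ 2 ∂μ)) + 2 * 0
          + ((a ++ b).map p).prod * ((1 + N) * suffixSq A v a * (p j * ∫ ω, g ω ^ 2 ∂μ)) := by
          gcongr
      _ = _ := by ring

end SwitchedModel

end Model

/-! ### Excitations of the Gram matrix, and their probability given a word. -/

section Excitation

open Matrix

/-- The regularized Gram matrix of the first `T` vectors of a sequence. -/
def gram {n : ℕ} (y : ℕ → Fin n → ℝ) (T : ℕ) : Matrix (Fin n) (Fin n) ℝ :=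
  1 + ∑ t ∈ Finset.range T, vecMulVec (y t) (y t)

section Gram

variable {n : ℕ} (y : ℕ → Fin n → ℝ)

lemma gram_succ (T : ℕ) : gram y (T + 1) = gram y T + vecMulVec (y T) (y T) := by
  simp [gram, Finset.sum_range_succ, add_assoc]

lemma quad_gram (T : ℕ) (v : Fin n → ℝ) :
    quad (gram y T) v = v ⬝ᵥ v + ∑ t ∈ Finset.range T, (y t ⬝ᵥ v) ^ 2 := by
  simp [gram, quad_add, quad_one, quad_sum, quad_vecMulVec]

lemma quad_gram_mono {r T : ℕ} (h : r ≤ T) (v : Fin n → ℝ) :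
    quad (gram y r) v ≤ quad (gram y T) v := by
  rw [quad_gram, quad_gram]
  gcongr

lemma posSemidef_sum_vecMulVec (s : Finset ℕ) :
    (∑ t ∈ s, vecMulVec (y t) (y t)).PosSemidef :=
  posSemidef_sum s fun t _ => posSemidef_vecMulVec (y t)

lemma posDef_gram (T : ℕ) : (gram y T).PosDef :=
  PosDef.one.add_posSemidef (posSemidef_sum_vecMulVec y _)

lemma det_gram_mono {r T : ℕ} (h : r ≤ T) : (gram y r).det ≤ (gram y T).det := by
  induction T, h using Nat.le_induction with
  | base => exact le_rfl
  | succ T _ ih =>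
    rw [gram_succ]; exact ih.trans (det_add_mono (posDef_gram y T) (posSemidef_vecMulVec _))

lemma one_le_det_gram (T : ℕ) : 1 ≤ (gram y T).det := by
  have := det_gram_mono y (Nat.zero_le T)
  simpa [gram] using this

lemma log_det_gram_nonneg (T : ℕ) : 0 ≤ Real.log (gram y T).det :=
  Real.log_nonneg (one_le_det_gram y T)

lemma log_det_gram_mono {r T : ℕ} (h : r ≤ T) :
    Real.log (gram y r).det ≤ Real.log (gram y T).det :=
  Real.log_le_log (posDef_gram y r).det_pos (det_gram_mono y h)

/-- By duality a response of square at least `c` in a direction of Gram norm at most one forces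
`quad (gram y r)⁻¹ (y t) ≥ c`. The rank-one update at time `t` alone then multiplies the determinant
by `1 + c`, and the other updates do not decrease it. -/
lemma log_det_gram_add_le {r L t : ℕ} (hr : r ≤ t) (ht : t < r + L) {v : Fin n → ℝ} {c : ℝ}
    (hc : 0 ≤ c) (hv : quad (gram y r) v ≤ 1) (hcv : c ≤ (v ⬝ᵥ y t) ^ 2) :
    Real.log (gram y r).det + Real.log (1 + c) ≤ Real.log (gram y (r + L)).det := by
  have hpos := (posDef_gram y r).det_pos
  rw [← Real.log_mul hpos.ne' (by positivity)]
  refine Real.log_le_log (by positivity) ?_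
  have e : gram y (r + L) = (gram y r + vecMulVec (y t) (y t))
      + ∑ j ∈ (Finset.Ico r (r + L)).erase t, vecMulVec (y j) (y j) := by
    rw [add_assoc, Finset.add_sum_erase _ (fun j => vecMulVec (y j) (y j))
      (Finset.mem_Ico.2 ⟨hr, ht⟩), gram, gram, add_assoc, Finset.range_eq_Ico,
      Finset.range_eq_Ico, Finset.sum_Ico_consecutive _ (Nat.zero_le r) (Nat.le_add_right r L)]
  rw [e]
  refine le_trans ?_ (det_add_mono ((posDef_gram y r).add_posSemidef (posSemidef_vecMulVec _))
    (posSemidef_sum_vecMulVec y _))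
  rw [det_add_vecMulVec (posDef_gram y r)]
  refine mul_le_mul_of_nonneg_left ?_ hpos.le
  have h1 := sq_dotProduct_le (posDef_gram y r) v (y t)
  have h2 := quad_nonneg (posDef_gram y r).inv.posSemidef (y t)
  nlinarith

/-- Counting the times at which a new excitation occurs within the next `L` steps. -/
lemma sum_indicator_excitation_le (L : ℕ) {c : ℝ} (hc : 0 ≤ c) (E : ℕ → Prop) [DecidablePred E]
    (hE : ∀ r, E r → ∃ t v, r ≤ t ∧ t < r + L ∧ quad (gram y r) v ≤ 1 ∧ c ≤ (v ⬝ᵥ y t) ^ 2)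
    (T : ℕ) : ∑ r ∈ Finset.range T, (if E r then Real.log (1 + c) else 0)
      ≤ L * Real.log (gram y (T + L)).det := by
  set g : ℕ → ℝ := fun r => Real.log (gram y r).det with hg
  have h1 : ∀ r, (if E r then Real.log (1 + c) else 0) ≤ g (r + L) - g r := by
    intro r
    split_ifs with h
    · obtain ⟨t, v, h1, h2, h3, h4⟩ := hE r h
      linarith [log_det_gram_add_le y h1 h2 hc h3 h4]
    · linarith [log_det_gram_mono y (Nat.le_add_right r L)]
  refine (Finset.sum_le_sum fun r _ => h1 r).trans ?_
  -- The windows of length `L` overlap, so an increment of `g` is counted at most `L` times; this is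
  -- a telescoping sum with step `L`.
  have h2 : ∀ L : ℕ, ∑ r ∈ Finset.range T, (g (r + L) - g r) ≤ L * g (T + L) := by
    intro L
    induction L with
    | zero => simp
    | succ L ih =>
      have e : ∑ r ∈ Finset.range T, (g (r + (L + 1)) - g r)
          = ∑ r ∈ Finset.range T, (g (r + L) - g r) + (g (T + L) - g L) := by
        have := Finset.sum_range_sub (fun r => g (r + L)) T
        rw [Nat.zero_add] at this
        rw [← this, ← Finset.sum_add_distrib]
        refine Finset.sum_congr rfl fun r _ => ?_
        rw [show r + (L + 1) = r + 1 + L by ring]; ring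
      rw [e]
      have h3 : g (T + L) ≤ g (T + (L + 1)) := log_det_gram_mono y (by omega)
      have h4 : 0 ≤ g L := log_det_gram_nonneg y L
      have h5 : (L : ℝ) * g (T + L) ≤ L * g (T + (L + 1)) := by gcongr
      push_cast; linarith
  exact h2 L

end Gram

/-- The regressors of mode `i`: the state at the times at which the discrete state is `i`. -/
def regressor {Ω : Type*} {n k : ℕ} (x : ℕ → Ω → Fin n → ℝ) (s : ℕ → Ω → Fin k) (i : Fin k)
    (ω : Ω) (t : ℕ) : Fin n → ℝ := if s t ω = i then x t ω else 0

/-- The words that start with `a ++ [i]` for which some vector `v` of the dense sequence, of norm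
at most one with respect to `V`, has a large response `v ⬝ᵥ Φ(a) z`, also when compared
with the responses to the noise. -/
noncomputable def Excites {n k : ℕ} (A : Fin k → Matrix (Fin n) (Fin n) ℝ) (i : Fin k) (h β : ℝ)
    (V : Matrix (Fin n) (Fin n) ℝ) (z : Fin n → ℝ) : Set (List (Fin k)) :=
  {u | ∃ a m, (a ++ [i]) <+: u ∧ quad V (TopologicalSpace.denseSeq (Fin n → ℝ) m) ≤ 1 ∧
    h ≤ (TopologicalSpace.denseSeq (Fin n → ℝ) m ⬝ᵥ (wordMat A a *ᵥ z)) ^ 2 ∧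
    suffixSq A (TopologicalSpace.denseSeq (Fin n → ℝ) m) a
      ≤ β * (TopologicalSpace.denseSeq (Fin n → ℝ) m ⬝ᵥ (wordMat A a *ᵥ z)) ^ 2}

/-- The event that some direction not yet excited before time `r` is excited by the regressors
within the next `L` steps. -/
noncomputable def excitationEvent {Ω : Type*} {n k : ℕ} (x : ℕ → Ω → Fin n → ℝ) (s : ℕ → Ω → Fin k)
    (i : Fin k) (c : ℝ) (r L : ℕ) : Set Ω :=
  {ω | ∃ l < L, ∃ m, s (r + l) ω = i ∧
    quad (gram (regressor x s i ω) r) (TopologicalSpace.denseSeq (Fin n → ℝ) m) ≤ 1 ∧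
    c ≤ (TopologicalSpace.denseSeq (Fin n → ℝ) m ⬝ᵥ x (r + l) ω) ^ 2}

variable {Ω : Type*} {m0 : MeasurableSpace Ω} {μ : Measure Ω} {n k : ℕ}
  {A : Fin k → Matrix (Fin n) (Fin n) ℝ} {p : Fin k → ℝ} {α N : ℝ} {𝒬 ℋ : Filtration ℕ m0}
  {x : ℕ → Ω → Fin n → ℝ} {s : ℕ → Ω → Fin k} {w : ℕ → Ω → Fin n → ℝ}

lemma occurs_of_append {r : ℕ} {a c : List (Fin k)} {ω : Ω} (h : ω ∈ occurs s r (a ++ c)) :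
    ω ∈ occurs s r a := by
  induction a generalizing r with
  | nil => trivial
  | cons j a ih => exact ⟨h.1, ih h.2⟩

lemma switch_eq_of_occurs {r : ℕ} {a c : List (Fin k)} {i : Fin k} {ω : Ω}
    (h : ω ∈ occurs s r (a ++ [i] ++ c)) : s (r + a.length) ω = i := by
  induction a generalizing r with
  | nil => exact h.1
  | cons b a ih =>
    have := ih h.2
    rwa [List.length_cons, show r + (a.length + 1) = r + 1 + a.length by ring]

namespace SwitchedModel

lemma measurable_regressor (hM : SwitchedModel μ A p α N 𝒬 ℋ x s w) (i : Fin k) (t : ℕ) :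
    Measurable[ℋ t] fun ω => regressor x s i ω t :=
  Measurable.ite (hM.measurableSet_switch t i) ((hM.state_meas t).mono (hM.past_le t) le_rfl)
    measurable_const

lemma measurable_quad_gram (hM : SwitchedModel μ A p α N 𝒬 ℋ x s w) (i : Fin k) (r : ℕ)
    (v : Fin n → ℝ) : Measurable[𝒬 r] fun ω => quad (gram (regressor x s i ω) r) v := by
  simp only [quad_gram]
  refine measurable_const.add (Finset.measurable_sum _ fun t ht => ?_)
  have h1 : Measurable[𝒬 r] fun ω => regressor x s i ω t :=
    (hM.measurable_regressor i t).mono ((hM.le_past t).trans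
      (𝒬.mono (Nat.succ_le_of_lt (Finset.mem_range.1 ht)))) le_rfl
  simp only [dotProduct_comm _ v]
  exact ((measurable_dotProduct_left v).comp h1).pow_const 2

lemma measurable_dotProduct_state (hM : SwitchedModel μ A p α N 𝒬 ℋ x s w) (r : ℕ)
    (M : Matrix (Fin n) (Fin n) ℝ) (v : Fin n → ℝ) :
    Measurable[𝒬 r] fun ω => v ⬝ᵥ (M *ᵥ x r ω) :=
  (measurable_dotProduct_left v).comp ((measurable_mulVec M).comp (hM.state_meas r))

lemma measurable_dotProduct_state' (hM : SwitchedModel μ A p α N 𝒬 ℋ x s w) (r : ℕ)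
    (v : Fin n → ℝ) : Measurable fun ω => v ⬝ᵥ x r ω :=
  (measurable_dotProduct_left v).comp ((hM.state_meas r).mono (𝒬.le r) le_rfl)

lemma measurableSet_excitationEvent (hM : SwitchedModel μ A p α N 𝒬 ℋ x s w) (i : Fin k) (c : ℝ)
    (r L : ℕ) : MeasurableSet (excitationEvent x s i c r L) := by
  have e : excitationEvent x s i c r L = ⋃ l ∈ Set.Iio L, ⋃ m, ({ω | s (r + l) ω = i} ∩
      ({ω | quad (gram (regressor x s i ω) r) (TopologicalSpace.denseSeq (Fin n → ℝ) m) ≤ 1} ∩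
      {ω | c ≤ (TopologicalSpace.denseSeq (Fin n → ℝ) m ⬝ᵥ x (r + l) ω) ^ 2})) := by
    ext ω
    simp only [excitationEvent, Set.mem_ofPred_eq, Set.mem_iUnion, Set.mem_Iio, Set.mem_inter_iff,
      exists_prop, exists_and_left]
  rw [e]
  refine MeasurableSet.biUnion (Set.to_countable _) fun l _ => MeasurableSet.iUnion fun m => ?_
  refine (ℋ.le _ _ (hM.measurableSet_switch (r + l) i)).inter (MeasurableSet.inter ?_ ?_)
  · exact measurableSet_le ((hM.measurable_quad_gram i r _).mono (𝒬.le r) le_rfl) measurable_const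
  · exact measurableSet_le measurable_const ((hM.measurable_dotProduct_state' (r + l) _).pow_const 2)

set_option linter.unusedSectionVars false

variable [IsProbabilityMeasure μ]

/-- A lower bound of Paley–Zygmund type for the response along a word. -/
lemma paley_zygmund (hM : SwitchedModel μ A p α N 𝒬 ℋ x s w) (v : Fin n → ℝ)
    {a u : List (Fin k)} (hau : a <+: u) (r : ℕ) {G : Set Ω} (hG : MeasurableSet[𝒬 r] G)
    {h β : ℝ} (hh : 0 < h) (hβ : 0 ≤ β)
    (hG1 : ∀ ω ∈ G, h ≤ (v ⬝ᵥ (wordMat A a *ᵥ x r ω)) ^ 2)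
    (hG2 : ∀ ω ∈ G, suffixSq A v a ≤ β * (v ⬝ᵥ (wordMat A a *ᵥ x r ω)) ^ 2) :
    (u.map p).prod * μ.real G ≤ 4 * (1 + (1 + N) * β) *
      μ.real (G ∩ (occurs s r u ∩ {ω | h / 4 ≤ (v ⬝ᵥ x (r + a.length) ω) ^ 2})) := by
  set X : Ω → ℝ := fun ω => v ⬝ᵥ (wordMat A a *ᵥ x r ω) with hX
  have hXm : Measurable[𝒬 r] X := hM.measurable_dotProduct_state r _ v
  -- Division by the noiseless response `X` writes the true response as `X * (1 + g R)`. Given the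
  -- word, `1 + g R` has mean one and second moment at most `B` on `G`, so it cannot be small too
  -- often.
  set g : Ω → ℝ := G.indicator fun ω => (X ω)⁻¹ with hg
  have hgm : StronglyMeasurable[𝒬 r] g := (hXm.inv.indicator hG).stronglyMeasurable
  have hXabs : ∀ ω ∈ G, √h ≤ |X ω| := fun ω hω => by
    rw [← Real.sqrt_sq_eq_abs]; exact Real.sqrt_le_sqrt (hG1 ω hω)
  have hsh : 0 < √h := Real.sqrt_pos.2 hh
  have hgc : ∀ ω, |g ω| ≤ (√h)⁻¹ := fun ω => by
    by_cases hω : ω ∈ G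
    · rw [hg, Set.indicator_of_mem hω, abs_inv]
      exact inv_anti₀ hsh (hXabs ω hω)
    · rw [hg, Set.indicator_of_notMem hω, abs_zero]; positivity
  have hg2 : MemLp g 2 μ :=
    MemLp.of_bound (hgm.mono (𝒬.le r)).aestronglyMeasurable _ (ae_of_all _ hgc)
  set R := noiseSum A w v r a with hR
  have hR2 : MemLp R 2 μ := hM.noiseSum_memLp v a r
  have hgR2 : MemLp (fun ω => g ω * R ω) 2 μ := by
    refine MemLp.of_le_mul (c := (√h)⁻¹) hR2
      ((hgm.mono (𝒬.le r)).aestronglyMeasurable.mul hR2.1) (ae_of_all _ fun ω => ?_)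
    rw [norm_mul]
    exact mul_le_mul_of_nonneg_right (hgc ω) (norm_nonneg _)
  have hN := hM.moment_nonneg
  set I := occurs s r u with hI
  set f : Ω → ℝ := G.indicator fun _ => 1 with hf
  have hfm : StronglyMeasurable[𝒬 r] f := stronglyMeasurable_const.indicator hG
  have hfi : Integrable f μ := (integrable_const 1).indicator (𝒬.le r _ hG)
  have hIm : MeasurableSet I := 𝒬.le _ _ (hM.measurableSet_occurs r u)
  set D : Set Ω := {ω | h / 4 ≤ (v ⬝ᵥ x (r + a.length) ω) ^ 2} with hD
  have hDm : MeasurableSet D := measurableSet_le measurable_const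
    ((hM.measurable_dotProduct_state' _ v).pow_const 2)
  have hi0 : ∫ ω in I, f ω ∂μ = (u.map p).prod * μ.real G := by
    rw [hM.setIntegral_occurs u r hfm, hf, integral_indicator (𝒬.le r _ hG)]
    simp
  have hi1 := hM.setIntegral_mul_noiseSum v hau r hgm hg2
  have hP := hM.word_prob_nonneg u
  have hi2 : ∫ ω in I, (g ω * R ω) ^ 2 ∂μ ≤ (u.map p).prod * ((1 + N) * β * μ.real G) := by
    refine (hM.setIntegral_sq_mul_noiseSum_le v hau r hgm hgc).trans ?_
    refine mul_le_mul_of_nonneg_left ?_ hP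
    rw [mul_assoc, mul_assoc]
    refine mul_le_mul_of_nonneg_left ?_ (by linarith)
    rw [← integral_const_mul]
    have : ∫ ω, f ω ∂μ = μ.real G := by rw [hf, integral_indicator (𝒬.le r _ hG)]; simp
    rw [← this, ← integral_const_mul]
    refine integral_mono (hg2.integrable_sq.const_mul _) (hfi.const_mul _) fun ω => ?_
    by_cases hω : ω ∈ G
    · simp only [hg, hf, Set.indicator_of_mem hω, inv_pow, mul_one]
      have h1 := hG1 ω hω
      have h2 := hG2 ω hω
      rw [← div_eq_mul_inv, div_le_iff₀ (by simp only [hX]; linarith)]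
      exact h2
    · simp [hg, hf, Set.indicator_of_notMem hω]
  set B := 1 + (1 + N) * β with hB
  have hB1 : 1 ≤ B := by
    have : 0 ≤ (1 + N) * β := mul_nonneg (by linarith) hβ
    linarith
  -- With `z = 1 + g R`: off `D` one has `z < 1 / 2`, and on `D` the inequality `z ≤ z ^ 2 / (4 * B)
  -- + B`. After integration, with `Q` the mass of word and `G`, this gives `Q ≤ Q / 2 + Q / 4 + B *
  -- μ (G ∩ I ∩ D)`.
  have hpt : ∀ ω ∈ I, f ω + g ω * R ω ≤ (1 / 2) * f ω + (4 * B)⁻¹ * (f ω + 2 * (g ω * R ω)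
      + (g ω * R ω) ^ 2) + B * (G ∩ D).indicator (fun _ => 1) ω := by
    intro ω hωI
    by_cases hω : ω ∈ G
    · have hX0 : X ω ≠ 0 := by
        intro h0; have := hXabs ω hω; rw [h0, abs_zero] at this; linarith
      have e1 : f ω = 1 := by simp [hf, hω]
      have e2 : g ω = (X ω)⁻¹ := by simp [hg, hω]
      rw [e1]
      set z := 1 + g ω * R ω with hz
      have e3 : 1 + 2 * (g ω * R ω) + (g ω * R ω) ^ 2 = z ^ 2 := by rw [hz]; ring
      rw [e3]
      have hz2 : z ≤ (4 * B)⁻¹ * z ^ 2 + B := by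
        rw [← sub_le_iff_le_add, ← div_eq_inv_mul, le_div_iff₀ (by linarith)]
        nlinarith [sq_nonneg (z - 2 * B)]
      have hz3 : 0 ≤ (4 * B)⁻¹ * z ^ 2 := by positivity
      by_cases hωD : ω ∈ D
      · rw [Set.indicator_of_mem (show ω ∈ G ∩ D from ⟨hω, hωD⟩)]; linarith
      · rw [Set.indicator_of_notMem fun (h : ω ∈ G ∩ D) => hωD h.2]
        have hlt : z < 1 / 2 := by
          by_contra hcon
          refine hωD ?_
          obtain ⟨c, hc⟩ := hau
          have hωa : ω ∈ occurs s r a := by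
            exact occurs_of_append (c := c) (by rw [hc]; exact hωI)
          have h1 := hM.dotProduct_state_eq v hωa
          have h2 : v ⬝ᵥ x (r + a.length) ω = X ω * z := by
            rw [h1, hz, e2, mul_add, mul_one, mul_inv_cancel_left₀ hX0]
          show h / 4 ≤ (v ⬝ᵥ x (r + a.length) ω) ^ 2
          rw [h2, mul_pow]
          have h3 := hG1 ω hω
          have h4 : (1 / 4 : ℝ) ≤ z ^ 2 := by nlinarith
          nlinarith [sq_nonneg (X ω)]
        linarith
    · have e1 : f ω = 0 := by simp [hf, hω]
      have e2 : g ω = 0 := by simp [hg, hω]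
      rw [Set.indicator_of_notMem fun (h : ω ∈ G ∩ D) => hω h.1, e1, e2]; simp
  have hgRi : Integrable (fun ω => g ω * R ω) μ := hgR2.integrable (by norm_num)
  have hgRs : Integrable (fun ω => (g ω * R ω) ^ 2) μ := hgR2.integrable_sq
  have hGDm : MeasurableSet (G ∩ D) := (𝒬.le r _ hG).inter hDm
  have hind : Integrable ((G ∩ D).indicator fun _ => (1 : ℝ)) μ :=
    (integrable_const 1).indicator hGDm
  have hA : Integrable (fun ω => f ω + 2 * (g ω * R ω)) μ := hfi.add (hgRi.const_mul 2)
  have hA2 : Integrable (fun ω => f ω + 2 * (g ω * R ω) + (g ω * R ω) ^ 2) μ := hA.add hgRs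
  have hA3 : Integrable (fun ω => (1 / 2) * f ω + (4 * B)⁻¹ * (f ω + 2 * (g ω * R ω)
      + (g ω * R ω) ^ 2)) μ := (hfi.const_mul _).add (hA2.const_mul _)
  have hint := setIntegral_mono_on (μ := μ) (hfi.add hgRi).integrableOn
    (hA3.add (hind.const_mul B)).integrableOn hIm hpt
  have e0 : ∫ ω in I, (f + fun ω => g ω * R ω) ω ∂μ = ∫ ω in I, f ω ∂μ := by
    rw [integral_add' hfi.integrableOn hgRi.integrableOn, hi1, add_zero]
  have e1 : ∫ ω in I, (G ∩ D).indicator (fun _ => (1 : ℝ)) ω ∂μ = μ.real (G ∩ (I ∩ D)) := by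
    rw [setIntegral_indicator hGDm]
    simp [Set.inter_left_comm]
  have e2 : ∫ ω in I, ((fun ω => (1 / 2) * f ω + (4 * B)⁻¹ * (f ω + 2 * (g ω * R ω)
      + (g ω * R ω) ^ 2)) + fun ω => B * (G ∩ D).indicator (fun _ => (1 : ℝ)) ω : Ω → ℝ) ω ∂μ
      = (1 / 2) * ∫ ω in I, f ω ∂μ + (4 * B)⁻¹ * (∫ ω in I, f ω ∂μ
        + ∫ ω in I, (g ω * R ω) ^ 2 ∂μ) + B * μ.real (G ∩ (I ∩ D)) := by
    rw [integral_add' hA3.integrableOn (hind.const_mul B).integrableOn,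
      integral_add (hfi.const_mul _).integrableOn (hA2.const_mul _).integrableOn,
      integral_const_mul, integral_const_mul, integral_const_mul,
      integral_add hA.integrableOn hgRs.integrableOn,
      integral_add hfi.integrableOn (hgRi.const_mul 2).integrableOn, integral_const_mul, hi1, e1]
    ring
  have hint' := e0.symm.le.trans (hint.trans e2.le)
  rw [hi0] at hint'
  set Q := (u.map p).prod * μ.real G with hQ
  have h3 : (4 * B)⁻¹ * (Q + ∫ ω in I, (g ω * R ω) ^ 2 ∂μ) ≤ (4 * B)⁻¹ * (B * Q) := by
    refine mul_le_mul_of_nonneg_left ?_ (by positivity)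
    have : B * Q = Q + (u.map p).prod * ((1 + N) * β * μ.real G) := by rw [hQ, hB]; ring
    linarith
  have h4 : (4 * B)⁻¹ * (B * Q) = Q / 4 := by field_simp
  linarith

lemma measurableSet_excites (hM : SwitchedModel μ A p α N 𝒬 ℋ x s w) (i : Fin k) (h β : ℝ) (r : ℕ)
    (u a : List (Fin k)) (v : Fin n → ℝ) :
    MeasurableSet[𝒬 r] {ω | (a ++ [i]) <+: u ∧ quad (gram (regressor x s i ω) r) v ≤ 1 ∧
      h ≤ (v ⬝ᵥ (wordMat A a *ᵥ x r ω)) ^ 2 ∧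
      suffixSq A v a ≤ β * (v ⬝ᵥ (wordMat A a *ᵥ x r ω)) ^ 2} := by
  have h1 := hM.measurable_quad_gram i r v
  have h2 := (hM.measurable_dotProduct_state r (wordMat A a) v).pow_const 2
  exact (MeasurableSet.const _).inter ((measurableSet_le h1 measurable_const).inter
    ((measurableSet_le measurable_const h2).inter
      (measurableSet_le measurable_const (h2.const_mul β))))

/-- A word that excites at time `r` leads to an excitation with a fair probability. -/
lemma measure_excites_le (hM : SwitchedModel μ A p α N 𝒬 ℋ x s w) (i : Fin k)
    {h β : ℝ} (hh : 0 < h) (hβ : 0 ≤ β) (r : ℕ) (u : List (Fin k)) :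
    (u.map p).prod * μ.real {ω | u ∈ Excites A i h β (gram (regressor x s i ω) r) (x r ω)}
      ≤ 4 * (1 + (1 + N) * β) *
        μ.real (occurs s r u ∩ excitationEvent x s i (h / 4) r u.length) := by
  have hN := hM.moment_nonneg
  have hP := hM.word_prob_nonneg u
  set B := 4 * (1 + (1 + N) * β) with hB
  have hB0 : 0 ≤ B := by positivity
  set e := TopologicalSpace.denseSeq (Fin n → ℝ)
  set G : List (Fin k) × ℕ → Set Ω := fun q => {ω | (q.1 ++ [i]) <+: u ∧
      quad (gram (regressor x s i ω) r) (e q.2) ≤ 1 ∧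
      h ≤ (e q.2 ⬝ᵥ (wordMat A q.1 *ᵥ x r ω)) ^ 2 ∧
      suffixSq A (e q.2) q.1 ≤ β * (e q.2 ⬝ᵥ (wordMat A q.1 *ᵥ x r ω)) ^ 2} with hG
  have hGm : ∀ q, MeasurableSet[𝒬 r] (G q) := fun q => hM.measurableSet_excites i h β r u q.1 _
  obtain ⟨φ, hφ⟩ := exists_surjective_nat (List (Fin k) × ℕ)
  -- The witness of excitation depends on the path. Taking the first suitable pair in an enumeration
  -- splits the event into disjoint `𝒬 r`-measurable pieces with a fixed witness, to each of which
  -- `paley_zygmund` applies.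
  set H : ℕ → Set Ω := disjointed fun j => G (φ j) with hH
  have hHm : ∀ j, MeasurableSet[𝒬 r] (H j) := fun j =>
    MeasurableSet.disjointed (fun j => hGm (φ j)) j
  have hU : {ω | u ∈ Excites A i h β (gram (regressor x s i ω) r) (x r ω)} = ⋃ j, H j := by
    rw [hH, iUnion_disjointed]
    ext ω
    simp only [Excites, Set.mem_ofPred_eq, Set.mem_iUnion, hG]
    constructor
    · rintro ⟨a, m, hm⟩
      obtain ⟨j, hj⟩ := hφ (a, m)
      exact ⟨j, by rw [hj]; exact hm⟩
    · rintro ⟨j, hj⟩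
      exact ⟨_, _, hj⟩
  set E := occurs s r u ∩ excitationEvent x s i (h / 4) r u.length with hE
  have hEm : MeasurableSet E := (𝒬.le _ _ (hM.measurableSet_occurs r u)).inter
    (hM.measurableSet_excitationEvent i _ r _)
  have key : ∀ j, ENNReal.ofReal (u.map p).prod * μ (H j) ≤ ENNReal.ofReal B * μ (H j ∩ E) := by
    intro j
    have hsub : H j ⊆ G (φ j) := disjointed_subset _ _
    by_cases hne : (H j).Nonempty
    swap
    · rw [Set.not_nonempty_iff_eq_empty.1 hne]; simp
    obtain ⟨ω0, hω0⟩ := hne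
    have hpre : ((φ j).1 ++ [i]) <+: u := (hsub hω0).1
    have hpz := hM.paley_zygmund (e (φ j).2) ((List.prefix_append _ [i]).trans hpre) r (hHm j) hh hβ
      (fun ω hω => (hsub hω).2.2.1) (fun ω hω => (hsub hω).2.2.2)
    have hsubE : H j ∩ (occurs s r u ∩
        {ω | h / 4 ≤ (e (φ j).2 ⬝ᵥ x (r + (φ j).1.length) ω) ^ 2}) ⊆ H j ∩ E := by
      rintro ω ⟨h1, h2, h3⟩
      refine ⟨h1, h2, (φ j).1.length, ?_, (φ j).2, ?_, (hsub h1).2.1, h3⟩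
      · have := hpre.length_le
        simp at this; omega
      · obtain ⟨c, hc⟩ := hpre
        rw [← hc] at h2
        exact switch_eq_of_occurs h2
    have h2 := hpz.trans (mul_le_mul_of_nonneg_left (measureReal_mono hsubE) hB0)
    have h3 := ENNReal.ofReal_le_ofReal h2
    rwa [ENNReal.ofReal_mul hP, ENNReal.ofReal_mul hB0, ofReal_measureReal, ofReal_measureReal] at h3
  have hdis : Pairwise (Function.onFun Disjoint H) := disjoint_disjointed _
  have hsum : ENNReal.ofReal (u.map p).prod * μ (⋃ j, H j) ≤ ENNReal.ofReal B * μ E := by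
    rw [measure_iUnion hdis fun j => 𝒬.le r _ (hHm j), ← ENNReal.tsum_mul_left]
    refine (ENNReal.tsum_le_tsum key).trans ?_
    rw [ENNReal.tsum_mul_left, ← measure_iUnion (fun a b hab => (hdis hab).mono
      Set.inter_subset_left Set.inter_subset_left) fun j => (𝒬.le r _ (hHm j)).inter hEm]
    gcongr
    exact Set.iUnion_subset fun j => Set.inter_subset_right
  have := ENNReal.toReal_mono (by finiteness) hsum
  rw [ENNReal.toReal_mul, ENNReal.toReal_mul, ENNReal.toReal_ofReal hP,
    ENNReal.toReal_ofReal hB0] at this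
  rw [hU]
  exact this

/-- The events that the individual words of length `l` occur from time `r` on partition the space,
so bounds word by word add up to a bound by the whole event. -/
lemma wordE_le_measure (hM : SwitchedModel μ A p α N 𝒬 ℋ x s w) (l : ℕ) (r : ℕ) {E : Set Ω}
    (hE : MeasurableSet E) {f : List (Fin k) → ℝ} {c : ℝ}
    (h : ∀ u, u.length = l → (u.map p).prod * f u ≤ c * μ.real (occurs s r u ∩ E)) :
    wordE p l f ≤ c * μ.real E := by
  induction l generalizing r E f with
  | zero => simpa [wordE, occurs] using h [] rfl
  | succ l ih =>
    have hS : ∀ j, MeasurableSet {ω | s r ω = j} := fun j => ℋ.le _ _ (hM.measurableSet_switch r j)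
    have h1 : ∀ j, p j * wordE p l (fun u => f (j :: u)) ≤ c * μ.real (E ∩ {ω | s r ω = j}) := by
      intro j
      rw [← wordE_const_mul]
      refine ih (r + 1) (hE.inter (hS j)) fun u hu => ?_
      have := h (j :: u) (by simp [hu])
      rw [List.map_cons, List.prod_cons, occurs] at this
      calc _ = p j * (u.map p).prod * f (j :: u) := by ring
        _ ≤ _ := this
        _ = _ := by congr 2; ext ω; simp only [Set.mem_inter_iff]; tauto
    calc wordE p (l + 1) f ≤ ∑ j, c * μ.real (E ∩ {ω | s r ω = j}) :=
          Finset.sum_le_sum fun j _ => h1 j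
      _ = c * μ.real E := by
          rw [← Finset.mul_sum, ← measureReal_biUnion_finset]
          · congr 2; ext ω; simp
          · intro a _ b _ hab
            rw [Function.onFun, Set.disjoint_left]
            rintro ω ⟨_, h1⟩ ⟨_, h2⟩
            exact hab (h1.symm.trans h2)
          · exact fun j _ => hE.inter (hS j)

end SwitchedModel

end Excitation

/-! ### Moments of the state, growth of the Gram determinant, laws of large numbers. -/

section Moments

open Matrix

lemma rpow_sum_le_sum_rpow {ι : Type*} (S : Finset ι) {f : ι → ℝ} (hf : ∀ i, 0 ≤ f i) {q : ℝ}
    (hq0 : 0 < q) (hq1 : q ≤ 1) : (∑ i ∈ S, f i) ^ q ≤ ∑ i ∈ S, f i ^ q := by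
  classical
  induction S using Finset.induction_on with
  | empty => simp [Real.zero_rpow hq0.ne']
  | insert a S ha ih =>
    rw [Finset.sum_insert ha, Finset.sum_insert ha]
    exact (Real.rpow_add_le_add_rpow (hf a) (Finset.sum_nonneg fun i _ => hf i) hq0.le hq1).trans
      (by gcongr)

/-- Only moments of order `θ ≤ 1` of the state are available, so the trace is controlled through its
power `θ / 2`, which is subadditive. The price is the factor `2 / θ`, the source of the dependence
on `p` that is removed later. -/
lemma log_det_gram_le {n : ℕ} (y : ℕ → Fin n → ℝ) (T : ℕ) {θ : ℝ} (hθ : 0 < θ) (hθ1 : θ ≤ 1) :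
    Real.log (gram y T).det
      ≤ n * ((2 / θ) * Real.log (1 + n + ∑ t ∈ Finset.range T, vnorm (y t) ^ θ)) := by
  set Y := ∑ t ∈ Finset.range T, vnorm (y t) ^ 2 with hY
  have hY0 : 0 ≤ Y := Finset.sum_nonneg fun t _ => sq_nonneg _
  have h1 : (gram y T).det ≤ (1 + n + Y) ^ n := by
    refine (det_add_le PosDef.one (posSemidef_sum_vecMulVec y (Finset.range T))).trans ?_
    have : (((1 : Matrix (Fin n) (Fin n) ℝ)⁻¹ * ∑ t ∈ Finset.range T,
        vecMulVec (y t) (y t)).trace) = Y := by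
      rw [Finset.mul_sum, trace_sum, hY]
      refine Finset.sum_congr rfl fun t _ => ?_
      rw [trace_mul_vecMulVec, inv_one, quad_one, vnorm_sq]
    rw [this, det_one, one_mul]
    exact pow_le_pow_left₀ (by positivity) (by linarith) n
  have hpos : 0 < 1 + n + Y := by positivity
  have h2 : Real.log (gram y T).det ≤ n * Real.log (1 + n + Y) := by
    rw [← Real.log_pow]
    exact Real.log_le_log (posDef_gram y T).det_pos h1
  refine h2.trans ?_
  gcongr
  have h3 : (1 + n + Y) ^ (θ / 2) ≤ 1 + n + ∑ t ∈ Finset.range T, vnorm (y t) ^ θ := by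
    refine (Real.rpow_add_le_add_rpow (by positivity) hY0 (by positivity) (by linarith)).trans ?_
    gcongr
    · calc ((1 : ℝ) + n) ^ (θ / 2) ≤ (1 + n) ^ (1 : ℝ) :=
          Real.rpow_le_rpow_of_exponent_le (by linarith [Nat.cast_nonneg (α := ℝ) n]) (by linarith)
        _ = _ := Real.rpow_one _
    · refine (rpow_sum_le_sum_rpow _ (fun t => sq_nonneg _) (by positivity) (by linarith)).trans
        (le_of_eq (Finset.sum_congr rfl fun t _ => ?_))
      rw [← Real.rpow_natCast, ← Real.rpow_mul (vnorm_nonneg _)]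
      congr 1; push_cast; ring
  calc Real.log (1 + n + Y) = (2 / θ) * Real.log ((1 + n + Y) ^ (θ / 2)) := by
        rw [Real.log_rpow hpos]; field_simp
    _ ≤ _ := by
        refine mul_le_mul_of_nonneg_left (Real.log_le_log (by positivity) h3) (by positivity)

/-- A martingale transform with bounded second moments is sublinear. -/
lemma ae_abs_sum_mul_le_linear {Ω : Type*} {m0 : MeasurableSpace Ω} {μ : Measure Ω}
    [IsProbabilityMeasure μ] {𝒢 : Filtration ℕ m0} {y ζ : ℕ → Ω → ℝ}
    (hy : ∀ t, StronglyMeasurable[𝒢 t] (y t)) (hζ : ∀ t, StronglyMeasurable[𝒢 (t + 1)] (ζ t))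
    (hζi : ∀ t, Integrable (ζ t) μ) (hc : ∀ t, μ[ζ t | 𝒢 t] =ᵐ[μ] 0) {N : ℝ}
    (hN : ∀ t, CondBound (𝒢 t) μ (fun ω => ENNReal.ofReal ((ζ t ω) ^ 2)) (ENNReal.ofReal N))
    {C : ℝ≥0} (hC : ∀ t, ∫⁻ ω, ENNReal.ofReal ((y t ω) ^ 2) ∂μ ≤ C) :
    ∀ᵐ ω ∂μ, ∀ δ > 0, ∃ K, ∀ T : ℕ,
      |∑ t ∈ Finset.range T, y t ω * ζ t ω| ≤ δ * (1 + T) + K := by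
  refine ae_abs_sum_mul_le (L := fun t _ => 1 + (t : ℝ)) (C := C) hy hζ hζi hc hN
    (fun t => stronglyMeasurable_const) (fun ω a b hab => by
      have : (a : ℝ) ≤ b := by exact_mod_cast hab
      simp only; linarith) (fun ω => by simp) fun T => ?_
  have h1 : ∀ t : ℕ, ∫⁻ ω, ENNReal.ofReal ((y t ω / (1 + ((t + 1 : ℕ) : ℝ))) ^ 2) ∂μ
      ≤ ENNReal.ofReal ((1 + ((t + 1 : ℕ) : ℝ)) ^ (-2 : ℝ)) * C := by
    intro t
    have hp : (0 : ℝ) < 1 + ((t + 1 : ℕ) : ℝ) := by positivity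
    calc _ = ∫⁻ ω, ENNReal.ofReal ((1 + ((t + 1 : ℕ) : ℝ)) ^ (-2 : ℝ)) *
            ENNReal.ofReal ((y t ω) ^ 2) ∂μ := by
          refine lintegral_congr fun ω => ?_
          rw [← ENNReal.ofReal_mul (Real.rpow_nonneg hp.le _), Real.rpow_neg hp.le, Real.rpow_two,
            div_pow, div_eq_inv_mul]
      _ ≤ _ := by
          rw [lintegral_const_mul' _ _ ENNReal.ofReal_ne_top]
          gcongr; exact hC t
  refine (Finset.sum_le_sum fun t _ => h1 t).trans ?_
  rw [← Finset.sum_mul, ← ENNReal.ofReal_sum_of_nonneg fun t _ => Real.rpow_nonneg (by positivity) _]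
  have h2 := sum_mul_rpow_neg_le' (a := fun _ => (1 : ℝ)) (fun _ => zero_le_one) (γ := 2)
    (by norm_num) T
  simp only [one_mul, Finset.sum_const, Finset.card_range, nsmul_eq_mul, mul_one] at h2
  calc _ ≤ ENNReal.ofReal 1 * (C : ℝ≥0∞) := by
        gcongr; exact h2.trans (by norm_num)
    _ = C := by simp

/-- Almost sure statements come for countably many directions at a time. Since the mean energy of
`z` is at most `B`, a small move of the direction changes the quadratic form little, and finitely
many dense directions cover the compact unit sphere. -/
lemma exists_uniform_lower_bound {n : ℕ} {z : ℕ → Fin n → ℝ} {B c : ℝ} (hB0 : 0 ≤ B) (hc : 0 < c)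
    (hB : ∀ᶠ T : ℕ in atTop, ∑ t ∈ Finset.range T, z t ⬝ᵥ z t ≤ B * T)
    (h : ∀ m, ∀ᶠ T : ℕ in atTop, c * T * (TopologicalSpace.denseSeq (Fin n → ℝ) m ⬝ᵥ
        TopologicalSpace.denseSeq (Fin n → ℝ) m)
      ≤ ∑ t ∈ Finset.range T, (TopologicalSpace.denseSeq (Fin n → ℝ) m ⬝ᵥ z t) ^ 2) :
    ∀ᶠ T : ℕ in atTop, ∀ v : Fin n → ℝ,
      c / 8 * T * (v ⬝ᵥ v) ≤ ∑ t ∈ Finset.range T, (v ⬝ᵥ z t) ^ 2 := by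
  set e := TopologicalSpace.denseSeq (Fin n → ℝ)
  have hcont : Continuous fun v : Fin n → ℝ => v ⬝ᵥ v := by unfold dotProduct; fun_prop
  set S : Set (Fin n → ℝ) := {v | v ⬝ᵥ v = 1} with hS
  have hScomp : IsCompact S := by
    refine Metric.isCompact_of_isClosed_isBounded (isClosed_eq hcont continuous_const) ?_
    refine (Metric.isBounded_closedBall (x := (0 : Fin n → ℝ)) (r := 1)).subset fun v hv => ?_
    rw [mem_closedBall_zero_iff, pi_norm_le_iff_of_nonneg zero_le_one]
    intro l
    have h1 : (v l) ^ 2 ≤ v ⬝ᵥ v := by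
      rw [dotProduct]
      simp only [← sq]
      exact Finset.single_le_sum (f := fun l => (v l) ^ 2) (fun l _ => sq_nonneg _)
        (Finset.mem_univ l)
    have hv : v ⬝ᵥ v = 1 := hv
    rw [Real.norm_eq_abs, ← sq_le_one_iff_abs_le_one]; linarith
  -- The passage to a nearby direction keeps `c / 4` of the bound and loses `ε * (c / 2 + B)`; this
  -- `ε` keeps the loss below `c / 8`.
  set ε := (c / 8) / (c / 2 + B + 1) with hε
  have hε0 : 0 < ε := by positivity
  have hεe : ε * (c / 2 + B + 1) = c / 8 := by rw [hε]; field_simp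
  obtain ⟨F, hF⟩ := hScomp.elim_finite_subcover (fun m => {v | (v - e m) ⬝ᵥ (v - e m) < ε})
    (fun m => isOpen_lt (hcont.comp (continuous_id.sub continuous_const)) continuous_const)
    (fun v _ => by
      have hop : IsOpen {u : Fin n → ℝ | (v - u) ⬝ᵥ (v - u) < ε} :=
        isOpen_lt (hcont.comp (continuous_const.sub continuous_id)) continuous_const
      obtain ⟨m, hu⟩ := (TopologicalSpace.denseRange_denseSeq (Fin n → ℝ)).exists_mem_open
        hop ⟨v, by simpa using hε0⟩
      exact Set.mem_iUnion.2 ⟨m, hu⟩)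
  filter_upwards [hB, (Filter.eventually_all_finset F).2 fun m _ => h m] with T hBT hT
  have hT0 : (0 : ℝ) ≤ T := Nat.cast_nonneg T
  have key : ∀ v ∈ S, c / 8 * T ≤ ∑ t ∈ Finset.range T, (v ⬝ᵥ z t) ^ 2 := by
    intro v hv
    obtain ⟨m, hmF, hm⟩ := Set.mem_iUnion₂.1 (hF hv)
    have hm : (v - e m) ⬝ᵥ (v - e m) < ε := hm
    have hv : v ⬝ᵥ v = 1 := hv
    have h1 := hT m hmF
    have h2 : ∑ t ∈ Finset.range T, (e m ⬝ᵥ z t) ^ 2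
        ≤ 2 * ∑ t ∈ Finset.range T, (v ⬝ᵥ z t) ^ 2 + 2 * (ε * (B * T)) := by
      calc _ ≤ ∑ t ∈ Finset.range T, (2 * (v ⬝ᵥ z t) ^ 2 + 2 * (ε * (z t ⬝ᵥ z t))) := by
            refine Finset.sum_le_sum fun t _ => ?_
            have h3 := sq_dotProduct_le_mul (v - e m) (z t)
            have h4 : (v - e m) ⬝ᵥ z t = v ⬝ᵥ z t - e m ⬝ᵥ z t := sub_dotProduct _ _ _
            have h5 := mul_le_mul_of_nonneg_right hm.le (dotProduct_self_nonneg' (z t))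
            rw [h4] at h3
            nlinarith [sq_nonneg (2 * (v ⬝ᵥ z t) - e m ⬝ᵥ z t)]
        _ ≤ _ := by
            rw [Finset.sum_add_distrib, ← Finset.mul_sum, ← Finset.mul_sum, ← Finset.mul_sum]
            have := mul_le_mul_of_nonneg_left hBT hε0.le
            linarith
    have h3 : 1 / 2 - ε ≤ e m ⬝ᵥ e m := by
      have h4 : v ⬝ᵥ v ≤ 2 * (e m ⬝ᵥ e m) + 2 * ((v - e m) ⬝ᵥ (v - e m)) := by
        have h5 := dotProduct_self_nonneg' (v - e m - e m)
        simp only [sub_dotProduct, dotProduct_sub] at h5 ⊢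
        rw [dotProduct_comm (e m) v] at h5 ⊢
        linarith
      linarith
    have h4 : c * T * (1 / 2 - ε) ≤ c * T * (e m ⬝ᵥ e m) :=
      mul_le_mul_of_nonneg_left h3 (by positivity)
    have h5 : ε * (c / 2 + B + 1) * T = c / 8 * T := by rw [hεe]
    nlinarith [mul_nonneg hε0.le hT0]
  intro v
  by_cases hv0 : v ⬝ᵥ v = 0
  · rw [hv0, mul_zero]; exact Finset.sum_nonneg fun t _ => sq_nonneg _
  have hvp : 0 < v ⬝ᵥ v := lt_of_le_of_ne (dotProduct_self_nonneg' v) (Ne.symm hv0)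
  have h1 := key ((√(v ⬝ᵥ v))⁻¹ • v) (by
    show ((√(v ⬝ᵥ v))⁻¹ • v) ⬝ᵥ ((√(v ⬝ᵥ v))⁻¹ • v) = 1
    rw [smul_dotProduct, dotProduct_smul, smul_eq_mul, smul_eq_mul, ← mul_assoc, ← mul_inv,
      Real.mul_self_sqrt hvp.le, inv_mul_cancel₀ hv0])
  simp only [smul_dotProduct, smul_eq_mul, mul_pow, inv_pow, Real.sq_sqrt hvp.le] at h1
  rw [← Finset.mul_sum, inv_mul_eq_div, le_div_iff₀ hvp] at h1
  exact h1

lemma sq_le_add_rpow {a K β : ℝ} (ha : 0 ≤ a) (hK : 0 < K) (hβ : 2 < β) :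
    a ^ 2 ≤ K ^ 2 + K ^ (2 - β) * a ^ β := by
  rcases le_total a K with h | h
  · have h1 : a ^ 2 ≤ K ^ 2 := pow_le_pow_left₀ ha h 2
    have h2 : 0 ≤ K ^ (2 - β) * a ^ β := by positivity
    linarith
  · have ha0 : 0 < a := hK.trans_le h
    have h1 : a ^ 2 = a ^ (2 - β) * a ^ β := by
      rw [← Real.rpow_add ha0, sub_add_cancel, Real.rpow_two]
    have h2 : a ^ (2 - β) ≤ K ^ (2 - β) := Real.rpow_le_rpow_of_nonpos hK h (by linarith)
    have h3 := mul_le_mul_of_nonneg_right h2 (Real.rpow_nonneg ha0.le β)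
    rw [h1]; nlinarith [sq_nonneg K]

/-- In every direction, a positive fraction of the noise vectors is not small. -/
lemma exists_card_noise {c B β : ℝ} (hc : 0 < c) (hβ : 2 < β) :
    ∃ c1 > (0 : ℝ), ∃ c2 > (0 : ℝ), ∀ {n : ℕ} (w : ℕ → Fin n → ℝ) (T : ℕ),
      (∀ v : Fin n → ℝ, c * T * (v ⬝ᵥ v) ≤ ∑ t ∈ Finset.range T, (v ⬝ᵥ w t) ^ 2) →
      ∑ t ∈ Finset.range T, vnorm (w t) ^ β ≤ B * T →
      ∀ v : Fin n → ℝ, c2 * T ≤ ((Finset.range T).filter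
        fun t => c1 * (v ⬝ᵥ v) ≤ (v ⬝ᵥ w t) ^ 2).card := by
  -- Vectors longer than `K` carry energy at most `K ^ (2 - β) * B * T`, which is made a quarter of
  -- the total.
  obtain ⟨K, hK1, hK⟩ : ∃ K : ℝ, 1 ≤ K ∧ K ^ (2 - β) * B ≤ c / 4 := by
    have ht : Tendsto (fun K : ℝ => K ^ (2 - β) * B) atTop (𝓝 0) := by
      have := (tendsto_rpow_neg_atTop (show 0 < β - 2 by linarith)).mul_const B
      simpa using this
    obtain ⟨K, h1, h2⟩ := ((ht.eventually (ge_mem_nhds (show 0 < c / 4 by positivity))).and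
      (eventually_ge_atTop 1)).exists
    exact ⟨K, h2, h1⟩
  have hK0 : 0 < K := by linarith
  -- A further quarter is lost to small responses; the remaining energy `c / 2 * T` comes from
  -- responses of square at most `K ^ 2` times `v ⬝ᵥ v` each. The minimum with one serves `v = 0`.
  refine ⟨c / 4, by positivity, min 1 (c / (2 * K ^ 2)), by positivity, ?_⟩
  intro n w T hlow hmom v
  have hT0 : (0 : ℝ) ≤ T := Nat.cast_nonneg T
  set F := (Finset.range T).filter fun t => c / 4 * (v ⬝ᵥ v) ≤ (v ⬝ᵥ w t) ^ 2 with hF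
  by_cases hv0 : v ⬝ᵥ v = 0
  · have : F = Finset.range T := by
      rw [hF]; refine Finset.filter_true_of_mem fun t _ => ?_
      rw [hv0, mul_zero]; positivity
    rw [this, Finset.card_range]
    exact mul_le_of_le_one_left hT0 (min_le_left _ _)
  have hvp : 0 < v ⬝ᵥ v := lt_of_le_of_ne (dotProduct_self_nonneg' v) (Ne.symm hv0)
  have h1 : ∑ t ∈ Finset.range T, (v ⬝ᵥ w t) ^ 2 ≤ ∑ t ∈ Finset.range T,
      (c / 4 * (v ⬝ᵥ v) + ((v ⬝ᵥ v) * (K ^ (2 - β) * vnorm (w t) ^ β)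
        + (if c / 4 * (v ⬝ᵥ v) ≤ (v ⬝ᵥ w t) ^ 2 then (v ⬝ᵥ v) * K ^ 2 else 0))) := by
    refine Finset.sum_le_sum fun t _ => ?_
    have h0 : 0 ≤ (v ⬝ᵥ v) * (K ^ (2 - β) * vnorm (w t) ^ β) := by
      have := vnorm_nonneg (w t); positivity
    split_ifs with h
    · have h2 := sq_dotProduct_le_mul v (w t)
      rw [← vnorm_sq (w t)] at h2
      have h3 := mul_le_mul_of_nonneg_left
        (sq_le_add_rpow (vnorm_nonneg (w t)) hK0 hβ) hvp.le
      nlinarith [mul_nonneg hc.le hvp.le]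
    · linarith
  rw [Finset.sum_add_distrib, Finset.sum_add_distrib, ← Finset.mul_sum, ← Finset.mul_sum,
    ← Finset.mul_sum, ← Finset.sum_filter, Finset.sum_const, Finset.sum_const, Finset.card_range, nsmul_eq_mul,
    nsmul_eq_mul] at h1
  have h2 := (hlow v).trans h1
  have h3 : (v ⬝ᵥ v) * (K ^ (2 - β) * ∑ t ∈ Finset.range T, vnorm (w t) ^ β)
      ≤ (v ⬝ᵥ v) * (c / 4 * T) := by
    refine mul_le_mul_of_nonneg_left ?_ hvp.le
    calc _ ≤ K ^ (2 - β) * (B * T) := by gcongr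
      _ = K ^ (2 - β) * B * T := by ring
      _ ≤ _ := by gcongr
  have h4 : (v ⬝ᵥ v) * (c / 2 * T) ≤ (v ⬝ᵥ v) * (F.card * K ^ 2) := by nlinarith
  have h5 := le_of_mul_le_mul_left h4 hvp
  calc min 1 (c / (2 * K ^ 2)) * T ≤ c / (2 * K ^ 2) * T := by gcongr; exact min_le_right _ _
    _ = (c / 2 * T) / K ^ 2 := by field_simp
    _ ≤ F.card := by rw [div_le_iff₀ (by positivity)]; exact h5

variable {Ω : Type*} {m0 : MeasurableSpace Ω} {μ : Measure Ω} {n k : ℕ}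
  {A : Fin k → Matrix (Fin n) (Fin n) ℝ} {p : Fin k → ℝ} {α N : ℝ} {𝒬 ℋ : Filtration ℕ m0}
  {x : ℕ → Ω → Fin n → ℝ} {s : ℕ → Ω → Fin k} {w : ℕ → Ω → Fin n → ℝ}

namespace SwitchedModel

set_option linter.unusedSectionVars false

variable [IsProbabilityMeasure μ]

lemma vnorm_state_succ_rpow_le (hM : SwitchedModel μ A p α N 𝒬 ℋ x s w) {θ : ℝ} (hθ : 0 ≤ θ)
    (hθ1 : θ ≤ 1) (t : ℕ) (ω : Ω) : vnorm (x (t + 1) ω) ^ θ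
      ≤ spectralNorm (A (s t ω)) ^ θ * vnorm (x t ω) ^ θ + vnorm (w t ω) ^ θ := by
  have h1 := spectralNorm_nonneg (A (s t ω))
  have h2 := vnorm_nonneg (x t ω)
  have h3 := vnorm_nonneg (w t ω)
  rw [← Real.mul_rpow h1 h2]
  refine le_trans ?_ (Real.rpow_add_le_add_rpow (mul_nonneg h1 h2) h3 hθ hθ1)
  refine Real.rpow_le_rpow (vnorm_nonneg _) ?_ hθ
  rw [hM.state_succ]
  exact (vnorm_add_le _ _).trans (by gcongr; exact vnorm_mulVec_le _ _)

/-- The switch is independent of the current state, so the moment of order `θ` satisfies the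
recursion `u ↦ ρ * u + (1 + N)` with `ρ < 1`. The constant is a bound that this recursion preserves.
-/
lemma exists_moment_bound (hM : SwitchedModel μ A p α N 𝒬 ℋ x s w) {θ : ℝ} (hθ : 0 ≤ θ)
    (hθ1 : θ ≤ 1) (hρ : ∑ j, p j * spectralNorm (A j) ^ θ < 1) :
    ∃ C, 0 ≤ C ∧ ∀ t, ∫⁻ ω, ENNReal.ofReal (vnorm (x t ω) ^ θ) ∂μ ≤ ENNReal.ofReal C := by
  set ρ := ∑ j, p j * spectralNorm (A j) ^ θ with hρd
  have hρ0 : 0 ≤ ρ := Finset.sum_nonneg fun j _ =>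
    mul_nonneg (hM.prob_pos j).le (Real.rpow_nonneg (spectralNorm_nonneg _) _)
  obtain ⟨x₀, hx₀⟩ := hM.state_zero
  have hN := hM.moment_nonneg
  have hx0 : 0 ≤ vnorm x₀ ^ θ := Real.rpow_nonneg (vnorm_nonneg _) _
  have h1ρ : 0 < 1 - ρ := by linarith
  set C := vnorm x₀ ^ θ + (1 + N) / (1 - ρ) with hC
  have hCρ : ρ * C + (1 + N) ≤ C := by
    have : (1 - ρ) * ((1 + N) / (1 - ρ)) = 1 + N := by field_simp
    nlinarith
  have hC0 : 0 ≤ C := by positivity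
  refine ⟨C, hC0, fun t => ?_⟩
  induction t with
  | zero =>
    simp only [hx₀]
    simpa using ENNReal.ofReal_le_ofReal (show vnorm x₀ ^ θ ≤ C by rw [hC]; linarith [div_nonneg (by linarith : 0 ≤ 1 + N) h1ρ.le])
  | succ t ih =>
    have hfm : Measurable[𝒬 t] fun ω => ENNReal.ofReal (vnorm (x t ω) ^ θ) :=
      ((measurable_vnorm.comp (hM.state_meas t)).pow_const θ).ennreal_ofReal
    have hw := hM.noise_moment_of_le hθ (by linarith [hM.two_lt]) t Set.univ MeasurableSet.univ
    rw [Measure.restrict_univ, measure_univ, mul_one] at hw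
    have hsp : ∫⁻ ω, ENNReal.ofReal (spectralNorm (A (s t ω)) ^ θ) *
        ENNReal.ofReal (vnorm (x t ω) ^ θ) ∂μ
        = ENNReal.ofReal ρ * ∫⁻ ω, ENNReal.ofReal (vnorm (x t ω) ^ θ) ∂μ := by
      have e : ∀ ω, ENNReal.ofReal (spectralNorm (A (s t ω)) ^ θ) *
          ENNReal.ofReal (vnorm (x t ω) ^ θ) = ∑ j, ENNReal.ofReal (spectralNorm (A j) ^ θ) *
            {ω | s t ω = j}.indicator (fun ω => ENNReal.ofReal (vnorm (x t ω) ^ θ)) ω := by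
        intro ω
        rw [Finset.sum_eq_single (s t ω)]
        · simp
        · intro j _ hj
          rw [Set.indicator_of_notMem (fun h => hj h.symm), mul_zero]
        · simp
      simp_rw [e]
      have hSm : ∀ j, MeasurableSet {ω | s t ω = j} := fun j =>
        ℋ.le _ _ (hM.measurableSet_switch t j)
      have hfm' := hfm.mono (𝒬.le t) le_rfl
      rw [lintegral_finsetSum _ fun j _ => ((hfm'.indicator (hSm j)).const_mul _)]
      simp_rw [lintegral_const_mul _ (hfm'.indicator (hSm _)), lintegral_indicator (hSm _),
        hM.setLIntegral_switch t _ hfm]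
      rw [hρd, ENNReal.ofReal_sum_of_nonneg fun j _ => mul_nonneg (hM.prob_pos j).le
        (Real.rpow_nonneg (spectralNorm_nonneg _) _), Finset.sum_mul]
      refine Finset.sum_congr rfl fun j _ => ?_
      rw [ENNReal.ofReal_mul (hM.prob_pos j).le]; ring
    calc ∫⁻ ω, ENNReal.ofReal (vnorm (x (t + 1) ω) ^ θ) ∂μ
        ≤ ∫⁻ ω, (ENNReal.ofReal (spectralNorm (A (s t ω)) ^ θ) *
            ENNReal.ofReal (vnorm (x t ω) ^ θ) + ENNReal.ofReal (vnorm (w t ω) ^ θ)) ∂μ := by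
          refine lintegral_mono fun ω => ?_
          have h1 := Real.rpow_nonneg (spectralNorm_nonneg (A (s t ω))) θ
          have h2 := Real.rpow_nonneg (vnorm_nonneg (x t ω)) θ
          rw [← ENNReal.ofReal_mul h1, ← ENNReal.ofReal_add (mul_nonneg h1 h2)
            (Real.rpow_nonneg (vnorm_nonneg _) _)]
          exact ENNReal.ofReal_le_ofReal (hM.vnorm_state_succ_rpow_le hθ hθ1 t ω)
      _ = ENNReal.ofReal ρ * ∫⁻ ω, ENNReal.ofReal (vnorm (x t ω) ^ θ) ∂μ
            + ∫⁻ ω, ENNReal.ofReal (vnorm (w t ω) ^ θ) ∂μ := by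
          have hwm : Measurable fun ω => ENNReal.ofReal (vnorm (w t ω) ^ θ) :=
            ((measurable_vnorm.comp (hM.noise_meas' t)).pow_const θ).ennreal_ofReal
          rw [lintegral_add_right _ hwm, hsp]
      _ ≤ ENNReal.ofReal ρ * ENNReal.ofReal C + ENNReal.ofReal (1 + N) := by gcongr
      _ ≤ ENNReal.ofReal C := by
          rw [← ENNReal.ofReal_mul hρ0, ← ENNReal.ofReal_add (by positivity) (by positivity)]
          exact ENNReal.ofReal_le_ofReal hCρ

lemma vnorm_regressor_rpow_le (i : Fin k) {θ : ℝ} (hθ : 0 < θ) (t : ℕ) (ω : Ω) :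
    vnorm (regressor x s i ω t) ^ θ ≤ vnorm (x t ω) ^ θ := by
  refine Real.rpow_le_rpow (vnorm_nonneg _) ?_ hθ.le
  unfold regressor
  split_ifs
  · exact le_rfl
  · have : vnorm (0 : Fin n → ℝ) = 0 := by simp [vnorm]
    rw [this]; exact vnorm_nonneg _

/-- Jensen's inequality in the form of the tangent to the logarithm at `1 + T`: the expected sum of
the `θ`-moments is at most `C * T`. -/
lemma exists_lintegral_log_det_le (hM : SwitchedModel μ A p α N 𝒬 ℋ x s w) {θ : ℝ} (hθ : 0 < θ)
    (hθ1 : θ ≤ 1) (hρ : ∑ j, p j * spectralNorm (A j) ^ θ < 1) (i : Fin k) :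
    ∃ C, 0 ≤ C ∧ ∀ T : ℕ, ∫⁻ ω, ENNReal.ofReal (Real.log (gram (regressor x s i ω) T).det) ∂μ
      ≤ ENNReal.ofReal (C * (1 + Real.log (1 + T))) := by
  obtain ⟨C, hC0, hC⟩ := hM.exists_moment_bound hθ.le hθ1 hρ
  refine ⟨n * (2 / θ) * (1 + n + C), by positivity, fun T => ?_⟩
  have hT : (0 : ℝ) < 1 + T := by positivity
  have hlT : 0 ≤ Real.log (1 + T) := Real.log_nonneg (by linarith [Nat.cast_nonneg (α := ℝ) T])
  set f : Ω → ℝ := fun ω => ∑ t ∈ Finset.range T, vnorm (x t ω) ^ θ with hf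
  have hfm : Measurable f := Finset.measurable_sum _ fun t _ =>
    (measurable_vnorm.comp ((hM.state_meas t).mono (𝒬.le t) le_rfl)).pow_const θ
  have hf0 : ∀ ω, 0 ≤ f ω := fun ω => Finset.sum_nonneg fun t _ =>
    Real.rpow_nonneg (vnorm_nonneg _) _
  have hpt : ∀ ω, Real.log (gram (regressor x s i ω) T).det
      ≤ n * (2 / θ) * (Real.log (1 + T) + (1 + n) / (1 + T)) + n * (2 / θ) / (1 + T) * f ω := by
    intro ω
    refine (log_det_gram_le _ T hθ hθ1).trans ?_
    have h1 : ∑ t ∈ Finset.range T, vnorm (regressor x s i ω t) ^ θ ≤ f ω :=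
      Finset.sum_le_sum fun t _ => vnorm_regressor_rpow_le i hθ t ω
    have h0 : 0 ≤ ∑ t ∈ Finset.range T, vnorm (regressor x s i ω t) ^ θ :=
      Finset.sum_nonneg fun t _ => Real.rpow_nonneg (vnorm_nonneg _) _
    have h2 : Real.log (1 + n + ∑ t ∈ Finset.range T, vnorm (regressor x s i ω t) ^ θ)
        ≤ Real.log (1 + T) + (1 + n + f ω) / (1 + T) := by
      have hz : 0 < 1 + n + f ω := by have := hf0 ω; positivity
      have h3 := Real.log_le_sub_one_of_pos (div_pos hz hT)
      rw [Real.log_div hz.ne' hT.ne'] at h3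
      have h4 := Real.log_le_log (by positivity)
        (show 1 + n + ∑ t ∈ Finset.range T, vnorm (regressor x s i ω t) ^ θ ≤ 1 + n + f ω by
          linarith)
      linarith
    calc _ ≤ n * ((2 / θ) * (Real.log (1 + T) + (1 + n + f ω) / (1 + T))) := by gcongr
      _ = _ := by ring
  calc _ ≤ ∫⁻ ω, (ENNReal.ofReal (n * (2 / θ) * (Real.log (1 + T) + (1 + n) / (1 + T)))
        + ENNReal.ofReal (n * (2 / θ) / (1 + T)) * ENNReal.ofReal (f ω)) ∂μ := by
        refine lintegral_mono fun ω => ?_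
        rw [← ENNReal.ofReal_mul (by positivity), ← ENNReal.ofReal_add (by positivity)
          (mul_nonneg (by positivity) (hf0 ω))]
        exact ENNReal.ofReal_le_ofReal (hpt ω)
    _ = ENNReal.ofReal (n * (2 / θ) * (Real.log (1 + T) + (1 + n) / (1 + T)))
        + ENNReal.ofReal (n * (2 / θ) / (1 + T)) * ∫⁻ ω, ENNReal.ofReal (f ω) ∂μ := by
        rw [lintegral_add_left measurable_const, lintegral_const_mul _ hfm.ennreal_ofReal]; simp
    _ ≤ ENNReal.ofReal (n * (2 / θ) * (Real.log (1 + T) + (1 + n) / (1 + T)))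
        + ENNReal.ofReal (n * (2 / θ) / (1 + T)) * ENNReal.ofReal (T * C) := by
        gcongr
        simp only [hf]
        simp_rw [ENNReal.ofReal_sum_of_nonneg fun t (_ : t ∈ Finset.range T) =>
          Real.rpow_nonneg (vnorm_nonneg (x t _)) θ]
        have hxm : ∀ t, Measurable fun ω => ENNReal.ofReal (vnorm (x t ω) ^ θ) := fun t =>
          ((measurable_vnorm.comp
            ((hM.state_meas t).mono (𝒬.le t) le_rfl)).pow_const θ).ennreal_ofReal
        rw [lintegral_finsetSum _ fun t _ => hxm t]
        refine (Finset.sum_le_sum fun t _ => hC t).trans ?_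
        rw [Finset.sum_const, Finset.card_range, nsmul_eq_mul, ENNReal.ofReal_mul (by positivity),
          ENNReal.ofReal_natCast]
    _ ≤ _ := by
        rw [← ENNReal.ofReal_mul (by positivity), ← ENNReal.ofReal_add (by positivity)
          (by positivity)]
        refine ENNReal.ofReal_le_ofReal ?_
        have h1 : (1 + n) / (1 + (T : ℝ)) ≤ 1 + n :=
          div_le_self (by positivity) (by linarith [Nat.cast_nonneg (α := ℝ) T])
        have h2 : n * (2 / θ) / (1 + T) * (T * C) ≤ n * (2 / θ) * C := by
          rw [div_mul_eq_mul_div, div_le_iff₀ hT]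
          have : 0 ≤ n * (2 / θ) * C := by positivity
          nlinarith
        have h3 : n * (2 / θ) * (Real.log (1 + T) + (1 + n) / (1 + T))
            ≤ n * (2 / θ) * (Real.log (1 + T) + (1 + n)) := by gcongr
        have h4 : 0 ≤ n * (2 / θ) * ((n + C) * Real.log (1 + T)) := by positivity
        nlinarith

lemma switch_condExp (hM : SwitchedModel μ A p α N 𝒬 ℋ x s w) {φ : Fin k → ℝ}
    (hφ : ∑ j, p j * φ j = 0) (t : ℕ) : μ[fun ω => φ (s t ω) | 𝒬 t] =ᵐ[μ] 0 := by
  have hSm : ∀ j, MeasurableSet {ω | s t ω = j} := fun j => ℋ.le _ _ (hM.measurableSet_switch t j)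
  have hm : Measurable fun ω => φ (s t ω) :=
    (measurable_of_countable φ).comp ((hM.switch_meas t).mono (ℋ.le t) le_rfl)
  have hb : Integrable (fun ω => φ (s t ω)) μ :=
    Integrable.of_bound hm.aestronglyMeasurable (∑ j, ‖φ j‖) (ae_of_all _ fun ω =>
      Finset.single_le_sum (f := fun j => ‖φ j‖) (fun _ _ => norm_nonneg _) (Finset.mem_univ _))
  refine (ae_eq_condExp_of_forall_setIntegral_eq (𝒬.le t) hb
    (fun _ _ _ => integrableOn_zero) (fun F hF _ => ?_)
    (stronglyMeasurable_zero).aestronglyMeasurable).symm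
  have e : ∀ ω, φ (s t ω) = ∑ j, {ω | s t ω = j}.indicator (fun _ => φ j) ω := by
    intro ω
    rw [Finset.sum_eq_single (s t ω)]
    · simp
    · intro j _ hj
      rw [Set.indicator_of_notMem (fun h => hj h.symm)]
    · simp
  simp_rw [e]
  rw [integral_finsetSum _ fun j _ => ((integrable_const (φ j)).indicator (hSm j)).integrableOn]
  have h1 : ∀ j, ∫ ω in F, {ω | s t ω = j}.indicator (fun _ => φ j) ω ∂μ
      = (p j * φ j) * μ.real F := by
    intro j
    rw [setIntegral_indicator (hSm j), setIntegral_const, measureReal_def, hM.switch_law t j F hF,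
      ENNReal.toReal_mul, ENNReal.toReal_ofReal (hM.prob_pos j).le, smul_eq_mul, measureReal_def]
    ring
  simp_rw [h1]
  rw [← Finset.sum_mul, hφ]; simp

/-- The law of large numbers for the switching sequence, weighted by a predictable sequence. -/
lemma ae_abs_sum_switch_le (hM : SwitchedModel μ A p α N 𝒬 ℋ x s w) {φ : Fin k → ℝ}
    (hφ : ∑ j, p j * φ j = 0) {y : ℕ → Ω → ℝ} (hy : ∀ t, StronglyMeasurable[𝒬 t] (y t)) {C : ℝ≥0}
    (hC : ∀ t, ∫⁻ ω, ENNReal.ofReal ((y t ω) ^ 2) ∂μ ≤ C) :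
    ∀ᵐ ω ∂μ, ∀ δ > 0, ∃ K, ∀ T : ℕ,
      |∑ t ∈ Finset.range T, y t ω * φ (s t ω)| ≤ δ * (1 + T) + K := by
  have hb : ∀ j, |φ j| ≤ ∑ j, |φ j| := fun j =>
    Finset.single_le_sum (f := fun j => |φ j|) (fun _ _ => abs_nonneg _) (Finset.mem_univ _)
  have hm : ∀ t, StronglyMeasurable[𝒬 (t + 1)] fun ω => φ (s t ω) := fun t =>
    ((measurable_of_countable φ).comp
      ((hM.switch_meas t).mono (hM.le_past t) le_rfl)).stronglyMeasurable
  refine ae_abs_sum_mul_le_linear (N := (∑ j, |φ j|) ^ 2) hy hm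
    (fun t => Integrable.of_bound ((hm t).mono (𝒬.le _)).aestronglyMeasurable (∑ j, |φ j|)
      (ae_of_all _ fun ω => hb _)) (hM.switch_condExp hφ) (fun t F _ => ?_) hC
  calc _ ≤ ∫⁻ _ in F, ENNReal.ofReal ((∑ j, |φ j|) ^ 2) ∂μ := by
        refine lintegral_mono fun ω => ENNReal.ofReal_le_ofReal ?_
        rw [← sq_abs]
        exact pow_le_pow_left₀ (abs_nonneg _) (hb _) 2
    _ = _ := by simp

/-- The weighted law of large numbers for moments of the noise. -/
lemma ae_sum_noise_le (hM : SwitchedModel μ A p α N 𝒬 ℋ x s w) {β : ℝ} (hβ0 : 0 < β)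
    (hβ : β < α) {a : ℕ → Ω → ℝ} (ha : ∀ t, StronglyMeasurable[ℋ t] (a t))
    (ha0 : ∀ t ω, 0 ≤ a t ω) (ha1 : ∀ t ω, a t ω ≤ 1) :
    ∀ᵐ ω ∂μ, ∃ K, ∀ T, ∑ t ∈ Finset.range T, a t ω * vnorm (w t ω) ^ β
      ≤ (2 + N) * (1 + ∑ t ∈ Finset.range T, a t ω) + K := by
  have hγ : 1 < min 2 (α / β) := lt_min one_lt_two ((one_lt_div hβ0).2 hβ)
  have hγβ : β * min 2 (α / β) ≤ α := by
    calc β * min 2 (α / β) ≤ β * (α / β) := by gcongr; exact min_le_right _ _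
      _ = α := by field_simp
  have hwm : ∀ t, StronglyMeasurable[ℋ (t + 1)] fun ω => vnorm (w t ω) ^ β := fun t =>
    ((measurable_vnorm.comp ((hM.noise_meas t).mono (hM.past_le (t + 1)) le_rfl)).pow_const
      β).stronglyMeasurable
  have h := ae_sum_mul_le ha ha0 ha1 hwm (fun t ω => Real.rpow_nonneg (vnorm_nonneg _) _)
    (M := 1 + N) (N := 1 + N) (by linarith [hM.moment_nonneg]) hγ (min_le_left _ _)
    (hM.noise_moment_of_le hβ0.le hβ.le) (fun t => by
      have := hM.noise_moment_of_le (by positivity) hγβ t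
      refine this.mono fun ω => le_of_eq ?_
      rw [Real.rpow_mul (vnorm_nonneg _)])
  filter_upwards [h] with ω h
  obtain ⟨K, hK⟩ := h 1 one_pos
  refine ⟨K, fun T => (hK T).trans_eq (by ring)⟩

lemma ae_eventually_sum_noise_le (hM : SwitchedModel μ A p α N 𝒬 ℋ x s w) {β : ℝ} (hβ0 : 0 < β)
    (hβ : β < α) : ∀ᵐ ω ∂μ, ∀ᶠ T : ℕ in atTop,
      ∑ t ∈ Finset.range T, vnorm (w t ω) ^ β ≤ (3 + N) * T := by
  filter_upwards [hM.ae_sum_noise_le hβ0 hβ (a := fun _ _ => 1) (fun t => stronglyMeasurable_const)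
    (fun _ _ => zero_le_one) (fun _ _ => le_rfl)] with ω ⟨K, hK⟩
  filter_upwards [eventually_ge_atTop ⌈2 + N + K⌉₊] with T hT
  have h1 := hK T
  have h2 := (Nat.le_ceil _).trans (Nat.cast_le (α := ℝ).2 hT)
  simp only [one_mul, Finset.sum_const, Finset.card_range, nsmul_eq_mul, mul_one] at h1
  linarith

/-- Cauchy–Schwarz for the weights `p`. With the exponent `θ / 2` the squares of the weights `vnorm
(x t) ^ (θ / 2)` are moments of order `θ`, hence have bounded expectations, as the martingale law
for the switches requires. -/
lemma sum_mul_rpow_half_lt_one (hM : SwitchedModel μ A p α N 𝒬 ℋ x s w) {θ : ℝ}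
    (hρ : ∑ j, p j * spectralNorm (A j) ^ θ < 1) :
    ∑ j, p j * spectralNorm (A j) ^ (θ / 2) < 1 := by
  have h1 : (∑ j, p j * spectralNorm (A j) ^ (θ / 2)) ^ 2
      ≤ ∑ j, p j * spectralNorm (A j) ^ θ := by
    calc (∑ j, p j * spectralNorm (A j) ^ (θ / 2)) ^ 2
        ≤ (∑ j, p j) * ∑ j, p j * spectralNorm (A j) ^ θ := by
          refine Finset.sum_sq_le_sum_mul_sum_of_sq_le_mul _ (fun j _ => (hM.prob_pos j).le)
            (fun j _ => mul_nonneg (hM.prob_pos j).le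
              (Real.rpow_nonneg (spectralNorm_nonneg _) _)) fun j _ => ?_
          have : spectralNorm (A j) ^ θ = (spectralNorm (A j) ^ (θ / 2)) ^ 2 := by
            rw [← Real.rpow_natCast, ← Real.rpow_mul (spectralNorm_nonneg _)]
            congr 1; push_cast; ring
          exact le_of_eq (by rw [this]; ring)
      _ = _ := by rw [hM.prob_sum, one_mul]
  by_contra hcon
  nlinarith [not_lt.1 hcon]

/-- Tightness of the state along almost every path. -/
lemma exists_ae_sum_state_le (hM : SwitchedModel μ A p α N 𝒬 ℋ x s w) {θ : ℝ} (hθ : 0 < θ)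
    (hθ1 : θ ≤ 1) (hρ : ∑ j, p j * spectralNorm (A j) ^ θ < 1) :
    ∃ C, 0 ≤ C ∧ ∀ᵐ ω ∂μ, ∀ᶠ T : ℕ in atTop,
      ∑ t ∈ Finset.range T, vnorm (x t ω) ^ (θ / 2) ≤ C * T := by
  obtain ⟨C, hC0, hC⟩ := hM.exists_moment_bound hθ.le hθ1 hρ
  have hρ' := hM.sum_mul_rpow_half_lt_one hρ
  set ρ' := ∑ j, p j * spectralNorm (A j) ^ (θ / 2) with hρd
  have hN := hM.moment_nonneg
  have h1ρ : 0 < 1 - ρ' := by linarith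
  refine ⟨(4 + N) / (1 - ρ'), by positivity, ?_⟩
  have h1 := hM.ae_abs_sum_switch_le (φ := fun j => spectralNorm (A j) ^ (θ / 2) - ρ') (C := C.toNNReal)
    (y := fun t ω => vnorm (x t ω) ^ (θ / 2)) (by
      simp only [mul_sub, Finset.sum_sub_distrib]
      rw [← Finset.sum_mul, hM.prob_sum, one_mul, ← hρd, sub_self])
    (fun t => ((measurable_vnorm.comp (hM.state_meas t)).pow_const _).stronglyMeasurable)
    (fun t => by
      refine le_trans (le_of_eq (lintegral_congr fun ω => ?_)) (hC t)
      rw [← Real.rpow_natCast, ← Real.rpow_mul (vnorm_nonneg _)]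
      congr 2; push_cast; ring)
  have h2 := hM.ae_sum_noise_le (β := θ / 2) (by positivity) (by linarith [hM.two_lt])
    (a := fun _ _ => 1) (fun t => stronglyMeasurable_const)
    (fun _ _ => zero_le_one) (fun _ _ => le_rfl)
  filter_upwards [h1, h2] with ω h1 ⟨K2, h2⟩
  obtain ⟨K1, h1⟩ := h1 1 one_pos
  set f := fun t => vnorm (x t ω) ^ (θ / 2) with hf
  have hf0 : ∀ t, 0 ≤ f t := fun t => Real.rpow_nonneg (vnorm_nonneg _) _
  filter_upwards [eventually_ge_atTop ⌈f 0 + K1 + K2 + (3 + N)⌉₊] with T hT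
  have h3 := (Nat.le_ceil _).trans (Nat.cast_le (α := ℝ).2 hT)
  -- Pathwise drift inequality: a switching martingale, the contraction `ρ'`, and the noise. The
  -- first and last grow at rates at most `1` and `2 + N`; one more unit absorbs the constants,
  -- whence `4 + N`.
  have h4 : ∑ t ∈ Finset.range T, f (t + 1) ≤ ∑ t ∈ Finset.range T,
      (f t * (spectralNorm (A (s t ω)) ^ (θ / 2) - ρ') + (ρ' * f t + 1 * vnorm (w t ω) ^ (θ / 2))) := by
    refine Finset.sum_le_sum fun t _ => ?_
    have := hM.vnorm_state_succ_rpow_le (θ := θ / 2) (by positivity) (by linarith) t ω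
    simp only [hf]; linarith
  rw [Finset.sum_add_distrib, Finset.sum_add_distrib, ← Finset.mul_sum] at h4
  have h5 : ∑ t ∈ Finset.range T, f t ≤ f 0 + ∑ t ∈ Finset.range T, f (t + 1) := by
    have := Finset.sum_range_succ' f T
    rw [Finset.sum_range_succ] at this
    linarith [hf0 T]
  have h6 := (abs_le.1 (h1 T)).2
  have h7 := h2 T
  simp only [Finset.sum_const, Finset.card_range, nsmul_eq_mul, mul_one] at h7
  rw [div_mul_eq_mul_div, le_div_iff₀ h1ρ]
  simp only [hf] at *
  nlinarith

/-- The constant is of order `1 / θ` and so depends on `p`. It is admissible only because it is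
later multiplied by the small conditional variance of the truncated part of the noise. -/
lemma exists_ae_log_det_le (hM : SwitchedModel μ A p α N 𝒬 ℋ x s w) {θ : ℝ} (hθ : 0 < θ)
    (hθ1 : θ ≤ 1) (hρ : ∑ j, p j * spectralNorm (A j) ^ θ < 1) (i : Fin k) :
    ∃ C, 0 ≤ C ∧ ∀ᵐ ω ∂μ, ∀ᶠ T : ℕ in atTop,
      Real.log (gram (regressor x s i ω) T).det ≤ C * Real.log T := by
  obtain ⟨C, hC0, hC⟩ := hM.exists_ae_sum_state_le hθ hθ1 hρ
  refine ⟨n * ((2 / (θ / 2)) * 2), by positivity, ?_⟩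
  filter_upwards [hC] with ω hω
  filter_upwards [hω, eventually_ge_atTop (⌈1 + n + C⌉₊ + 1)] with T hT hT1
  refine (log_det_gram_le _ T (θ := θ / 2) (by positivity) (by linarith)).trans ?_
  rw [mul_assoc, mul_assoc]
  have hTC : 1 + n + C ≤ T := (Nat.le_ceil _).trans (Nat.cast_le.2 (by omega))
  have hT1' : (1 : ℝ) ≤ T := by exact_mod_cast (by omega : 1 ≤ T)
  have h0 : 0 ≤ ∑ t ∈ Finset.range T, vnorm (regressor x s i ω t) ^ (θ / 2) :=
    Finset.sum_nonneg fun t _ => Real.rpow_nonneg (vnorm_nonneg _) _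
  have h1 : ∑ t ∈ Finset.range T, vnorm (regressor x s i ω t) ^ (θ / 2) ≤ C * T :=
    (Finset.sum_le_sum fun t _ => vnorm_regressor_rpow_le i (by positivity) t ω).trans hT
  gcongr
  have e : 2 * Real.log T = Real.log ((T : ℝ) ^ 2) := by rw [Real.log_pow]; norm_num
  rw [e]
  refine Real.log_le_log (by positivity) ?_
  have : (1 + n) * 1 ≤ (1 + (n : ℝ)) * T := by gcongr
  nlinarith

end SwitchedModel

end Moments

/-! ### Inverse Gram matrices are tame: dominating words force excitations. -/

section Tame

open Matrix

variable {n k : ℕ}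

/-- The words starting with `a ++ [i]` for which some vector `v` of the dense sequence, of norm at
most one with respect to `V`, has a large image `Φ(a)ᵀ v` that dominates those of the suffixes. -/
noncomputable def Dominates (A : Fin k → Matrix (Fin n) (Fin n) ℝ) (i : Fin k)
    (V : Matrix (Fin n) (Fin n) ℝ) : Set (List (Fin k)) :=
  {u | ∃ a m, (a ++ [i]) <+: u ∧ quad V (TopologicalSpace.denseSeq (Fin n → ℝ) m) ≤ 1 ∧
    1 ≤ ((wordMat A a)ᵀ *ᵥ TopologicalSpace.denseSeq (Fin n → ℝ) m) ⬝ᵥ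
      ((wordMat A a)ᵀ *ᵥ TopologicalSpace.denseSeq (Fin n → ℝ) m) ∧
    ∀ a', a' <:+ a → ((wordMat A a')ᵀ *ᵥ TopologicalSpace.denseSeq (Fin n → ℝ) m) ⬝ᵥ
      ((wordMat A a')ᵀ *ᵥ TopologicalSpace.denseSeq (Fin n → ℝ) m)
      ≤ 4 * (((wordMat A a)ᵀ *ᵥ TopologicalSpace.denseSeq (Fin n → ℝ) m) ⬝ᵥ
        ((wordMat A a)ᵀ *ᵥ TopologicalSpace.denseSeq (Fin n → ℝ) m))}

variable {A : Fin k → Matrix (Fin n) (Fin n) ℝ} {p : Fin k → ℝ} {i : Fin k}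

/-- Duality: if `V⁻¹` is large at `Φ(a) z`, then a multiple `v` of `V⁻¹ Φ(a) z` has `V`-norm below
one and `‖Φ(a)ᵀ v‖ > 1`. Passing to the suffix of `a` with the largest image gives domination. The
inequalities are strict, so a nearby vector of the dense sequence also works; the factor four in
`Dominates` leaves room for this. -/
lemma exists_suffix_dominates {V : Matrix (Fin n) (Fin n) ℝ} (hV : V.PosDef) {u : List (Fin k)}
    (hu : u ∈ Amplifies A i V⁻¹ 2) : ∃ u', u' <:+ u ∧ u' ∈ Dominates A i V := by
  obtain ⟨a, z, ha, hz, hq⟩ := hu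
  set q := quad V⁻¹ (wordMat A a *ᵥ z) with hqd
  have hq0 : 0 < q := by linarith
  -- Normalized so that `quad V v = 3 / 4`. Then `‖Φ(a)ᵀ v‖²` is at least `3 / 4 * q ≥ 3 / 2`, and
  -- both bounds have room for perturbation.
  set r := √(3 / (4 * q)) with hr
  have hr2 : r ^ 2 = 3 / (4 * q) := Real.sq_sqrt (by positivity)
  set v := r • (V⁻¹ *ᵥ (wordMat A a *ᵥ z)) with hv
  set g : List (Fin k) → (Fin n → ℝ) → ℝ := fun b y => ((wordMat A b)ᵀ *ᵥ y) ⬝ᵥ ((wordMat A b)ᵀ *ᵥ y)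
    with hg
  have hquad : quad V v = 3 / 4 := by
    rw [hv, quad_smul_right, quad_mulVec_inv hV, hr2]
    change 3 / (4 * q) * q = 3 / 4
    field_simp
  have hga : 1 < g a v := by
    have h1 : v ⬝ᵥ (wordMat A a *ᵥ z) = r * q := by
      rw [hv, smul_dotProduct, smul_eq_mul, dotProduct_comm]; rfl
    have h2 := sq_dotProduct_le_mul ((wordMat A a)ᵀ *ᵥ v) z
    rw [dotProduct_mulVec_transpose, h1, mul_pow, hr2] at h2
    have h3 : 3 / (4 * q) * q ^ 2 = 3 / 4 * q := by field_simp
    rw [h3] at h2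
    have h4 : 0 ≤ g a v := dotProduct_self_nonneg' _
    have h5 : g a v * (z ⬝ᵥ z) ≤ g a v := mul_le_of_le_one_right h4 hz
    simp only [hg] at h5 ⊢
    linarith
  obtain ⟨b, hb, hmax⟩ := a.tails.toFinset.exists_max_image (fun b => g b v)
    ⟨a, by simp⟩
  have hba : b <:+ a := by simpa using hb
  have hgb : 1 < g b v := hga.trans_le (hmax a (by simp))
  have hcont : ∀ c, Continuous (g c) := fun c => by
    simp only [hg, dotProduct, mulVec]; fun_prop
  have hcq : Continuous (quad V) := by
    unfold quad; simp only [dotProduct, mulVec]; fun_prop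
  have hev : ∀ᶠ y in 𝓝 v, quad V y < 1 ∧ 1 < g b y ∧ ∀ c ∈ b.tails.toFinset, g c y < 4 * g b y := by
    refine (hcq.continuousAt.eventually_lt continuousAt_const (by rw [hquad]; norm_num)).and
      ((continuousAt_const.eventually_lt (hcont b).continuousAt hgb).and ?_)
    rw [Filter.eventually_all_finset]
    intro c hc
    refine (hcont c).continuousAt.eventually_lt ((hcont b).const_mul 4).continuousAt ?_
    have hca : c <:+ a := (show c <:+ b by simpa using hc).trans hba
    have := hmax c (by simpa using hca)
    linarith
  obtain ⟨S, hS, hSo, hvS⟩ := mem_nhds_iff.1 hev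
  obtain ⟨m, hm⟩ := (TopologicalSpace.denseRange_denseSeq (Fin n → ℝ)).exists_mem_open hSo ⟨v, hvS⟩
  obtain ⟨h1, h2, h3⟩ := hS hm
  obtain ⟨pre, hpre⟩ := hba
  obtain ⟨c1, c2, hc⟩ := ha
  refine ⟨b ++ [i] ++ c2, ⟨c1 ++ pre, by rw [← hc, ← hpre]; simp⟩, b, m, List.prefix_append _ _,
    h1.le, h2.le, fun c hc => (h3 c (by simpa using hc)).le⟩

/-- A union bound over the `l` starting positions. Closure of `D` under extension to the right
compensates for the shorter length of the suffixes. -/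
lemma wordPr_exists_suffix_le (hp : ∀ j, 0 ≤ p j) (h1 : ∑ j, p j = 1) {D : Set (List (Fin k))}
    (hD : ∀ u v, u ∈ D → u ++ v ∈ D) (hnil : [] ∉ D) (l : ℕ) :
    wordPr p l {u | ∃ u', u' <:+ u ∧ u' ∈ D} ≤ l * wordPr p l D := by
  induction l with
  | zero =>
    have : ([] : List (Fin k)) ∉ {u | ∃ u', u' <:+ u ∧ u' ∈ D} := by
      rintro ⟨u', h, h'⟩
      rw [List.suffix_nil] at h
      exact hnil (h ▸ h')
    simp [wordPr, wordE, this]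
  | succ l ih =>
    have e1 : wordPr p (l + 1) {u | ∃ u', u' <:+ u ∧ u' ∈ D}
        ≤ wordPr p (l + 1) {u | u ∈ D ∨ u ∈ {u | u.tail ∈ {u | ∃ u', u' <:+ u ∧ u' ∈ D}}} := by
      refine wordPr_mono hp fun u hu => ?_
      rintro ⟨u', h, h'⟩
      cases u with
      | nil => simp at hu
      | cons j u =>
        rcases List.suffix_cons_iff.1 h with h | h
        · left; rwa [← h]
        · right; exact ⟨u', h, h'⟩
    have e2 : wordPr p (l + 1) {u | u.tail ∈ {u | ∃ u', u' <:+ u ∧ u' ∈ D}}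
        ≤ wordPr p l {u | ∃ u', u' <:+ u ∧ u' ∈ D} := wordPr_cons hp h1 fun j u _ h => h
    have e3 : wordPr p l D ≤ wordPr p (l + 1) D :=
      wordPr_le_append_right hp h1 fun u v _ _ h => hD u v h
    have e4 : (l : ℝ) * wordPr p l D ≤ l * wordPr p (l + 1) D := by gcongr
    have e5 := wordPr_union_le hp (l + 1) D {u | u.tail ∈ {u | ∃ u', u' <:+ u ∧ u' ∈ D}}
    push_cast
    linarith

lemma suffixSq_le {v : Fin n → ℝ} {c : ℝ} (a : List (Fin k))
    (h : ∀ a', a' <:+ a → ((wordMat A a')ᵀ *ᵥ v) ⬝ᵥ ((wordMat A a')ᵀ *ᵥ v) ≤ c) :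
    suffixSq A v a ≤ a.length * c := by
  induction a with
  | nil => simp [suffixSq]
  | cons j a ih =>
    have h1 := ih fun a' ha' => h a' (ha'.trans (List.suffix_cons j a))
    have h2 := h a (List.suffix_cons j a)
    rw [suffixSq, List.length_cons]; push_cast; linarith

variable {Ω : Type*} {m0 : MeasurableSpace Ω} {μ : Measure Ω}
  {α N : ℝ} {𝒬 ℋ : Filtration ℕ m0}
  {x : ℕ → Ω → Fin n → ℝ} {s : ℕ → Ω → Fin k} {w : ℕ → Ω → Fin n → ℝ}

/-- The probability that a random word excites at time `r`. -/
noncomputable def excitePr (A : Fin k → Matrix (Fin n) (Fin n) ℝ) (p : Fin k → ℝ) (i : Fin k)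
    (h β : ℝ) (x : ℕ → Ω → Fin n → ℝ) (s : ℕ → Ω → Fin k) (l r : ℕ) (ω : Ω) : ℝ :=
  wordPr p l (Excites A i h β (gram (regressor x s i ω) r) (x r ω))

namespace SwitchedModel

/-- The responses `v ⬝ᵥ Φ(a) x (r + 1)` and `v ⬝ᵥ Φ(s r :: a) x r` differ by the noise term `Φ(a)ᵀ v
⬝ᵥ w r`. If that term is large, one of the two responses is. The direction is still unexcited at
time `r`, since Gram matrices increase. Domination bounds `suffixSq` by `4 * l * ‖Φ(a)ᵀ v‖²`, and
`16 * l / c` compares this with a response of square at least `c / 4 * ‖Φ(a)ᵀ v‖²`. -/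
lemma excites_of_dominates (hM : SwitchedModel μ A p α N 𝒬 ℋ x s w) {c : ℝ} (hc : 0 < c)
    {T r l : ℕ} (hr : r < T) {ω : Ω} {v : Fin n → ℝ} {m : ℕ} {a u : List (Fin k)}
    (hv : v = TopologicalSpace.denseSeq (Fin n → ℝ) m)
    (hau : (a ++ [i]) <+: u) (hul : u.length = l)
    (hV : quad (gram (regressor x s i ω) T) v ≤ 1)
    (h1 : 1 ≤ ((wordMat A a)ᵀ *ᵥ v) ⬝ᵥ ((wordMat A a)ᵀ *ᵥ v))
    (hsuf : ∀ a', a' <:+ a → ((wordMat A a')ᵀ *ᵥ v) ⬝ᵥ ((wordMat A a')ᵀ *ᵥ v)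
      ≤ 4 * (((wordMat A a)ᵀ *ᵥ v) ⬝ᵥ ((wordMat A a)ᵀ *ᵥ v)))
    (hw : c * (((wordMat A a)ᵀ *ᵥ v) ⬝ᵥ ((wordMat A a)ᵀ *ᵥ v))
      ≤ (((wordMat A a)ᵀ *ᵥ v) ⬝ᵥ w r ω) ^ 2) :
    u ∈ Excites A i (c / 4) (16 * l / c) (gram (regressor x s i ω) (r + 1)) (x (r + 1) ω) ∨
    s r ω :: u ∈ Excites A i (c / 4) (16 * l / c) (gram (regressor x s i ω) r) (x r ω) := by
  set y := (wordMat A a)ᵀ *ᵥ v with hy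
  have hlen : (a.length : ℝ) + 1 ≤ l := by
    have := hau.length_le
    simp at this
    rw [← hul]; exact_mod_cast this
  have hVr : ∀ r', r' ≤ T → quad (gram (regressor x s i ω) r') v ≤ 1 := fun r' hr' =>
    (quad_gram_mono _ hr' v).trans hV
  have hsq := suffixSq_le a hsuf
  have e1 : y ⬝ᵥ w r ω = v ⬝ᵥ (wordMat A a *ᵥ x (r + 1) ω)
      - v ⬝ᵥ (wordMat A (s r ω :: a) *ᵥ x r ω) := by
    rw [hy, dotProduct_mulVec_transpose, hM.state_succ, wordMat, mulVec_add, dotProduct_add,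
      mulVec_mulVec]; ring
  rw [e1] at hw
  have hy0 : 0 ≤ y ⬝ᵥ y := dotProduct_self_nonneg' y
  have hor : c / 4 * (y ⬝ᵥ y) ≤ (v ⬝ᵥ (wordMat A a *ᵥ x (r + 1) ω)) ^ 2 ∨
      c / 4 * (y ⬝ᵥ y) ≤ (v ⬝ᵥ (wordMat A (s r ω :: a) *ᵥ x r ω)) ^ 2 := by
    by_contra hcon
    push Not at hcon
    nlinarith [sq_nonneg (v ⬝ᵥ (wordMat A a *ᵥ x (r + 1) ω)
      + v ⬝ᵥ (wordMat A (s r ω :: a) *ᵥ x r ω))]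
  have hfin : ∀ X : ℝ, c / 4 * (y ⬝ᵥ y) ≤ X → 4 * l * (y ⬝ᵥ y) ≤ 16 * l / c * X := by
    intro X hX
    have h3 : 0 ≤ 16 * (l : ℝ) / c := by positivity
    calc 4 * l * (y ⬝ᵥ y) = 16 * l / c * (c / 4 * (y ⬝ᵥ y)) := by field_simp; ring
      _ ≤ _ := mul_le_mul_of_nonneg_left hX h3
  rcases hor with h | h
  · left
    refine ⟨a, m, hau, by rw [← hv]; exact hVr _ hr, by rw [← hv]; nlinarith, ?_⟩
    rw [← hv]
    refine le_trans ?_ (hfin _ h)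
    nlinarith [mul_nonneg (Nat.cast_nonneg (α := ℝ) a.length) hy0]
  · right
    refine ⟨s r ω :: a, m, ?_, by rw [← hv]; exact hVr _ hr.le, by rw [← hv]; nlinarith, ?_⟩
    · rw [List.cons_append]; exact (List.prefix_cons_inj _).2 hau
    · rw [← hv]
      refine le_trans ?_ (hfin _ h)
      rw [suffixSq]
      nlinarith [mul_nonneg (Nat.cast_nonneg (α := ℝ) a.length) hy0]

open Classical in
/-- The number of excitations is large if many words are dominating. -/
lemma wordPr_dominates_le (hM : SwitchedModel μ A p α N 𝒬 ℋ x s w) {c c2 : ℝ} (hc : 0 < c)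
    {T l : ℕ} {ω : Ω} {q : ℝ} (hq : 0 < q) (hqp : ∀ j, q ≤ p j)
    (hw : ∀ v : Fin n → ℝ, c2 * T ≤ ((Finset.range T).filter
        fun t => c * (v ⬝ᵥ v) ≤ (v ⬝ᵥ w t ω) ^ 2).card) :
    c2 * T * wordPr p l (Dominates A i (gram (regressor x s i ω) T))
      ≤ ∑ r ∈ Finset.range T, (excitePr A p i (c / 4) (16 * l / c) x s l (r + 1) ω
        + q⁻¹ * excitePr A p i (c / 4) (16 * l / c) x s (l + 1) r ω) := by
  have hp : ∀ j, 0 ≤ p j := fun j => (hM.prob_pos j).le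
  set D := Dominates A i (gram (regressor x s i ω) T) with hD
  set X : ℕ → Set (List (Fin k)) := fun r =>
    Excites A i (c / 4) (16 * l / c) (gram (regressor x s i ω) r) (x r ω) with hX
  have h1 : ∀ u : List (Fin k), u.length = l → c2 * T * (if u ∈ D then 1 else 0)
      ≤ ∑ r ∈ Finset.range T, ((if u ∈ X (r + 1) then (1 : ℝ) else 0)
        + (if s r ω :: u ∈ X r then (1 : ℝ) else 0)) := by
    intro u hul
    by_cases hu : u ∈ D
    · obtain ⟨a, m, hau, hV, ha1, hsuf⟩ := hu
      rw [if_pos ⟨a, m, hau, hV, ha1, hsuf⟩, mul_one]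
      refine (hw ((wordMat A a)ᵀ *ᵥ TopologicalSpace.denseSeq (Fin n → ℝ) m)).trans ?_
      rw [← nsmul_one, ← Finset.sum_const, Finset.sum_filter]
      refine Finset.sum_le_sum fun r hr => ?_
      split_ifs with h h2 h3 h3 h2 h3 h3
      all_goals try norm_num
      exact absurd (hM.excites_of_dominates hc (Finset.mem_range.1 hr) rfl hau hul hV ha1 hsuf h)
        (by rintro (h | h); exacts [h2 h, h3 h])
    · rw [if_neg hu, mul_zero]
      exact Finset.sum_nonneg fun r _ => by positivity
  have h2 := wordE_mono hp h1
  rw [wordE_const_mul] at h2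
  refine h2.trans ?_
  have h3 : ∀ (S : Finset ℕ) (f : ℕ → List (Fin k) → ℝ),
      wordE p l (fun u => ∑ r ∈ S, f r u) = ∑ r ∈ S, wordE p l (f r) := by
    intro S f
    induction S using Finset.induction_on with
    | empty =>
      have := wordE_const hM.prob_sum l 0
      simpa using this
    | insert a S ha ih =>
      simp only [Finset.sum_insert ha]
      rw [wordE_add, ih]
  rw [h3]
  refine Finset.sum_le_sum fun r _ => ?_
  rw [wordE_add]
  refine add_le_add le_rfl ?_
  -- The first letter is here the actual switch `s r`, not a random one. Averaging over it costs at
  -- most the inverse of the least letter probability.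
  rw [inv_mul_eq_div, le_div_iff₀ hq, mul_comm]
  have h4 : excitePr A p i (c / 4) (16 * l / c) x s (l + 1) r ω
      = ∑ j, p j * wordPr p l {u | j :: u ∈ X r} := rfl
  rw [h4]
  have h5 : p (s r ω) * wordPr p l {u | s r ω :: u ∈ X r} ≤ ∑ j, p j * wordPr p l {u | j :: u ∈ X r} :=
    Finset.single_le_sum (f := fun j => p j * wordPr p l {u | j :: u ∈ X r})
      (fun j _ => mul_nonneg (hp j) (wordPr_nonneg hp _ _)) (Finset.mem_univ _)
  exact (mul_le_mul_of_nonneg_right (hqp _) (wordPr_nonneg hp l {u | s r ω :: u ∈ X r})).trans h5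

set_option linter.unusedSectionVars false

variable [IsProbabilityMeasure μ]

lemma integral_wordE (l : ℕ) {f : List (Fin k) → Ω → ℝ} (hf : ∀ u, Integrable (f u) μ) :
    Integrable (fun ω => wordE p l fun u => f u ω) μ ∧
      ∫ ω, wordE p l (fun u => f u ω) ∂μ = wordE p l fun u => ∫ ω, f u ω ∂μ := by
  induction l generalizing f with
  | zero => exact ⟨hf [], rfl⟩
  | succ l ih =>
    have h := fun j => ih (f := fun u => f (j :: u)) fun u => hf _
    refine ⟨integrable_finsetSum _ fun j _ => (h j).1.const_mul _, ?_⟩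
    simp only [wordE]
    rw [integral_finsetSum _ fun j _ => (h j).1.const_mul _]
    exact Finset.sum_congr rfl fun j _ => by rw [integral_const_mul, (h j).2]

lemma measurableSet_mem_excites (hM : SwitchedModel μ A p α N 𝒬 ℋ x s w) (i : Fin k)
    (h β : ℝ) (r : ℕ) (u : List (Fin k)) :
    MeasurableSet {ω | u ∈ Excites A i h β (gram (regressor x s i ω) r) (x r ω)} := by
  have e : {ω | u ∈ Excites A i h β (gram (regressor x s i ω) r) (x r ω)}
      = ⋃ a : List (Fin k), ⋃ m : ℕ, {ω | (a ++ [i]) <+: u ∧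
        quad (gram (regressor x s i ω) r) (TopologicalSpace.denseSeq (Fin n → ℝ) m) ≤ 1 ∧
        h ≤ (TopologicalSpace.denseSeq (Fin n → ℝ) m ⬝ᵥ (wordMat A a *ᵥ x r ω)) ^ 2 ∧
        suffixSq A (TopologicalSpace.denseSeq (Fin n → ℝ) m) a
          ≤ β * (TopologicalSpace.denseSeq (Fin n → ℝ) m ⬝ᵥ (wordMat A a *ᵥ x r ω)) ^ 2} := by
    ext ω; simp [Excites]
  rw [e]
  exact MeasurableSet.iUnion fun a => MeasurableSet.iUnion fun m =>
    𝒬.le r _ (hM.measurableSet_excites i h β r u a _)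

lemma integral_excitePr_le (hM : SwitchedModel μ A p α N 𝒬 ℋ x s w) (i : Fin k)
    {h β : ℝ} (hh : 0 < h) (hβ : 0 ≤ β) (l r : ℕ) :
    Integrable (excitePr A p i h β x s l r) μ ∧ ∫ ω, excitePr A p i h β x s l r ω ∂μ
      ≤ 4 * (1 + (1 + N) * β) * μ.real (excitationEvent x s i (h / 4) r l) := by
  classical
  set f : List (Fin k) → Ω → ℝ := fun u =>
    {ω | u ∈ Excites A i h β (gram (regressor x s i ω) r) (x r ω)}.indicator fun _ => 1 with hf
  have hfi : ∀ u, Integrable (f u) μ := fun u =>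
    (integrable_const 1).indicator (hM.measurableSet_mem_excites i h β r u)
  have e : excitePr A p i h β x s l r = fun ω => wordE p l fun u => f u ω := by
    ext ω
    unfold excitePr wordPr
    refine wordE_congr fun u _ => ?_
    simp only [hf, Set.indicator, Set.mem_ofPred_eq]
  obtain ⟨h1, h2⟩ := integral_wordE (p := p) l hfi
  rw [e]
  refine ⟨h1, ?_⟩
  rw [h2]
  refine hM.wordE_le_measure l r (hM.measurableSet_excitationEvent i _ r l) fun u hu => ?_
  have h3 : ∫ ω, f u ω ∂μ = μ.real {ω | u ∈ Excites A i h β (gram (regressor x s i ω) r) (x r ω)} := by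
    rw [hf, integral_indicator (hM.measurableSet_mem_excites i h β r u)]; simp
  rw [h3, ← hu]
  exact hM.measure_excites_le i hh hβ r u

/-- Every excitation raises `log det` by at least `log (1 + c)` within `l` steps, so the expected
number of excitations is at most logarithmic in time, up to the factor `l`. -/
lemma sum_measure_excitation_le (hM : SwitchedModel μ A p α N 𝒬 ℋ x s w) (i : Fin k) {C : ℝ}
    (hC0 : 0 ≤ C)
    (hC : ∀ T : ℕ, ∫⁻ ω, ENNReal.ofReal (Real.log (gram (regressor x s i ω) T).det) ∂μ
      ≤ ENNReal.ofReal (C * (1 + Real.log (1 + T)))) {c : ℝ} (hc : 0 ≤ c) (T l : ℕ) :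
    (∑ r ∈ Finset.range T, μ.real (excitationEvent x s i c r l)) * Real.log (1 + c)
      ≤ l * (C * (1 + Real.log (1 + (T + l : ℕ)))) := by
  classical
  have hlog : 0 ≤ Real.log (1 + c) := Real.log_nonneg (by linarith)
  have hEm := fun r => hM.measurableSet_excitationEvent i c r l
  have hpt : ∀ ω, ∑ r ∈ Finset.range T, (excitationEvent x s i c r l).indicator
      (fun _ => ENNReal.ofReal (Real.log (1 + c))) ω
      ≤ ENNReal.ofReal (l * Real.log (gram (regressor x s i ω) (T + l)).det) := by
    intro ω
    have h1 := sum_indicator_excitation_le (regressor x s i ω) l hc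
      (fun r => ω ∈ excitationEvent x s i c r l) (fun r hr => by
        obtain ⟨t, ht, m, h1, h2, h3⟩ := hr
        refine ⟨r + t, _, by omega, by omega, h2, ?_⟩
        rw [regressor, if_pos h1]; exact h3) T
    refine le_trans (le_of_eq ?_) (ENNReal.ofReal_le_ofReal h1)
    rw [ENNReal.ofReal_sum_of_nonneg fun r _ => by split_ifs <;> [exact hlog; exact le_rfl]]
    refine Finset.sum_congr rfl fun r _ => ?_
    simp only [Set.indicator]
    split_ifs <;> simp
  have h2 := lintegral_mono (μ := μ) hpt
  rw [lintegral_finsetSum _ fun r _ => measurable_const.indicator (hEm r)] at h2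
  simp_rw [lintegral_indicator_const (hEm _), ENNReal.ofReal_mul (Nat.cast_nonneg (α := ℝ) l)] at h2
  rw [lintegral_const_mul' _ _ ENNReal.ofReal_ne_top, ← Finset.mul_sum] at h2
  have h3 := h2.trans (mul_le_mul_right (hC (T + l)) (ENNReal.ofReal (l : ℝ)))
  have hlT : 0 ≤ Real.log (1 + ((T + l : ℕ) : ℝ)) :=
    Real.log_nonneg (by linarith [Nat.cast_nonneg (α := ℝ) (T + l)])
  have h4 := ENNReal.toReal_mono (by finiteness) h3
  rw [ENNReal.toReal_mul, ENNReal.toReal_mul, ENNReal.toReal_ofReal hlog,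
    ENNReal.toReal_ofReal (by positivity), ENNReal.toReal_ofReal (by positivity),
    ENNReal.toReal_sum fun r _ => by finiteness] at h4
  rw [mul_comm]
  exact h4

/-- Markov's inequality and the Borel–Cantelli lemma, for expectations of polynomial growth. -/
lemma ae_eventually_not_le_of_integral_le {X : ℕ → Ω → ℝ} (hX0 : ∀ m ω, 0 ≤ X m ω)
    (hXi : ∀ m, Integrable (X m) μ) {c2 a K : ℝ} (hc2 : 0 < c2) (ha : 1 < a)
    (hK : ∀ m : ℕ, ∫ ω, X m ω ∂μ ≤ K * ((m : ℝ) + 1) ^ 8) :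
    ∀ᵐ ω ∂μ, ∀ᶠ m : ℕ in atTop, ω ∉ {ω | c2 * a ^ m ≤ ((m : ℝ) + 1) ^ 2 * X m ω} := by
  have hsumm : Summable fun m : ℕ => c2⁻¹ * (K * (((m + 1 : ℕ) : ℝ) ^ 10 * (a⁻¹) ^ (m + 1) * a)) := by
    have := summable_pow_mul_geometric_of_norm_lt_one (R := ℝ) 10 (r := a⁻¹) (by
      rw [Real.norm_eq_abs, abs_of_pos (by positivity)]; exact inv_lt_one_of_one_lt₀ ha)
    exact ((((summable_nat_add_iff 1).2 this).mul_right a).mul_left K).mul_left _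
  refine ae_eventually_notMem (ne_top_of_le_ne_top hsumm.tsum_ofReal_ne_top
    (ENNReal.tsum_le_tsum fun m => ?_))
  have ham : 0 < c2 * a ^ m := by positivity
  have h1 := mul_meas_ge_le_integral_of_nonneg (μ := μ) (f := fun ω => ((m : ℝ) + 1) ^ 2 * X m ω)
    (ae_of_all _ fun ω => mul_nonneg (by positivity) (hX0 m ω)) ((hXi m).const_mul _) (c2 * a ^ m)
  rw [integral_const_mul] at h1
  have h2 : μ.real {ω | c2 * a ^ m ≤ ((m : ℝ) + 1) ^ 2 * X m ω}
      ≤ c2⁻¹ * (K * (((m + 1 : ℕ) : ℝ) ^ 10 * (a⁻¹) ^ (m + 1) * a)) := by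
    rw [mul_comm, ← le_div_iff₀ ham] at h1
    refine h1.trans ?_
    rw [div_le_iff₀ ham]
    calc _ ≤ ((m : ℝ) + 1) ^ 2 * (K * ((m : ℝ) + 1) ^ 8) := by gcongr; exact hK m
      _ = _ := by
        push_cast
        rw [inv_pow, pow_succ a m]
        field_simp
  rw [← ofReal_measureReal]
  exact ENNReal.ofReal_le_ofReal h2

/-- Word lengths are at most `m ^ 2`. Hence the Paley–Zygmund factor is of order `m ^ 2`, and the
expected number of excitations up to time `2 ^ m`, of order `l m + 1` times `log (2 ^ m + l m)`, is
bounded crudely by a multiple of `(m + 1) ^ 6`. -/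
lemma exists_integral_sum_excitePr_le (hM : SwitchedModel μ A p α N 𝒬 ℋ x s w) (i : Fin k) {C : ℝ}
    (hC0 : 0 ≤ C)
    (hC : ∀ T : ℕ, ∫⁻ ω, ENNReal.ofReal (Real.log (gram (regressor x s i ω) T).det) ∂μ
      ≤ ENNReal.ofReal (C * (1 + Real.log (1 + T)))) {c1 q : ℝ} (hc1 : 0 < c1) (hq : 0 < q)
    {l : ℕ → ℕ} (hl : ∀ m, l m ≤ m ^ 2) :
    ∃ K, ∀ m : ℕ, ∫ ω, ∑ r ∈ Finset.range (2 ^ m),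
      (excitePr A p i (c1 / 4) (16 * l m / c1) x s (l m) (r + 1) ω
        + q⁻¹ * excitePr A p i (c1 / 4) (16 * l m / c1) x s (l m + 1) r ω) ∂μ
      ≤ K * ((m : ℝ) + 1) ^ 8 := by
  have hN := hM.moment_nonneg
  set L0 := Real.log (1 + c1 / 4 / 4) with hL0
  have hL0p : 0 < L0 := Real.log_pos (by linarith)
  refine ⟨4 * (1 + (1 + N) * (16 / c1)) * (1 + q⁻¹) * (2 * (C * 8)) / L0, fun m => ?_⟩
  have hXr : ∀ r, Integrable (fun ω => excitePr A p i (c1 / 4) (16 * l m / c1) x s (l m) (r + 1) ω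
        + q⁻¹ * excitePr A p i (c1 / 4) (16 * l m / c1) x s (l m + 1) r ω) μ := fun r =>
    (hM.integral_excitePr_le i (by positivity) (by positivity) _ _).1.add
      ((hM.integral_excitePr_le i (by positivity) (by positivity) _ _).1.const_mul _)
  set B := 4 * (1 + (1 + N) * (16 * l m / c1)) with hB
  have hB0 : 0 ≤ B := by positivity
  have e1 : ∫ ω, ∑ r ∈ Finset.range (2 ^ m), (excitePr A p i (c1 / 4) (16 * l m / c1) x s (l m) (r + 1) ω + q⁻¹ * excitePr A p i (c1 / 4) (16 * l m / c1) x s (l m + 1) r ω) ∂μ ≤ ∑ r ∈ Finset.range (2 ^ m),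
      (B * μ.real (excitationEvent x s i (c1 / 4 / 4) (r + 1) (l m))
        + q⁻¹ * (B * μ.real (excitationEvent x s i (c1 / 4 / 4) r (l m + 1)))) := by
    rw [integral_finsetSum _ fun r _ => hXr r]
    refine Finset.sum_le_sum fun r _ => ?_
    rw [integral_add (hM.integral_excitePr_le i (by positivity) (by positivity) _ _).1
      ((hM.integral_excitePr_le i (by positivity) (by positivity) _ _).1.const_mul _),
      integral_const_mul]
    refine add_le_add (hM.integral_excitePr_le i (by positivity) (by positivity) _ _).2 ?_
    exact mul_le_mul_of_nonneg_left
      (hM.integral_excitePr_le i (by positivity) (by positivity) _ _).2 (inv_nonneg.2 hq.le)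
  rw [Finset.sum_add_distrib, ← Finset.mul_sum, ← Finset.mul_sum, ← Finset.mul_sum] at e1
  set Y := (l m + 1 : ℕ) * (C * (1 + Real.log (1 + (2 ^ m + 1 + (l m + 1) : ℕ)))) with hY
  have hlm : (l m : ℝ) ≤ (m : ℝ) ^ 2 := by exact_mod_cast hl m
  have e2 : (∑ r ∈ Finset.range (2 ^ m), μ.real (excitationEvent x s i (c1 / 4 / 4) (r + 1) (l m)))
      * L0 ≤ Y := by
    have h1 := hM.sum_measure_excitation_le i hC0 hC (c := c1 / 4 / 4) (by positivity) (2 ^ m + 1) (l m)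
    have h2 : ∑ r ∈ Finset.range (2 ^ m), μ.real (excitationEvent x s i (c1 / 4 / 4) (r + 1) (l m))
        ≤ ∑ r ∈ Finset.range (2 ^ m + 1), μ.real (excitationEvent x s i (c1 / 4 / 4) r (l m)) := by
      rw [Finset.sum_range_succ']
      exact le_add_of_nonneg_right measureReal_nonneg
    refine ((mul_le_mul_of_nonneg_right h2 hL0p.le).trans h1).trans ?_
    rw [hY]
    have h3 : Real.log (1 + ((2 ^ m + 1 + l m : ℕ) : ℝ))
        ≤ Real.log (1 + ((2 ^ m + 1 + (l m + 1) : ℕ) : ℝ)) :=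
      Real.log_le_log (by positivity) (by push_cast; linarith)
    have h4 : 0 ≤ Real.log (1 + ((2 ^ m + 1 + l m : ℕ) : ℝ)) := Real.log_nonneg (by
      linarith [Nat.cast_nonneg (α := ℝ) (2 ^ m + 1 + l m)])
    gcongr
    omega
  have e3 : (∑ r ∈ Finset.range (2 ^ m), μ.real (excitationEvent x s i (c1 / 4 / 4) r (l m + 1)))
      * L0 ≤ Y := by
    have h1 := hM.sum_measure_excitation_le i hC0 hC (c := c1 / 4 / 4) (by positivity) (2 ^ m) (l m + 1)
    refine h1.trans ?_
    rw [hY]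
    have h3 : Real.log (1 + ((2 ^ m + (l m + 1) : ℕ) : ℝ))
        ≤ Real.log (1 + ((2 ^ m + 1 + (l m + 1) : ℕ) : ℝ)) :=
      Real.log_le_log (by positivity) (by push_cast; linarith)
    gcongr
  rw [← le_div_iff₀ hL0p] at e2 e3
  have hm0 : (0 : ℝ) ≤ m := Nat.cast_nonneg m
  have e4 : Y ≤ 2 * (C * 8) * ((m : ℝ) + 1) ^ 6 := by
    have h1 : Real.log (1 + ((2 ^ m + 1 + (l m + 1) : ℕ) : ℝ)) ≤ m + (m ^ 2 + 4) := by
      have h2 : (1 + ((2 ^ m + 1 + (l m + 1) : ℕ) : ℝ)) ≤ 2 ^ m * (m ^ 2 + 4) := by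
        push_cast
        have : (1 : ℝ) ≤ 2 ^ m := one_le_pow₀ (by norm_num)
        nlinarith [sq_nonneg (m : ℝ)]
      refine (Real.log_le_log (by positivity) h2).trans ?_
      rw [Real.log_mul (by positivity) (by positivity), Real.log_pow]
      have h3 := Real.log_le_sub_one_of_pos (show (0 : ℝ) < m ^ 2 + 4 by positivity)
      have h4 := Real.log_two_lt_d9
      nlinarith
    have h0 : (1 : ℝ) ≤ m + 1 := by linarith
    have h5 : 1 + Real.log (1 + ((2 ^ m + 1 + (l m + 1) : ℕ) : ℝ)) ≤ 8 * ((m : ℝ) + 1) ^ 2 := by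
      nlinarith
    have h6 : ((l m + 1 : ℕ) : ℝ) ≤ ((m : ℝ) + 1) ^ 2 := by push_cast; nlinarith
    have h7 : ((m : ℝ) + 1) ^ 4 ≤ ((m : ℝ) + 1) ^ 6 := pow_le_pow_right₀ h0 (by norm_num)
    have h8 : 0 ≤ Real.log (1 + ((2 ^ m + 1 + (l m + 1) : ℕ) : ℝ)) := Real.log_nonneg (by
      linarith [Nat.cast_nonneg (α := ℝ) (2 ^ m + 1 + (l m + 1))])
    calc Y ≤ ((m : ℝ) + 1) ^ 2 * (C * (8 * ((m : ℝ) + 1) ^ 2)) := by rw [hY]; gcongr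
      _ = C * 8 * ((m : ℝ) + 1) ^ 4 := by ring
      _ ≤ C * 8 * ((m : ℝ) + 1) ^ 6 := by gcongr
      _ ≤ _ := by nlinarith [show 0 ≤ C * 8 * ((m : ℝ) + 1) ^ 6 by positivity]
  have e5 : B ≤ 4 * (1 + (1 + N) * (16 / c1)) * ((m : ℝ) + 1) ^ 2 := by
    have h1 : (l m : ℝ) ≤ ((m : ℝ) + 1) ^ 2 := by nlinarith
    have h2 : (1 : ℝ) ≤ ((m : ℝ) + 1) ^ 2 := one_le_pow₀ (by linarith)
    calc B = 4 * (1 + (1 + N) * (16 / c1) * l m) := by rw [hB]; ring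
      _ ≤ 4 * (((m : ℝ) + 1) ^ 2 + (1 + N) * (16 / c1) * ((m : ℝ) + 1) ^ 2) := by gcongr
      _ = _ := by ring
  have hY0 : 0 ≤ Y / L0 := (mul_nonneg (Finset.sum_nonneg fun _ _ => measureReal_nonneg) hL0p.le |> fun h =>
    div_nonneg (h.trans ((le_div_iff₀ hL0p).1 e3)) hL0p.le)
  calc _ ≤ _ := e1
    _ ≤ B * (Y / L0) + q⁻¹ * (B * (Y / L0)) := by gcongr
    _ = (1 + q⁻¹) * (B * (Y / L0)) := by ring
    _ ≤ (1 + q⁻¹) * ((4 * (1 + (1 + N) * (16 / c1)) * ((m : ℝ) + 1) ^ 2) *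
        ((2 * (C * 8) * ((m : ℝ) + 1) ^ 6) / L0)) := by gcongr
    _ = _ := by ring

/-- The inverse Gram matrices are tame forms at all large dyadic times. -/
lemma ae_eventually_inv_gram_mem_tameForms (hM : SwitchedModel μ A p α N 𝒬 ℋ x s w) (i : Fin k)
    {θ : ℝ} (hθ : 0 < θ) (hθ1 : θ ≤ 1) (hρ : ∑ j, p j * spectralNorm (A j) ^ θ < 1)
    {c0 : ℝ} (hc0 : 0 < c0) {a : ℝ} (ha : 1 < a) {l : ℕ → ℕ} (hl : ∀ m, l m ≤ m ^ 2) :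
    ∀ᵐ ω ∂μ, (∀ v : Fin n → ℝ, ∀ᶠ T : ℕ in atTop,
        c0 * T * (v ⬝ᵥ v) ≤ ∑ t ∈ Finset.range T, (v ⬝ᵥ w t ω) ^ 2) →
      ∀ᶠ m : ℕ in atTop,
        (gram (regressor x s i ω) (2 ^ m))⁻¹ ∈ tameForms A i p (l m) ((a / 2) ^ m) := by
  have hp : ∀ j, 0 ≤ p j := fun j => (hM.prob_pos j).le
  have hN := hM.moment_nonneg
  obtain ⟨C, hC0, hC⟩ := hM.exists_lintegral_log_det_le hθ hθ1 hρ i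
  set β := (2 + α) / 2 with hβ
  have hβ2 : 2 < β := by rw [hβ]; linarith [hM.two_lt]
  have hβα : β < α := by rw [hβ]; linarith [hM.two_lt]
  obtain ⟨c1, hc1, c2, hc2, hcard⟩ := exists_card_noise (c := c0 / 8) (B := 3 + N) (by positivity) hβ2
  obtain ⟨q, hq, hqp⟩ : ∃ q > 0, ∀ j, q ≤ p j := by
    have : Nonempty (Fin k) := ⟨i⟩
    obtain ⟨j, hj⟩ := Finite.exists_min p
    exact ⟨p j, hM.prob_pos j, hj⟩
  set X : ℕ → Ω → ℝ := fun m ω => ∑ r ∈ Finset.range (2 ^ m),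
    (excitePr A p i (c1 / 4) (16 * l m / c1) x s (l m) (r + 1) ω
        + q⁻¹ * excitePr A p i (c1 / 4) (16 * l m / c1) x s (l m + 1) r ω) with hX
  have hXi : ∀ m, Integrable (X m) μ := fun m => integrable_finsetSum _ fun r _ =>
    (hM.integral_excitePr_le i (by positivity) (by positivity) _ _).1.add
      ((hM.integral_excitePr_le i (by positivity) (by positivity) _ _).1.const_mul _)
  have hX0 : ∀ m ω, 0 ≤ X m ω := fun m ω => Finset.sum_nonneg fun r _ =>
    add_nonneg (wordPr_nonneg hp _ _) (mul_nonneg (inv_nonneg.2 hq.le) (wordPr_nonneg hp _ _))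
  obtain ⟨K, hK⟩ := hM.exists_integral_sum_excitePr_le i hC0 hC hc1 hq hl
  have hBC := ae_eventually_not_le_of_integral_le hX0 hXi hc2 ha hK
  filter_upwards [hBC, hM.ae_eventually_sum_noise_le (β := 2) (by norm_num) hM.two_lt,
    hM.ae_eventually_sum_noise_le (by linarith) hβα] with ω hω h2 hβω hlow
  have hunif := exists_uniform_lower_bound (z := fun t => w t ω) (B := 3 + N) (by linarith) hc0
    (by simpa only [Real.rpow_two, vnorm_sq] using h2) fun m => hlow _
  have hpow : Tendsto (fun m : ℕ => 2 ^ m) atTop atTop := tendsto_pow_atTop_atTop_of_one_lt one_lt_two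
  filter_upwards [hω, hpow.eventually hunif, hpow.eventually hβω] with m hm hlowm hβm
  have hcm := hcard (fun t => w t ω) (2 ^ m) hlowm hβm
  have hVd := posDef_gram (regressor x s i ω) (2 ^ m)
  refine ⟨hVd.inv.posSemidef, fun z => ?_, ?_⟩
  · have := quad_inv_le (A := 1) PosDef.one hVd (c := 1) (fun z => by
      rw [one_mul, quad_one, quad_gram]
      exact le_add_of_nonneg_right (Finset.sum_nonneg fun _ _ => sq_nonneg _)) z
    rwa [one_mul, inv_one, quad_one] at this
  -- If the form were not tame, words would dominate with probability at least `(a / 2) ^ m / l m`.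
  -- A positive fraction of the `2 ^ m` noise vectors is not small in the direction concerned, so
  -- the total exciting probability `X m` would be at least `c2 * a ^ m / l m`. This is exponential,
  -- against an expectation polynomial in `m`.
  by_contra hcon
  push Not at hcon
  refine hm ?_
  show c2 * a ^ m ≤ ((m : ℝ) + 1) ^ 2 * X m ω
  have e1 : wordPr p (l m) (Amplifies A i (gram (regressor x s i ω) (2 ^ m))⁻¹ 2)
      ≤ l m * wordPr p (l m) (Dominates A i (gram (regressor x s i ω) (2 ^ m))) := by
    refine le_trans (wordPr_mono hp fun u _ hu => ?_)
      (wordPr_exists_suffix_le hp hM.prob_sum (D := Dominates A i _) ?_ ?_ (l m))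
    · exact exists_suffix_dominates hVd hu
    · rintro u v ⟨b, m, h1, h2⟩
      exact ⟨b, m, h1.trans (List.prefix_append u v), h2⟩
    · rintro ⟨b, m, h1, -⟩
      simp at h1
  have e2 := hM.wordPr_dominates_le (i := i) hc1 (l := l m) hq hqp hcm
  have e3 : c2 * 2 ^ m * wordPr p (l m) (Dominates A i (gram (regressor x s i ω) (2 ^ m))) ≤ X m ω := by
    simpa [hX] using e2
  have hlm : (l m : ℝ) ≤ (m : ℝ) ^ 2 := by exact_mod_cast hl m
  have e4 : (a / 2) ^ m ≤ l m * wordPr p (l m) (Dominates A i (gram (regressor x s i ω) (2 ^ m))) :=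
    hcon.le.trans e1
  have hm0 : (0 : ℝ) ≤ m := Nat.cast_nonneg m
  calc c2 * a ^ m = c2 * 2 ^ m * (a / 2) ^ m := by rw [div_pow]; field_simp
    _ ≤ c2 * 2 ^ m * (l m * wordPr p (l m) (Dominates A i (gram (regressor x s i ω) (2 ^ m)))) := by
      gcongr
    _ = l m * (c2 * 2 ^ m * wordPr p (l m) (Dominates A i (gram (regressor x s i ω) (2 ^ m)))) := by
      ring
    _ ≤ l m * X m ω := by gcongr
    _ ≤ _ := mul_le_mul_of_nonneg_right (by nlinarith) (hX0 m ω)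

end SwitchedModel

end Tame

/-! ### The state as a sum over windows of switches. -/

section Epoch

open Matrix

variable {n k : ℕ}

lemma quad_finsetSum_le {ι : Type*} {P : Matrix (Fin n) (Fin n) ℝ} (hP : P.PosSemidef)
    (S : Finset ι) (f : ι → Fin n → ℝ) :
    quad P (∑ j ∈ S, f j) ≤ S.card * ∑ j ∈ S, quad P (f j) := by
  have hsymm : ∀ y z : Fin n → ℝ, y ⬝ᵥ (P *ᵥ z) = z ⬝ᵥ (P *ᵥ y) := fun y z => by
    have : Pᵀ = P := by simpa using hP.isHermitian.eq
    rw [← dotProduct_mulVec_transpose, this, dotProduct_comm]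
  have h1 : ∀ y z : Fin n → ℝ, y ⬝ᵥ (P *ᵥ z) ≤ (quad P y + quad P z) / 2 := by
    intro y z
    have h := quad_nonneg hP (y - z)
    have e : quad P (y - z) = quad P y + quad P z - 2 * (y ⬝ᵥ (P *ᵥ z)) := by
      simp only [quad, mulVec_sub, dotProduct_sub, sub_dotProduct]
      rw [hsymm z y]; ring
    linarith
  calc quad P (∑ j ∈ S, f j) = ∑ j ∈ S, ∑ l ∈ S, f j ⬝ᵥ (P *ᵥ f l) := by
        simp only [quad, mulVec_sum, sum_dotProduct, dotProduct_sum]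
        exact Finset.sum_comm
    _ ≤ ∑ j ∈ S, ∑ l ∈ S, (quad P (f j) + quad P (f l)) / 2 :=
        Finset.sum_le_sum fun j _ => Finset.sum_le_sum fun l _ => h1 _ _
    _ = S.card * ∑ j ∈ S, quad P (f j) := by
        simp only [add_div, Finset.sum_add_distrib, Finset.sum_const, nsmul_eq_mul,
          ← Finset.mul_sum]
        rw [← Finset.sum_div]; ring

/-- The word of the `L` switches from time `j` on. -/
def letters {Ω : Type*} (s : ℕ → Ω → Fin k) (ω : Ω) : ℕ → ℕ → List (Fin k)
  | _, 0 => []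
  | j, L + 1 => s j ω :: letters s ω (j + 1) L

section Letters

variable {Ω : Type*} {s : ℕ → Ω → Fin k} {ω : Ω}

lemma letters_add (j a b : ℕ) :
    letters s ω j (a + b) = letters s ω j a ++ letters s ω (j + a) b := by
  induction a generalizing j with
  | zero => simp [letters]
  | succ a ih =>
    rw [show a + 1 + b = a + b + 1 by ring, letters, letters, ih, List.cons_append]
    rw [show j + 1 + a = j + (a + 1) by ring]

lemma letters_succ (j L : ℕ) : letters s ω j (L + 1) = letters s ω j L ++ [s (j + L) ω] := by
  rw [letters_add]; rfl

end Letters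

namespace SwitchedModel

variable {A : Fin k → Matrix (Fin n) (Fin n) ℝ} {p : Fin k → ℝ}
variable {Ω : Type*} {m0 : MeasurableSpace Ω} {μ : Measure Ω} {α N : ℝ}
  {𝒬 ℋ : Filtration ℕ m0} {x : ℕ → Ω → Fin n → ℝ} {s : ℕ → Ω → Fin k} {w : ℕ → Ω → Fin n → ℝ}

lemma measure_letters_le (hM : SwitchedModel μ A p α N 𝒬 ℋ x s w) (L j : ℕ)
    (B : Set (List (Fin k))) {F : Set Ω} (hF : MeasurableSet[𝒬 j] F) :
    μ (F ∩ {ω | letters s ω j L ∈ B}) ≤ ENNReal.ofReal (wordPr p L B) * μ F := by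
  have hp : ∀ j, 0 ≤ p j := fun j => (hM.prob_pos j).le
  induction L generalizing j B F with
  | zero =>
    by_cases h : [] ∈ B <;> simp [letters, wordPr, wordE, h]
  | succ L ih =>
    have e : F ∩ {ω | letters s ω j (L + 1) ∈ B}
        ⊆ ⋃ c : Fin k, (F ∩ {ω | s j ω = c}) ∩ {ω | letters s ω (j + 1) L ∈ {u | c :: u ∈ B}} := by
      rintro ω ⟨h1, h2⟩
      exact Set.mem_iUnion.2 ⟨s j ω, ⟨h1, rfl⟩, h2⟩
    calc _ ≤ _ := measure_mono e
      _ ≤ ∑ c, μ ((F ∩ {ω | s j ω = c}) ∩ {ω | letters s ω (j + 1) L ∈ {u | c :: u ∈ B}}) :=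
          measure_iUnion_fintype_le _ _
      _ ≤ ∑ c, ENNReal.ofReal (wordPr p L {u | c :: u ∈ B}) * μ (F ∩ {ω | s j ω = c}) :=
          Finset.sum_le_sum fun c _ => ih (j + 1) _
            ((𝒬.mono (Nat.le_succ j) _ hF).inter (hM.le_past j _ (hM.measurableSet_switch j c)))
      _ = ∑ c, ENNReal.ofReal (p c * wordPr p L {u | c :: u ∈ B}) * μ F := by
          refine Finset.sum_congr rfl fun c _ => ?_
          rw [hM.switch_law j c F hF, ← mul_assoc, mul_comm (ENNReal.ofReal (wordPr _ _ _)),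
            ENNReal.ofReal_mul (hp c)]
      _ = _ := by
          rw [← Finset.sum_mul, ← ENNReal.ofReal_sum_of_nonneg fun c _ =>
            mul_nonneg (hp c) (wordPr_nonneg hp _ _)]
          rfl

lemma state_eq_sum (hM : SwitchedModel μ A p α N 𝒬 ℋ x s w) (t : ℕ) (ω : Ω) :
    x t ω = wordMat A (letters s ω 0 t) *ᵥ x 0 ω
      + ∑ j ∈ Finset.range t, wordMat A (letters s ω (j + 1) (t - (j + 1))) *ᵥ w j ω := by
  have hsnoc : ∀ (u : List (Fin k)) (c : Fin k) (z : Fin n → ℝ),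
      wordMat A (u ++ [c]) *ᵥ z = A c *ᵥ (wordMat A u *ᵥ z) := fun u c z => by
    rw [wordMat_append, ← mulVec_mulVec]; simp [wordMat]
  induction t with
  | zero => simp [letters, wordMat]
  | succ t ih =>
    rw [hM.state_succ, ih, mulVec_add, mulVec_sum, Finset.sum_range_succ, letters_succ, hsnoc,
      zero_add, Nat.sub_self]
    have h0 : wordMat A (letters s ω (t + 1) 0) *ᵥ w t ω = w t ω := by simp [letters, wordMat]
    rw [h0, add_assoc]
    congr 2
    refine Finset.sum_congr rfl fun j hj => ?_
    have hj := Finset.mem_range.1 hj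
    rw [← hsnoc, show t + 1 - (j + 1) = t - (j + 1) + 1 by omega, letters_succ,
      show j + 1 + (t - (j + 1)) = t by omega]

/-- The state is a sum of `t + 1` transported vectors, the initial state and the noises; convexity
of the form gives the factor `t + 1`. -/
lemma quad_state_le (hM : SwitchedModel μ A p α N 𝒬 ℋ x s w) {P : Matrix (Fin n) (Fin n) ℝ}
    (hP : P.PosSemidef) {G : ℝ} {t : ℕ} {ω : Ω}
    (hG : ∀ j ≤ t, ∀ z, quad P (wordMat A (letters s ω j (t - j)) *ᵥ z) ≤ G * (z ⬝ᵥ z)) :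
    quad P (x t ω) ≤ (t + 1) * (G * (x 0 ω ⬝ᵥ x 0 ω + ∑ j ∈ Finset.range t, w j ω ⬝ᵥ w j ω)) := by
  have h := quad_finsetSum_le hP (Finset.range (t + 1)) fun j => match j with
    | 0 => wordMat A (letters s ω 0 t) *ᵥ x 0 ω
    | j + 1 => wordMat A (letters s ω (j + 1) (t - (j + 1))) *ᵥ w j ω
  rw [Finset.sum_range_succ', Finset.sum_range_succ', add_comm, ← hM.state_eq_sum,
    Finset.card_range] at h
  push_cast at h
  refine h.trans (mul_le_mul_of_nonneg_left ?_ (by positivity))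
  rw [mul_add, Finset.mul_sum, add_comm (G * _)]
  refine add_le_add (Finset.sum_le_sum fun j hj => hG (j + 1) (Finset.mem_range.1 hj) _) ?_
  exact hG 0 (Nat.zero_le t) _

/-- If no window of switches is bad for `P`, then the regressors are bounded with respect to `P`. -/
lemma sum_quad_regressor_le (hM : SwitchedModel μ A p α N 𝒬 ℋ x s w) {i : Fin k}
    {P : Matrix (Fin n) (Fin n) ℝ} (hP : P.PosSemidef) (hP1 : ∀ z, quad P z ≤ z ⬝ᵥ z) {G : ℝ}
    (hG : 1 ≤ G) {T l : ℕ} {ω : Ω}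
    (hshort : ∀ j < T, letters s ω j l ∉ Amplifies A i P G)
    (hlong : ∀ j < T, ∀ L < T, l ≤ L → letters s ω j L ∉ {u | 1 < spectralNorm (wordMat A u)}) :
    ∑ t ∈ Finset.range T, quad P (regressor x s i ω t)
      ≤ T * (T * (G * (x 0 ω ⬝ᵥ x 0 ω + ∑ j ∈ Finset.range T, w j ω ⬝ᵥ w j ω))) := by
  have hS : ∀ t, 0 ≤ x 0 ω ⬝ᵥ x 0 ω + ∑ j ∈ Finset.range t, w j ω ⬝ᵥ w j ω := fun t =>
    add_nonneg (dotProduct_self_nonneg' _) (Finset.sum_nonneg fun _ _ => dotProduct_self_nonneg' _)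
  calc _ ≤ ∑ t ∈ Finset.range T,
        T * (G * (x 0 ω ⬝ᵥ x 0 ω + ∑ j ∈ Finset.range T, w j ω ⬝ᵥ w j ω)) := by
        refine Finset.sum_le_sum fun t ht => ?_
        have ht := Finset.mem_range.1 ht
        unfold regressor
        split_ifs with hst
        · refine (hM.quad_state_le hP (G := G) fun j hj z => ?_).trans ?_
          -- A window shorter than `l` that ends at a time of mode `i` is a factor of the word of
          -- length `l` from time `j`, which does not amplify `P` beyond `G`. Windows of length at
          -- least `l` contract, and `P` is below the identity.
          · rcases lt_or_ge (t - j) l with hl | hl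
            · have h1 := hshort j (by omega)
              have h2 : letters s ω j (t - j) ++ [i] <:+: letters s ω j l := by
                rw [show l = (t - j + 1) + (l - (t - j + 1)) by omega, letters_add, letters_succ,
                  show j + (t - j) = t by omega, hst]
                exact (List.prefix_append _ _).isInfix
              have h3 : ∀ z, z ⬝ᵥ z ≤ 1 → quad P (wordMat A (letters s ω j (t - j)) *ᵥ z) < G := by
                intro z hz
                by_contra hcon
                exact h1 ⟨_, z, h2, hz, not_lt.1 hcon⟩
              rcases (dotProduct_self_nonneg' z).eq_or_lt with h0 | h0
              · have : z = 0 := dotProduct_self_eq_zero.1 h0.symm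
                simp [this, quad]
              · have h4 := h3 ((√(z ⬝ᵥ z))⁻¹ • z) (by
                  rw [smul_dotProduct, dotProduct_smul, smul_eq_mul, smul_eq_mul, ← mul_assoc,
                    ← mul_inv, Real.mul_self_sqrt h0.le, inv_mul_cancel₀ h0.ne'])
                rw [mulVec_smul, quad_smul_right, inv_pow, Real.sq_sqrt h0.le, inv_mul_lt_iff₀ h0]
                  at h4
                linarith
            · have h1 := hlong j (by omega) (t - j) (by omega) hl
              have h1 : spectralNorm (wordMat A (letters s ω j (t - j))) ≤ 1 := not_lt.1 h1
              refine (hP1 _).trans ((mulVec_self_le _ z).trans ?_)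
              refine mul_le_mul_of_nonneg_right ?_ (dotProduct_self_nonneg' z)
              exact (pow_le_one₀ (spectralNorm_nonneg _) h1).trans hG
          · have h5 : (t + 1 : ℝ) ≤ T := by exact_mod_cast ht
            have h6 : ∑ j ∈ Finset.range t, w j ω ⬝ᵥ w j ω ≤ ∑ j ∈ Finset.range T, w j ω ⬝ᵥ w j ω :=
              Finset.sum_le_sum_of_subset_of_nonneg (Finset.range_mono ht.le)
                fun _ _ _ => dotProduct_self_nonneg' _
            have := hS t
            gcongr
        · have : quad P 0 = 0 := by simp [quad]
          rw [this]
          have := hS T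
          positivity
    _ = _ := by rw [Finset.sum_const, Finset.card_range, nsmul_eq_mul]

end SwitchedModel

end Epoch

/-! ### Choice of scales and Borel–Cantelli for the dyadic epochs. -/

section Epoch

open Matrix

variable {n k : ℕ}

/-- The choice is `a = ρ ^ (-1 / (2 * D))`; rounding in `m / D` costs at most `a ^ (2 * D)`. The
exponent `2 * m` is what beats the tameness threshold: `2 ^ m * (a / 2) ^ m * a⁻¹ ^ (2 * m) = a⁻¹ ^
m`. -/
lemma exists_decay_base {ρ : ℝ} (h0 : 0 < ρ) (h1 : ρ < 1) {D : ℕ} (hD : 1 ≤ D) :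
    ∃ a : ℝ, 1 < a ∧ ∀ m : ℕ, ρ ^ (m / D) ≤ a ^ (2 * D) * (a⁻¹) ^ (2 * m) := by
  have hD0 : (2 * D : ℕ) ≠ 0 := by omega
  set a := (ρ⁻¹) ^ (((2 * D : ℕ) : ℝ)⁻¹) with ha
  have ha1 : 1 < a := Real.one_lt_rpow ((one_lt_inv₀ h0).2 h1) (by positivity)
  have haD : a ^ (2 * D) = ρ⁻¹ := Real.rpow_inv_natCast_pow (inv_nonneg.2 h0.le) hD0
  refine ⟨a, ha1, fun m => ?_⟩
  have e : ρ = (a⁻¹) ^ (2 * D) := by rw [inv_pow, haD, inv_inv]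
  have h2 : ρ ^ (m / D) = a ^ (2 * D) * (a⁻¹) ^ (2 * D * (m / D) + 2 * D) := by
    rw [pow_add, ← e, haD, mul_left_comm, inv_mul_cancel₀ h0.ne', mul_one, pow_mul, ← e]
  rw [h2]
  refine mul_le_mul_of_nonneg_left ?_ (by positivity)
  refine pow_le_pow_of_le_one (by positivity) (inv_le_one_of_one_le₀ ha1.le) ?_
  have := Nat.lt_div_mul_add (a := m) hD
  nlinarith

namespace SwitchedModel

variable {A : Fin k → Matrix (Fin n) (Fin n) ℝ} {p : Fin k → ℝ}
variable {Ω : Type*} {m0 : MeasurableSpace Ω} {μ : Measure Ω} {α N : ℝ}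
  {𝒬 ℋ : Filtration ℕ m0} {x : ℕ → Ω → Fin n → ℝ} {s : ℕ → Ω → Fin k} {w : ℕ → Ω → Fin n → ℝ}

lemma ae_eventually_notMem_of_le {b : ℕ → ℝ}
    (hb : Summable b) {E : ℕ → Set Ω} {M : ℕ} (hE : ∀ m ≥ M, μ (E m) ≤ ENNReal.ofReal (b m)) :
    ∀ᵐ ω ∂μ, ∀ᶠ m in atTop, ω ∉ E m := by
  have h : ∀ᵐ ω ∂μ, ∀ᶠ m in atTop, ω ∉ (if M ≤ m then E m else ∅) := by
    refine ae_eventually_notMem (ne_top_of_le_ne_top hb.tsum_ofReal_ne_top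
      (ENNReal.tsum_le_tsum fun m => ?_))
    split_ifs with hm
    · exact hE m hm
    · simp
  filter_upwards [h] with ω hω
  filter_upwards [hω, eventually_ge_atTop M] with m h1 h2
  rwa [if_pos h2] at h1

variable [IsProbabilityMeasure μ]

/-- Deterministic reference forms for the dyadic epochs: they dominate the inverse Gram matrices,
and the regressors grow only polynomially with respect to them. -/
lemma exists_epoch_forms (hM : SwitchedModel μ A p α N 𝒬 ℋ x s w) (i : Fin k)
    {θ : ℝ} (hθ : 0 < θ) (hθ1 : θ ≤ 1) (hρ : ∑ j, p j * spectralNorm (A j) ^ θ < 1)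
    {c0 : ℝ} (hc0 : 0 < c0) :
    ∃ P : ℕ → Matrix (Fin n) (Fin n) ℝ, (∀ m, (P m).PosDef) ∧
      ∀ᵐ ω ∂μ, (∀ v : Fin n → ℝ, ∀ᶠ T : ℕ in atTop,
          c0 * T * (v ⬝ᵥ v) ≤ ∑ t ∈ Finset.range T, (v ⬝ᵥ w t ω) ^ 2) →
        ∀ᶠ m : ℕ in atTop,
          (∀ z, quad (gram (regressor x s i ω) (2 ^ m))⁻¹ z ≤ 2 * (2 * 2 ^ m) ^ n * quad (P m) z) ∧
          ∑ t ∈ Finset.range (2 ^ (m + 1)), quad (P m) (regressor x s i ω t) ≤ 2 ^ (5 * m) := by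
  have hp : ∀ j, 0 ≤ p j := fun j => (hM.prob_pos j).le
  have h1 := hM.prob_sum
  obtain ⟨D, hD1, hD⟩ : ∃ D : ℕ, 1 ≤ D ∧ ∀ j, spectralNorm (A j) ^ 2 ≤ 2 ^ D := by
    obtain ⟨D, hD⟩ := pow_unbounded_of_one_lt (∑ j, spectralNorm (A j) ^ 2) (one_lt_two (α := ℝ))
    refine ⟨D + 1, by omega, fun j => ?_⟩
    have h2 := Finset.single_le_sum (f := fun j => spectralNorm (A j) ^ 2)
      (fun j _ => sq_nonneg _) (Finset.mem_univ j)
    have h3 : (2 : ℝ) ^ D ≤ 2 ^ (D + 1) := pow_le_pow_right₀ (by norm_num) (by omega)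
    linarith
  set ρ₁ := max (∑ j, p j * spectralNorm (A j) ^ θ) (1 / 2) with hρ₁
  have hρ0 : 0 < ρ₁ := lt_max_of_lt_right (by norm_num)
  have hρ11 : ρ₁ < 1 := max_lt hρ (by norm_num)
  have hlong : ∀ L, wordPr p L {u | 1 < spectralNorm (wordMat A u)} ≤ ρ₁ ^ L := fun L =>
    (wordPr_one_lt_spectralNorm_le A hp hθ.le L).trans (pow_le_pow_left₀
      (Finset.sum_nonneg fun j _ => mul_nonneg (hp j) (Real.rpow_nonneg (spectralNorm_nonneg _) _))
      (le_max_left _ _) L)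
  obtain ⟨a, ha, har⟩ := exists_decay_base hρ0 hρ11 hD1
  -- With blocks of `m / D` letters the growth factor `(2 ^ D) ^ d` stays below `2 ^ m`, while an
  -- expanding block has probability at most `ρ₁ ^ d`. A word of length `d * m` then has expansion
  -- probability at most `(ρ₁ ^ d) ^ m ≤ (1 / 8) ^ m`.
  set d : ℕ → ℕ := fun m => m / D with hd
  set l : ℕ → ℕ := fun m => d m * m with hl
  have hlm : ∀ m, l m ≤ m ^ 2 := fun m => by
    rw [sq]; exact Nat.mul_le_mul_right m (Nat.div_le_self m D)
  have hlr : ∀ m : ℕ, (l m : ℝ) ≤ (m : ℝ) ^ 2 := fun m => by exact_mod_cast hlm m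
  have hai : |a⁻¹| < 1 := by
    rw [abs_of_pos (by positivity)]; exact inv_lt_one_of_one_lt₀ ha
  have hsumm : Summable fun m : ℕ => 2 * a ^ (2 * D) * ((m : ℝ) ^ 2 * (a⁻¹) ^ m) :=
    (summable_pow_mul_geometric_of_norm_lt_one (R := ℝ) 2 (r := a⁻¹)
      (by rwa [Real.norm_eq_abs])).mul_left _
  have hle1 : ∀ m : ℕ, (a⁻¹) ^ (2 * m) ≤ (a⁻¹) ^ m := fun m =>
    pow_le_pow_of_le_one (by positivity) (inv_le_one_of_one_le₀ ha.le) (by omega)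
  obtain ⟨M, hMr⟩ : ∃ M, ∀ m ≥ M, D ≤ m ∧ 2 * (l m * ρ₁ ^ (d m)) ≤ 1 ∧ 8 * ρ₁ ^ (d m) ≤ 1 := by
    have t1 := hsumm.tendsto_atTop_zero
    have t2 := (tendsto_pow_atTop_nhds_zero_of_abs_lt_one hai).const_mul (8 * a ^ (2 * D))
    rw [mul_zero] at t2
    obtain ⟨M, hM⟩ := eventually_atTop.1 ((eventually_ge_atTop D).and
      ((t1.eventually_le_const one_pos).and (t2.eventually_le_const one_pos)))
    refine ⟨M, fun m hm => ⟨(hM m hm).1, ?_, ?_⟩⟩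
    · refine le_trans ?_ (hM m hm).2.1
      calc 2 * (l m * ρ₁ ^ (d m)) ≤ 2 * ((m : ℝ) ^ 2 * (a ^ (2 * D) * (a⁻¹) ^ m)) := by
            gcongr
            · exact hlr m
            · exact (har m).trans (mul_le_mul_of_nonneg_left (hle1 m) (by positivity))
        _ = _ := by ring
    · refine le_trans ?_ (hM m hm).2.2
      rw [mul_assoc]
      gcongr
      exact (har m).trans (mul_le_mul_of_nonneg_left (hle1 m) (by positivity))
  have hbd : ∀ m, ((2 : ℝ) ^ D) ^ (d m) ≤ 2 ^ m := fun m => by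
    rw [← pow_mul]; exact pow_le_pow_right₀ (by norm_num) (Nat.mul_div_le m D)
  have hform : ∀ m, ∃ P : Matrix (Fin n) (Fin n) ℝ, P.PosDef ∧ (M ≤ m →
      P ∈ tameForms A i p (l m) ((a / 2) ^ m) ∧
      ∀ P' ∈ tameForms A i p (l m) ((a / 2) ^ m), ∀ z,
        quad P' z ≤ 2 * (2 * 2 ^ m) ^ n * quad P z) := by
    intro m
    by_cases hm : M ≤ m
    · obtain ⟨P, hP1, hP2, hP3⟩ := exists_reference_form (A := A) (i := i) (l := l m)
        (τ := (a / 2) ^ m) (one_le_pow₀ (by norm_num)) hD hp h1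
        ((Nat.one_le_div_iff (by omega)).2 (hMr m hm).1) (hbd m) (hlong (d m)) (hMr m hm).2.1
        (by positivity)
      exact ⟨P, hP2, fun _ => ⟨hP1, hP3⟩⟩
    · exact ⟨1, PosDef.one, fun h => absurd h hm⟩
  choose P hPd hP using hform
  refine ⟨P, hPd, ?_⟩
  -- Raising the level of the tame form from two to `2 * 2 ^ m` multiplies `(a / 2) ^ m` by at most
  -- a constant times `m ^ 2 * a⁻¹ ^ (2 * m)`. A union bound over `2 ^ (m + 1)` starting times
  -- leaves the summable `m ^ 2 * a⁻¹ ^ m`.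
  have hshortBC : ∀ᵐ ω ∂μ, ∀ᶠ m in atTop, ω ∉ ⋃ j ∈ Finset.range (2 ^ (m + 1)),
      {ω | letters s ω j (l m) ∈ Amplifies A i (P m) (2 * 2 ^ m)} := by
    refine ae_eventually_notMem_of_le hsumm (M := M) fun m hm => ?_
    obtain ⟨hm1, hm2, -⟩ := hMr m hm
    obtain ⟨⟨-, hPm1, hPm2⟩, -⟩ := hP m hm
    have hdrop := wordPr_amplifies_le (i := i) (X := 2 * 2 ^ m) (one_le_pow₀ (by norm_num)) hD hp h1
      hPm1 ((Nat.one_le_div_iff (by omega)).2 hm1)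
      ((hbd m).trans_lt (by linarith [pow_pos (two_pos (α := ℝ)) m])) (hlong (d m)) (l m)
    have h2 : wordPr p (l m) (Amplifies A i (P m) (2 * 2 ^ m / (2 ^ D) ^ d m)) ≤ (a / 2) ^ m := by
      refine (wordPr_mono hp fun u _ hu => Amplifies.mono ?_ hu).trans hPm2
      rw [le_div_iff₀ (by positivity)]
      linarith [hbd m]
    have h3 : wordPr p (l m) (Amplifies A i (P m) (2 * 2 ^ m))
        ≤ (m : ℝ) ^ 2 * (a ^ (2 * D) * (a⁻¹) ^ (2 * m)) * (a / 2) ^ m := by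
      refine hdrop.trans ?_
      have := wordPr_nonneg hp (l m) (Amplifies A i (P m) (2 * 2 ^ m / (2 ^ D) ^ d m))
      gcongr
      · exact hlr m
      · exact har m
    calc _ ≤ ∑ j ∈ Finset.range (2 ^ (m + 1)),
          μ {ω | letters s ω j (l m) ∈ Amplifies A i (P m) (2 * 2 ^ m)} :=
          measure_biUnion_finset_le _ _
      _ ≤ ∑ j ∈ Finset.range (2 ^ (m + 1)),
          ENNReal.ofReal ((m : ℝ) ^ 2 * (a ^ (2 * D) * (a⁻¹) ^ (2 * m)) * (a / 2) ^ m) := by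
          refine Finset.sum_le_sum fun j _ => ?_
          have := hM.measure_letters_le (l m) j (Amplifies A i (P m) (2 * 2 ^ m)) MeasurableSet.univ
          rw [Set.univ_inter, measure_univ, mul_one] at this
          exact this.trans (ENNReal.ofReal_le_ofReal h3)
      _ = ENNReal.ofReal (2 * a ^ (2 * D) * ((m : ℝ) ^ 2 * (a⁻¹) ^ m)) := by
          rw [Finset.sum_const, Finset.card_range, ← ENNReal.ofReal_nsmul, nsmul_eq_mul]
          congr 1
          push_cast
          rw [div_pow, two_mul m, pow_add (a⁻¹), pow_succ (2 : ℝ) m, inv_pow]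
          field_simp
  -- There are `4 ^ (m + 1)` pairs of starting time and length, each expanding with probability at
  -- most `(1 / 8) ^ m`.
  have hlongBC : ∀ᵐ ω ∂μ, ∀ᶠ m in atTop, ω ∉ ⋃ j ∈ Finset.range (2 ^ (m + 1)),
      ⋃ L ∈ Finset.range (2 ^ (m + 1)),
      {ω | l m ≤ L ∧ letters s ω j L ∈ {u | 1 < spectralNorm (wordMat A u)}} := by
    have hs2 : Summable fun m : ℕ => 4 * (1 / 2 : ℝ) ^ m := summable_geometric_two.mul_left 4
    refine ae_eventually_notMem_of_le hs2 (M := M) fun m hm => ?_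
    obtain ⟨-, -, hm3⟩ := hMr m hm
    have h2 : ∀ L, l m ≤ L → ρ₁ ^ L ≤ (1 / 8) ^ m := fun L hL => by
      refine (pow_le_pow_of_le_one hρ0.le hρ11.le hL).trans ?_
      rw [hl, pow_mul]
      exact pow_le_pow_left₀ (by positivity) (by linarith) m
    have h3 : ∀ j L, μ {ω | l m ≤ L ∧ letters s ω j L ∈ {u | 1 < spectralNorm (wordMat A u)}}
        ≤ ENNReal.ofReal ((1 / 8) ^ m) := by
      intro j L
      by_cases hL : l m ≤ L
      · have := hM.measure_letters_le L j {u | 1 < spectralNorm (wordMat A u)} MeasurableSet.univ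
        rw [Set.univ_inter, measure_univ, mul_one] at this
        simp only [hL, true_and]
        exact this.trans (ENNReal.ofReal_le_ofReal ((hlong L).trans (h2 L hL)))
      · simp [hL]
    calc _ ≤ ∑ j ∈ Finset.range (2 ^ (m + 1)), ∑ L ∈ Finset.range (2 ^ (m + 1)),
          ENNReal.ofReal ((1 / 8) ^ m) :=
          (measure_biUnion_finset_le _ _).trans (Finset.sum_le_sum fun j _ =>
            (measure_biUnion_finset_le _ _).trans (Finset.sum_le_sum fun L _ => h3 j L))
      _ = ENNReal.ofReal (4 * (1 / 2 : ℝ) ^ m) := by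
          rw [Finset.sum_const, Finset.sum_const, ← ENNReal.ofReal_nsmul, ← ENNReal.ofReal_nsmul,
            Finset.card_range, nsmul_eq_mul, nsmul_eq_mul]
          congr 1
          push_cast
          rw [show (1 / 8 : ℝ) = 1 / 2 * (1 / 2) * (1 / 2) by norm_num, mul_pow, mul_pow, pow_succ]
          simp only [one_div, inv_pow]
          field_simp
          norm_num
  obtain ⟨x₀, hx₀⟩ := hM.state_zero
  filter_upwards [hM.ae_eventually_inv_gram_mem_tameForms i hθ hθ1 hρ hc0 ha hlm, hshortBC, hlongBC,
    hM.ae_eventually_sum_noise_le (β := 2) (by norm_num) hM.two_lt] with ω hω hsh hlo hnoise hlow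
  have hpow : Tendsto (fun m : ℕ => 2 ^ (m + 1)) atTop atTop :=
    (tendsto_pow_atTop_atTop_of_one_lt one_lt_two).comp (tendsto_add_atTop_nat 1)
  have hbig : ∀ᶠ m : ℕ in atTop, 8 * (x₀ ⬝ᵥ x₀) + 16 * (3 + N) ≤ (2 : ℝ) ^ m :=
    (tendsto_pow_atTop_atTop_of_one_lt one_lt_two).eventually_ge_atTop _
  filter_upwards [hω hlow, hsh, hlo, hpow.eventually hnoise, eventually_ge_atTop M, hbig]
    with m hm1 hm2 hm3 hm4 hm5 hm6
  refine ⟨(hP m hm5).2 _ hm1, ?_⟩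
  have h2m : (1 : ℝ) ≤ 2 ^ m := one_le_pow₀ (by norm_num)
  simp only [Set.mem_iUnion, Finset.mem_range, not_exists, Set.mem_ofPred_eq] at hm2 hm3
  refine (hM.sum_quad_regressor_le (hPd m).posSemidef (hP m hm5).1.2.1 (G := 2 * 2 ^ m)
    (by linarith) (fun j hj => hm2 j hj) (fun j hj L hL hlL hmem => hm3 j hj L hL ⟨hlL, hmem⟩)).trans ?_
  simp only [Real.rpow_two, vnorm_sq] at hm4
  rw [hx₀]
  have hx0 := dotProduct_self_nonneg' x₀
  have hN := hM.moment_nonneg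
  -- Two powers of `2 ^ m` for the number of terms, one for the amplification and one for the energy
  -- of the noise; the fifth absorbs the constants, which may depend on the model because `m` is
  -- large. The exponent five is thus free of `p`.
  calc _ ≤ ((2 ^ (m + 1) : ℕ) : ℝ) * ((2 ^ (m + 1) : ℕ) * (2 * 2 ^ m *
        (x₀ ⬝ᵥ x₀ + (3 + N) * (2 ^ (m + 1) : ℕ)))) := by gcongr
    _ = (2 ^ m) ^ 3 * (8 * (x₀ ⬝ᵥ x₀) + 16 * (3 + N) * 2 ^ m) := by
        push_cast; rw [pow_succ]; ring
    _ ≤ (2 ^ m) ^ 3 * (2 ^ m * 2 ^ m) := by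
        refine mul_le_mul_of_nonneg_left ?_ (by positivity)
        nlinarith
    _ = _ := by rw [mul_comm 5 m, pow_mul]; ring

end SwitchedModel

end Epoch

/-! ### Leverages, predictions and the recursion for the self-normalized sum. -/

section SelfNormalized

open Matrix

variable {n : ℕ}

/-- The Gram matrix `U + ∑ y yᵀ` regularized by `U`. -/
def gramFrom (U : Matrix (Fin n) (Fin n) ℝ) (y : ℕ → Fin n → ℝ) (T : ℕ) :
    Matrix (Fin n) (Fin n) ℝ :=
  U + ∑ t ∈ Finset.range T, vecMulVec (y t) (y t)

/-- The correlation of the noise with the regressors. -/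
def corr (y : ℕ → Fin n → ℝ) (ξ : ℕ → ℝ) (T : ℕ) : Fin n → ℝ :=
  ∑ t ∈ Finset.range T, ξ t • y t

/-- The leverage of the regressor `y t`. -/
noncomputable def leverage (U : Matrix (Fin n) (Fin n) ℝ) (y : ℕ → Fin n → ℝ) (t : ℕ) : ℝ :=
  quad (gramFrom U y t)⁻¹ (y t) / (1 + quad (gramFrom U y t)⁻¹ (y t))

/-- The prediction of the noise at time `t` by the regression on the past. -/
noncomputable def prediction (U : Matrix (Fin n) (Fin n) ℝ) (y : ℕ → Fin n → ℝ) (ξ : ℕ → ℝ)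
    (t : ℕ) : ℝ :=
  (y t ⬝ᵥ ((gramFrom U y t)⁻¹ *ᵥ corr y ξ t)) / (1 + quad (gramFrom U y t)⁻¹ (y t))

section Deterministic

variable {U : Matrix (Fin n) (Fin n) ℝ} (y : ℕ → Fin n → ℝ) (ξ : ℕ → ℝ)

lemma gramFrom_succ (T : ℕ) :
    gramFrom U y (T + 1) = gramFrom U y T + vecMulVec (y T) (y T) := by
  simp [gramFrom, Finset.sum_range_succ, add_assoc]

lemma quad_gramFrom (T : ℕ) (v : Fin n → ℝ) :
    quad (gramFrom U y T) v = quad U v + ∑ t ∈ Finset.range T, (y t ⬝ᵥ v) ^ 2 := by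
  simp [gramFrom, quad_add, quad_sum, quad_vecMulVec]

lemma corr_succ (T : ℕ) : corr y ξ (T + 1) = corr y ξ T + ξ T • y T := by
  simp [corr, Finset.sum_range_succ]

variable (hU : U.PosDef)
include hU

lemma posDef_gramFrom (T : ℕ) : (gramFrom U y T).PosDef :=
  hU.add_posSemidef (posSemidef_sum_vecMulVec y _)

lemma quad_inv_gramFrom_nonneg (T : ℕ) (v : Fin n → ℝ) : 0 ≤ quad (gramFrom U y T)⁻¹ v :=
  quad_nonneg (posDef_gramFrom y hU T).inv.posSemidef v

lemma leverage_nonneg (t : ℕ) : 0 ≤ leverage U y t := by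
  have := quad_inv_gramFrom_nonneg y hU t (y t)
  unfold leverage; positivity

lemma leverage_le_one (t : ℕ) : leverage U y t ≤ 1 := by
  have := quad_inv_gramFrom_nonneg y hU t (y t)
  exact (div_le_one (by positivity)).2 (by linarith)

/-- With `h = quad (gramFrom U y T)⁻¹ (y T)`, the leverage is `1 - 1 / (1 + h) ≤ log (1 + h)`, and
`log (1 + h)` is exactly the increment of `log det`. -/
lemma sum_leverage_le (T : ℕ) : ∑ t ∈ Finset.range T, leverage U y t
    ≤ Real.log (gramFrom U y T).det - Real.log U.det := by
  induction T with
  | zero => simp [gramFrom]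
  | succ T ih =>
    have h0 := quad_inv_gramFrom_nonneg y hU T (y T)
    have h1 : (0 : ℝ) < 1 + quad (gramFrom U y T)⁻¹ (y T) := by positivity
    have h2 := Real.one_sub_inv_le_log_of_pos h1
    have h3 : leverage U y T = 1 - (1 + quad (gramFrom U y T)⁻¹ (y T))⁻¹ := by
      unfold leverage; field_simp; ring
    rw [Finset.sum_range_succ, gramFrom_succ, det_add_vecMulVec (posDef_gramFrom y hU T),
      Real.log_mul (posDef_gramFrom y hU T).det_pos.ne' h1.ne']
    linarith

/-- The determinant is measured relative to `U`, so only the size of the regressors in the form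
`U⁻¹` enters. This is where a well-chosen deterministic `U` replaces the identity. -/
lemma sum_leverage_le_log (T : ℕ) : ∑ t ∈ Finset.range T, leverage U y t
    ≤ n * Real.log (n + ∑ t ∈ Finset.range T, quad U⁻¹ (y t)) := by
  refine (sum_leverage_le y hU T).trans ?_
  have h1 := det_add_le hU (posSemidef_sum_vecMulVec y (Finset.range T))
  have e : (U⁻¹ * ∑ t ∈ Finset.range T, vecMulVec (y t) (y t)).trace
      = ∑ t ∈ Finset.range T, quad U⁻¹ (y t) := by
    rw [Finset.mul_sum, trace_sum]
    exact Finset.sum_congr rfl fun t _ => trace_mul_vecMulVec _ _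
  rw [e] at h1
  set q := (n : ℝ) + ∑ t ∈ Finset.range T, quad U⁻¹ (y t)
  have hd := hU.det_pos
  have hg : 0 < (gramFrom U y T).det := (posDef_gramFrom y hU T).det_pos
  have hq : 0 < q ^ n := by
    by_contra hcon
    have : (gramFrom U y T).det ≤ 0 :=
      h1.trans (mul_nonpos_of_nonneg_of_nonpos hd.le (not_lt.1 hcon))
    linarith
  rw [← Real.log_pow, sub_le_iff_le_add', ← Real.log_mul hd.ne' hq.ne']
  exact Real.log_le_log hg h1

/-- From the exact update `quad_inv_update`, keeping only a coefficient one of the negative square.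
That square is what absorbs the martingale term. -/
lemma quad_inv_corr_succ (T : ℕ) :
    quad (gramFrom U y (T + 1))⁻¹ (corr y ξ (T + 1))
      ≤ quad (gramFrom U y T)⁻¹ (corr y ξ T) - prediction U y ξ T ^ 2
        + 2 * prediction U y ξ T * ξ T + leverage U y T * ξ T ^ 2 := by
  rw [gramFrom_succ, corr_succ, quad_inv_update (posDef_gramFrom y hU T)]
  have h0 := quad_inv_gramFrom_nonneg y hU T (y T)
  unfold prediction leverage
  nlinarith [mul_nonneg h0 (sq_nonneg ((y T ⬝ᵥ ((gramFrom U y T)⁻¹ *ᵥ corr y ξ T))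
    / (1 + quad (gramFrom U y T)⁻¹ (y T))))]

lemma quad_inv_corr_le (T : ℕ) :
    quad (gramFrom U y T)⁻¹ (corr y ξ T)
      ≤ - ∑ t ∈ Finset.range T, prediction U y ξ t ^ 2
        + 2 * ∑ t ∈ Finset.range T, prediction U y ξ t * ξ t
        + ∑ t ∈ Finset.range T, leverage U y t * ξ t ^ 2 := by
  induction T with
  | zero => simp [corr, quad]
  | succ T ih =>
    refine (quad_inv_corr_succ y ξ hU T).trans ?_
    simp only [Finset.sum_range_succ]
    linarith

end Deterministic

section Measurability

variable {Ω : Type*} {m : MeasurableSpace Ω}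

lemma measurable_inv_entry {M : Ω → Matrix (Fin n) (Fin n) ℝ}
    (hM : ∀ a b, Measurable fun ω => M ω a b) (a b : Fin n) :
    Measurable fun ω => (M ω)⁻¹ a b := by
  have hc1 : Continuous fun f : Fin n → Fin n → ℝ => (Matrix.of f).det :=
    Continuous.matrix_det continuous_id
  have hc2 : Continuous fun f : Fin n → Fin n → ℝ => (Matrix.of f).adjugate a b :=
    (Continuous.matrix_adjugate continuous_id).matrix_elem a b
  have hm : Measurable fun ω => (fun a b => M ω a b : Fin n → Fin n → ℝ) :=
    measurable_pi_lambda _ fun a => measurable_pi_lambda _ fun b => hM a b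
  have e : (fun ω => (M ω)⁻¹ a b) = fun ω => (M ω).det⁻¹ * (M ω).adjugate a b := by
    ext ω
    rw [Matrix.inv_def, Ring.inverse_eq_inv', Matrix.smul_apply, smul_eq_mul]
  rw [e]
  exact (hc1.measurable.comp hm).inv.mul (hc2.measurable.comp hm)

lemma measurable_bilin {M : Ω → Matrix (Fin n) (Fin n) ℝ} {u v : Ω → Fin n → ℝ}
    (hM : ∀ a b, Measurable fun ω => M ω a b) (hu : Measurable u) (hv : Measurable v) :
    Measurable fun ω => u ω ⬝ᵥ (M ω *ᵥ v ω) := by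
  simp only [dotProduct, mulVec]
  exact Finset.measurable_sum _ fun a _ => ((measurable_pi_apply a).comp hu).mul
    (Finset.measurable_sum _ fun b _ => (hM a b).mul ((measurable_pi_apply b).comp hv))

variable {U : Matrix (Fin n) (Fin n) ℝ} {y : Ω → ℕ → Fin n → ℝ} {ξ : ℕ → Ω → ℝ} {T : ℕ}

lemma measurable_gramFrom (hy : ∀ t < T, Measurable fun ω => y ω t) (a b : Fin n) :
    Measurable fun ω => gramFrom U (y ω) T a b := by
  simp only [gramFrom, Matrix.add_apply, Matrix.sum_apply, vecMulVec_apply]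
  exact measurable_const.add (Finset.measurable_sum _ fun t ht =>
    ((measurable_pi_apply a).comp (hy t (Finset.mem_range.1 ht))).mul
      ((measurable_pi_apply b).comp (hy t (Finset.mem_range.1 ht))))

lemma measurable_corr (hy : ∀ t < T, Measurable fun ω => y ω t) (hξ : ∀ t < T, Measurable (ξ t)) :
    Measurable fun ω => corr (y ω) (fun t => ξ t ω) T := by
  simp only [corr]
  exact Finset.measurable_sum _ fun t ht =>
    (hξ t (Finset.mem_range.1 ht)).smul (hy t (Finset.mem_range.1 ht))

lemma measurable_quad_inv_corr (hy : ∀ t < T, Measurable fun ω => y ω t)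
    (hξ : ∀ t < T, Measurable (ξ t)) :
    Measurable fun ω => quad (gramFrom U (y ω) T)⁻¹ (corr (y ω) (fun t => ξ t ω) T) :=
  measurable_bilin (measurable_inv_entry (measurable_gramFrom hy)) (measurable_corr hy hξ)
    (measurable_corr hy hξ)

lemma measurable_leverage (hy : ∀ t ≤ T, Measurable fun ω => y ω t) :
    Measurable fun ω => leverage U (y ω) T := by
  have h := measurable_bilin (measurable_inv_entry (measurable_gramFrom (U := U)
    fun t ht => hy t (le_of_lt ht))) (hy T le_rfl) (hy T le_rfl)
  exact h.div (measurable_const.add h)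

lemma measurable_prediction (hy : ∀ t ≤ T, Measurable fun ω => y ω t)
    (hξ : ∀ t < T, Measurable (ξ t)) :
    Measurable fun ω => prediction U (y ω) (fun t => ξ t ω) T := by
  have h := measurable_inv_entry (measurable_gramFrom (U := U) fun t ht => hy t (le_of_lt ht))
  exact (measurable_bilin h (hy T le_rfl)
    (measurable_corr (fun t ht => hy t (le_of_lt ht)) hξ)).div
    (measurable_const.add (measurable_bilin h (hy T le_rfl) (hy T le_rfl)))

end Measurability

end SelfNormalized

/-! ### Exponential supermartingale and almost sure bounds for self-normalized sums. -/

section SelfNormalized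

open Matrix

/-- With `c = 1 / (60 * b ^ 2)` one has `c * w ^ 2 ≤ 1 / 60`. If `c * Y ^ 2 ≤ 1 / 4` the exponent is
at most one in absolute value, and `exp u ≤ 1 + u + u ^ 2` applies, the term `-c * Y ^ 2` paying for
the square. If `c * Y ^ 2` is larger, the negative square already dominates the linear term, whose
coefficient may then be set to zero; this keeps that coefficient bounded, hence integrable. -/
lemma exp_step_le {b w Y l : ℝ} (hb : 0 < b) (hw : |w| ≤ b) (hl0 : 0 ≤ l) (hl1 : l ≤ 1) :
    Real.exp ((60 * b ^ 2)⁻¹ * (-Y ^ 2 + 2 * Y * w + l * w ^ 2))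
      ≤ 1 + (if (60 * b ^ 2)⁻¹ * Y ^ 2 ≤ 1 / 4 then 2 * (60 * b ^ 2)⁻¹ * Y else 0) * w
        + 2 * (60 * b ^ 2)⁻¹ * l * w ^ 2 := by
  set c := (60 * b ^ 2)⁻¹ with hc
  have hc0 : 0 < c := by positivity
  have hcw : c * w ^ 2 ≤ 1 / 60 := by
    have h1 : w ^ 2 ≤ b ^ 2 := sq_le_sq' (by linarith [abs_le.1 hw]) (abs_le.1 hw).2
    rw [hc, inv_mul_le_iff₀ (by positivity)]; linarith
  have hcw0 : 0 ≤ c * w ^ 2 := by positivity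
  set a := c * Y ^ 2 with ha
  set d := 2 * c * Y * w with hd
  set e := c * (l * w ^ 2) with he
  have ha0 : 0 ≤ a := by positivity
  have he0 : 0 ≤ e := by positivity
  have he1 : e ≤ 1 / 60 := by
    have : e = l * (c * w ^ 2) := by rw [he]; ring
    nlinarith
  have hd2 : d ^ 2 ≤ a / 15 := by
    have : d ^ 2 = 4 * a * (c * w ^ 2) := by rw [hd, ha]; ring
    nlinarith
  have hu : c * (-Y ^ 2 + 2 * Y * w + l * w ^ 2) = -a + d + e := by rw [ha, hd, he]; ring
  rw [hu]
  have hexp : ∀ u : ℝ, |u| ≤ 1 → Real.exp u ≤ 1 + u + u ^ 2 := fun u h => by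
    linarith [(abs_le.1 (Real.abs_exp_sub_one_sub_id_le h)).2]
  split_ifs with h
  · have hd1 : |d| ≤ 1 / 2 := abs_le_of_sq_le_sq (by nlinarith) (by norm_num)
    have h1 : |-a + d + e| ≤ 1 := by
      rw [abs_le] at hd1 ⊢; constructor <;> linarith
    have h2 : (-a + d + e) ^ 2 ≤ 3 * (a ^ 2 + d ^ 2 + e ^ 2) := by
      nlinarith [sq_nonneg (a + d), sq_nonneg (d - e), sq_nonneg (a + e)]
    have h3 := hexp _ h1
    have h4 : (2 * c * Y) * w = d := rfl
    have h5 : 2 * c * l * w ^ 2 = 2 * e := by rw [he]; ring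
    rw [h4, h5]
    nlinarith
  · have h1 : d ≤ a := by
      have := abs_le_of_sq_le_sq (a := d) (b := a) (by nlinarith) ha0
      exact (le_abs_self d).trans this
    have h2 : Real.exp (-a + d + e) ≤ Real.exp e := Real.exp_le_exp.2 (by linarith)
    have h3 := hexp e (by rw [abs_of_nonneg he0]; linarith)
    have h5 : 2 * c * l * w ^ 2 = 2 * e := by rw [he]; ring
    rw [h5]
    nlinarith

section Conditional

variable {Ω : Type*} {m m0 : MeasurableSpace Ω} {μ : Measure Ω}

lemma CondBound.integral_mul_le (hm : m ≤ m0) {ξ : Ω → ℝ} (hξ : Measurable ξ) (hξ0 : ∀ ω, 0 ≤ ξ ω)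
    {c : ℝ} (hc : 0 ≤ c)
    (h : CondBound m μ (fun ω => ENNReal.ofReal (ξ ω)) (ENNReal.ofReal c)) {Y : Ω → ℝ}
    (hY : Measurable[m] Y) (hY0 : ∀ ω, 0 ≤ Y ω) (hYi : Integrable Y μ) :
    ∫ ω, Y ω * ξ ω ∂μ ≤ c * ∫ ω, Y ω ∂μ := by
  have h1 := h.lintegral_mul_le hm hξ.ennreal_ofReal (hY.ennreal_ofReal)
  have h2 : ∫ ω, Y ω * ξ ω ∂μ = (∫⁻ ω, ENNReal.ofReal (Y ω) * ENNReal.ofReal (ξ ω) ∂μ).toReal := by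
    rw [integral_eq_lintegral_of_nonneg_ae (ae_of_all _ fun ω => mul_nonneg (hY0 ω) (hξ0 ω))
      (((hY.mono hm le_rfl).mul hξ).aestronglyMeasurable)]
    simp_rw [ENNReal.ofReal_mul (hY0 _)]
  have h3 : ∫ ω, Y ω ∂μ = (∫⁻ ω, ENNReal.ofReal (Y ω) ∂μ).toReal :=
    integral_eq_lintegral_of_nonneg_ae (ae_of_all _ hY0)
      (hY.mono hm le_rfl).aestronglyMeasurable
  have h4 : ∫⁻ ω, ENNReal.ofReal (Y ω) ∂μ ≠ ⊤ := by
    have := (hasFiniteIntegral_iff_ofReal (ae_of_all μ hY0)).1 hYi.2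
    exact this.ne
  rw [h2, h3]
  have := ENNReal.toReal_mono (ENNReal.mul_ne_top ENNReal.ofReal_ne_top h4) h1
  rwa [ENNReal.toReal_mul, ENNReal.toReal_ofReal hc] at this

lemma integrable_of_abs_le [IsFiniteMeasure μ] {f : Ω → ℝ} (hf : Measurable f) {c : ℝ}
    (h : ∀ ω, |f ω| ≤ c) : Integrable f μ :=
  Integrable.of_bound hf.aestronglyMeasurable c (ae_of_all _ h)

/-- After `exp_step_le` the linear term has conditional mean zero and the quadratic one at most `2 *
c * N * l`. The factor `ψ = exp (-2 * c * N * l)` compensates, since `ψ * (1 + 2 * c * N * l) ≤ 1`.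
-/
lemma condBound_exp_step [IsProbabilityMeasure μ] (hm : m ≤ m0) {w Y l : Ω → ℝ} (hw : Measurable w)
    {b : ℝ} (hb : 0 < b) (hwb : ∀ ω, |w ω| ≤ b) (hc : μ[w | m] =ᵐ[μ] 0) {N : ℝ} (hN0 : 0 ≤ N)
    (hN : CondBound m μ (fun ω => ENNReal.ofReal (w ω ^ 2)) (ENNReal.ofReal N))
    (hY : Measurable[m] Y) (hl : Measurable[m] l) (hl0 : ∀ ω, 0 ≤ l ω) (hl1 : ∀ ω, l ω ≤ 1) :
    CondBound m μ (fun ω => ENNReal.ofReal (Real.exp ((60 * b ^ 2)⁻¹ *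
      (-Y ω ^ 2 + 2 * Y ω * w ω + l ω * w ω ^ 2 - 2 * N * l ω)))) 1 := by
  classical
  intro F hF
  set c := (60 * b ^ 2)⁻¹ with hcd
  have hc0 : 0 < c := by positivity
  set I : Ω → ℝ := F.indicator fun _ => 1 with hI
  have hIm : Measurable[m] I := measurable_const.indicator hF
  have hI0 : ∀ ω, 0 ≤ I ω := fun ω => Set.indicator_nonneg (fun _ _ => zero_le_one) ω
  have hI1 : ∀ ω, I ω ≤ 1 := fun ω => Set.indicator_le_self' (fun _ _ => zero_le_one) ω |>.trans le_rfl
  set ψ : Ω → ℝ := fun ω => Real.exp (c * (-(2 * N * l ω))) with hψ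
  have hψm : Measurable[m] ψ := Real.measurable_exp.comp ((hl.const_mul (2 * N)).neg.const_mul c)
  have hψ0 : ∀ ω, 0 < ψ ω := fun ω => Real.exp_pos _
  have hψ1 : ∀ ω, ψ ω ≤ 1 := fun ω => Real.exp_le_one_iff.2 (by
    have := mul_nonneg hc0.le (mul_nonneg (mul_nonneg zero_le_two hN0) (hl0 ω)); linarith)
  set g : Ω → ℝ := fun ω => if c * Y ω ^ 2 ≤ 1 / 4 then 2 * c * Y ω else 0 with hg
  have hgm : Measurable[m] g :=
    Measurable.ite (measurableSet_le ((hY.pow_const 2).const_mul c) measurable_const)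
      (hY.const_mul _) measurable_const
  have hgb : ∀ ω, |g ω| ≤ c + 1 := fun ω => by
    simp only [hg]
    split_ifs with h
    · refine abs_le_of_sq_le_sq ?_ (by positivity)
      have : (2 * c * Y ω) ^ 2 = 4 * c * (c * Y ω ^ 2) := by ring
      nlinarith
    · simp; positivity
  have hφ0 : ∀ ω, 0 ≤ I ω * ψ ω := fun ω => mul_nonneg (hI0 ω) (hψ0 ω).le
  have hφ1 : ∀ ω, I ω * ψ ω ≤ 1 := fun ω => mul_le_one₀ (hI1 ω) (hψ0 ω).le (hψ1 ω)
  have hφm : Measurable[m] fun ω => I ω * ψ ω := hIm.mul hψm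
  have i1 : Integrable (fun ω => I ω * ψ ω) μ :=
    integrable_of_abs_le (hφm.mono hm le_rfl) (c := 1) fun ω => by
      rw [abs_of_nonneg (hφ0 ω)]; exact hφ1 ω
  have m2 : Measurable[m] fun ω => I ω * ψ ω * g ω := hφm.mul hgm
  have i2 : Integrable (fun ω => I ω * ψ ω * g ω * w ω) μ :=
    integrable_of_abs_le ((m2.mono hm le_rfl).mul hw) (c := 1 * (c + 1) * b) fun ω => by
      rw [abs_mul, abs_mul, abs_of_nonneg (hφ0 ω)]
      have := hφ1 ω; have := hgb ω; have := hwb ω; have := hφ0 ω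
      gcongr
  have m3 : Measurable[m] fun ω => I ω * ψ ω * (2 * c * l ω) := hφm.mul (hl.const_mul _)
  have n3 : ∀ ω, 0 ≤ I ω * ψ ω * (2 * c * l ω) := fun ω =>
    mul_nonneg (hφ0 ω) (mul_nonneg (by positivity) (hl0 ω))
  have b3 : ∀ ω, I ω * ψ ω * (2 * c * l ω) ≤ 1 * (2 * c * 1) := fun ω => by
    have := hφ1 ω; have := hl1 ω; have := hl0 ω
    gcongr
  have j3 : Integrable (fun ω => I ω * ψ ω * (2 * c * l ω)) μ :=
    integrable_of_abs_le (m3.mono hm le_rfl) (c := 1 * (2 * c * 1)) fun ω => by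
      rw [abs_of_nonneg (n3 ω)]; exact b3 ω
  have i3 : Integrable (fun ω => I ω * ψ ω * (2 * c * l ω) * w ω ^ 2) μ :=
    integrable_of_abs_le ((m3.mono hm le_rfl).mul (hw.pow_const 2)) (c := 1 * (2 * c * 1) * b ^ 2)
      fun ω => by
        rw [abs_mul, abs_of_nonneg (n3 ω), abs_pow]
        have := b3 ω; have := hwb ω
        gcongr
  set H : Ω → ℝ := fun ω => I ω * ψ ω + I ω * ψ ω * g ω * w ω
    + I ω * ψ ω * (2 * c * l ω) * w ω ^ 2 with hH
  have hHi : Integrable H μ := (i1.add i2).add i3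
  have hpt : ∀ ω, F.indicator (fun ω => Real.exp (c *
      (-Y ω ^ 2 + 2 * Y ω * w ω + l ω * w ω ^ 2 - 2 * N * l ω))) ω ≤ H ω := by
    intro ω
    have e1 : Real.exp (c * (-Y ω ^ 2 + 2 * Y ω * w ω + l ω * w ω ^ 2 - 2 * N * l ω))
        = ψ ω * Real.exp (c * (-Y ω ^ 2 + 2 * Y ω * w ω + l ω * w ω ^ 2)) := by
      rw [hψ, ← Real.exp_add]; congr 1; ring
    have e2 : F.indicator (fun ω => Real.exp (c *
        (-Y ω ^ 2 + 2 * Y ω * w ω + l ω * w ω ^ 2 - 2 * N * l ω))) ω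
        = I ω * (ψ ω * Real.exp (c * (-Y ω ^ 2 + 2 * Y ω * w ω + l ω * w ω ^ 2))) := by
      by_cases h : ω ∈ F
      · rw [Set.indicator_of_mem h, hI, Set.indicator_of_mem h, e1, one_mul]
      · rw [Set.indicator_of_notMem h, hI, Set.indicator_of_notMem h, zero_mul]
    rw [e2, ← mul_assoc]
    refine (mul_le_mul_of_nonneg_left (exp_step_le hb (hwb ω) (hl0 ω) (hl1 ω)) (hφ0 ω)).trans
      (le_of_eq ?_)
    simp only [hH, hg]; ring
  have hfin : ∫ ω, H ω ∂μ ≤ μ.real F := by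
    have s1 : ∫ ω, H ω ∂μ = ∫ ω, I ω * ψ ω ∂μ + ∫ ω, I ω * ψ ω * g ω * w ω ∂μ
        + ∫ ω, I ω * ψ ω * (2 * c * l ω) * w ω ^ 2 ∂μ := by
      rw [hH, integral_add (show Integrable (fun ω => I ω * ψ ω + I ω * ψ ω * g ω * w ω) μ from
        i1.add i2) i3, integral_add i1 i2]
    have s2 := integral_mul_eq_zero_of_condExp hm (integrable_of_abs_le (μ := μ) hw hwb) hc
      m2.stronglyMeasurable i2
    have s3 := hN.integral_mul_le hm (hw.pow_const 2) (fun ω => sq_nonneg _) hN0 m3 n3 j3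
    rw [s1, s2, add_zero]
    calc _ ≤ ∫ ω, I ω * ψ ω ∂μ + N * ∫ ω, I ω * ψ ω * (2 * c * l ω) ∂μ := by linarith
      _ = ∫ ω, (I ω * ψ ω + N * (I ω * ψ ω * (2 * c * l ω))) ∂μ := by
          rw [integral_add i1 (j3.const_mul N), integral_const_mul]
      _ ≤ ∫ ω, I ω ∂μ := by
          refine integral_mono (i1.add (j3.const_mul N)) (integrable_of_abs_le (hIm.mono hm le_rfl)
            (c := 1) fun ω => by rw [abs_of_nonneg (hI0 ω)]; exact hI1 ω) fun ω => ?_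
          have h1 := Real.add_one_le_exp (c * (2 * N * l ω))
          have h2 : ψ ω * Real.exp (c * (2 * N * l ω)) = 1 := by
            rw [hψ, ← Real.exp_add]; simp
          have h3 : ψ ω * (c * (2 * N * l ω) + 1) ≤ 1 :=
            (mul_le_mul_of_nonneg_left h1 (hψ0 ω).le).trans h2.le
          calc I ω * ψ ω + N * (I ω * ψ ω * (2 * c * l ω))
              = I ω * (ψ ω * (c * (2 * N * l ω) + 1)) := by ring
            _ ≤ I ω := mul_le_of_le_one_right (hI0 ω) h3
      _ = μ.real F := by rw [hI, integral_indicator (hm F hF)]; simp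
  calc _ = ∫⁻ ω, ENNReal.ofReal (F.indicator (fun ω => Real.exp (c *
        (-Y ω ^ 2 + 2 * Y ω * w ω + l ω * w ω ^ 2 - 2 * N * l ω))) ω) ∂μ := by
        rw [← lintegral_indicator (hm F hF)]
        refine lintegral_congr fun ω => ?_
        by_cases h : ω ∈ F
        · rw [Set.indicator_of_mem h, Set.indicator_of_mem h]
        · rw [Set.indicator_of_notMem h, Set.indicator_of_notMem h, ENNReal.ofReal_zero]
    _ ≤ ∫⁻ ω, ENNReal.ofReal (H ω) ∂μ := lintegral_mono fun ω => ENNReal.ofReal_le_ofReal (hpt ω)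
    _ = ENNReal.ofReal (∫ ω, H ω ∂μ) := by
        refine (ofReal_integral_eq_lintegral_ofReal hHi (ae_of_all _ fun ω => ?_)).symm
        exact (Set.indicator_nonneg (fun _ _ => (Real.exp_pos _).le) ω).trans (hpt ω)
    _ ≤ ENNReal.ofReal (μ.real F) := ENNReal.ofReal_le_ofReal hfin
    _ = 1 * μ F := by rw [ofReal_measureReal, one_mul]

end Conditional

variable {n : ℕ} {Ω : Type*} {m0 : MeasurableSpace Ω} {μ : Measure Ω} [IsProbabilityMeasure μ]
  {𝒢 : Filtration ℕ m0} {y : Ω → ℕ → Fin n → ℝ} {ξ : ℕ → Ω → ℝ}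

/-- The exponential tail of a self-normalized martingale with bounded increments. -/
lemma measure_selfNormalized_le (hy : ∀ t, Measurable[𝒢 t] fun ω => y ω t)
    (hξ : ∀ t, Measurable[𝒢 (t + 1)] (ξ t)) {b : ℝ} (hb : 0 < b) (hξb : ∀ t ω, |ξ t ω| ≤ b)
    (hc : ∀ t, μ[ξ t | 𝒢 t] =ᵐ[μ] 0) {N : ℝ} (hN0 : 0 ≤ N)
    (hN : ∀ t, CondBound (𝒢 t) μ (fun ω => ENNReal.ofReal (ξ t ω ^ 2)) (ENNReal.ofReal N))
    {U : Matrix (Fin n) (Fin n) ℝ} (hU : U.PosDef) (R : ℝ) :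
    μ {ω | ∃ T, R + 2 * N * ∑ t ∈ Finset.range T, leverage U (y ω) t
        ≤ quad (gramFrom U (y ω) T)⁻¹ (corr (y ω) (fun t => ξ t ω) T)}
      ≤ ENNReal.ofReal (Real.exp (-((60 * b ^ 2)⁻¹ * R))) := by
  set c := (60 * b ^ 2)⁻¹ with hcd
  have hc0 : 0 < c := by positivity
  set Q : ℕ → Ω → ℝ := fun T ω => quad (gramFrom U (y ω) T)⁻¹ (corr (y ω) (fun t => ξ t ω) T)
    with hQ
  set Z : ℕ → Ω → ℝ≥0∞ := fun T ω => ENNReal.ofReal (Real.exp (c * (Q T ω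
    - 2 * N * ∑ t ∈ Finset.range T, leverage U (y ω) t))) with hZ
  have hy' : ∀ {t T}, t ≤ T → Measurable[𝒢 T] fun ω => y ω t := fun h =>
    (hy _).mono (𝒢.mono h) le_rfl
  have hξ' : ∀ {t T}, t < T → Measurable[𝒢 T] (ξ t) := fun h =>
    (hξ _).mono (𝒢.mono h) le_rfl
  have hlm : ∀ t, Measurable[𝒢 t] fun ω => leverage U (y ω) t := fun t =>
    measurable_leverage fun r hr => hy' hr
  have hYm : ∀ t, Measurable[𝒢 t] fun ω => prediction U (y ω) (fun t => ξ t ω) t := fun t =>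
    measurable_prediction (fun r hr => hy' hr) fun r hr => hξ' hr
  have hZm : ∀ T, Measurable[𝒢 T] (Z T) := fun T => by
    refine (Real.measurable_exp.comp (Measurable.const_mul (Measurable.sub ?_ ?_) c)).ennreal_ofReal
    · exact measurable_quad_inv_corr (fun t ht => hy' (le_of_lt ht)) fun t ht => hξ' ht
    · exact (Finset.measurable_sum _ fun t ht =>
        (hlm t).mono (𝒢.mono (Finset.mem_range.1 ht).le) le_rfl).const_mul _
  have hstep := fun T => condBound_exp_step (𝒢.le T) ((hξ T).mono (𝒢.le _) le_rfl) hb (hξb T) (hc T)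
    hN0 (hN T) (hYm T) (hlm T) (fun ω => leverage_nonneg (y ω) hU T)
    fun ω => leverage_le_one (y ω) hU T
  have hsm : ∀ T, Measurable fun ω => ENNReal.ofReal (Real.exp (c *
      (-prediction U (y ω) (fun t => ξ t ω) T ^ 2 + 2 * prediction U (y ω) (fun t => ξ t ω) T * ξ T ω
        + leverage U (y ω) T * ξ T ω ^ 2 - 2 * N * leverage U (y ω) T))) := fun T => by
    have h1 := (hYm T).mono (𝒢.le T) le_rfl
    have h2 := (hlm T).mono (𝒢.le T) le_rfl
    have h3 := (hξ T).mono (𝒢.le _) le_rfl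
    exact (Real.measurable_exp.comp ((((((h1.pow_const 2).neg).add ((h1.const_mul 2).mul h3)).add
      (h2.mul (h3.pow_const 2))).sub (h2.const_mul _)).const_mul c)).ennreal_ofReal
  have hZstep : ∀ T ω, Z (T + 1) ω ≤ Z T ω * ENNReal.ofReal (Real.exp (c *
      (-prediction U (y ω) (fun t => ξ t ω) T ^ 2 + 2 * prediction U (y ω) (fun t => ξ t ω) T * ξ T ω
        + leverage U (y ω) T * ξ T ω ^ 2 - 2 * N * leverage U (y ω) T))) := fun T ω => by
    simp only [hZ]
    rw [← ENNReal.ofReal_mul (Real.exp_pos _).le, ← Real.exp_add]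
    refine ENNReal.ofReal_le_ofReal (Real.exp_le_exp.2 ?_)
    rw [← mul_add]
    refine mul_le_mul_of_nonneg_left ?_ hc0.le
    have := quad_inv_corr_succ (y ω) (fun t => ξ t ω) hU T
    rw [Finset.sum_range_succ]
    simp only [hQ]
    linarith
  have hsup : ∀ T F, MeasurableSet[𝒢 T] F → ∫⁻ ω in F, Z (T + 1) ω ∂μ ≤ ∫⁻ ω in F, Z T ω ∂μ := by
    intro T F hF
    have hFm := 𝒢.le T F hF
    have h1 := (hstep T).lintegral_mul_le (𝒢.le T) (hsm T) ((hZm T).indicator hF)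
    rw [one_mul, lintegral_indicator hFm] at h1
    refine le_trans ?_ h1
    rw [← lintegral_indicator hFm]
    refine lintegral_mono fun ω => ?_
    by_cases h : ω ∈ F
    · simp only [Set.indicator_of_mem h]; exact hZstep T ω
    · simp [Set.indicator_of_notMem h]
  -- The supermartingale starts at one, because `corr` vanishes at time zero.
  have hv := ville hZm hsup (ENNReal.ofReal (Real.exp (c * R)))
  have hZ0 : ∫⁻ ω, Z 0 ω ∂μ = 1 := by simp [hZ, hQ, corr, quad]
  rw [hZ0] at hv
  have hsub : {ω | ∃ T, R + 2 * N * ∑ t ∈ Finset.range T, leverage U (y ω) t ≤ Q T ω}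
      ⊆ {ω | ∃ T, ENNReal.ofReal (Real.exp (c * R)) ≤ Z T ω} := by
    rintro ω ⟨T, hT⟩
    refine ⟨T, ENNReal.ofReal_le_ofReal (Real.exp_le_exp.2 (mul_le_mul_of_nonneg_left ?_ hc0.le))⟩
    linarith
  refine (measure_mono hsub).trans ?_
  rw [Real.exp_neg, ENNReal.ofReal_inv_of_pos (Real.exp_pos _), ENNReal.le_inv_iff_mul_le, mul_comm]
  exact hv

/-- A self-normalized martingale is controlled by the conditional second moment of the noise. -/
lemma ae_quad_inv_corr_le (hy : ∀ t, Measurable[𝒢 t] fun ω => y ω t)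
    (hξ : ∀ t, Measurable[𝒢 (t + 1)] (ξ t)) (hξi : ∀ t, Integrable (ξ t) μ)
    (hc : ∀ t, μ[ξ t | 𝒢 t] =ᵐ[μ] 0) {M N γ : ℝ} (hM0 : 0 ≤ M) (hγ : 1 < γ) (hγ2 : γ ≤ 2)
    (hM : ∀ t, CondBound (𝒢 t) μ (fun ω => ENNReal.ofReal (ξ t ω ^ 2)) (ENNReal.ofReal M))
    (hN : ∀ t, CondBound (𝒢 t) μ (fun ω => ENNReal.ofReal ((ξ t ω ^ 2) ^ γ)) (ENNReal.ofReal N))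
    {U : Matrix (Fin n) (Fin n) ℝ} (hU : U.PosDef) :
    ∀ᵐ ω ∂μ, ∀ δ > 0, ∃ K, ∀ T,
      quad (gramFrom U (y ω) T)⁻¹ (corr (y ω) (fun t => ξ t ω) T)
        ≤ (M + δ) * (1 + ∑ t ∈ Finset.range T, leverage U (y ω) t) + K := by
  have hy' : ∀ {t T}, t ≤ T → Measurable[𝒢 T] fun ω => y ω t := fun h =>
    (hy _).mono (𝒢.mono h) le_rfl
  have hξ' : ∀ {t T}, t < T → Measurable[𝒢 T] (ξ t) := fun h =>
    (hξ _).mono (𝒢.mono h) le_rfl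
  have h1 := ae_abs_sum_mul_le_sq (𝒢 := 𝒢) (μ := μ)
    (y := fun t ω => prediction U (y ω) (fun t => ξ t ω) t) (ζ := ξ)
    (fun t => (measurable_prediction (fun r hr => hy' hr) fun r hr => hξ' hr).stronglyMeasurable)
    (fun t => (hξ t).stronglyMeasurable) hξi hc hM
  have h2 := ae_sum_mul_le (𝒢 := 𝒢) (μ := μ) (a := fun t ω => leverage U (y ω) t)
    (ξ := fun t ω => ξ t ω ^ 2)
    (fun t => (measurable_leverage fun r hr => hy' hr).stronglyMeasurable)
    (fun t ω => leverage_nonneg (y ω) hU t) (fun t ω => leverage_le_one (y ω) hU t)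
    (fun t => ((hξ t).pow_const 2).stronglyMeasurable) (fun t ω => sq_nonneg _) hM0 hγ hγ2 hM hN
  filter_upwards [h1, h2] with ω h1 h2 δ hδ
  -- The martingale term appears twice in the recursion, so half of the sum of squared predictions
  -- is exactly what the negative sum can absorb.
  obtain ⟨K1, hK1⟩ := h1 (1 / 2) (by norm_num)
  obtain ⟨K2, hK2⟩ := h2 δ hδ
  refine ⟨1 + 2 * K1 + K2, fun T => ?_⟩
  have := quad_inv_corr_le (y ω) (fun t => ξ t ω) hU T
  have h3 := (le_abs_self _).trans (hK1 T)
  have h4 := hK2 T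
  linarith

end SelfNormalized

/-! ### Splitting the noise into a bounded part and a part of small conditional variance. -/

section Truncation

open Matrix

section Conditional

variable {Ω : Type*} {m m0 : MeasurableSpace Ω} {μ : Measure Ω}

/-- A bounded version of the conditional expectation of a bounded function. -/
lemma exists_bounded_condExp {a : Ω → ℝ} {B : ℝ} (hB : 0 ≤ B)
    (ha : ∀ ω, |a ω| ≤ B) :
    ∃ b : Ω → ℝ, Measurable[m] b ∧ (∀ ω, |b ω| ≤ B) ∧ b =ᵐ[μ] μ[a | m] := by
  have h := ae_bdd_abs_condExp_of_ae_bdd_abs (m := m) (μ := μ) (R := B) (f := a) (ae_of_all _ ha)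
  refine ⟨fun ω => max (-B) (min B ((μ[a | m]) ω)), ?_, fun ω => ?_, ?_⟩
  · exact measurable_const.max (measurable_const.min stronglyMeasurable_condExp.measurable)
  · rw [abs_le]
    exact ⟨le_max_left _ _, max_le (by linarith) (min_le_left _ _)⟩
  · filter_upwards [h] with ω h
    rw [abs_le] at h
    rw [min_eq_right h.2, max_eq_right h.1]

variable [IsProbabilityMeasure μ]

/-- Centering does not increase the conditional second moment. -/
lemma CondBound.sub_condExp (hm : m ≤ m0) {a b : Ω → ℝ} (ha : MemLp a 2 μ)
    (hb : Measurable[m] b) {B : ℝ} (hbB : ∀ ω, |b ω| ≤ B) (hba : b =ᵐ[μ] μ[a | m]) {c : ℝ≥0∞}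
    (hc : CondBound m μ (fun ω => ENNReal.ofReal (a ω ^ 2)) c) :
    CondBound m μ (fun ω => ENNReal.ofReal ((a ω - b ω) ^ 2)) c := by
  intro F hF
  refine le_trans ?_ (hc F hF)
  have hFm := hm F hF
  have hai : Integrable a μ := ha.integrable (by norm_num)
  have hbm : Measurable b := hb.mono hm le_rfl
  have hbi : Integrable b μ := integrable_of_abs_le hbm hbB
  have hb2 : MemLp b 2 μ := MemLp.of_bound hbm.aestronglyMeasurable B (ae_of_all _ hbB)
  have hI : Measurable[m] (F.indicator b) := hb.indicator hF
  have hIB : ∀ ω, |F.indicator b ω| ≤ B := fun ω => by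
    by_cases h : ω ∈ F
    · rw [Set.indicator_of_mem h]; exact hbB ω
    · rw [Set.indicator_of_notMem h, abs_zero]; exact (abs_nonneg _).trans (hbB ω)
  have hzero : μ[fun ω => a ω - b ω | m] =ᵐ[μ] 0 := by
    have h1 := condExp_sub (μ := μ) hai hbi m
    have h2 : μ[b | m] = b := condExp_of_stronglyMeasurable hm hb.stronglyMeasurable hbi
    filter_upwards [h1, hba] with ω h1 h3
    rw [h2] at h1
    have h1 : (μ[fun ω => a ω - b ω | m]) ω = (μ[a | m]) ω - b ω := h1
    rw [h1, h3]; simp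
  have hsi : Integrable (fun ω => F.indicator b ω * (a ω - b ω)) μ :=
    (hai.sub hbi).bdd_mul (hI.mono hm le_rfl).aestronglyMeasurable (c := B) (ae_of_all _ hIB)
  have horth := integral_mul_eq_zero_of_condExp hm (hai.sub hbi) hzero hI.stronglyMeasurable hsi
  have ha2 : Integrable (fun ω => a ω ^ 2) μ := ha.integrable_sq
  have hab2 : Integrable (fun ω => (a ω - b ω) ^ 2) μ := (ha.sub hb2).integrable_sq
  have horth' : ∫ ω in F, b ω * (a ω - b ω) ∂μ = 0 := by
    rw [← integral_indicator hFm, ← horth]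
    refine integral_congr_ae (ae_of_all _ fun ω => ?_)
    by_cases h : ω ∈ F <;> simp [h]
  have hbi' : Integrable (fun ω => b ω * (a ω - b ω)) μ :=
    (hai.sub hbi).bdd_mul hbm.aestronglyMeasurable (c := B) (ae_of_all _ hbB)
  have hle : ∫ ω in F, (a ω - b ω) ^ 2 ∂μ ≤ ∫ ω in F, a ω ^ 2 ∂μ := by
    have e : ∫ ω in F, ((a ω - b ω) ^ 2 + 2 * (b ω * (a ω - b ω))) ∂μ
        = ∫ ω in F, (a ω - b ω) ^ 2 ∂μ := by
      rw [integral_add hab2.integrableOn (hbi'.const_mul 2).integrableOn, integral_const_mul,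
        horth', mul_zero, add_zero]
    rw [← e]
    exact integral_mono (hab2.integrableOn.add (hbi'.const_mul 2).integrableOn) ha2.integrableOn
      fun ω => by nlinarith [sq_nonneg (b ω)]
  rw [← ofReal_integral_eq_lintegral_ofReal hab2.integrableOn (ae_of_all _ fun ω => sq_nonneg _),
    ← ofReal_integral_eq_lintegral_ofReal ha2.integrableOn (ae_of_all _ fun ω => sq_nonneg _)]
  exact ENNReal.ofReal_le_ofReal hle

end Conditional

namespace SwitchedModel

variable {n k : ℕ} {A : Fin k → Matrix (Fin n) (Fin n) ℝ} {p : Fin k → ℝ}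
variable {Ω : Type*} {m0 : MeasurableSpace Ω} {μ : Measure Ω} {α N : ℝ}
  {𝒬 ℋ : Filtration ℕ m0} {x : ℕ → Ω → Fin n → ℝ} {s : ℕ → Ω → Fin k} {w : ℕ → Ω → Fin n → ℝ}

lemma abs_apply_le_vnorm (z : Fin n → ℝ) (l : Fin n) : |z l| ≤ vnorm z := by
  refine abs_le_of_sq_le_sq ?_ (vnorm_nonneg z)
  rw [vnorm_sq, dotProduct]
  have := Finset.single_le_sum (f := fun j => z j * z j) (fun j _ => mul_self_nonneg _)
    (Finset.mem_univ l)
  simpa [sq] using this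

variable [IsProbabilityMeasure μ]

/-- Splitting a coordinate of the noise at the level `B` into a bounded martingale difference
sequence and one of small conditional variance. -/
lemma exists_noise_split (hM : SwitchedModel μ A p α N 𝒬 ℋ x s w) (l : Fin n) {B : ℝ} (hB : 1 ≤ B) :
    ∃ ξ ζ : ℕ → Ω → ℝ, (∀ t ω, w t ω l = ξ t ω + ζ t ω) ∧
      ((∀ t, Measurable[ℋ (t + 1)] (ξ t)) ∧ (∀ t ω, |ξ t ω| ≤ 2 * B) ∧
        (∀ t, μ[ξ t | ℋ t] =ᵐ[μ] 0) ∧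
        ∀ t, CondBound (ℋ t) μ (fun ω => ENNReal.ofReal (ξ t ω ^ 2)) (ENNReal.ofReal (1 + N))) ∧
      ((∀ t, Measurable[ℋ (t + 1)] (ζ t)) ∧ (∀ t, Integrable (ζ t) μ) ∧
        (∀ t, μ[ζ t | ℋ t] =ᵐ[μ] 0) ∧
        (∀ t, CondBound (ℋ t) μ (fun ω => ENNReal.ofReal (ζ t ω ^ 2))
          (ENNReal.ofReal (B ^ (2 - α) * N))) ∧
        ∃ γ N' : ℝ, 1 < γ ∧ γ ≤ 2 ∧ ∀ t, CondBound (ℋ t) μ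
          (fun ω => ENNReal.ofReal ((ζ t ω ^ 2) ^ γ)) (ENNReal.ofReal N')) := by
  have hN0 := hM.moment_nonneg
  have hα := hM.two_lt
  have hB0 : 0 < B := by linarith
  set z : ℕ → Ω → ℝ := fun t ω => w t ω l with hz
  have hzm : ∀ t, Measurable[ℋ (t + 1)] (z t) := fun t =>
    ((measurable_pi_apply l).comp (hM.noise_meas t)).mono (hM.past_le _) le_rfl
  set a : ℕ → Ω → ℝ := fun t ω => if |z t ω| ≤ B then z t ω else 0 with ha
  have ham : ∀ t, Measurable[ℋ (t + 1)] (a t) := fun t =>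
    Measurable.ite (measurableSet_le (continuous_abs.measurable.comp (hzm t)) measurable_const) (hzm t) measurable_const
  have haB : ∀ t ω, |a t ω| ≤ B := fun t ω => by
    simp only [ha]; split_ifs with h <;> simp [h, hB0.le]
  -- A conditional mean bounded everywhere, not only almost everywhere, so that `a - b` is bounded
  -- by `2 * B` on every path, as the exponential bound requires.
  choose b hbm hbB hba using fun t => exists_bounded_condExp (μ := μ) (m := ℋ t) hB0.le (haB t)
  have hai : ∀ t, Integrable (a t) μ := fun t =>
    integrable_of_abs_le ((ham t).mono (ℋ.le _) le_rfl) (haB t)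
  have hbi : ∀ t, Integrable (b t) μ := fun t =>
    integrable_of_abs_le ((hbm t).mono (ℋ.le _) le_rfl) (hbB t)
  have hzi : ∀ t, Integrable (z t) μ := fun t => hM.noise_integrable t l
  have hbc : ∀ t, μ[b t | ℋ t] = b t := fun t =>
    condExp_of_stronglyMeasurable (ℋ.le t) (hbm t).stronglyMeasurable (hbi t)
  have hξc : ∀ t, μ[fun ω => a t ω - b t ω | ℋ t] =ᵐ[μ] 0 := fun t => by
    filter_upwards [condExp_sub (μ := μ) (hai t) (hbi t) (ℋ t), hba t] with ω h1 h3
    rw [hbc] at h1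
    have h1 : (μ[fun ω => a t ω - b t ω | ℋ t]) ω = (μ[a t | ℋ t]) ω - b t ω := h1
    rw [h1, h3]; simp
  have hzc : ∀ t, μ[z t | ℋ t] =ᵐ[μ] 0 := fun t => hM.noise_condExp t l
  have hz2 : ∀ t, MemLp (z t) 2 μ := fun t => by
    have := hM.dotProduct_noise_memLp (Pi.single l 1) t
    simpa using this
  have hzsq : ∀ t, CondBound (ℋ t) μ (fun ω => ENNReal.ofReal (z t ω ^ 2))
      (ENNReal.ofReal (1 + N)) := fun t => by
    have := hM.noise_sq_condBound (Pi.single l 1) t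
    simpa using this
  have hpow : ∀ {β : ℝ}, 0 ≤ β → ∀ t ω, |z t ω| ^ β ≤ vnorm (w t ω) ^ β := fun hβ t ω =>
    Real.rpow_le_rpow (abs_nonneg _) (abs_apply_le_vnorm _ _) hβ
  refine ⟨fun t ω => a t ω - b t ω, fun t ω => z t ω - (a t ω - b t ω), fun t ω => by ring,
    ⟨fun t => (ham t).sub ((hbm t).mono (ℋ.mono (Nat.le_succ t)) le_rfl), fun t ω => ?_, hξc,
      fun t => ?_⟩,
    ⟨fun t => (hzm t).sub ((ham t).sub ((hbm t).mono (ℋ.mono (Nat.le_succ t)) le_rfl)),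
      fun t => (hzi t).sub ((hai t).sub (hbi t)), fun t => ?_, fun t => ?_, ?_⟩⟩
  · have h1 := haB t ω; have h2 := hbB t ω
    rw [abs_le] at h1 h2 ⊢; constructor <;> linarith
  · refine CondBound.sub_condExp (ℋ.le t) ?_ (hbm t) (hbB t) (hba t)
      ((hzsq t).mono fun ω => ENNReal.ofReal_le_ofReal ?_)
    · exact MemLp.of_bound ((ham t).mono (ℋ.le _) le_rfl).aestronglyMeasurable B
        (ae_of_all _ (haB t))
    · simp only [ha]; split_ifs
      · exact le_rfl
      · simpa using sq_nonneg (z t ω)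
  · have h1 := condExp_sub (μ := μ) (hzi t) ((hai t).sub (hbi t)) (ℋ t)
    filter_upwards [h1, hzc t, hξc t] with ω h1 h2 h3
    have h1 : (μ[fun ω => z t ω - (a t ω - b t ω) | ℋ t]) ω
      = (μ[z t | ℋ t]) ω - (μ[fun ω => a t ω - b t ω | ℋ t]) ω := h1
    rw [h1, h2, h3]; simp
  · have hd : CondBound (ℋ t) μ (fun ω => ENNReal.ofReal ((z t ω - a t ω) ^ 2))
        (ENNReal.ofReal (B ^ (2 - α) * N)) := by
      intro F hF
      have hm := hM.noise_moment t F hF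
      calc _ ≤ ∫⁻ ω in F, ENNReal.ofReal (B ^ (2 - α)) * ENNReal.ofReal (vnorm (w t ω) ^ α) ∂μ := by
            refine lintegral_mono fun ω => ?_
            rw [← ENNReal.ofReal_mul (Real.rpow_nonneg hB0.le _)]
            refine ENNReal.ofReal_le_ofReal ?_
            have hv : 0 ≤ vnorm (w t ω) ^ α := Real.rpow_nonneg (vnorm_nonneg _) _
            simp only [ha]
            split_ifs with h
            · rw [sub_self, zero_pow two_ne_zero]; positivity
            · rw [sub_zero]
              have hzB : B ≤ |z t ω| := (not_le.1 h).le
              have hz0 : 0 < |z t ω| := hB0.trans_le hzB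
              calc z t ω ^ 2 = |z t ω| ^ (2 - α) * |z t ω| ^ α := by
                    rw [← Real.rpow_add hz0, sub_add_cancel, Real.rpow_two, sq_abs]
                _ ≤ B ^ (2 - α) * vnorm (w t ω) ^ α := by
                    exact mul_le_mul (Real.rpow_le_rpow_of_nonpos hB0 hzB (by linarith))
                      (hpow (β := α) (by linarith) t ω) (by positivity) (by positivity)
        _ = ENNReal.ofReal (B ^ (2 - α)) * ∫⁻ ω in F, ENNReal.ofReal (vnorm (w t ω) ^ α) ∂μ :=
            lintegral_const_mul' _ _ ENNReal.ofReal_ne_top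
        _ ≤ _ := by
            rw [ENNReal.ofReal_mul (Real.rpow_nonneg hB0.le _), mul_assoc]; gcongr
    have hd2 : MemLp (fun ω => z t ω - a t ω) 2 μ := (hz2 t).sub
      (MemLp.of_bound ((ham t).mono (ℋ.le _) le_rfl).aestronglyMeasurable B
        (ae_of_all _ (haB t)))
    -- The noise has conditional mean zero, so the conditional mean of `z - a` is the opposite of
    -- that of `a`. The large part `ζ` is therefore `z - a` recentered, and its second moment is
    -- bounded by that of `z - a`, at most `B ^ (2 - α) * N`.
    have hnb : (fun ω => -b t ω) =ᵐ[μ] μ[fun ω => z t ω - a t ω | ℋ t] := by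
      filter_upwards [condExp_sub (μ := μ) (hzi t) (hai t) (ℋ t), hzc t, hba t] with ω h1 h2 h3
      have h1 : (μ[fun ω => z t ω - a t ω | ℋ t]) ω = (μ[z t | ℋ t]) ω - (μ[a t | ℋ t]) ω := h1
      rw [h1, h2, h3]; simp
    have h := CondBound.sub_condExp (ℋ.le t) hd2 (hbm t).neg (B := B)
      (fun ω => by rw [Pi.neg_apply, abs_neg]; exact hbB t ω) hnb hd
    refine h.mono fun ω => le_of_eq ?_
    simp only [Pi.neg_apply]; congr 2; ring
  -- An order above one for `ζ ^ 2`, since `2 * γ ≤ α` and `α > 2`. Its bound `N'` may depend on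
  -- `B`; it influences only when the limit laws take effect.
  · set γ := min (α / 2) 2 with hγ
    have hγ1 : 1 < γ := lt_min (by linarith) (by norm_num)
    have hγ0 : 0 < γ := by linarith
    have h2γ : 2 * γ ≤ α := by linarith [min_le_left (α / 2) 2]
    refine ⟨γ, 2 ^ γ * (2 ^ γ * (1 + N) + (8 * B ^ 2) ^ γ), hγ1, min_le_right _ _, fun t F hF => ?_⟩
    have hm := hM.noise_moment_of_le (β := 2 * γ) (by positivity) h2γ t F hF
    calc _ ≤ ∫⁻ ω in F, (ENNReal.ofReal (2 ^ γ * 2 ^ γ) * ENNReal.ofReal (vnorm (w t ω) ^ (2 * γ))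
          + ENNReal.ofReal (2 ^ γ * (8 * B ^ 2) ^ γ)) ∂μ := by
          refine lintegral_mono fun ω => ?_
          have hv : 0 ≤ vnorm (w t ω) ^ (2 * γ) := Real.rpow_nonneg (vnorm_nonneg _) _
          rw [← ENNReal.ofReal_mul (by positivity), ← ENNReal.ofReal_add (by positivity)
            (by positivity)]
          refine ENNReal.ofReal_le_ofReal ?_
          have hab : |a t ω - b t ω| ≤ 2 * B := by
            have h1 := haB t ω; have h2 := hbB t ω
            rw [abs_le] at h1 h2 ⊢; constructor <;> linarith
          have h1 : (z t ω - (a t ω - b t ω)) ^ 2 ≤ 2 * z t ω ^ 2 + 8 * B ^ 2 := by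
            have : (a t ω - b t ω) ^ 2 ≤ (2 * B) ^ 2 :=
              sq_le_sq' (by linarith [abs_le.1 hab]) (abs_le.1 hab).2
            nlinarith [sq_nonneg (z t ω + (a t ω - b t ω))]
          set X := 2 * z t ω ^ 2
          set Y := 8 * B ^ 2
          have hX : 0 ≤ X := by positivity
          have hY : 0 ≤ Y := by positivity
          have h3 : (X + Y) ^ γ ≤ 2 ^ γ * (X ^ γ + Y ^ γ) := by
            have e : X + Y ≤ 2 * max X Y := by linarith [le_max_left X Y, le_max_right X Y]
            refine (Real.rpow_le_rpow (by positivity) e hγ0.le).trans ?_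
            rw [Real.mul_rpow (by norm_num) (le_max_of_le_left hX)]
            refine mul_le_mul_of_nonneg_left ?_ (by positivity)
            rcases max_choice X Y with h | h <;> rw [h]
            · linarith [Real.rpow_nonneg hY γ]
            · linarith [Real.rpow_nonneg hX γ]
          have h4 : X ^ γ ≤ 2 ^ γ * vnorm (w t ω) ^ (2 * γ) := by
            rw [Real.mul_rpow (by norm_num) (sq_nonneg _)]
            refine mul_le_mul_of_nonneg_left ?_ (by positivity)
            rw [← sq_abs, ← Real.rpow_two, ← Real.rpow_mul (abs_nonneg _)]
            exact hpow (by positivity) t ω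
          have h5 : (0 : ℝ) < 2 ^ γ := by positivity
          calc _ ≤ (X + Y) ^ γ := Real.rpow_le_rpow (sq_nonneg _) h1 hγ0.le
            _ ≤ 2 ^ γ * (X ^ γ + Y ^ γ) := h3
            _ ≤ 2 ^ γ * (2 ^ γ * vnorm (w t ω) ^ (2 * γ) + Y ^ γ) := by gcongr
            _ = _ := by ring
      _ = ENNReal.ofReal (2 ^ γ * 2 ^ γ) * ∫⁻ ω in F, ENNReal.ofReal (vnorm (w t ω) ^ (2 * γ)) ∂μ
          + ENNReal.ofReal (2 ^ γ * (8 * B ^ 2) ^ γ) * μ F := by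
          rw [lintegral_add_right _ measurable_const,
            lintegral_const_mul' _ _ ENNReal.ofReal_ne_top]
          simp
      _ ≤ ENNReal.ofReal (2 ^ γ * 2 ^ γ) * (ENNReal.ofReal (1 + N) * μ F)
          + ENNReal.ofReal (2 ^ γ * (8 * B ^ 2) ^ γ) * μ F := by gcongr
      _ = _ := by
          rw [← mul_assoc, ← ENNReal.ofReal_mul (by positivity), ← add_mul,
            ← ENNReal.ofReal_add (by positivity) (by positivity)]
          congr 2; ring

end SwitchedModel

end Truncation

/-! ### The self-normalized noise is of order `log T` uniformly in `p`. -/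

section Estimate

open Matrix

lemma eventually_natLog {q : ℕ → Prop} (h : ∀ᶠ m in atTop, q m) :
    ∀ᶠ T in atTop, q (Nat.log 2 T) := by
  obtain ⟨M, hM⟩ := eventually_atTop.1 h
  exact eventually_atTop.2 ⟨2 ^ M, fun T hT => hM _ (Nat.le_log_of_pow_le one_lt_two hT)⟩

lemma natLog_le_two_mul_log {T : ℕ} (hT : T ≠ 0) : (Nat.log 2 T : ℝ) ≤ 2 * Real.log T := by
  have h1 : ((2 : ℝ) ^ Nat.log 2 T) ≤ T := by exact_mod_cast Nat.pow_log_le_self 2 hT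
  have h2 := Real.log_le_log (by positivity) h1
  rw [Real.log_pow] at h2
  have h3 := Real.log_two_gt_d9
  have h4 : (0 : ℝ) ≤ Nat.log 2 T := Nat.cast_nonneg _
  nlinarith

/-- The constant in the bound for the self-normalized noise: it does not depend on the switching
probabilities. -/
noncomputable def noiseConst (n : ℕ) (N : ℝ) : ℝ :=
  4 * (1 + 2 * (1 + N) * (n * (n + 2 ^ (n + 1) + (n + 5))))

/-- The logarithm of a polynomial in `2 ^ m` is linear in `m`, with a coefficient that depends only
on the dimension. -/
lemma log_epoch_le (n : ℕ) {m : ℕ} (hm : 1 ≤ m) {X : ℝ} (hX : 0 ≤ X)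
    (h : X ≤ 2 * (2 * 2 ^ m) ^ n * 2 ^ (5 * m)) :
    Real.log (n + X) ≤ (n + 2 ^ (n + 1) + (n + 5)) * m := by
  rcases (add_nonneg (Nat.cast_nonneg (α := ℝ) n) hX).eq_or_lt with h0 | h0
  · rw [← h0, Real.log_zero]; positivity
  have hm1 : (1 : ℝ) ≤ m := by exact_mod_cast hm
  have e : 2 * (2 * 2 ^ m) ^ n * 2 ^ (5 * m) = (2 : ℝ) ^ (n + 1) * 2 ^ ((n + 5) * m) := by
    rw [mul_pow, ← pow_mul, add_mul, pow_add, pow_succ, mul_comm m n]; ring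
  have h1 : n + X ≤ (n + 2 ^ (n + 1)) * 2 ^ ((n + 5) * m) := by
    have : (1 : ℝ) ≤ 2 ^ ((n + 5) * m) := one_le_pow₀ (by norm_num)
    rw [e] at h
    nlinarith [Nat.cast_nonneg (α := ℝ) n]
  refine (Real.log_le_log h0 h1).trans ?_
  rw [Real.log_mul (by positivity) (by positivity), Real.log_pow]
  have h2 := Real.log_le_sub_one_of_pos (show (0 : ℝ) < n + 2 ^ (n + 1) by positivity)
  have h3 := Real.log_two_lt_d9
  have h4 : (0 : ℝ) < n + 2 ^ (n + 1) := by positivity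
  push_cast
  nlinarith [mul_nonneg (show (0 : ℝ) ≤ (n + 5) by positivity) (show (0 : ℝ) ≤ m by positivity)]

lemma corr_add {n : ℕ} (y : ℕ → Fin n → ℝ) (ξ ζ : ℕ → ℝ) (T : ℕ) :
    corr y (fun t => ξ t + ζ t) T = corr y ξ T + corr y ζ T := by
  simp [corr, add_smul, Finset.sum_add_distrib]

lemma quad_add_le {n : ℕ} {P : Matrix (Fin n) (Fin n) ℝ} (hP : P.PosSemidef) (u v : Fin n → ℝ) :
    quad P (u + v) ≤ 2 * quad P u + 2 * quad P v := by
  have h := quad_finsetSum_le hP Finset.univ ![u, v]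
  simp only [Fin.sum_univ_two, Matrix.cons_val_zero, Matrix.cons_val_one, Finset.card_univ,
    Fintype.card_fin] at h
  push_cast at h
  linarith

namespace SwitchedModel

variable {n k : ℕ} {A : Fin k → Matrix (Fin n) (Fin n) ℝ} {p : Fin k → ℝ}
variable {Ω : Type*} {m0 : MeasurableSpace Ω} {μ : Measure Ω} {α N : ℝ}
  {𝒬 ℋ : Filtration ℕ m0} {x : ℕ → Ω → Fin n → ℝ} {s : ℕ → Ω → Fin k} {w : ℕ → Ω → Fin n → ℝ}

variable [IsProbabilityMeasure μ]

/-- The self-normalized sum of a bounded noise is at most a multiple of `log T`, with a constant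
that depends neither on the switching probabilities nor on the bound of the noise. -/
lemma ae_eventually_quad_bounded_le (hM : SwitchedModel μ A p α N 𝒬 ℋ x s w) (i : Fin k)
    {θ : ℝ} (hθ : 0 < θ) (hθ1 : θ ≤ 1) (hρ : ∑ j, p j * spectralNorm (A j) ^ θ < 1)
    {c0 : ℝ} (hc0 : 0 < c0) {ξ : ℕ → Ω → ℝ} (hξ : ∀ t, Measurable[ℋ (t + 1)] (ξ t)) {b : ℝ}
    (hb : 0 < b) (hξb : ∀ t ω, |ξ t ω| ≤ b) (hc : ∀ t, μ[ξ t | ℋ t] =ᵐ[μ] 0)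
    (hN : ∀ t, CondBound (ℋ t) μ (fun ω => ENNReal.ofReal (ξ t ω ^ 2))
      (ENNReal.ofReal (1 + N))) :
    ∀ᵐ ω ∂μ, (∀ v : Fin n → ℝ, ∀ᶠ T : ℕ in atTop,
        c0 * T * (v ⬝ᵥ v) ≤ ∑ t ∈ Finset.range T, (v ⬝ᵥ w t ω) ^ 2) →
      ∀ᶠ T : ℕ in atTop, quad (gram (regressor x s i ω) T)⁻¹
        (corr (regressor x s i ω) (fun t => ξ t ω) T) ≤ noiseConst n N * Real.log T := by
  have hN0 := hM.moment_nonneg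
  obtain ⟨P, hP, hae⟩ := hM.exists_epoch_forms i hθ hθ1 hρ hc0
  set H : ℕ → ℝ := fun m => 2 * (2 * 2 ^ m) ^ n with hH
  have hH0 : ∀ m, 0 < H m := fun m => by positivity
  have hHP : ∀ m, (H m • P m).PosDef := fun m => (hP m).smul (hH0 m)
  -- Inversion reverses the order: the reference form dominates the inverse Gram matrix at time `2 ^
  -- m`, so `U m` lies below that Gram matrix.
  set U : ℕ → Matrix (Fin n) (Fin n) ℝ := fun m => (H m • P m)⁻¹ with hU
  have hUd : ∀ m, (U m).PosDef := fun m => (hHP m).inv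
  have hUinv : ∀ m, (U m)⁻¹ = H m • P m := fun m =>
    nonsing_inv_nonsing_inv _ (hHP m).det_pos.ne'.isUnit
  have hBC : ∀ᵐ ω ∂μ, ∀ᶠ m : ℕ in atTop, ω ∉ {ω | ∃ T, (m : ℝ) + 2 * (1 + N) *
      ∑ t ∈ Finset.range T, leverage (U m) (regressor x s i ω) t
        ≤ quad (gramFrom (U m) (regressor x s i ω) T)⁻¹
          (corr (regressor x s i ω) (fun t => ξ t ω) T)} := by
    -- At the threshold `m` the failure probability is geometric in `m` whatever the bound `b` of
    -- the noise. So `b` affects only when the estimate sets in, not its constant.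
    refine ae_eventually_notMem_of_le (M := 0) (b := fun m : ℕ => Real.exp (-((60 * b ^ 2)⁻¹ * m)))
      ?_ fun m _ => measure_selfNormalized_le (fun t => hM.measurable_regressor i t) hξ hb hξb hc
        (by linarith) hN (hUd m) m
    have h0 : (0 : ℝ) < (60 * b ^ 2)⁻¹ := by positivity
    have e : (fun m : ℕ => Real.exp (-((60 * b ^ 2)⁻¹ * m)))
        = fun m : ℕ => (Real.exp (-(60 * b ^ 2)⁻¹)) ^ m := by
      ext m; rw [← Real.exp_nat_mul]; congr 1; ring
    rw [e]
    exact summable_geometric_of_lt_one (Real.exp_pos _).le (by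
      rw [← Real.exp_zero]; exact Real.exp_lt_exp.2 (by linarith))
  filter_upwards [hae, hBC] with ω hω hbc hlow
  filter_upwards [eventually_natLog ((hω hlow).and (hbc.and (eventually_ge_atTop 1))),
    eventually_ge_atTop 1] with T hT hT1
  set m := Nat.log 2 T with hm
  obtain ⟨⟨hm1, hm2⟩, hm3, hm4⟩ := hT
  have hT0 : T ≠ 0 := by omega
  set y := regressor x s i ω with hy
  have hmT : 2 ^ m ≤ T := Nat.pow_log_le_self 2 hT0
  have hTm : T ≤ 2 ^ (m + 1) := (Nat.lt_pow_succ_log_self one_lt_two T).le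
  have hm3 : quad (gramFrom (U m) y T)⁻¹ (corr y (fun t => ξ t ω) T)
      ≤ m + 2 * (1 + N) * ∑ t ∈ Finset.range T, leverage (U m) y t := by
    by_contra hcon
    exact hm3 ⟨T, (not_le.1 hcon).le⟩
  have hlev : ∑ t ∈ Finset.range T, leverage (U m) y t
      ≤ n * ((n + 2 ^ (n + 1) + (n + 5)) * m) := by
    refine (sum_leverage_le_log y (hUd m) T).trans (mul_le_mul_of_nonneg_left ?_ (by positivity))
    have hPn : ∀ t, 0 ≤ quad (P m) (y t) := fun t => quad_nonneg (hP m).posSemidef _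
    rw [hUinv]
    simp only [quad_smul, ← Finset.mul_sum]
    refine log_epoch_le n hm4 (mul_nonneg (hH0 m).le (Finset.sum_nonneg fun t _ => hPn t)) ?_
    refine mul_le_mul_of_nonneg_left ((Finset.sum_le_sum_of_subset_of_nonneg
      (Finset.range_mono hTm) fun t _ _ => hPn t).trans hm2) (hH0 m).le
  have hUle : ∀ z, quad (U m) z ≤ quad (gram y (2 ^ m)) z := fun z => by
    have h1 := quad_inv_le (posDef_gram y (2 ^ m)).inv (hHP m) (c := 1) (fun z => by
      rw [one_mul, quad_smul]; exact hm1 z) z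
    rwa [one_mul, nonsing_inv_nonsing_inv _ (posDef_gram y (2 ^ m)).det_pos.ne'.isUnit] at h1
  -- `U m` lies below the Gram matrix at `2 ^ m ≤ T`, so adding the regressors up to `T` to it gives
  -- at most twice the Gram matrix at `T`; inversion turns this around.
  have hcmp : quad (gram y T)⁻¹ (corr y (fun t => ξ t ω) T)
      ≤ 2 * quad (gramFrom (U m) y T)⁻¹ (corr y (fun t => ξ t ω) T) := by
    refine quad_inv_le (posDef_gramFrom y (hUd m) T) (posDef_gram y T) (fun z => ?_) _
    have h1 := hUle z
    have h2 := quad_gram_mono y hmT z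
    rw [quad_gramFrom]
    have h3 := quad_gram y T z
    have h4 := dotProduct_self_nonneg' z
    linarith
  have hlog := natLog_le_two_mul_log hT0
  have hc1 : 0 ≤ 1 + 2 * (1 + N) * (n * (n + 2 ^ (n + 1) + (n + 5)) : ℝ) := by positivity
  calc _ ≤ _ := hcmp
    _ ≤ 2 * (m + 2 * (1 + N) * (n * ((n + 2 ^ (n + 1) + (n + 5)) * m))) := by gcongr; exact hm3.trans (by gcongr)
    _ = 2 * (1 + 2 * (1 + N) * (n * (n + 2 ^ (n + 1) + (n + 5)))) * m := by ring
    _ ≤ 2 * (1 + 2 * (1 + N) * (n * (n + 2 ^ (n + 1) + (n + 5)))) * (2 * Real.log T) := by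
        gcongr
    _ = _ := by unfold noiseConst; ring

/-- The self-normalized sum of the noise is at most a multiple of `log T`, with a constant
that does not depend on the switching probabilities. -/
lemma ae_eventually_quad_noise_le (hM : SwitchedModel μ A p α N 𝒬 ℋ x s w) (i : Fin k)
    {θ : ℝ} (hθ : 0 < θ) (hθ1 : θ ≤ 1) (hρ : ∑ j, p j * spectralNorm (A j) ^ θ < 1)
    {c0 : ℝ} (hc0 : 0 < c0) (l : Fin n) :
    ∀ᵐ ω ∂μ, (∀ v : Fin n → ℝ, ∀ᶠ T : ℕ in atTop,
        c0 * T * (v ⬝ᵥ v) ≤ ∑ t ∈ Finset.range T, (v ⬝ᵥ w t ω) ^ 2) →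
      ∀ᶠ T : ℕ in atTop, quad (gram (regressor x s i ω) T)⁻¹
        (corr (regressor x s i ω) (fun t => w t ω l) T)
          ≤ 2 * (noiseConst n N + 2) * Real.log T := by
  have hN0 := hM.moment_nonneg
  obtain ⟨C, hC0, hC⟩ := hM.exists_ae_log_det_le hθ hθ1 hρ i
  -- The truncation level makes the variance of the large part smaller than the reciprocal of the
  -- `p`-dependent constant `C`; it exists because `α > 2`.
  obtain ⟨B, hB1, hB⟩ : ∃ B : ℝ, 1 ≤ B ∧ B ^ (2 - α) * N * (C + 1) ≤ 1 / 2 := by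
    have ht : Tendsto (fun B : ℝ => B ^ (2 - α) * N * (C + 1)) atTop (𝓝 0) := by
      have := ((tendsto_rpow_neg_atTop (show 0 < α - 2 by linarith [hM.two_lt])).mul_const N).mul_const
        (C + 1)
      simpa using this
    obtain ⟨B, h1, h2⟩ := ((ht.eventually_le_const (show (0 : ℝ) < 1 / 2 by norm_num)).and
      (eventually_ge_atTop 1)).exists
    exact ⟨B, h2, h1⟩
  obtain ⟨ξ, ζ, hw, ⟨hξ1, hξ2, hξ3, hξ4⟩, hζ1, hζ2, hζ3, hζ4, γ, N', hγ1, hγ2, hζ5⟩ :=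
    hM.exists_noise_split l hB1
  have hM0 : 0 ≤ B ^ (2 - α) * N := mul_nonneg (Real.rpow_nonneg (by linarith) _) hN0
  filter_upwards [hM.ae_eventually_quad_bounded_le i hθ hθ1 hρ hc0 hξ1 (by linarith) hξ2 hξ3 hξ4,
    ae_quad_inv_corr_le (fun t => hM.measurable_regressor i t) hζ1 hζ2 hζ3 hM0 hγ1 hγ2 hζ4 hζ5
      (U := 1) PosDef.one, hC] with ω h1 h2 h3 hlow
  obtain ⟨K, hK⟩ := h2 (1 / (2 * (C + 1))) (by positivity)
  have hlogt : Tendsto (fun T : ℕ => Real.log T) atTop atTop :=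
    Real.tendsto_log_atTop.comp tendsto_natCast_atTop_atTop
  filter_upwards [h1 hlow, h3, hlogt.eventually_ge_atTop (1 + K), hlogt.eventually_ge_atTop 0]
    with T hT1 hT2 hT3 hT4
  have e : (fun t => w t ω l) = fun t => ξ t ω + ζ t ω := funext fun t => hw t ω
  rw [e, corr_add]
  refine (quad_add_le (posDef_gram _ T).inv.posSemidef _ _).trans ?_
  have h5 : quad (gram (regressor x s i ω) T)⁻¹ (corr (regressor x s i ω) (fun t => ζ t ω) T)
      ≤ 2 * Real.log T := by
    have h6 := hK T
    have h7 := sum_leverage_le (regressor x s i ω) (U := 1) PosDef.one T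
    rw [det_one, Real.log_one, sub_zero] at h7
    have h7 : ∑ t ∈ Finset.range T, leverage 1 (regressor x s i ω) t ≤ C * Real.log T := h7.trans hT2
    have h8 : (B ^ (2 - α) * N + 1 / (2 * (C + 1))) * (C + 1) ≤ 1 := by
      have : 1 / (2 * (C + 1)) * (C + 1) = 1 / 2 := by field_simp
      rw [add_mul, this]; linarith
    set E := B ^ (2 - α) * N + 1 / (2 * (C + 1)) with hE
    have hE0 : 0 ≤ E := by positivity
    have h9 : E ≤ 1 := by nlinarith
    have h10 : E * C ≤ 1 := by nlinarith
    calc _ ≤ E * (1 + ∑ t ∈ Finset.range T, leverage 1 (regressor x s i ω) t) + K := h6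
      _ ≤ E * (1 + C * Real.log T) + K := by gcongr
      _ = E + E * C * Real.log T + K := by ring
      _ ≤ 1 + 1 * Real.log T + K := by gcongr
      _ ≤ _ := by linarith
  linarith

end SwitchedModel

end Estimate

/-! ### Lower bounds: the noise excites the regressors of every mode. -/

section Excitation

open Matrix

lemma eventually_add_const_le_mul {a b : ℝ} (h : a < b) (K : ℝ) :
    ∀ᶠ T : ℕ in atTop, a * T + K ≤ b * T := by
  filter_upwards [eventually_ge_atTop ⌈K / (b - a)⌉₊] with T hT
  have h1 : K / (b - a) ≤ T := (Nat.le_ceil _).trans (by exact_mod_cast hT)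
  rw [div_le_iff₀ (by linarith)] at h1
  linarith

/-- The states truncated at the level `R`. -/
noncomputable def truncState {Ω : Type*} {n : ℕ} (R : ℝ) (x : ℕ → Ω → Fin n → ℝ) (t : ℕ) (ω : Ω) :
    Fin n → ℝ :=
  if vnorm (x t ω) ≤ R then x t ω else 0

namespace SwitchedModel

variable {n k : ℕ} {A : Fin k → Matrix (Fin n) (Fin n) ℝ} {p : Fin k → ℝ}
variable {Ω : Type*} {m0 : MeasurableSpace Ω} {μ : Measure Ω} {α N : ℝ}
  {𝒬 ℋ : Filtration ℕ m0} {x : ℕ → Ω → Fin n → ℝ} {s : ℕ → Ω → Fin k} {w : ℕ → Ω → Fin n → ℝ}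

lemma measurableSet_vnorm_state_le (hM : SwitchedModel μ A p α N 𝒬 ℋ x s w) (R : ℝ) (t : ℕ) :
    MeasurableSet[𝒬 t] {ω | vnorm (x t ω) ≤ R} :=
  measurableSet_le (measurable_vnorm.comp (hM.state_meas t)) measurable_const

lemma measurable_truncState (hM : SwitchedModel μ A p α N 𝒬 ℋ x s w) (R : ℝ) (t : ℕ) :
    Measurable[𝒬 t] (truncState R x t) :=
  Measurable.ite (hM.measurableSet_vnorm_state_le R t) (hM.state_meas t) measurable_const

variable [IsProbabilityMeasure μ]

lemma truncState_dotProduct_self_le {R : ℝ} (t : ℕ) (ω : Ω) :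
    truncState R x t ω ⬝ᵥ truncState R x t ω ≤ R ^ 2 := by
  unfold truncState
  split_ifs with h
  · rw [← vnorm_sq]; exact pow_le_pow_left₀ (vnorm_nonneg _) h 2
  · rw [dotProduct_zero]; positivity

/-- The fraction of the times at which the state is large. -/
lemma exists_ae_card_large_state_le (hM : SwitchedModel μ A p α N 𝒬 ℋ x s w)
    {θ : ℝ} (hθ : 0 < θ) (hθ1 : θ ≤ 1) (hρ : ∑ j, p j * spectralNorm (A j) ^ θ < 1)
    {ε : ℝ} (hε : 0 < ε) :
    ∃ R > (0 : ℝ), ∀ᵐ ω ∂μ, ∀ᶠ T : ℕ in atTop,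
      ∑ t ∈ Finset.range T, (if vnorm (x t ω) ≤ R then (0 : ℝ) else 1) ≤ ε * T := by
  obtain ⟨C, hC0, hC⟩ := hM.exists_ae_sum_state_le hθ hθ1 hρ
  -- Markov's inequality along the path: the average of `vnorm (x t) ^ (θ / 2)` is at most `C`, so a
  -- level with `R ^ (θ / 2) ≥ C / ε` suffices.
  have ht := (tendsto_rpow_atTop (show 0 < θ / 2 by positivity)).eventually_ge_atTop (C / ε)
  obtain ⟨R, hR1, hR0⟩ := (ht.and (eventually_gt_atTop 0)).exists
  refine ⟨R, hR0, ?_⟩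
  filter_upwards [hC] with ω hω
  filter_upwards [hω] with T hT
  have hRp : 0 < R ^ (θ / 2) := Real.rpow_pos_of_pos hR0 _
  have h1 : ∀ t, (if vnorm (x t ω) ≤ R then (0 : ℝ) else 1) * R ^ (θ / 2)
      ≤ vnorm (x t ω) ^ (θ / 2) := fun t => by
    split_ifs with h
    · rw [zero_mul]; exact Real.rpow_nonneg (vnorm_nonneg _) _
    · rw [one_mul]; exact Real.rpow_le_rpow hR0.le (not_le.1 h).le (by positivity)
  have h2 := (Finset.sum_le_sum fun t (_ : t ∈ Finset.range T) => h1 t).trans hT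
  rw [← Finset.sum_mul] at h2
  rw [div_le_iff₀ hε] at hR1
  have h3 : (∑ t ∈ Finset.range T, (if vnorm (x t ω) ≤ R then (0 : ℝ) else 1)) * R ^ (θ / 2)
      ≤ (ε * T) * R ^ (θ / 2) := by
    refine h2.trans ?_
    have : (0 : ℝ) ≤ T := Nat.cast_nonneg T
    nlinarith
  exact le_of_mul_le_mul_right h3 hRp

/-- The states following a moderate state are excited by the noise. -/
lemma ae_eventually_sum_moderate_ge (hM : SwitchedModel μ A p α N 𝒬 ℋ x s w) {c0 R : ℝ}
    (hc0 : 0 < c0)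
    (hR : ∀ᵐ ω ∂μ, ∀ᶠ T : ℕ in atTop,
      ∑ t ∈ Finset.range T, (if vnorm (x t ω) ≤ R then (0 : ℝ) else 1) ≤ c0 / (8 * (2 + N)) * T)
    (v : Fin n → ℝ) (hv : 0 < v ⬝ᵥ v) :
    ∀ᵐ ω ∂μ, (∀ᶠ T : ℕ in atTop, c0 * T * (v ⬝ᵥ v) ≤ ∑ t ∈ Finset.range T, (v ⬝ᵥ w t ω) ^ 2) →
      ∀ᶠ T : ℕ in atTop, c0 / 2 * T * (v ⬝ᵥ v)
        ≤ ∑ t ∈ Finset.range T, (if vnorm (x t ω) ≤ R then (v ⬝ᵥ x (t + 1) ω) ^ 2 else 0) := by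
  have hN0 := hM.moment_nonneg
  set a : ℕ → Ω → ℝ := fun t ω => if vnorm (x t ω) ≤ R then (0 : ℝ) else 1 with ha
  set y : ℕ → Ω → ℝ := fun t ω => if vnorm (x t ω) ≤ R then v ⬝ᵥ (A (s t ω) *ᵥ x t ω) else 0 with hy
  have hset : ∀ t, MeasurableSet[ℋ t] {ω | vnorm (x t ω) ≤ R} := fun t =>
    hM.past_le t _ (hM.measurableSet_vnorm_state_le R t)
  have ham : ∀ t, StronglyMeasurable[ℋ t] (a t) := fun t =>
    (Measurable.ite (hset t) measurable_const measurable_const).stronglyMeasurable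
  have hym : ∀ t, StronglyMeasurable[ℋ t] (y t) := fun t => by
    refine (Measurable.ite (hset t) ?_ measurable_const).stronglyMeasurable
    have e : (fun ω => v ⬝ᵥ (A (s t ω) *ᵥ x t ω))
        = fun ω => ∑ j, if s t ω = j then v ⬝ᵥ (A j *ᵥ x t ω) else 0 := by
      ext ω; simp
    rw [e]
    exact Finset.measurable_sum _ fun j _ => Measurable.ite (hM.measurableSet_switch t j)
      ((hM.measurable_dotProduct_state t (A j) v).mono (hM.past_le t) le_rfl) measurable_const
  have h1 := ae_abs_sum_mul_le_sq (𝒢 := ℋ) (μ := μ) (y := y) (ζ := fun t ω => v ⬝ᵥ w t ω) hym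
    (fun t => (hM.dotProduct_noise_meas v t).mono (hM.past_le _))
    (fun t => hM.dotProduct_noise_integrable v t) (fun t => hM.dotProduct_noise_condExp v t)
    (fun t => hM.noise_sq_condBound v t)
  have h2 := hM.ae_sum_noise_le (β := 2) (by norm_num) hM.two_lt ham
    (fun t ω => by simp only [ha]; split_ifs <;> norm_num)
    (fun t ω => by simp only [ha]; split_ifs <;> norm_num)
  filter_upwards [h1, h2, hR] with ω h1 h2 hR hlow
  obtain ⟨K1, hK1⟩ := h1 (1 / 2) (by norm_num)
  obtain ⟨K2, hK2⟩ := h2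
  filter_upwards [hlow, hR, eventually_add_const_le_mul (a := (v ⬝ᵥ v) * (c0 / 8))
    (b := (v ⬝ᵥ v) * (c0 / 2)) (by nlinarith) ((v ⬝ᵥ v) * (2 + N + K2) + 1 + 2 * K1)] with T hT1 hT2 hT3
  -- After a moderate state the response is `y + v ⬝ᵥ w`; on summation `y ^ 2` absorbs the
  -- martingale of the mixed terms. At the other, rare times the noise energy is subtracted, and the
  -- weighted law of large numbers bounds it by about `c0 / 8 * T`, up to the factor `v ⬝ᵥ v`.
  have hpt : ∀ t, (v ⬝ᵥ w t ω) ^ 2 - (v ⬝ᵥ v) * (a t ω * vnorm (w t ω) ^ (2 : ℝ))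
      + y t ω ^ 2 + 2 * (y t ω * (v ⬝ᵥ w t ω))
      ≤ if vnorm (x t ω) ≤ R then (v ⬝ᵥ x (t + 1) ω) ^ 2 else 0 := fun t => by
    simp only [ha, hy]
    split_ifs with h
    · rw [hM.state_succ, dotProduct_add]; nlinarith
    · rw [Real.rpow_two, vnorm_sq]
      have := sq_dotProduct_le_mul v (w t ω)
      linarith
  have hsum := Finset.sum_le_sum fun t (_ : t ∈ Finset.range T) => hpt t
  simp only [Finset.sum_add_distrib, Finset.sum_sub_distrib, ← Finset.mul_sum] at hsum
  have h3 := (abs_le.1 (hK1 T)).1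
  have h4 := hK2 T
  have h5 : (2 + N) * (1 + ∑ t ∈ Finset.range T, a t ω) ≤ (2 + N) + c0 / 8 * T := by
    have : (2 + N) * (c0 / (8 * (2 + N)) * T) = c0 / 8 * T := by field_simp
    rw [mul_add, mul_one, ← this]
    have h6 : ∑ t ∈ Finset.range T, a t ω ≤ c0 / (8 * (2 + N)) * T := hT2
    gcongr
  have h6 : (v ⬝ᵥ v) * ∑ t ∈ Finset.range T, a t ω * vnorm (w t ω) ^ (2 : ℝ)
      ≤ (v ⬝ᵥ v) * ((2 + N) + c0 / 8 * T + K2) := by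
    refine mul_le_mul_of_nonneg_left ?_ hv.le
    linarith
  refine le_trans ?_ hsum
  nlinarith

/-- The truncated states are excited by the noise. -/
lemma exists_ae_eventually_sum_truncState_ge (hM : SwitchedModel μ A p α N 𝒬 ℋ x s w)
    {θ : ℝ} (hθ : 0 < θ) (hθ1 : θ ≤ 1) (hρ : ∑ j, p j * spectralNorm (A j) ^ θ < 1)
    {c0 : ℝ} (hc0 : 0 < c0) :
    ∃ R' > (0 : ℝ), ∀ v : Fin n → ℝ, 0 < v ⬝ᵥ v → ∀ᵐ ω ∂μ,
      (∀ᶠ T : ℕ in atTop, c0 * T * (v ⬝ᵥ v) ≤ ∑ t ∈ Finset.range T, (v ⬝ᵥ w t ω) ^ 2) →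
      ∀ᶠ T : ℕ in atTop, c0 / 8 * T * (v ⬝ᵥ v)
        ≤ ∑ t ∈ Finset.range T, (v ⬝ᵥ truncState R' x t ω) ^ 2 := by
  have hN0 := hM.moment_nonneg
  obtain ⟨R, hR0, hR⟩ := hM.exists_ae_card_large_state_le hθ hθ1 hρ
    (show 0 < c0 / (8 * (2 + N)) by positivity)
  set β := (2 + α) / 2 with hβ
  have hβ2 : 2 < β := by rw [hβ]; linarith [hM.two_lt]
  have hβα : β < α := by rw [hβ]; linarith [hM.two_lt]
  set G := (∑ j, spectralNorm (A j)) * R with hG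
  have hG0 : 0 ≤ G := mul_nonneg (Finset.sum_nonneg fun j _ => spectralNorm_nonneg _) hR0.le
  -- From a moderate state the next one has norm at most `G + vnorm w`. For noise up to `W` this is
  -- at most `2 * W`, the new truncation level; for larger noise it is at most `2 * vnorm w`, and
  -- the moment of order `β > 2` makes such terms cost at most `c0 / 4`.
  obtain ⟨W, hWG, hW0, hW⟩ : ∃ W, G ≤ W ∧ 0 < W ∧ 4 * W ^ (2 - β) * (3 + N) ≤ c0 / 4 := by
    have ht : Tendsto (fun W : ℝ => 4 * W ^ (2 - β) * (3 + N)) atTop (𝓝 0) := by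
      have := ((tendsto_rpow_neg_atTop (show 0 < β - 2 by linarith)).const_mul 4).mul_const (3 + N)
      simpa using this
    obtain ⟨W, h1, h2, h3⟩ := ((ht.eventually_le_const (show (0 : ℝ) < c0 / 4 by positivity)).and
      ((eventually_ge_atTop G).and (eventually_gt_atTop 0))).exists
    exact ⟨W, h2, h3, h1⟩
  refine ⟨2 * W, by positivity, fun v hv => ?_⟩
  filter_upwards [hM.ae_eventually_sum_moderate_ge hc0 hR v hv,
    hM.ae_eventually_sum_noise_le (by linarith) hβα] with ω h1 h2 hlow
  have h3 : ∀ᶠ T : ℕ in atTop, c0 / 4 * T * (v ⬝ᵥ v)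
      ≤ ∑ t ∈ Finset.range (T + 1), (v ⬝ᵥ truncState (2 * W) x t ω) ^ 2 := by
    filter_upwards [h1 hlow, h2] with T hT1 hT2
    have hpt : ∀ t, (if vnorm (x t ω) ≤ R then (v ⬝ᵥ x (t + 1) ω) ^ 2 else 0)
        ≤ (v ⬝ᵥ truncState (2 * W) x (t + 1) ω) ^ 2
          + (v ⬝ᵥ v) * (4 * W ^ (2 - β)) * vnorm (w t ω) ^ β := fun t => by
      have hnn : 0 ≤ (v ⬝ᵥ v) * (4 * W ^ (2 - β)) * vnorm (w t ω) ^ β :=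
        mul_nonneg (by positivity) (Real.rpow_nonneg (vnorm_nonneg _) _)
      split_ifs with h
      · have hx : vnorm (x (t + 1) ω) ≤ G + vnorm (w t ω) := by
          rw [hM.state_succ]
          refine (vnorm_add_le _ _).trans (add_le_add ((vnorm_mulVec_le _ _).trans ?_) le_rfl)
          refine mul_le_mul (Finset.single_le_sum (f := fun j => spectralNorm (A j))
            (fun j _ => spectralNorm_nonneg _) (Finset.mem_univ _)) h (vnorm_nonneg _)
            (Finset.sum_nonneg fun j _ => spectralNorm_nonneg _)
        rcases le_or_gt (vnorm (w t ω)) W with hw | hw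
        · rw [truncState, if_pos (by linarith)]; linarith
        · have hw0 : 0 < vnorm (w t ω) := hW0.trans hw
          have h4 : (v ⬝ᵥ x (t + 1) ω) ^ 2 ≤ (v ⬝ᵥ v) * (4 * vnorm (w t ω) ^ 2) := by
            refine (sq_dotProduct_le_mul _ _).trans (mul_le_mul_of_nonneg_left ?_ hv.le)
            rw [← vnorm_sq, show 4 * vnorm (w t ω) ^ 2 = (2 * vnorm (w t ω)) ^ 2 by ring]
            exact pow_le_pow_left₀ (vnorm_nonneg _) (by linarith) 2
          have h5 : vnorm (w t ω) ^ 2 ≤ W ^ (2 - β) * vnorm (w t ω) ^ β := by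
            calc vnorm (w t ω) ^ 2 = vnorm (w t ω) ^ (2 - β) * vnorm (w t ω) ^ β := by
                  rw [← Real.rpow_add hw0, sub_add_cancel, Real.rpow_two]
              _ ≤ _ := mul_le_mul_of_nonneg_right
                  (Real.rpow_le_rpow_of_nonpos hW0 hw.le (by linarith))
                  (Real.rpow_nonneg hw0.le _)
          have h6 : (v ⬝ᵥ v) * (4 * vnorm (w t ω) ^ 2)
              ≤ (v ⬝ᵥ v) * (4 * W ^ (2 - β)) * vnorm (w t ω) ^ β := by
            rw [mul_assoc, mul_assoc]; gcongr
          linarith [sq_nonneg (v ⬝ᵥ truncState (2 * W) x (t + 1) ω)]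
      · positivity
    have hsum := Finset.sum_le_sum fun t (_ : t ∈ Finset.range T) => hpt t
    rw [Finset.sum_add_distrib, ← Finset.mul_sum] at hsum
    rw [Finset.sum_range_succ']
    have h7 : (v ⬝ᵥ v) * (4 * W ^ (2 - β)) * ∑ t ∈ Finset.range T, vnorm (w t ω) ^ β
        ≤ (v ⬝ᵥ v) * (c0 / 4 * T) := by
      rw [mul_assoc]
      refine mul_le_mul_of_nonneg_left ?_ hv.le
      calc _ ≤ 4 * W ^ (2 - β) * ((3 + N) * T) := by gcongr
        _ = 4 * W ^ (2 - β) * (3 + N) * T := by ring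
        _ ≤ _ := by gcongr
    nlinarith [sq_nonneg (v ⬝ᵥ truncState (2 * W) x 0 ω)]
  filter_upwards [(tendsto_sub_atTop_nat 1).eventually h3, eventually_ge_atTop 2] with T hT hT2
  rw [Nat.sub_add_cancel (by omega), Nat.cast_sub (by omega)] at hT
  refine le_trans ?_ hT
  have : (2 : ℝ) ≤ T := by exact_mod_cast hT2
  refine mul_le_mul_of_nonneg_right ?_ hv.le
  push_cast
  nlinarith

/-- The regressors of every mode are excited, in proportion to the probability of the mode. -/
lemma ae_eventually_sum_regressor_ge (hM : SwitchedModel μ A p α N 𝒬 ℋ x s w) (i : Fin k)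
    {θ : ℝ} (hθ : 0 < θ) (hθ1 : θ ≤ 1) (hρ : ∑ j, p j * spectralNorm (A j) ^ θ < 1)
    {c0 : ℝ} (hc0 : 0 < c0) :
    ∀ᵐ ω ∂μ, (∀ v : Fin n → ℝ, ∀ᶠ T : ℕ in atTop,
        c0 * T * (v ⬝ᵥ v) ≤ ∑ t ∈ Finset.range T, (v ⬝ᵥ w t ω) ^ 2) →
      ∀ᶠ T : ℕ in atTop, ∀ v : Fin n → ℝ, p i * (c0 / 16) / 8 * T * (v ⬝ᵥ v)
        ≤ ∑ t ∈ Finset.range T, (v ⬝ᵥ regressor x s i ω t) ^ 2 := by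
  obtain ⟨R, hR0, hR⟩ := hM.exists_ae_eventually_sum_truncState_ge hθ hθ1 hρ hc0
  have hpi := hM.prob_pos i
  -- Truncation bounds every regressor by `R`. Bounded energy is needed both in the law of large
  -- numbers for the switches and in the passage from countably many directions to all.
  set z : Ω → ℕ → Fin n → ℝ := fun ω t => if s t ω = i then truncState R x t ω else 0 with hz
  have hzR : ∀ ω t, z ω t ⬝ᵥ z ω t ≤ R ^ 2 := fun ω t => by
    simp only [hz]
    split_ifs
    · exact truncState_dotProduct_self_le t ω
    · rw [dotProduct_zero]; positivity
  have hzx : ∀ ω t (v : Fin n → ℝ), (v ⬝ᵥ z ω t) ^ 2 ≤ (v ⬝ᵥ regressor x s i ω t) ^ 2 := fun ω t v => by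
    simp only [hz, regressor, truncState]
    split_ifs <;> simp [sq_nonneg]
  -- The centered indicator of mode `i`. The truncated state is known before the switch is drawn, so
  -- its energy at the times of mode `i` is asymptotically the fraction `p i` of its total.
  set φ : Fin k → ℝ := fun j => (if j = i then 1 else 0) - p i with hφ
  have hφ0 : ∑ j, p j * φ j = 0 := by
    simp only [hφ, mul_sub, Finset.sum_sub_distrib, ← Finset.sum_mul, hM.prob_sum]
    simp
  have hpt : ∀ v : Fin n → ℝ, 0 < v ⬝ᵥ v → ∀ᵐ ω ∂μ,
      (∀ᶠ T : ℕ in atTop, c0 * T * (v ⬝ᵥ v) ≤ ∑ t ∈ Finset.range T, (v ⬝ᵥ w t ω) ^ 2) →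
      ∀ᶠ T : ℕ in atTop, p i * (c0 / 16) * T * (v ⬝ᵥ v)
        ≤ ∑ t ∈ Finset.range T, (v ⬝ᵥ z ω t) ^ 2 := by
    intro v hv
    have hb : ∀ t ω, (v ⬝ᵥ truncState R x t ω) ^ 2 ≤ (v ⬝ᵥ v) * R ^ 2 := fun t ω =>
      (sq_dotProduct_le_mul _ _).trans
        (mul_le_mul_of_nonneg_left (truncState_dotProduct_self_le t ω) hv.le)
    have h1 := hM.ae_abs_sum_switch_le hφ0 (y := fun t ω => (v ⬝ᵥ truncState R x t ω) ^ 2)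
      (fun t => (((measurable_dotProduct_left v).comp
        (hM.measurable_truncState R t)).pow_const 2).stronglyMeasurable)
      (C := (((v ⬝ᵥ v) * R ^ 2) ^ 2).toNNReal) (fun t => by
        calc _ ≤ ∫⁻ _, ENNReal.ofReal (((v ⬝ᵥ v) * R ^ 2) ^ 2) ∂μ :=
              lintegral_mono fun ω => ENNReal.ofReal_le_ofReal
                (pow_le_pow_left₀ (sq_nonneg _) (hb t ω) 2)
          _ = _ := by rw [lintegral_const, measure_univ, mul_one]; rfl)
    filter_upwards [h1, hR v hv] with ω h1 h2 hlow
    obtain ⟨K, hK⟩ := h1 (p i * (c0 / 32) * (v ⬝ᵥ v)) (by positivity)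
    filter_upwards [h2 hlow, eventually_add_const_le_mul (a := p i * (c0 / 32) * (v ⬝ᵥ v))
      (b := p i * (c0 / 16) * (v ⬝ᵥ v)) (by nlinarith [mul_pos (mul_pos hpi hc0) hv])
      (p i * (c0 / 32) * (v ⬝ᵥ v) + K)] with T hT1 hT2
    have h3 := (abs_le.1 (hK T)).1
    have e : ∑ t ∈ Finset.range T, (v ⬝ᵥ truncState R x t ω) ^ 2 * φ (s t ω)
        = ∑ t ∈ Finset.range T, (v ⬝ᵥ z ω t) ^ 2
          - p i * ∑ t ∈ Finset.range T, (v ⬝ᵥ truncState R x t ω) ^ 2 := by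
      rw [Finset.mul_sum, ← Finset.sum_sub_distrib]
      refine Finset.sum_congr rfl fun t _ => ?_
      simp only [hφ, hz]
      split_ifs
      · ring
      · rw [dotProduct_zero]; ring
    rw [e] at h3
    have h4 := mul_le_mul_of_nonneg_left hT1 hpi.le
    linarith
  have hae : ∀ᵐ ω ∂μ, ∀ m : ℕ, 0 < TopologicalSpace.denseSeq (Fin n → ℝ) m ⬝ᵥ
      TopologicalSpace.denseSeq (Fin n → ℝ) m →
      (∀ᶠ T : ℕ in atTop, c0 * T * (TopologicalSpace.denseSeq (Fin n → ℝ) m ⬝ᵥ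
        TopologicalSpace.denseSeq (Fin n → ℝ) m)
        ≤ ∑ t ∈ Finset.range T, (TopologicalSpace.denseSeq (Fin n → ℝ) m ⬝ᵥ w t ω) ^ 2) →
      ∀ᶠ T : ℕ in atTop, p i * (c0 / 16) * T * (TopologicalSpace.denseSeq (Fin n → ℝ) m ⬝ᵥ
        TopologicalSpace.denseSeq (Fin n → ℝ) m)
        ≤ ∑ t ∈ Finset.range T, (TopologicalSpace.denseSeq (Fin n → ℝ) m ⬝ᵥ z ω t) ^ 2 := by
    refine ae_all_iff.2 fun m => ?_
    by_cases hm : 0 < TopologicalSpace.denseSeq (Fin n → ℝ) m ⬝ᵥ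
      TopologicalSpace.denseSeq (Fin n → ℝ) m
    · filter_upwards [hpt _ hm] with ω hω _ using hω
    · exact ae_of_all _ fun ω h => absurd h hm
  filter_upwards [hae] with ω hω hlow
  have hunif := exists_uniform_lower_bound (z := z ω) (B := R ^ 2) (c := p i * (c0 / 16))
    (sq_nonneg _) (by positivity)
    (Eventually.of_forall fun T => by
      calc _ ≤ ∑ t ∈ Finset.range T, R ^ 2 := Finset.sum_le_sum fun t _ => hzR ω t
        _ = _ := by rw [Finset.sum_const, Finset.card_range, nsmul_eq_mul, mul_comm])
    (fun m => by
      rcases (dotProduct_self_nonneg' (TopologicalSpace.denseSeq (Fin n → ℝ) m)).eq_or_lt with h | h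
      · refine Eventually.of_forall fun T => ?_
        rw [← h, mul_zero]; exact Finset.sum_nonneg fun t _ => sq_nonneg _
      · exact hω m h (hlow _))
  filter_upwards [hunif] with T hT v
  exact (hT v).trans (Finset.sum_le_sum fun t _ => hzx ω t v)

end SwitchedModel

end Excitation

/-! ### From excitation and self-normalized noise to the estimation error. -/

section LeastSquares

open Matrix

/-- The basic inequality of least squares in one coordinate. -/
lemma dotProduct_self_le_of_leastSquares {n : ℕ} {y : ℕ → Fin n → ℝ} {ζ : ℕ → ℝ} {T : ℕ}
    {d : Fin n → ℝ}
    (hd : ∑ t ∈ Finset.range T, (d ⬝ᵥ y t) ^ 2 ≤ 2 * ∑ t ∈ Finset.range T, ζ t * (d ⬝ᵥ y t))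
    {c Q : ℝ} (hc1 : 1 ≤ c)
    (hc : ∀ v : Fin n → ℝ, c * (v ⬝ᵥ v) ≤ ∑ t ∈ Finset.range T, (v ⬝ᵥ y t) ^ 2)
    (hQ : quad (gram y T)⁻¹ (corr y ζ T) ≤ Q) : c * (d ⬝ᵥ d) ≤ 8 * Q := by
  refine (hc d).trans ?_
  set E := ∑ t ∈ Finset.range T, (d ⬝ᵥ y t) ^ 2 with hE
  have hE0 : 0 ≤ E := Finset.sum_nonneg fun t _ => sq_nonneg _
  have hS : d ⬝ᵥ corr y ζ T = ∑ t ∈ Finset.range T, ζ t * (d ⬝ᵥ y t) := by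
    simp [corr, dotProduct_sum]
  have hQ0 : 0 ≤ quad (gram y T)⁻¹ (corr y ζ T) := quad_nonneg (posDef_gram y T).inv.posSemidef _
  -- The identity in the regularized Gram matrix is harmless: `d ⬝ᵥ d ≤ c * (d ⬝ᵥ d) ≤ E` because `1
  -- ≤ c`.
  have hV : quad (gram y T) d ≤ 2 * E := by
    have h1 := hc d
    have h2 := dotProduct_self_nonneg' d
    rw [quad_gram]
    simp_rw [dotProduct_comm (y _) d]
    nlinarith
  have h3 := sq_dotProduct_le (posDef_gram y T) d (corr y ζ T)
  rw [← hS] at hd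
  have h4 : E ^ 2 ≤ 8 * E * Q := by
    calc E ^ 2 ≤ (2 * (d ⬝ᵥ corr y ζ T)) ^ 2 := pow_le_pow_left₀ hE0 hd 2
      _ = 4 * (d ⬝ᵥ corr y ζ T) ^ 2 := by ring
      _ ≤ 4 * (2 * E * Q) := by
          refine mul_le_mul_of_nonneg_left (h3.trans ?_) (by norm_num)
          exact mul_le_mul hV hQ hQ0 (by positivity)
      _ = _ := by ring
  rcases hE0.eq_or_lt with h | h
  · rw [← h]; linarith
  · nlinarith

/-- The constant of the estimation error: it does not depend on the switching probabilities. -/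
noncomputable def errorConst (n : ℕ) (N c0 : ℝ) : ℝ :=
  16 * (noiseConst n N + 2) / (c0 / 128)

lemma noiseConst_nonneg (n : ℕ) {N : ℝ} (hN : 0 ≤ N) : 0 ≤ noiseConst n N := by
  unfold noiseConst; positivity

namespace SwitchedModel

variable {n k : ℕ} {A : Fin k → Matrix (Fin n) (Fin n) ℝ} {p : Fin k → ℝ}
variable {Ω : Type*} {m0 : MeasurableSpace Ω} {μ : Measure Ω} {α N : ℝ}
  {𝒬 ℋ : Filtration ℕ m0} {x : ℕ → Ω → Fin n → ℝ} {s : ℕ → Ω → Fin k} {w : ℕ → Ω → Fin n → ℝ}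

variable [IsProbabilityMeasure μ]

/-- The error of least squares in one coordinate. -/
lemma ae_eventually_leastSquares_error_le (hM : SwitchedModel μ A p α N 𝒬 ℋ x s w)
    (hA : ∏ j, spectralNorm (A j) ^ p j < 1) {c0 : ℝ} (hc0 : 0 < c0) :
    ∀ᵐ ω ∂μ, (∀ v : Fin n → ℝ, ∀ᶠ T : ℕ in atTop,
        c0 * T * (v ⬝ᵥ v) ≤ ∑ t ∈ Finset.range T, (v ⬝ᵥ w t ω) ^ 2) →
      ∀ i, ∀ᶠ T : ℕ in atTop, ∀ (d : Fin n → ℝ) (l : Fin n),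
        ∑ t ∈ Finset.range T, (d ⬝ᵥ regressor x s i ω t) ^ 2
          ≤ 2 * ∑ t ∈ Finset.range T, w t ω l * (d ⬝ᵥ regressor x s i ω t) →
        d ⬝ᵥ d ≤ errorConst n N c0 * (Real.log T / (p i * T)) := by
  obtain ⟨θ, hθ, hθ1, hρ⟩ := exists_rpow_sum_lt_one (fun j => spectralNorm_nonneg (A j)) hM.prob_pos
    hM.prob_sum hA
  filter_upwards [ae_all_iff.2 fun i => ae_all_iff.2 fun l =>
      hM.ae_eventually_quad_noise_le i hθ hθ1 hρ hc0 l,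
    ae_all_iff.2 fun i => hM.ae_eventually_sum_regressor_ge i hθ hθ1 hρ hc0] with ω h1 h2 hlow i
  have hpi := hM.prob_pos i
  have hc : 0 < p i * (c0 / 16) / 8 := by positivity
  have hbig : ∀ᶠ T : ℕ in atTop, 1 ≤ p i * (c0 / 16) / 8 * T :=
    (tendsto_natCast_atTop_atTop.const_mul_atTop hc).eventually_ge_atTop 1
  filter_upwards [eventually_all.2 fun l => h1 i l hlow, h2 i hlow, hbig, eventually_gt_atTop 0]
    with T hT1 hT2 hT3 hT4 d l hd
  have h3 := dotProduct_self_le_of_leastSquares hd hT3 hT2 (hT1 l)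
  have hT0 : (0 : ℝ) < T := by exact_mod_cast hT4
  unfold errorConst
  have e : 16 * (noiseConst n N + 2) / (c0 / 128) * (Real.log T / (p i * T))
      = 8 * (2 * (noiseConst n N + 2) * Real.log T) / (p i * (c0 / 16) / 8 * T) := by
    field_simp
    ring
  rw [e, le_div_iff₀ (by positivity)]
  linarith

end SwitchedModel

end LeastSquares

/-! ### Measurability, filtrations and stopping of the noise at a deterministic moment bound. -/

section Reduction

open Matrix

variable {Ω : Type*} {n k : ℕ}

lemma measurable_ofLp {n : ℕ} :
    Measurable fun z : EuclideanSpace ℝ (Fin n) => (z.ofLp : Fin n → ℝ) :=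
  (PiLp.continuous_ofLp 2 _).measurable

lemma measurable_toLp {n : ℕ} :
    Measurable fun z : Fin n → ℝ => (WithLp.toLp 2 z : EuclideanSpace ℝ (Fin n)) :=
  (PiLp.continuous_toLp 2 _).measurable

lemma measurable_switched_mulVec {m : MeasurableSpace Ω} (A : Fin k → Matrix (Fin n) (Fin n) ℝ)
    {s : Ω → Fin k} {x : Ω → Fin n → ℝ} (hs : Measurable s) (hx : Measurable x) :
    Measurable fun ω => A (s ω) *ᵥ x ω := by
  have e : (fun ω => A (s ω) *ᵥ x ω) = fun ω => ∑ j, if s ω = j then A j *ᵥ x ω else 0 := by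
    funext ω; simp
  rw [e]
  exact Finset.measurable_sum _ fun j _ => Measurable.ite (hs (measurableSet_singleton j))
    ((measurable_mulVec (A j)).comp hx) measurable_const

lemma ofLp_state_succ (A : Fin k → Matrix (Fin n) (Fin n) ℝ) (x₀ : EuclideanSpace ℝ (Fin n))
    (s : ℕ → Ω → Fin k) (w : ℕ → Ω → EuclideanSpace ℝ (Fin n)) (t : ℕ) (ω : Ω) :
    (state A x₀ s w (t + 1) ω).ofLp
      = A (s t ω) *ᵥ (state A x₀ s w t ω).ofLp + (w t ω).ofLp := by
  rw [state, WithLp.ofLp_add]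
  rfl

lemma measurable_state {m : MeasurableSpace Ω} (A : Fin k → Matrix (Fin n) (Fin n) ℝ)
    (x₀ : EuclideanSpace ℝ (Fin n)) {s : ℕ → Ω → Fin k}
    {w : ℕ → Ω → EuclideanSpace ℝ (Fin n)} (hs : ∀ t, Measurable (s t)) (hw : ∀ t, Measurable (w t))
    (t : ℕ) : Measurable (state A x₀ s w t) := by
  suffices h : Measurable fun ω => (state A x₀ s w t ω).ofLp from measurable_toLp.comp h
  induction t with
  | zero => exact (measurable_const : Measurable fun _ : Ω => x₀.ofLp)
  | succ t ih =>
    simp only [ofLp_state_succ]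
    exact (measurable_switched_mulVec A (hs t) ih).add (measurable_ofLp.comp (hw t))

section Filtrations

variable {x : ℕ → Ω → EuclideanSpace ℝ (Fin n)} {s : ℕ → Ω → Fin k}

lemma comap_state_le_past {r t : ℕ} (h : r ≤ t) :
    MeasurableSpace.comap (x r) inferInstance ≤ past x s t :=
  le_sup_of_le_left (le_iSup₂_of_le r h le_rfl)

lemma comap_switch_le_past {r t : ℕ} (h : r < t) :
    MeasurableSpace.comap (s r) inferInstance ≤ past x s t :=
  le_sup_of_le_right (le_iSup₂_of_le r h le_rfl)

lemma comap_state_le_history {r t : ℕ} (h : r ≤ t) :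
    MeasurableSpace.comap (x r) inferInstance ≤ history x s t :=
  le_sup_of_le_left (le_iSup₂_of_le r h le_rfl)

lemma comap_switch_le_history {r t : ℕ} (h : r ≤ t) :
    MeasurableSpace.comap (s r) inferInstance ≤ history x s t :=
  le_sup_of_le_right (le_iSup₂_of_le r h le_rfl)

lemma past_le_history (t : ℕ) : past x s t ≤ history x s t :=
  sup_le (iSup₂_le fun _ h => comap_state_le_history h)
    (iSup₂_le fun _ h => comap_switch_le_history (le_of_lt h))

lemma history_le_past_succ (t : ℕ) : history x s t ≤ past x s (t + 1) :=
  sup_le (iSup₂_le fun _ h => comap_state_le_past (Nat.le_succ_of_le h))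
    (iSup₂_le fun _ h => comap_switch_le_past (Nat.lt_succ_of_le h))

lemma past_mono : Monotone (past x s) := fun _ _ h =>
  sup_le (iSup₂_le fun _ h' => comap_state_le_past (h'.trans h))
    (iSup₂_le fun _ h' => comap_switch_le_past (lt_of_lt_of_le h' h))

lemma history_mono : Monotone (history x s) := fun _ _ h =>
  sup_le (iSup₂_le fun _ h' => comap_state_le_history (h'.trans h))
    (iSup₂_le fun _ h' => comap_switch_le_history (h'.trans h))

lemma history_le [m0 : MeasurableSpace Ω] (hx : ∀ t, Measurable (x t)) (hs : ∀ t, Measurable (s t))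
    (t : ℕ) : history x s t ≤ m0 :=
  sup_le (iSup₂_le fun r _ => (hx r).comap_le) (iSup₂_le fun r _ => (hs r).comap_le)

/-- The filtration of the pasts. -/
def pastFiltration [m0 : MeasurableSpace Ω] (hx : ∀ t, Measurable (x t))
    (hs : ∀ t, Measurable (s t)) : Filtration ℕ m0 where
  seq := past x s
  mono' := past_mono
  le' t := (past_le_history t).trans (history_le hx hs t)

/-- The filtration of the histories. -/
def historyFiltration [m0 : MeasurableSpace Ω] (hx : ∀ t, Measurable (x t))
    (hs : ∀ t, Measurable (s t)) : Filtration ℕ m0 where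
  seq := history x s
  mono' := history_mono
  le' := history_le hx hs

end Filtrations

variable [m0 : MeasurableSpace Ω] {μ : Measure Ω} {A : Fin k → Matrix (Fin n) (Fin n) ℝ}
  {x₀ : EuclideanSpace ℝ (Fin n)} {s : ℕ → Ω → Fin k} {w : ℕ → Ω → EuclideanSpace ℝ (Fin n)}

/-- The event that the conditional moments are at most `N` up to time `t`. -/
def momentBounded (μ : Measure Ω) (x : ℕ → Ω → EuclideanSpace ℝ (Fin n)) (s : ℕ → Ω → Fin k)
    (w : ℕ → Ω → EuclideanSpace ℝ (Fin n)) (α : ℝ) (N : ℝ≥0∞) (t : ℕ) : Set Ω :=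
  {ω | ∀ r ≤ t, condMoment μ x s w α r ω ≤ N}

lemma measurableSet_momentBounded (x : ℕ → Ω → EuclideanSpace ℝ (Fin n)) (α : ℝ) (N : ℝ≥0∞) (t : ℕ) :
    MeasurableSet[history x s t] (momentBounded μ x s w α N t) := by
  have e : momentBounded μ x s w α N t = ⋂ r ∈ Set.Iic t, {ω | condMoment μ x s w α r ω ≤ N} := by
    ext; simp [momentBounded]
  rw [e]
  refine MeasurableSet.biInter (Set.to_countable _) fun r hr => ?_
  exact history_mono (Set.mem_Iic.1 hr) _
    (measurableSet_le (measurable_condLExp _ _ _) measurable_const)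

/-- The system driven by the noise stopped when its conditional moments exceed `N`. -/
lemma switchedModel_stopped [IsProbabilityMeasure μ] {p : Fin k → ℝ} (hp : ∀ i, 0 < p i)
    (h1 : ∑ i, p i = 1) {α : ℝ} (hα : 2 < α) {C : Matrix (Fin n) (Fin n) ℝ}
    (hs : IsIIDSwitching μ (state A x₀ s w) s p)
    (hw : NoiseAssumption μ (state A x₀ s w) s w α C) (N : ℕ) :
    SwitchedModel μ A p α N (pastFiltration (measurable_state A x₀ hs.measurable hw.measurable)
      hs.measurable) (historyFiltration (measurable_state A x₀ hs.measurable hw.measurable)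
      hs.measurable)
      (fun t ω => (state A x₀ s (fun t => (momentBounded μ (state A x₀ s w) s w α N t).indicator
        (w t)) t ω).ofLp) s
      (fun t ω => ((momentBounded μ (state A x₀ s w) s w α N t).indicator (w t) ω).ofLp) := by
  set x := state A x₀ s w with hx
  set D := momentBounded μ x s w α N with hD
  have hxm : ∀ t, Measurable (x t) := measurable_state A x₀ hs.measurable hw.measurable
  have hle := history_le hxm hs.measurable
  have hDm : ∀ t, MeasurableSet[history x s t] (D t) := measurableSet_momentBounded x α N
  have hsp : ∀ t, Measurable[past x s (t + 1)] (s t) := fun t =>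
    measurable_iff_comap_le.2 (comap_switch_le_past (Nat.lt_succ_self t))
  have hxp : ∀ {r t}, r ≤ t → Measurable[past x s t] fun ω => (x r ω).ofLp := fun h =>
    measurable_ofLp.comp (measurable_iff_comap_le.2 (comap_state_le_past h))
  -- The noise is recovered from two successive states and the switch between them, so it belongs to
  -- the past of time `t + 1`.
  have hwp : ∀ t, Measurable[past x s (t + 1)] fun ω => (w t ω).ofLp := fun t => by
    have e : (fun ω => (w t ω).ofLp)
        = fun ω => (x (t + 1) ω).ofLp - A (s t ω) *ᵥ (x t ω).ofLp := by
      ext1 ω; rw [hx, ofLp_state_succ]; simp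
    rw [e]
    exact (hxp le_rfl).sub (measurable_switched_mulVec A (hsp t) (hxp (Nat.le_succ t)))
  have hind : ∀ t ω, ((D t).indicator (w t) ω).ofLp = (D t).indicator (fun ω => (w t ω).ofLp) ω :=
    fun t ω => by by_cases h : ω ∈ D t <;> simp [h]
  have hwD : ∀ t, Measurable[past x s (t + 1)] fun ω => ((D t).indicator (w t) ω).ofLp := fun t => by
    simp only [hind]
    exact (hwp t).indicator (history_le_past_succ t _ (hDm t))
  have hcoord : ∀ t l, Integrable (fun ω => (w t ω).ofLp l) μ := fun t l =>
    (ContinuousLinearMap.integrable_comp (EuclideanSpace.proj (𝕜 := ℝ) l) (hw.integrable t) :)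
  have hcoordc : ∀ t l, μ[fun ω => (w t ω).ofLp l | history x s t] =ᵐ[μ] 0 := fun t l => by
    have h2 := ContinuousLinearMap.comp_condExp_comm (m := history x s t) (hw.integrable t)
      (EuclideanSpace.proj (𝕜 := ℝ) l)
    filter_upwards [h2, hw.condExp_eq_zero t] with ω h2 h3
    have h4 : (μ[fun ω => (w t ω).ofLp l | history x s t]) ω
      = (EuclideanSpace.proj (𝕜 := ℝ) l) ((μ[w t | history x s t]) ω) := h2.symm
    rw [h4, h3]; simp
  have hindl : ∀ t l, (fun ω => ((D t).indicator (w t) ω).ofLp l)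
      = (D t).indicator fun ω => (w t ω).ofLp l := fun t l => by
    ext ω; by_cases h : ω ∈ D t <;> simp [h]
  exact
  { past_le := past_le_history
    le_past := history_le_past_succ
    -- The filtrations are those of the original system. The stopped state is adapted to them
    -- because stopping is decided by the history before the noise enters.
    state_meas := fun t => by
      induction t with
      | zero => exact @measurable_const _ _ _ (past x s 0) x₀.ofLp
      | succ t ih =>
        simp only [ofLp_state_succ]
        exact (measurable_switched_mulVec A (hsp t) (ih.mono (past_mono (Nat.le_succ t)) le_rfl)).add
          (hwD t)
    switch_meas := fun t => measurable_iff_comap_le.2 (comap_switch_le_history le_rfl)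
    noise_meas := hwD
    switch_law := fun t j F hF => by
      have h2 := (Indep_iff _ _ _).1 (hs.indep t) {ω | s t ω = j} F
        ⟨{j}, measurableSet_singleton j, rfl⟩ hF
      rw [Set.inter_comm, h2, hs.law]
    noise_integrable := fun t l => by
      rw [hindl]; exact (hcoord t l).indicator (hle t _ (hDm t))
    noise_condExp := fun t l => by
      rw [hindl]
      filter_upwards [condExp_indicator (m := history x s t) (hcoord t l) (hDm t), hcoordc t l]
        with ω h2 h3
      refine h2.trans ?_
      by_cases h : ω ∈ D t <;> simp [h, h3]
    noise_moment := fun t F hF => by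
      have hFD : MeasurableSet[history x s t] (F ∩ D t) := MeasurableSet.inter hF (hDm t)
      calc ∫⁻ ω in F, ENNReal.ofReal (vnorm ((D t).indicator (w t) ω).ofLp ^ α) ∂μ
          = ∫⁻ ω in F, (D t).indicator (fun ω => ‖w t ω‖ₑ ^ α) ω ∂μ := by
            refine lintegral_congr fun ω => ?_
            by_cases h : ω ∈ D t
            · rw [Set.indicator_of_mem h, Set.indicator_of_mem h,
                ← ENNReal.ofReal_rpow_of_nonneg (vnorm_nonneg _) (by linarith)]
              congr 1
              exact ofReal_norm (w t ω)
            · rw [Set.indicator_of_notMem h, Set.indicator_of_notMem h]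
              have : vnorm (0 : EuclideanSpace ℝ (Fin n)).ofLp = 0 := by simp [vnorm]
              rw [this, Real.zero_rpow (by linarith), ENNReal.ofReal_zero]
        _ = ∫⁻ ω in F ∩ D t, ‖w t ω‖ₑ ^ α ∂μ := by
            rw [setLIntegral_indicator (hle t _ (hDm t)), Set.inter_comm]
        _ = ∫⁻ ω in F ∩ D t, condMoment μ x s w α t ω ∂μ :=
            (setLIntegral_condLExp (hle t) μ _ hFD).symm
        _ ≤ ∫⁻ _ in F ∩ D t, (N : ℝ≥0∞) ∂μ :=
            setLIntegral_mono' (hle t _ hFD) fun ω hω => hω.2 t le_rfl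
        _ ≤ ENNReal.ofReal N * μ F := by
            rw [setLIntegral_const, ENNReal.ofReal_natCast]
            gcongr
            exact Set.inter_subset_left
    state_succ := fun t ω => ofLp_state_succ _ _ _ _ t ω
    state_zero := ⟨x₀.ofLp, fun ω => rfl⟩
    prob_pos := hp
    prob_sum := h1
    two_lt := hα
    moment_nonneg := Nat.cast_nonneg N }

-- Transfers pathwise results from the stopped system: on a path where the conditional moments never
-- exceed the level, no noise is removed and both systems have the same states.
omit m0 in
lemma state_congr {w' : ℕ → Ω → EuclideanSpace ℝ (Fin n)} {ω : Ω} (h : ∀ t, w' t ω = w t ω) (t : ℕ) :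
    state A x₀ s w' t ω = state A x₀ s w t ω := by
  induction t with
  | zero => rfl
  | succ t ih => rw [state, state, ih, h]

end Reduction

/-! ### Constants from `C`, rows of the estimate, and the entrywise error. -/

section Final

open Matrix

variable {Ω : Type*} {n k : ℕ}

/-- Duality with `S = v` bounds `quad C v` below through the spectral norm of `C⁻¹`. Half of that
bound makes the inequality strict, as the passage from an inferior limit to eventual bounds
requires. -/
lemma exists_mul_dotProduct_lt_quad {C : Matrix (Fin n) (Fin n) ℝ} (hC : C.PosDef) :
    ∃ c > (0 : ℝ), ∀ v : Fin n → ℝ, v ≠ 0 → c * (v ⬝ᵥ v) < quad C v := by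
  set σ := spectralNorm C⁻¹ with hσ
  have hσ0 : 0 ≤ σ := spectralNorm_nonneg _
  refine ⟨(2 * (σ + 1))⁻¹, by positivity, fun v hv => ?_⟩
  have hvv : 0 < v ⬝ᵥ v := (dotProduct_self_nonneg' v).lt_of_ne' fun h => hv (dotProduct_self_eq_zero.1 h)
  have h1 := sq_dotProduct_le hC v v
  have h2 : quad C⁻¹ v ≤ σ * (v ⬝ᵥ v) := by
    refine (le_abs_self _).trans (abs_le_of_sq_le_sq ?_ (by positivity))
    refine (sq_dotProduct_le_mul v (C⁻¹ *ᵥ v)).trans ?_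
    have := mul_le_mul_of_nonneg_left (mulVec_self_le C⁻¹ v) hvv.le
    nlinarith
  have h3 : 0 < quad C v := quad_pos hC hv
  have h4 : v ⬝ᵥ v ≤ quad C v * σ := by
    have := mul_le_mul_of_nonneg_left h2 h3.le
    nlinarith
  rw [inv_mul_lt_iff₀ (by positivity)]
  nlinarith

lemma eventually_lower_of_liminf {z : ℕ → Fin n → ℝ} {v : Fin n → ℝ} {c b : ℝ}
    (hcb : c * (v ⬝ᵥ v) < b)
    (h : liminf (fun T : ℕ => (((1 / (T : ℝ)) * (v ⬝ᵥ
      ((∑ t ∈ Finset.range T, vecMulVec (z t) (z t)) *ᵥ v)) : ℝ) : EReal)) atTop = (b : EReal)) :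
    ∀ᶠ T : ℕ in atTop, c * T * (v ⬝ᵥ v) ≤ ∑ t ∈ Finset.range T, (v ⬝ᵥ z t) ^ 2 := by
  have h1 : ((c * (v ⬝ᵥ v) : ℝ) : EReal) < liminf (fun T : ℕ => (((1 / (T : ℝ)) * (v ⬝ᵥ
      ((∑ t ∈ Finset.range T, vecMulVec (z t) (z t)) *ᵥ v)) : ℝ) : EReal)) atTop := by
    rw [h]; exact_mod_cast hcb
  filter_upwards [eventually_lt_of_lt_liminf h1, eventually_gt_atTop 0] with T hT hT0
  have hT0 : (0 : ℝ) < T := by exact_mod_cast hT0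
  rw [EReal.coe_lt_coe_iff, one_div, lt_inv_mul_iff₀ hT0] at hT
  have e : v ⬝ᵥ ((∑ t ∈ Finset.range T, vecMulVec (z t) (z t)) *ᵥ v)
      = ∑ t ∈ Finset.range T, (v ⬝ᵥ z t) ^ 2 := by
    have := quad_sum (Finset.range T) (fun t => vecMulVec (z t) (z t)) v
    simp only [quad_vecMulVec] at this
    simp only [quad] at this
    rw [this]
    exact Finset.sum_congr rfl fun t _ => by rw [dotProduct_comm]
  rw [e] at hT
  linarith

/-- The basic inequality for a row of the switched least squares estimate. -/
lemma sum_sq_le_of_isSwitchedLeastSquares {A : Fin k → Matrix (Fin n) (Fin n) ℝ}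
    {x₀ : EuclideanSpace ℝ (Fin n)} {s : ℕ → Ω → Fin k} {w : ℕ → Ω → EuclideanSpace ℝ (Fin n)}
    {ω : Ω} {Ahat : ℕ → Fin k → Matrix (Fin n) (Fin n) ℝ}
    (h : IsSwitchedLeastSquares (state A x₀ s w) s ω Ahat) (T : ℕ) (i : Fin k) (l : Fin n) :
    ∑ t ∈ Finset.range T,
        ((Ahat T i l - A i l) ⬝ᵥ regressor (fun t ω => (state A x₀ s w t ω).ofLp) s i ω t) ^ 2
      ≤ 2 * ∑ t ∈ Finset.range T, (w t ω).ofLp l *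
        ((Ahat T i l - A i l) ⬝ᵥ regressor (fun t ω => (state A x₀ s w t ω).ofLp) s i ω t) := by
  set x := state A x₀ s w with hx
  -- The competitor replaces only row `l` of the estimate by the true row; the squared error
  -- separates over rows, so all other rows cancel.
  have h1 := h T i ((Ahat T i).updateRow l (A i l))
  have hcost : ∀ B : Matrix (Fin n) (Fin n) ℝ, lsCost x s i T ω B
      = ∑ t ∈ modeTimes s i T ω, ∑ q, ((x (t + 1) ω).ofLp q - B q ⬝ᵥ (x t ω).ofLp) ^ 2 := fun B => by
    refine Finset.sum_congr rfl fun t _ => ?_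
    rw [EuclideanSpace.real_norm_sq_eq]
    rfl
  rw [hcost, hcost, ← sub_nonneg, ← Finset.sum_sub_distrib] at h1
  have h2 : ∀ t ∈ modeTimes s i T ω,
      ∑ q, ((x (t + 1) ω).ofLp q - (Ahat T i).updateRow l (A i l) q ⬝ᵥ (x t ω).ofLp) ^ 2
        - ∑ q, ((x (t + 1) ω).ofLp q - Ahat T i q ⬝ᵥ (x t ω).ofLp) ^ 2
      = 2 * ((w t ω).ofLp l * ((Ahat T i l - A i l) ⬝ᵥ (x t ω).ofLp))
        - ((Ahat T i l - A i l) ⬝ᵥ (x t ω).ofLp) ^ 2 := by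
    intro t ht
    have hst : s t ω = i := (Finset.mem_filter.1 ht).2
    rw [← Finset.sum_sub_distrib, Finset.sum_eq_single l]
    · rw [updateRow_self]
      have e : (x (t + 1) ω).ofLp l = A i l ⬝ᵥ (x t ω).ofLp + (w t ω).ofLp l := by
        rw [hx, ofLp_state_succ, hst]; rfl
      rw [e, sub_dotProduct]; ring
    · intro q _ hq
      rw [updateRow_ne hq, sub_self]
    · exact fun hl => absurd (Finset.mem_univ l) hl
  rw [Finset.sum_congr rfl h2, modeTimes, Finset.sum_filter] at h1
  rw [← sub_nonneg, Finset.mul_sum, ← Finset.sum_sub_distrib]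
  refine h1.trans (le_of_eq (Finset.sum_congr rfl fun t _ => ?_))
  unfold regressor
  split_ifs <;> simp

lemma maxNorm_le {a b : Type*} [Fintype a] [Fintype b] {M : Matrix a b ℝ} {c : ℝ} (hc : 0 ≤ c)
    (h : ∀ i j, |M i j| ≤ c) : maxNorm M ≤ c :=
  Real.iSup_le (fun q => h q.1 q.2) hc

lemma tendsto_sqrt_log_div (q K : ℝ) :
    Tendsto (fun T : ℕ => K * √(Real.log T / (q * T))) atTop (𝓝 0) := by
  have h1 : Tendsto (fun T : ℕ => Real.log T / (T : ℝ)) atTop (𝓝 0) :=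
    Real.isLittleO_log_id_atTop.tendsto_div_nhds_zero.comp tendsto_natCast_atTop_atTop
  have h2 : Tendsto (fun T : ℕ => Real.log T / (q * T)) atTop (𝓝 0) := by
    have := h1.const_mul q⁻¹
    rw [mul_zero] at this
    refine this.congr fun T => ?_
    rw [inv_mul_eq_div, div_div, mul_comm]
  have h3 := (h2.sqrt).const_mul K
  rwa [Real.sqrt_zero, mul_zero] at h3

lemma errorConst_nonneg (n : ℕ) {N c0 : ℝ} (hN : 0 ≤ N) (hc0 : 0 ≤ c0) : 0 ≤ errorConst n N c0 := by
  have := noiseConst_nonneg n hN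
  unfold errorConst; positivity

variable [m0 : MeasurableSpace Ω] {μ : Measure Ω} [IsProbabilityMeasure μ]
  {A : Fin k → Matrix (Fin n) (Fin n) ℝ}
  {x₀ : EuclideanSpace ℝ (Fin n)} {s : ℕ → Ω → Fin k} {w : ℕ → Ω → EuclideanSpace ℝ (Fin n)}

/-- The entrywise error of the switched least squares estimates. -/
lemma ae_eventually_abs_error_le {p : Fin k → ℝ} (hp : ∀ i, 0 < p i)
    (h1 : ∑ i, p i = 1) (hA : ∏ i, spectralNorm (A i) ^ p i < 1) {α : ℝ} (hα : 2 < α)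
    {C : Matrix (Fin n) (Fin n) ℝ} {c0 : ℝ} (hc0 : 0 < c0)
    (hC : ∀ v : Fin n → ℝ, v ≠ 0 → c0 * (v ⬝ᵥ v) < quad C v)
    (hs : IsIIDSwitching μ (state A x₀ s w) s p)
    (hw : NoiseAssumption μ (state A x₀ s w) s w α C) :
    ∀ᵐ ω ∂μ, ∀ Ahat : ℕ → Fin k → Matrix (Fin n) (Fin n) ℝ,
      IsSwitchedLeastSquares (state A x₀ s w) s ω Ahat → ∀ i, ∀ᶠ T : ℕ in atTop, ∀ l q,
        |Ahat T i l q - A i l q| ≤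
          √(errorConst n ⌈(⨆ t, condMoment μ (state A x₀ s w) s w α t ω).toNNReal⌉₊ c0)
            * √(Real.log T / (p i * T)) := by
  -- The moment bound is random. The stopped systems form a countable family over the integers `N`,
  -- so a single null set serves all of them and each path may then choose its own `N`, the ceiling
  -- of its bound.
  have hmodel := fun N : ℕ =>
    (switchedModel_stopped hp h1 hα hs hw N).ae_eventually_leastSquares_error_le hA hc0
  filter_upwards [ae_all_iff.2 hmodel, hw.condMoment_bounded, hw.liminf_eq] with ω hmod hbd hlim Ahat
    hAhat i
  set M := ⨆ t, condMoment μ (state A x₀ s w) s w α t ω with hM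
  set N := ⌈M.toNNReal⌉₊ with hN
  have hMN : M ≤ (N : ℝ≥0∞) := by
    rw [← ENNReal.coe_toNNReal hbd.ne]
    exact_mod_cast Nat.le_ceil M.toNNReal
  have hmem : ∀ t, ω ∈ momentBounded μ (state A x₀ s w) s w α N t := fun t r _ =>
    (le_iSup (fun t => condMoment μ (state A x₀ s w) s w α t ω) r).trans hMN
  have hwN : ∀ t, (momentBounded μ (state A x₀ s w) s w α N t).indicator (w t) ω = w t ω := fun t =>
    Set.indicator_of_mem (hmem t) _
  have hreg : regressor (fun t ω => (state A x₀ s (fun t => (momentBounded μ (state A x₀ s w)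
      s w α N t).indicator (w t)) t ω).ofLp) s i ω
      = regressor (fun t ω => (state A x₀ s w t ω).ofLp) s i ω := by
    funext t
    simp only [regressor]
    rw [state_congr hwN]
  have h2 := hmod N (fun v => by
    by_cases hv : v = 0
    · refine Eventually.of_forall fun T => ?_
      rw [hv, dotProduct_zero, mul_zero]; exact Finset.sum_nonneg fun t _ => sq_nonneg _
    · simp only [hwN]
      exact eventually_lower_of_liminf (hC v hv) (hlim v)) i
  simp only [hwN, hreg] at h2
  filter_upwards [h2, eventually_gt_atTop 1] with T hT hT1 l q
  have h3 := hT (Ahat T i l - A i l) l (sum_sq_le_of_isSwitchedLeastSquares hAhat T i l)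
  rw [← Real.sqrt_mul (errorConst_nonneg n (Nat.cast_nonneg _) hc0.le)]
  refine Real.abs_le_sqrt (le_trans ?_ h3)
  have h4 := SwitchedModel.abs_apply_le_vnorm (Ahat T i l - A i l) q
  rw [← vnorm_sq, ← sq_abs]
  exact pow_le_pow_left₀ (abs_nonneg _) h4 2

end Final

end SwitchedLS

/-! ### The main theorem. -/

theorem theorem2 {n k : ℕ} (A : Fin k → Matrix (Fin n) (Fin n) ℝ)
    (x₀ : EuclideanSpace ℝ (Fin n)) (C : Matrix (Fin n) (Fin n) ℝ) (hC : C.PosDef)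
    (α : ℝ) (hα : 2 < α) :
    -- `K` is chosen before `p`; its argument bounds the conditional moments of the noise
    ∃ K : ℝ≥0 → ℝ, ∀ p : Fin k → ℝ, (∀ i, 0 < p i) → ∑ i, p i = 1 →
      ∏ i, SwitchedLS.spectralNorm (A i) ^ p i < 1 →
      ∀ (Ω : Type*) [MeasurableSpace Ω] (μ : Measure Ω) [IsProbabilityMeasure μ]
        (s : ℕ → Ω → Fin k) (w : ℕ → Ω → EuclideanSpace ℝ (Fin n)),
        SwitchedLS.IsIIDSwitching μ (SwitchedLS.state A x₀ s w) s p →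
        SwitchedLS.NoiseAssumption μ (SwitchedLS.state A x₀ s w) s w α C →
        ∀ᵐ ω ∂μ, ∀ Ahat : ℕ → Fin k → Matrix (Fin n) (Fin n) ℝ,
          SwitchedLS.IsSwitchedLeastSquares (SwitchedLS.state A x₀ s w) s ω Ahat →
          (∀ i, ∀ᶠ T : ℕ in atTop,
            SwitchedLS.maxNorm (Ahat T i - A i) ≤
              K (⨆ t, SwitchedLS.condMoment μ (SwitchedLS.state A x₀ s w) s w α t ω).toNNReal *
                √(Real.log T / (p i * T))) ∧
          Tendsto (fun T : ℕ =>
            SwitchedLS.maxNorm (SwitchedLS.stack (Ahat T) - SwitchedLS.stack A)) atTop (𝓝 0) ∧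
          ∀ᶠ T : ℕ in atTop,
            SwitchedLS.maxNorm (SwitchedLS.stack (Ahat T) - SwitchedLS.stack A) ≤
              K (⨆ t, SwitchedLS.condMoment μ (SwitchedLS.state A x₀ s w) s w α t ω).toNNReal *
                √(Real.log T / ((⨅ j, p j) * T)) := by
  obtain ⟨c0, hc0, hCc⟩ := SwitchedLS.exists_mul_dotProduct_lt_quad hC
  -- The constant is built from `n`, the moment bound and `c0` alone, and `c0` depends only on `C`;
  -- so it is fixed before `p` and the probability space.
  refine ⟨fun M => √(SwitchedLS.errorConst n ⌈M⌉₊ c0), fun p hp h1 hA Ω _ μ _ s w hs hw => ?_⟩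
  have : Nonempty (Fin k) := by
    by_contra hk
    rw [not_nonempty_iff] at hk
    simp at h1
  filter_upwards [SwitchedLS.ae_eventually_abs_error_le hp h1 hA hα hc0 hCc hs hw] with ω hω Ahat hAhat
  have herr := hω Ahat hAhat
  set K := √(SwitchedLS.errorConst n
    ⌈(⨆ t, SwitchedLS.condMoment μ (SwitchedLS.state A x₀ s w) s w α t ω).toNNReal⌉₊ c0)
  have hK : 0 ≤ K := Real.sqrt_nonneg _
  have hinf : 0 < ⨅ j, p j := by
    obtain ⟨j, hj⟩ := exists_eq_ciInf_of_finite (f := p)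
    rw [← hj]; exact hp j
  have hstack : ∀ᶠ T : ℕ in atTop,
      SwitchedLS.maxNorm (SwitchedLS.stack (Ahat T) - SwitchedLS.stack A)
        ≤ K * √(Real.log T / ((⨅ j, p j) * T)) := by
    -- There are finitely many modes, so the bounds hold for all of them from some time on, and each
    -- `p i` is at least the infimum.
    filter_upwards [eventually_all.2 herr, eventually_gt_atTop 0] with T hT hT0
    have hT0 : (0 : ℝ) < T := by exact_mod_cast hT0
    refine SwitchedLS.maxNorm_le (by positivity) fun q r => (hT q.1 r q.2).trans ?_
    refine mul_le_mul_of_nonneg_left (Real.sqrt_le_sqrt ?_) hK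
    refine div_le_div_of_nonneg_left (Real.log_natCast_nonneg T) (by positivity) ?_
    exact mul_le_mul_of_nonneg_right (ciInf_le (Set.finite_range p).bddBelow q.1) hT0.le
  refine ⟨fun i => ?_, ?_, hstack⟩
  · filter_upwards [herr i] with T hT
    exact SwitchedLS.maxNorm_le (by positivity) fun l q => hT l q
  · refine squeeze_zero' (Eventually.of_forall fun T => ?_) hstack
      (SwitchedLS.tendsto_sqrt_log_div _ K)
    exact Real.iSup_nonneg fun q => abs_nonneg _
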